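/- Let $m\ge 0$ and $\alpha,\beta\in\mathbb R$, let $z:[0,\infty)\to\mathbb R$ and $\lambda:[0,\infty)\to\mathbb C$ be continuously differentiable, and let $\Omega=\{(x,t): t\ge 0,\ x\ge z(t)\}$. Assume (H1) $z(0)=0$ and $-1<z'(t)<1$ for all $t\ge 0$; (H2) $|\lambda(t)|^2(1-z'(t))\le 1+z'(t)$ for all $t\ge 0$. Consider, for complex-valued $u,v$, the system $$i(u_t+u_x)=-mv+N_1(u,v),\qquad i(v_t-v_x)=-mu+N_2(u,v)\qquad\text{in }\Omega,$$ $$N_1(u,v)=\alpha u|v|^2+2\beta v(\bar u v+u\bar v),\qquad N_2(u,v)=\alpha v|u|^2+2\beta u(\bar u v+u\bar v),$$ with initial condition $(u,v)(x,0)=(u_0,v_0)(x)$ for $x\ge 0$ and boundary condition $u(z(t),t)=\lambda(t)v(z(t),t)$ for $t\ge0$. A pair of measurable functions $(u,v)$ on $\Omega$ is called a (global) strong solution of this problem if there are classical solutions $(u^{(n)},v^{(n)})$ of the system, $C^1$ on $\Omega$ up to the boundary, with $u^{(n)}(z(t),t)=\lambda(t)v^{(n)}(z(t),t)$ for $t>0$,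 such that $$\int_0^N\big(|u^{(n)}(x,0)-u_0(x)|^2+|v^{(n)}(x,0)-v_0(x)|^2\big)dx\to0,\qquad \iint_K\big(|u^{(n)}-u|^2+|v^{(n)}-v|^2\big)dxdt\to 0$$ as $n\to\infty$, for every $N>0$ and every compact $K\subset\Omega$. Theorem. For all $u_0,v_0\in L^2_{loc}([0,\infty))$ the problem has a strong solution $(u,v)$ with $u,v\in L^2_{loc}(\Omega)$ (square integrable on every compact subset of the closed set $\Omega$), and it is unique: any strong solution with the same data equals $(u,v)$ almost everywhere in $\Omega$. Moreover $|u||v|\in L^2_{loc}(\Omega)$, and for all $\varphi,\psi\in C^1(\Omega)$ (up to the boundary, complex-valued) with bounded support in $\Omega$ and $\varphi(z(t),t)=\psi(z(t),t)=0$ for $t\ge 0$, the following integrals converge absolutely and $$\iint_\Omega\big(iu(\varphi_t+\varphi_x)-mv\varphi+N_1(u,v)\varphi\big)dxdt=-i\int_0^\infty u_0(x)\varphi(x,0)\,dx,$$ $$\iint_\Omega\big(iv(\psi_t-\psi_x)-mu\psi+N_2(u,v)\psi\big)dxdt=-i\int_0^\infty v_0(x)\psi(x,0)\,dx.$$ 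-/

import Mathlib

open MeasureTheory Set Filter Topology

noncomputable section

namespace DiracIBVP

/-- The closed space-time region `t ≥ 0`, `x ≥ z t`; a point of the plane is `p = (x, t)`. -/
def Omega (z : ℝ → ℝ) : Set (ℝ × ℝ) := {p | 0 ≤ p.2 ∧ z p.2 ≤ p.1}

/-- The derivative of a function of time `t ∈ [0, ∞)` (one-sided at `t = 0`). -/
def timeDeriv (f : ℝ → ℝ) (t : ℝ) : ℝ := derivWithin f (Ici 0) t

/-- The partial derivative in `x`, taken within the closed region (so up to the boundary). -/
def dx (z : ℝ → ℝ) (w : ℝ × ℝ → ℂ) (p : ℝ × ℝ) : ℂ := fderivWithin ℝ w (Omega z) p (1, 0)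

/-- The partial derivative in `t`, taken within the closed region (so up to the boundary). -/
def dt (z : ℝ → ℝ) (w : ℝ × ℝ → ℂ) (p : ℝ × ℝ) : ℂ := fderivWithin ℝ w (Omega z) p (0, 1)

/-- `N₁(u, v) = α u |v|² + 2 β v (ū v + u v̄)`. -/
def N1 (α β : ℝ) (u v : ℂ) : ℂ :=
  (α : ℂ) * u * ((‖v‖ ^ 2 : ℝ) : ℂ) +
    2 * (β : ℂ) * v * ((starRingEnd ℂ) u * v + u * (starRingEnd ℂ) v)

/-- `N₂(u, v) = α v |u|² + 2 β u (ū v + u v̄)`. -/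
def N2 (α β : ℝ) (u v : ℂ) : ℂ :=
  (α : ℂ) * v * ((‖u‖ ^ 2 : ℝ) : ℂ) +
    2 * (β : ℂ) * u * ((starRingEnd ℂ) u * v + u * (starRingEnd ℂ) v)

/-- `(u, v)` is a global classical solution of the Dirac system: it is `C¹` up to the boundary
of the region and satisfies both equations there. -/
structure IsClassicalSolution (m α β : ℝ) (z : ℝ → ℝ) (u v : ℝ × ℝ → ℂ) : Prop where
  contDiffOn_u : ContDiffOn ℝ 1 u (Omega z)
  contDiffOn_v : ContDiffOn ℝ 1 v (Omega z)
  eq_u : ∀ p ∈ Omega z,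
    Complex.I * (dt z u p + dx z u p) = -(m : ℂ) * v p + N1 α β (u p) (v p)
  eq_v : ∀ p ∈ Omega z,
    Complex.I * (dt z v p - dx z v p) = -(m : ℂ) * u p + N2 α β (u p) (v p)

/-- `f ∈ L²_loc([0, ∞))`. -/
def L2locHalfLine (f : ℝ → ℂ) : Prop :=
  ∀ N : ℝ, 0 < N → MemLp f 2 (volume.restrict (Icc 0 N))

/-- `f ∈ L²_loc` of the closed region: square integrable on each of its compact subsets. -/
def L2locOmega {E : Type*} [NormedAddCommGroup E] (z : ℝ → ℝ) (f : ℝ × ℝ → E) : Prop :=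
  ∀ K : Set (ℝ × ℝ), K ⊆ Omega z → IsCompact K → MemLp f 2 (volume.restrict K)

/-- `(u, v)` is a global strong solution of the initial boundary value problem with initial data
`(u₀, v₀)` and boundary condition `u = lam v` on `x = z t`. -/
def IsStrongSolution (m α β : ℝ) (z : ℝ → ℝ) (lam : ℝ → ℂ) (u₀ v₀ : ℝ → ℂ)
    (u v : ℝ × ℝ → ℂ) : Prop :=
  AEStronglyMeasurable u (volume.restrict (Omega z)) ∧
  AEStronglyMeasurable v (volume.restrict (Omega z)) ∧
  ∃ un vn : ℕ → ℝ × ℝ → ℂ,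
    (∀ n, IsClassicalSolution m α β z (un n) (vn n)) ∧
    (∀ n, ∀ t : ℝ, 0 < t → un n (z t, t) = lam t * vn n (z t, t)) ∧
    (∀ N : ℝ, 0 < N → Tendsto
      (fun n => ∫⁻ x in Icc 0 N, (‖un n (x, 0) - u₀ x‖ₑ ^ 2 + ‖vn n (x, 0) - v₀ x‖ₑ ^ 2))
      atTop (𝓝 0)) ∧
    (∀ K : Set (ℝ × ℝ), K ⊆ Omega z → IsCompact K → Tendsto
      (fun n => ∫⁻ p in K, (‖un n p - u p‖ₑ ^ 2 + ‖vn n p - v p‖ₑ ^ 2))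
      atTop (𝓝 0))

/-- Test functions: `C¹` up to the boundary of the region, with bounded support in the region,
vanishing on the lateral boundary `x = z t`. -/
structure IsTestFunction (z : ℝ → ℝ) (φ : ℝ × ℝ → ℂ) : Prop where
  contDiffOn : ContDiffOn ℝ 1 φ (Omega z)
  bounded_support : Bornology.IsBounded {p | p ∈ Omega z ∧ φ p ≠ 0}
  boundary : ∀ t : ℝ, 0 ≤ t → φ (z t, t) = 0

/-- The weak (integral) form of the initial boundary value problem; all integrals involved are
required to converge absolutely. -/
def IsWeakSolution (m α β : ℝ) (z : ℝ → ℝ) (u₀ v₀ : ℝ → ℂ) (u v : ℝ × ℝ → ℂ) : Prop :=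
  ∀ φ ψ : ℝ × ℝ → ℂ, IsTestFunction z φ → IsTestFunction z ψ →
    (IntegrableOn (fun p => Complex.I * u p * (dt z φ p + dx z φ p) - (m : ℂ) * v p * φ p
        + N1 α β (u p) (v p) * φ p) (Omega z) ∧
      IntegrableOn (fun x => u₀ x * φ (x, 0)) (Ici 0) ∧
      ∫ p in Omega z, (Complex.I * u p * (dt z φ p + dx z φ p) - (m : ℂ) * v p * φ p
        + N1 α β (u p) (v p) * φ p) = -Complex.I * ∫ x in Ici 0, u₀ x * φ (x, 0)) ∧
    (IntegrableOn (fun p => Complex.I * v p * (dt z ψ p - dx z ψ p) - (m : ℂ) * u p * ψ p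
        + N2 α β (u p) (v p) * ψ p) (Omega z) ∧
      IntegrableOn (fun x => v₀ x * ψ (x, 0)) (Ici 0) ∧
      ∫ p in Omega z, (Complex.I * v p * (dt z ψ p - dx z ψ p) - (m : ℂ) * u p * ψ p
        + N2 α β (u p) (v p) * ψ p) = -Complex.I * ∫ x in Ici 0, v₀ x * ψ (x, 0))

end DiracIBVP

end

/-! In the null coordinates ξ = x - t, η = x + t the system becomes a pair of ordinary differential
equations along two families of lines, ∂_η u = F(u, v) and ∂_ξ v = -F(v, u) with F = `nullRHS`. The
nonlinearity obeys the local charge law ∂_η|u|² = ∂_ξ|v|², and (H2) says that the reflection at the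
moving boundary does not increase the charge. Integrating the law over the causal past of a point
bounds ∫|v|² along each line on which u is transported, and ∫|u|² along each line on which v is
transported, by the charge of the data (`IsMild.charge_le_apex`). These are exactly the Grönwall
coefficients of the two equations, so |u|² is bounded by its starting value, a function of ξ alone,
and |v|² by a function of η alone (`IsMild.pointwise_bounds`).

The same mechanism applies to the difference of two solutions. A two-dimensional Grönwall inequality
(`gronwall_past`) yields `exists_stability`: |u - u'|² ≤ p(ξ) and |v - v'|² ≤ q(η), where ∫p and ∫q
are at most a constant times the squared L² distance of the data. Since the majorants of u and of v
depend on different coordinates, a product such as |u - u'|²|v|² integrates over the plane as a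
product of two one-dimensional integrals. This puts |u||v| in L² and makes the cubic terms converge
in L¹ although the data are only square integrable.

Regular solutions come from a contraction argument for a truncated equation (`exists_volterra`); the
a priori bounds remove the truncation (`exists_isMild`). Data vanishing near the corner satisfy all
compatibility conditions there, so their solutions are C¹ (`IsMild.exists_hasFDerivWithinAt`), and
solutions on growing regions glue to global classical ones (`exists_isClassicalSolution`).

Square integrable data are approximated by such data. Stability (`exists_classical_stability`) makes
the approximations Cauchy, gives uniqueness by comparing two approximating sequences, and carries
the weak equations, which for classical solutions are an integration along characteristics, to the
limit. -/

namespace DiracIBVP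

/-! ### Grönwall's inequality and the algebra of the nonlinearity. -/

/-- Grönwall's inequality with variable coefficients, in differential form. -/
lemma gronwall_variable {φ φ' a b : ℝ → ℝ} {s t : ℝ} (hst : s ≤ t)
    (hφ : ∀ y, HasDerivAt φ (φ' y) y) (ha : Continuous a) (hb : Continuous b)
    (ha0 : ∀ y, 0 ≤ a y) (hb0 : ∀ y, 0 ≤ b y)
    (h : ∀ y ∈ Icc s t, φ' y ≤ a y * φ y + b y) :
    φ t ≤ Real.exp (∫ y in s..t, a y) * (φ s + ∫ y in s..t, b y) := by
  have hA : ∀ y, HasDerivAt (fun y => ∫ w in s..y, a w) (a y) y := fun y =>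
    intervalIntegral.integral_hasDerivAt_right (ha.intervalIntegrable _ _)
      ha.aestronglyMeasurable.stronglyMeasurableAtFilter ha.continuousAt
  have hB : ∀ y, HasDerivAt (fun y => ∫ w in s..y, b w) (b y) y := fun y =>
    intervalIntegral.integral_hasDerivAt_right (hb.intervalIntegrable _ _)
      hb.aestronglyMeasurable.stronglyMeasurableAtFilter hb.continuousAt
  have hψ : ∀ y, HasDerivAt
      (fun y => Real.exp (-∫ w in s..y, a w) * φ y - ∫ w in s..y, b w)
      (Real.exp (-∫ w in s..y, a w) * (-a y) * φ y + Real.exp (-∫ w in s..y, a w) * φ' y - b y)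
      y := fun y => (((hA y).neg.exp).mul (hφ y)).sub (hB y)
  -- The integrating factor absorbs the term a φ. Since it is at most 1 and b ≥ 0, the forcing costs
  -- at most b, so this combination decreases.
  have hanti : AntitoneOn
      (fun y => Real.exp (-∫ w in s..y, a w) * φ y - ∫ w in s..y, b w) (Icc s t) := by
    apply antitoneOn_of_deriv_nonpos (convex_Icc s t)
    · exact fun y _ => (hψ y).continuousAt.continuousWithinAt
    · exact fun y _ => (hψ y).differentiableAt.differentiableWithinAt
    · intro y hy
      rw [interior_Icc] at hy
      have hy' : y ∈ Icc s t := ⟨hy.1.le, hy.2.le⟩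
      rw [(hψ y).deriv]
      have h0 : 0 ≤ ∫ w in s..y, a w :=
        intervalIntegral.integral_nonneg hy'.1 fun w _ => ha0 w
      have h1 : Real.exp (-∫ w in s..y, a w) ≤ 1 := Real.exp_le_one_iff.2 (by linarith)
      have h2 := Real.exp_pos (-∫ w in s..y, a w)
      nlinarith [h y hy', hb0 y, mul_le_mul_of_nonneg_left (h y hy') h2.le,
        mul_le_mul_of_nonneg_right h1 (hb0 y)]
  have := hanti (left_mem_Icc.2 hst) (right_mem_Icc.2 hst) hst
  simp only [intervalIntegral.integral_same, neg_zero, Real.exp_zero, one_mul, sub_zero] at this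
  have h3 : Real.exp (-∫ w in s..t, a w) * φ t ≤ φ s + ∫ w in s..t, b w := by linarith
  calc φ t = Real.exp (∫ w in s..t, a w) * (Real.exp (-∫ w in s..t, a w) * φ t) := by
        rw [← mul_assoc, ← Real.exp_add]; simp
    _ ≤ _ := mul_le_mul_of_nonneg_left h3 (Real.exp_pos _).le

/-- The right-hand side of the system in null coordinates: `∂_η u = F(u, v)`,
`∂_ξ v = -F(v, u)`. -/
noncomputable def nullRHS (m α β : ℝ) (a b : ℂ) : ℂ :=
  Complex.I / 2 * ((m : ℂ) * b - N1 α β a b)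

/-- The structural properties of the right-hand side that yield charge conservation and the
bounds along characteristics. -/
structure IsChargeRHS (m C : ℝ) (f : ℂ → ℂ → ℂ) : Prop where
  continuous : Continuous fun p : ℂ × ℂ => f p.1 p.2
  charge : ∀ a b, ((starRingEnd ℂ) a * f a b).re + ((starRingEnd ℂ) b * f b a).re = 0
  growth : ∀ a b, 2 * ((starRingEnd ℂ) a * f a b).re
    ≤ (m + C * ‖b‖ ^ 2) * ‖a‖ ^ 2 + m * ‖b‖ ^ 2

/-- Separates the phase-neutral monomial a|b|² from the exchange monomial conj(a)b²; their
coefficients are the two terms of `strength`. -/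
lemma N1_eq (α β : ℝ) (a b : ℂ) :
    N1 α β a b = ((α + 2 * β : ℝ) : ℂ) * (a * b * (starRingEnd ℂ) b)
      + ((2 * β : ℝ) : ℂ) * ((starRingEnd ℂ) a * b * b) := by
  have : ((‖b‖ ^ 2 : ℝ) : ℂ) = b * (starRingEnd ℂ) b := by
    rw [Complex.mul_conj, Complex.normSq_eq_norm_sq]
  rw [N1, this]; push_cast; ring

lemma N2_eq_N1 (α β : ℝ) (a b : ℂ) : N2 α β a b = N1 α β b a := by
  simp only [N1, N2]; ring

/-- Coupling strength. -/
noncomputable def strength (α β : ℝ) : ℝ := |α + 2 * β| + |2 * β|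

lemma strength_nonneg (α β : ℝ) : 0 ≤ strength α β := by unfold strength; positivity

/-- The telescoping is deliberately asymmetric: the increment of the first argument meets only `b`,
and that of the second meets the first argument only through `a'`. In the comparison of two
solutions just one of them then needs a pointwise bound. -/
lemma norm_N1_sub_le (α β : ℝ) (a b a' b' : ℂ) :
    ‖N1 α β a b - N1 α β a' b'‖ ≤ strength α β *
      (‖b‖ ^ 2 * ‖a - a'‖ + ‖a'‖ * (‖b‖ + ‖b'‖) * ‖b - b'‖) := by
  have h1 : a * b * (starRingEnd ℂ) b - a' * b' * (starRingEnd ℂ) b'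
      = (a - a') * b * (starRingEnd ℂ) b + a' * (b - b') * (starRingEnd ℂ) b
        + a' * b' * (starRingEnd ℂ) (b - b') := by rw [map_sub]; ring
  have h2 : (starRingEnd ℂ) a * b * b - (starRingEnd ℂ) a' * b' * b'
      = (starRingEnd ℂ) (a - a') * b * b + (starRingEnd ℂ) a' * (b - b') * b
        + (starRingEnd ℂ) a' * b' * (b - b') := by rw [map_sub]; ring
  have h3 : ‖a * b * (starRingEnd ℂ) b - a' * b' * (starRingEnd ℂ) b'‖
      ≤ ‖b‖ ^ 2 * ‖a - a'‖ + ‖a'‖ * (‖b‖ + ‖b'‖) * ‖b - b'‖ := by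
    rw [h1]
    refine (norm_add₃_le).trans (le_of_eq ?_)
    simp only [norm_mul, RCLike.norm_conj]; ring
  have h4 : ‖(starRingEnd ℂ) a * b * b - (starRingEnd ℂ) a' * b' * b'‖
      ≤ ‖b‖ ^ 2 * ‖a - a'‖ + ‖a'‖ * (‖b‖ + ‖b'‖) * ‖b - b'‖ := by
    rw [h2]
    refine (norm_add₃_le).trans (le_of_eq ?_)
    simp only [norm_mul, RCLike.norm_conj]; ring
  have h5 : N1 α β a b - N1 α β a' b'
      = ((α + 2 * β : ℝ) : ℂ) * (a * b * (starRingEnd ℂ) b - a' * b' * (starRingEnd ℂ) b')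
      + ((2 * β : ℝ) : ℂ) * ((starRingEnd ℂ) a * b * b - (starRingEnd ℂ) a' * b' * b') := by
    rw [N1_eq, N1_eq]; ring
  rw [h5]
  refine (norm_add_le _ _).trans ?_
  rw [norm_mul, norm_mul, Complex.norm_real, Complex.norm_real, Real.norm_eq_abs,
    Real.norm_eq_abs, strength, add_mul]
  gcongr

lemma norm_N1_le (α β : ℝ) (a b : ℂ) : ‖N1 α β a b‖ ≤ strength α β * (‖b‖ ^ 2 * ‖a‖) := by
  have := norm_N1_sub_le α β a b 0 0
  simpa [N1] using this

/-- After multiplication by conj(a), the first monomial is real, and the second becomes 2β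
conj(a)²b², whose counterpart with a and b exchanged is its complex conjugate. -/
lemma charge_N1 (α β : ℝ) (a b : ℂ) :
    ((starRingEnd ℂ) a * N1 α β a b).im + ((starRingEnd ℂ) b * N1 α β b a).im = 0 := by
  rw [N1_eq, N1_eq]
  simp only [Complex.add_im, Complex.add_re, Complex.mul_im, Complex.mul_re, Complex.conj_re,
    Complex.conj_im, Complex.ofReal_re, Complex.ofReal_im]
  ring

lemma two_re_conj_mul_I_half (a w : ℂ) :
    2 * ((starRingEnd ℂ) a * (Complex.I / 2 * w)).re = -((starRingEnd ℂ) a * w).im := by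
  have : (starRingEnd ℂ) a * (Complex.I / 2 * w)
      = ((2⁻¹ : ℝ) : ℂ) * (Complex.I * ((starRingEnd ℂ) a * w)) := by push_cast; ring
  rw [this, Complex.re_ofReal_mul, Complex.I_mul_re]; ring

lemma continuous_N1 (α β : ℝ) : Continuous fun p : ℂ × ℂ => N1 α β p.1 p.2 := by
  unfold N1
  have h : Continuous fun z : ℂ => (starRingEnd ℂ) z := Complex.continuous_conj
  fun_prop

/-- A right-hand side whose cubic term is multiplied by a symmetric factor in `[0, 1]`. -/
lemma isChargeRHS_of_factor {m : ℝ} (hm : 0 ≤ m) (α β : ℝ) {s : ℂ × ℂ → ℝ} (hs : Continuous s)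
    (h0 : ∀ p, 0 ≤ s p) (h1 : ∀ p, s p ≤ 1) (hsymm : ∀ a b, s (a, b) = s (b, a)) :
    IsChargeRHS m (strength α β)
      (fun a b => Complex.I / 2 * ((m : ℂ) * b - (s (a, b) : ℂ) * N1 α β a b)) where
  continuous := by
    have := continuous_N1 α β
    fun_prop
  charge a b := by
    have e1 := two_re_conj_mul_I_half a ((m : ℂ) * b - (s (a, b) : ℂ) * N1 α β a b)
    have e2 := two_re_conj_mul_I_half b ((m : ℂ) * a - (s (b, a) : ℂ) * N1 α β b a)
    -- Symmetry of the factor gives both cubic terms the same weight, so their cancellation in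
    -- `charge_N1` survives; the mass terms cancel by themselves.
    rw [hsymm b a] at e2 ⊢
    have h := charge_N1 α β a b
    have h2 : ((starRingEnd ℂ) a * ((m : ℂ) * b - (s (a, b) : ℂ) * N1 α β a b)).im
        = m * ((starRingEnd ℂ) a * b).im - s (a, b) * ((starRingEnd ℂ) a * N1 α β a b).im := by
      rw [mul_sub, Complex.sub_im, ← Complex.im_ofReal_mul, ← Complex.im_ofReal_mul]
      ring_nf
    have h3 : ((starRingEnd ℂ) b * ((m : ℂ) * a - (s (a, b) : ℂ) * N1 α β b a)).im
        = m * ((starRingEnd ℂ) b * a).im - s (a, b) * ((starRingEnd ℂ) b * N1 α β b a).im := by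
      rw [mul_sub, Complex.sub_im, ← Complex.im_ofReal_mul, ← Complex.im_ofReal_mul]
      ring_nf
    have h4 : ((starRingEnd ℂ) b * a).im = -((starRingEnd ℂ) a * b).im := by
      simp only [Complex.mul_im, Complex.conj_re, Complex.conj_im]; ring
    rw [h2] at e1
    rw [h3, h4] at e2
    have h5 : s (a, b) * ((starRingEnd ℂ) a * N1 α β a b).im
      + s (a, b) * ((starRingEnd ℂ) b * N1 α β b a).im = 0 := by rw [← mul_add, h, mul_zero]
    linarith
  growth a b := by
    rw [two_re_conj_mul_I_half]
    have h1' : -((starRingEnd ℂ) a * ((m : ℂ) * b - (s (a, b) : ℂ) * N1 α β a b)).im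
        ≤ ‖a‖ * (m * ‖b‖ + strength α β * (‖b‖ ^ 2 * ‖a‖)) := by
      refine (neg_le_abs _).trans ((Complex.abs_im_le_norm _).trans ?_)
      rw [norm_mul, RCLike.norm_conj]
      gcongr
      refine (norm_sub_le _ _).trans ?_
      rw [norm_mul, norm_mul, Complex.norm_real, Complex.norm_real, Real.norm_eq_abs,
        Real.norm_eq_abs, abs_of_nonneg hm, abs_of_nonneg (h0 _)]
      exact add_le_add le_rfl ((mul_le_of_le_one_left (norm_nonneg _) (h1 _)).trans
        (norm_N1_le α β a b))
    refine h1'.trans ?_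
    nlinarith [mul_nonneg hm (sq_nonneg (‖a‖ - ‖b‖)), mul_nonneg hm (sq_nonneg ‖a‖),
      mul_nonneg hm (sq_nonneg ‖b‖)]

lemma isChargeRHS_nullRHS {m : ℝ} (hm : 0 ≤ m) (α β : ℝ) :
    IsChargeRHS m (strength α β) (nullRHS m α β) := by
  have := isChargeRHS_of_factor hm α β (s := fun _ => 1) continuous_const (by simp) (by simp)
    (by simp)
  simp only [Complex.ofReal_one, one_mul] at this
  exact this

/-- Shaped for Grönwall along a characteristic of `a`: the coefficient of ‖a - a'‖² contains only
the other field, whose square has a bounded integral there, and the forcing contains only `a'`,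
which is bounded pointwise by its value at the start of the characteristic. -/
lemma two_re_conj_sub_mul_le {m : ℝ} (hm : 0 ≤ m) (α β : ℝ) (a b a' b' : ℂ) :
    2 * ((starRingEnd ℂ) (a - a') * (nullRHS m α β a b - nullRHS m α β a' b')).re
      ≤ (m + 2 * strength α β * (‖b‖ ^ 2 + ‖b'‖ ^ 2)) * ‖a - a'‖ ^ 2
        + (m + strength α β * ‖a'‖ ^ 2) * ‖b - b'‖ ^ 2 := by
  have h0 : nullRHS m α β a b - nullRHS m α β a' b'
      = Complex.I / 2 * ((m : ℂ) * (b - b') - (N1 α β a b - N1 α β a' b')) := by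
    simp only [nullRHS]; ring
  rw [h0, two_re_conj_mul_I_half]
  have h1 : -((starRingEnd ℂ) (a - a') * ((m : ℂ) * (b - b')
        - (N1 α β a b - N1 α β a' b'))).im
      ≤ ‖a - a'‖ * (m * ‖b - b'‖ + strength α β *
        (‖b‖ ^ 2 * ‖a - a'‖ + ‖a'‖ * (‖b‖ + ‖b'‖) * ‖b - b'‖)) := by
    refine (neg_le_abs _).trans ((Complex.abs_im_le_norm _).trans ?_)
    rw [norm_mul, RCLike.norm_conj]
    gcongr
    refine (norm_sub_le _ _).trans ?_
    rw [norm_mul, Complex.norm_real, Real.norm_eq_abs, abs_of_nonneg hm]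
    gcongr
    exact norm_N1_sub_le α β a b a' b'
  refine h1.trans ?_
  have hg := strength_nonneg α β
  set p := ‖a - a'‖
  set q := ‖b - b'‖
  have e1 : m * (2 * p * q) ≤ m * (p ^ 2 + q ^ 2) :=
    mul_le_mul_of_nonneg_left (by nlinarith [sq_nonneg (p - q)]) hm
  have e2 : p * (‖a'‖ * (‖b‖ + ‖b'‖) * q)
      ≤ (‖b‖ ^ 2 + ‖b'‖ ^ 2) * p ^ 2 + ‖a'‖ ^ 2 * q ^ 2 := by
    nlinarith [sq_nonneg ((‖b‖ + ‖b'‖) * p - ‖a'‖ * q),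
      mul_nonneg (sq_nonneg (‖b‖ - ‖b'‖)) (sq_nonneg p), sq_nonneg (‖a'‖ * q)]
  have e3 : ‖b‖ ^ 2 * p ^ 2 ≤ (‖b‖ ^ 2 + ‖b'‖ ^ 2) * p ^ 2 := by
    gcongr; nlinarith [sq_nonneg ‖b'‖]
  nlinarith [mul_le_mul_of_nonneg_left e2 hg, mul_le_mul_of_nonneg_left e3 hg,
    mul_nonneg hm (sq_nonneg p), mul_nonneg hm (sq_nonneg q)]

end DiracIBVP

namespace DiracIBVP

/-! ### Squared moduli along a characteristic. -/

section Characteristic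

variable {w g : ℝ → ℂ} {s t : ℝ}

lemma hasDerivAt_primitive {E : Type*} [NormedAddCommGroup E] [NormedSpace ℝ E] [CompleteSpace E]
    {g : ℝ → E} (hg : Continuous g) (c : E) (s y : ℝ) :
    HasDerivAt (fun y => c + ∫ r in s..y, g r) (g y) y :=
  (intervalIntegral.integral_hasDerivAt_right (hg.intervalIntegrable _ _)
    hg.aestronglyMeasurable.stronglyMeasurableAtFilter hg.continuousAt).const_add c

lemma hasDerivAt_norm_sq_primitive (hg : Continuous g) (c : ℂ) (s y : ℝ) :
    HasDerivAt (fun y => ‖c + ∫ r in s..y, g r‖ ^ 2)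
      (2 * ((starRingEnd ℂ) (c + ∫ r in s..y, g r) * g y).re) y := by
  have := (hasDerivAt_primitive hg c s y).norm_sq
  rwa [Complex.inner, mul_comm (g y)] at this

/-- The integral equation is available on `Icc s t` only, so the calculus is done on the primitive,
which is differentiable everywhere and agrees with `w` on that interval. -/
lemma norm_sq_eq_of_primitive (hg : Continuous g) (hst : s ≤ t)
    (h : ∀ y ∈ Icc s t, w y = w s + ∫ r in s..y, g r) :
    ‖w t‖ ^ 2 = ‖w s‖ ^ 2 + ∫ y in s..t, 2 * ((starRingEnd ℂ) (w y) * g y).re := by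
  have hc : Continuous fun y => w s + ∫ r in s..y, g r :=
    continuous_iff_continuousAt.2 fun y => (hasDerivAt_primitive hg _ s y).continuousAt
  have hconj : Continuous fun z : ℂ => (starRingEnd ℂ) z := Complex.continuous_conj
  have h1 := intervalIntegral.integral_eq_sub_of_hasDerivAt
    (fun y _ => hasDerivAt_norm_sq_primitive hg (w s) s y)
    (Continuous.intervalIntegrable (by fun_prop) s t)
  have h2 : ∫ y in s..t, 2 * ((starRingEnd ℂ) (w y) * g y).re
      = ∫ y in s..t, 2 * ((starRingEnd ℂ) (w s + ∫ r in s..y, g r) * g y).re := by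
    refine intervalIntegral.integral_congr fun y hy => ?_
    rw [uIcc_of_le hst] at hy
    simp only [← h y hy]
  rw [h2, h1, ← h t (right_mem_Icc.2 hst)]
  simp

lemma norm_sq_le_of_primitive (hg : Continuous g) (hst : s ≤ t)
    (h : ∀ y ∈ Icc s t, w y = w s + ∫ r in s..y, g r)
    {a b : ℝ → ℝ} (ha : Continuous a) (hb : Continuous b)
    (ha0 : ∀ y, 0 ≤ a y) (hb0 : ∀ y, 0 ≤ b y)
    (hab : ∀ y ∈ Icc s t, 2 * ((starRingEnd ℂ) (w y) * g y).re ≤ a y * ‖w y‖ ^ 2 + b y) :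
    ‖w t‖ ^ 2 ≤ Real.exp (∫ y in s..t, a y) * (‖w s‖ ^ 2 + ∫ y in s..t, b y) := by
  have h1 := gronwall_variable hst (fun y => hasDerivAt_norm_sq_primitive hg (w s) s y)
    ha hb ha0 hb0 (fun y hy => by rw [← h y hy]; exact hab y hy)
  rw [← h t (right_mem_Icc.2 hst)] at h1
  simpa using h1

/-- The field v is integrated downwards from the upper end of its characteristic; the reflection r ↦
-r reduces this to the forward case. -/
lemma primitive_neg (h : ∀ x ∈ Icc s t, w x = w t + ∫ r in x..t, g r) :
    ∀ y ∈ Icc (-t) (-s), w (-y) = w (- -t) + ∫ r in -t..y, g (-r) := by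
  intro y hy
  rw [intervalIntegral.integral_comp_neg, neg_neg]
  exact h (-y) ⟨by linarith [hy.2], by linarith [hy.1]⟩

lemma norm_sq_eq_of_primitive_left (hg : Continuous g) (hst : s ≤ t)
    (h : ∀ x ∈ Icc s t, w x = w t + ∫ r in x..t, g r) :
    ‖w s‖ ^ 2 = ‖w t‖ ^ 2 + ∫ y in s..t, 2 * ((starRingEnd ℂ) (w y) * g y).re := by
  have := norm_sq_eq_of_primitive (w := fun y => w (-y)) (g := fun y => g (-y))
    (hg.comp continuous_neg) (neg_le_neg hst) (primitive_neg h)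
  rw [intervalIntegral.integral_comp_neg
    (fun y => 2 * ((starRingEnd ℂ) (w y) * g y).re)] at this
  simpa using this

lemma norm_sq_le_of_primitive_left (hg : Continuous g) (hst : s ≤ t)
    (h : ∀ x ∈ Icc s t, w x = w t + ∫ r in x..t, g r)
    {a b : ℝ → ℝ} (ha : Continuous a) (hb : Continuous b)
    (ha0 : ∀ y, 0 ≤ a y) (hb0 : ∀ y, 0 ≤ b y)
    (hab : ∀ y ∈ Icc s t, 2 * ((starRingEnd ℂ) (w y) * g y).re ≤ a y * ‖w y‖ ^ 2 + b y) :
    ‖w s‖ ^ 2 ≤ Real.exp (∫ y in s..t, a y) * (‖w t‖ ^ 2 + ∫ y in s..t, b y) := by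
  have := norm_sq_le_of_primitive (w := fun y => w (-y)) (g := fun y => g (-y))
    (a := fun y => a (-y)) (b := fun y => b (-y))
    (hg.comp continuous_neg) (neg_le_neg hst) (primitive_neg h)
    (ha.comp continuous_neg) (hb.comp continuous_neg) (fun y => ha0 _) (fun y => hb0 _)
    (fun y hy => hab (-y) ⟨by linarith [hy.2], by linarith [hy.1]⟩)
  rw [intervalIntegral.integral_comp_neg a, intervalIntegral.integral_comp_neg b] at this
  simpa using this

end Characteristic

/-! ### Geometry of the causal past in null coordinates. -/

/-- In the null coordinates `ξ = x - t`, `η = x + t`, the lower boundary of the region is the graph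
`η = h ξ`: it is `t = 0` for `0 ≤ ξ`, and the moving boundary for `ξ ≤ 0`, where `k` is the
inverse of `h` and `μ` is the reflection coefficient. The last field says that the reflection at
the moving boundary does not increase the charge. -/
structure IsMirror (h k : ℝ → ℝ) (μ : ℝ → ℂ) (ξ₀ : ℝ) : Prop where
  continuous_h : Continuous h
  continuous_k : Continuous k
  continuous_μ : Continuous μ
  h_of_nonneg : ∀ x, 0 ≤ x → h x = x
  h_antitone : AntitoneOn h (Iic 0)
  h_k : ∀ y, 0 ≤ y → h (k y) = y
  k_h : ∀ x, x ≤ 0 → k (h x) = x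
  k_nonpos : ∀ y, 0 ≤ y → k y ≤ 0
  reflect : ∀ w : ℝ → ℝ, Continuous w → (∀ y, 0 ≤ w y) → ∀ ξ, ξ₀ ≤ ξ → ξ ≤ 0 →
    ∫ x in ξ..0, ‖μ x‖ ^ 2 * w (h x) ≤ ∫ y in 0..h ξ, w y

/-- The part of the region, in null coordinates, in the causal past of `(ξ₀, η₀)`. -/
def past (h : ℝ → ℝ) (ξ₀ η₀ : ℝ) : Set (ℝ × ℝ) := {p | ξ₀ ≤ p.1 ∧ h p.1 ≤ p.2 ∧ p.2 ≤ η₀}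

namespace IsMirror

variable {h k : ℝ → ℝ} {μ : ℝ → ℂ} {ξ₀ η₀ : ℝ} (H : IsMirror h k μ ξ₀)
include H

lemma mono {ξ₁ : ℝ} (h01 : ξ₀ ≤ ξ₁) : IsMirror h k μ ξ₁ :=
  { H with reflect := fun w hw hw0 ξ hξ hξ0 => H.reflect w hw hw0 ξ (h01.trans hξ) hξ0 }

lemma h_zero : h 0 = 0 := H.h_of_nonneg 0 le_rfl

lemma h_nonneg (x : ℝ) : 0 ≤ h x := by
  rcases le_total 0 x with hx | hx
  · rwa [H.h_of_nonneg x hx]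
  · have := H.h_antitone (mem_Iic.2 hx) (mem_Iic.2 le_rfl) hx
    rwa [H.h_zero] at this

lemma le_h (x : ℝ) : x ≤ h x := by
  rcases le_total 0 x with hx | hx
  · rw [H.h_of_nonneg x hx]
  · exact hx.trans (H.h_nonneg x)

/-- `h` decreases up to 0 and is the identity afterwards, so a horizontal line meets the past in an
interval that reaches the diagonal. -/
lemma h_le_of_le {x x' y : ℝ} (hx : h x ≤ y) (h1 : x ≤ x') (h2 : x' ≤ y) : h x' ≤ y := by
  rcases le_total 0 x' with hx' | hx'
  · rwa [H.h_of_nonneg x' hx']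
  · exact (H.h_antitone (mem_Iic.2 (h1.trans hx')) (mem_Iic.2 hx') h1).trans hx

/-- Identifies the endpoints of the horizontal slices: the mirror point `k y` and the diagonal point
`y`. -/
lemma h_le_iff {x y : ℝ} (hy : 0 ≤ y) : h x ≤ y ↔ k y ≤ x ∧ x ≤ y := by
  constructor
  · intro hx
    refine ⟨?_, (H.le_h x).trans hx⟩
    by_contra hlt
    push Not at hlt
    have hk := H.k_nonpos y hy
    have h1 := H.h_antitone (mem_Iic.2 (hlt.le.trans hk)) (mem_Iic.2 hk) hlt.le
    rw [H.h_k y hy] at h1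
    have h2 : h x = y := le_antisymm hx h1
    have h3 := H.k_h x (hlt.le.trans hk)
    rw [h2] at h3
    exact absurd h3 hlt.ne'
  · rintro ⟨h1, h2⟩
    exact H.h_le_of_le (H.h_k y hy).le h1 h2

lemma past_subset : past h ξ₀ η₀ ⊆ Icc ξ₀ η₀ ×ˢ Icc ξ₀ η₀ := by
  rintro ⟨x, y⟩ ⟨h1, h2, h3⟩
  have := H.le_h x
  simp only at h1 h2 h3
  exact ⟨⟨h1, by linarith⟩, ⟨by linarith, h3⟩⟩

lemma isClosed_past : IsClosed (past h ξ₀ η₀) := by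
  have := H.continuous_h
  refine (isClosed_le continuous_const continuous_fst).inter
    ((isClosed_le (by fun_prop) continuous_snd).inter
      (isClosed_le continuous_snd continuous_const))

lemma isCompact_past : IsCompact (past h ξ₀ η₀) :=
  (isCompact_Icc.prod isCompact_Icc).of_isClosed_subset H.isClosed_past H.past_subset

omit H in
lemma past_mono {ξ η : ℝ} (h1 : ξ₀ ≤ ξ) (h2 : η ≤ η₀) : past h ξ η ⊆ past h ξ₀ η₀ :=
  fun _ hp => ⟨h1.trans hp.1, hp.2.1, hp.2.2.trans h2⟩

lemma diag_mem {x : ℝ} (h0 : 0 ≤ x) (h1 : ξ₀ ≤ x) (h2 : x ≤ η₀) : (x, x) ∈ past h ξ₀ η₀ :=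
  ⟨h1, (H.h_of_nonneg x h0).le, h2⟩

variable {E : Type*} [NormedAddCommGroup E] [NormedSpace ℝ E] {G : ℝ × ℝ → E}

omit [NormedSpace ℝ E] in
lemma integrable_indicator_past (hG : ContinuousOn G (past h ξ₀ η₀)) :
    Integrable ((past h ξ₀ η₀).indicator G) (volume.prod volume) := by
  rw [integrable_indicator_iff H.isClosed_past.measurableSet]
  exact hG.integrableOn_compact H.isCompact_past

/-- This and the horizontal slicing below are the two orders of Fubini on the past. Comparing them
for the charge density gives the charge inequality; taken separately they give the two weak
equations. -/
lemma integral_past_vertical (hG : ContinuousOn G (past h ξ₀ η₀)) (h0 : h ξ₀ ≤ η₀) :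
    ∫ p in past h ξ₀ η₀, G p = ∫ x in ξ₀..η₀, ∫ y in h x..η₀, G (x, y) := by
  rw [← integral_indicator H.isClosed_past.measurableSet, Measure.volume_eq_prod,
    integral_prod _ (H.integrable_indicator_past hG),
    intervalIntegral.integral_of_le ((H.le_h _).trans h0), ← integral_Icc_eq_integral_Ioc,
    ← integral_indicator measurableSet_Icc]
  congr 1
  ext x
  by_cases hx : x ∈ Icc ξ₀ η₀
  · have hle : h x ≤ η₀ := H.h_le_of_le h0 hx.1 hx.2
    rw [indicator_of_mem hx, intervalIntegral.integral_of_le hle, ← integral_Icc_eq_integral_Ioc,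
      ← integral_indicator measurableSet_Icc]
    congr 1
    ext y
    by_cases hy : y ∈ Icc (h x) η₀
    · rw [indicator_of_mem hy, indicator_of_mem (show (x, y) ∈ past h ξ₀ η₀ from
        ⟨hx.1, hy.1, hy.2⟩)]
    · rw [indicator_of_notMem hy, indicator_of_notMem (fun hm => hy ⟨hm.2.1, hm.2.2⟩)]
  · rw [indicator_of_notMem hx]
    have : ∀ y, (past h ξ₀ η₀).indicator G (x, y) = 0 := fun y =>
      indicator_of_notMem (fun hm => hx (H.past_subset hm).1) _
    simp [this]

lemma integral_past_horizontal (hG : ContinuousOn G (past h ξ₀ η₀)) (h0 : h ξ₀ ≤ η₀) :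
    ∫ p in past h ξ₀ η₀, G p
      = ∫ y in max ξ₀ 0..η₀, ∫ x in max ξ₀ (k y)..y, G (x, y) := by
  have hle : max ξ₀ 0 ≤ η₀ := max_le ((H.le_h _).trans h0) ((H.h_nonneg _).trans h0)
  rw [← integral_indicator H.isClosed_past.measurableSet, Measure.volume_eq_prod,
    integral_prod_symm _ (H.integrable_indicator_past hG),
    intervalIntegral.integral_of_le hle, ← integral_Icc_eq_integral_Ioc,
    ← integral_indicator measurableSet_Icc]
  congr 1
  ext y
  by_cases hy : y ∈ Icc (max ξ₀ 0) η₀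
  · have hy0 : 0 ≤ y := (le_max_right _ _).trans hy.1
    have hyξ : ξ₀ ≤ y := (le_max_left _ _).trans hy.1
    have hle : max ξ₀ (k y) ≤ y := max_le hyξ ((H.k_nonpos y hy0).trans hy0)
    rw [indicator_of_mem hy, intervalIntegral.integral_of_le hle, ← integral_Icc_eq_integral_Ioc,
      ← integral_indicator measurableSet_Icc]
    congr 1
    ext x
    by_cases hx : x ∈ Icc (max ξ₀ (k y)) y
    · rw [indicator_of_mem hx, indicator_of_mem (show (x, y) ∈ past h ξ₀ η₀ from
        ⟨(le_max_left _ _).trans hx.1, (H.h_le_iff hy0).2 ⟨(le_max_right _ _).trans hx.1, hx.2⟩,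
          hy.2⟩)]
    · rw [indicator_of_notMem hx, indicator_of_notMem]
      intro hm
      have := (H.h_le_iff hy0).1 hm.2.1
      exact hx ⟨max_le hm.1 this.1, this.2⟩
  · rw [indicator_of_notMem hy]
    have : ∀ x, (past h ξ₀ η₀).indicator G (x, y) = 0 := fun x =>
      indicator_of_notMem (fun hm => hy ⟨max_le (H.past_subset hm).2.1
        ((H.h_nonneg x).trans hm.2.1), hm.2.2⟩) _
    simp [this]

end IsMirror

/-! ### Mild solutions and the charge of their data. -/

/-- Continuous fields solving the characteristic integral equations, with the reflection condition
at the moving boundary, in the past of `(ξ₀, η₀)`. -/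
structure IsMild (f : ℂ → ℂ → ℂ) (h : ℝ → ℝ) (μ : ℝ → ℂ) (ξ₀ η₀ : ℝ) (U V : ℝ × ℝ → ℂ) :
    Prop where
  continuous_U : Continuous U
  continuous_V : Continuous V
  eq_U : ∀ x y, (x, y) ∈ past h ξ₀ η₀ →
    U (x, y) = U (x, h x) + ∫ r in h x..y, f (U (x, r)) (V (x, r))
  eq_V : ∀ x y, (x, y) ∈ past h ξ₀ η₀ →
    V (x, y) = V (y, y) + ∫ r in x..y, f (V (r, y)) (U (r, y))
  boundary : ∀ x, ξ₀ ≤ x → x ≤ 0 → h x ≤ η₀ → U (x, h x) = μ x * V (x, h x)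

namespace IsMild

variable {f : ℂ → ℂ → ℂ} {h k : ℝ → ℝ} {μ : ℝ → ℂ} {ξ₀ η₀ : ℝ} {U V : ℝ × ℝ → ℂ} {m C : ℝ}

lemma mono (S : IsMild f h μ ξ₀ η₀ U V) {ξ η : ℝ} (h1 : ξ₀ ≤ ξ) (h2 : η ≤ η₀) :
    IsMild f h μ ξ η U V :=
  { S with
    eq_U := fun x y hp => S.eq_U x y (IsMirror.past_mono h1 h2 hp)
    eq_V := fun x y hp => S.eq_V x y (IsMirror.past_mono h1 h2 hp)
    boundary := fun x hx hx0 hh => S.boundary x (h1.trans hx) hx0 (hh.trans h2) }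

end IsMild

/-- The charge of the initial data in the past of `(ξ, η)`. -/
noncomputable def baseCharge (U V : ℝ × ℝ → ℂ) (ξ η : ℝ) : ℝ :=
  ∫ x in max ξ 0..η, (‖U (x, x)‖ ^ 2 + ‖V (x, x)‖ ^ 2)

/-- Writing `max ξ₀ 0` covers both positions of the apex: for ξ₀ ≤ 0 this is `reflect`, and for ξ₀ ≥
0 the past does not see the mirror and both intervals degenerate. -/
lemma IsMirror.integral_boundary_le {h k : ℝ → ℝ} {μ : ℝ → ℂ} {ξ₀ : ℝ} (H : IsMirror h k μ ξ₀)
    {w : ℝ → ℝ} (hw : Continuous w) (hw0 : ∀ y, 0 ≤ w y) :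
    ∫ x in ξ₀..max ξ₀ 0, ‖μ x‖ ^ 2 * w (h x) ≤ ∫ y in max ξ₀ 0..h ξ₀, w y := by
  rcases le_total ξ₀ 0 with h0 | h0
  · rw [max_eq_right h0]
    exact H.reflect w hw hw0 ξ₀ le_rfl h0
  · rw [max_eq_left h0, H.h_of_nonneg ξ₀ h0]
    simp

lemma IsMirror.base_le_h {h k : ℝ → ℝ} {μ : ℝ → ℂ} {ξ₀ : ℝ} (H : IsMirror h k μ ξ₀) (ξ : ℝ) :
    max ξ 0 ≤ h ξ := max_le (H.le_h ξ) (H.h_nonneg ξ)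

lemma baseCharge_mono {U V : ℝ × ℝ → ℂ} (hU : Continuous U) (hV : Continuous V)
    {ξ₀ ξ η η₀ : ℝ} (h1 : ξ₀ ≤ ξ) (h2 : η ≤ η₀) (h3 : max ξ 0 ≤ η) :
    baseCharge U V ξ η ≤ baseCharge U V ξ₀ η₀ := by
  refine intervalIntegral.integral_mono_interval (max_le_max h1 le_rfl) h3 h2
    (Eventually.of_forall fun x => by positivity) (Continuous.intervalIntegrable (by fun_prop) _ _)

lemma baseCharge_nonneg (U V : ℝ × ℝ → ℂ) {ξ η : ℝ} (h3 : max ξ 0 ≤ η) :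
    0 ≤ baseCharge U V ξ η :=
  intervalIntegral.integral_nonneg h3 fun x _ => by positivity

end DiracIBVP

/-! ### The charge inequality and the bounds along characteristics. -/

namespace DiracIBVP

variable {f : ℂ → ℂ → ℂ} {h k : ℝ → ℝ} {μ : ℝ → ℂ} {ξ₀ η₀ : ℝ} {U V : ℝ × ℝ → ℂ} {m C : ℝ}

/-- The base of the past consists of a piece of the mirror, where the boundary condition turns U
into μ V, and a piece of the initial line, where `h` is the identity. -/
lemma integral_boundary_eq (H : IsMirror h k μ ξ₀) (hU : Continuous U)
    (h0 : h ξ₀ ≤ η₀)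
    (hb : ∀ x, ξ₀ ≤ x → x ≤ 0 → h x ≤ η₀ → U (x, h x) = μ x * V (x, h x)) :
    ∫ x in ξ₀..η₀, ‖U (x, h x)‖ ^ 2
      = (∫ x in ξ₀..max ξ₀ 0, ‖μ x‖ ^ 2 * ‖V (x, h x)‖ ^ 2)
        + ∫ x in max ξ₀ 0..η₀, ‖U (x, x)‖ ^ 2 := by
  have hh := H.continuous_h
  have hI : ∀ a b : ℝ, IntervalIntegrable (fun x => ‖U (x, h x)‖ ^ 2) volume a b :=
    fun a b => Continuous.intervalIntegrable (by fun_prop) _ _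
  rw [← intervalIntegral.integral_add_adjacent_intervals (hI ξ₀ (max ξ₀ 0)) (hI _ _)]
  congr 1
  · rcases le_total ξ₀ 0 with h1 | h1
    · rw [max_eq_right h1]
      refine intervalIntegral.integral_congr fun x hx => ?_
      rw [uIcc_of_le h1] at hx
      rw [hb x hx.1 hx.2 (H.h_le_of_le h0 hx.1 (hx.2.trans ((H.h_nonneg _).trans h0))),
        norm_mul, mul_pow]
    · rw [max_eq_left h1]; simp
  · refine intervalIntegral.integral_congr fun x hx => ?_
    rw [uIcc_of_le ((H.base_le_h ξ₀).trans h0)] at hx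
    rw [H.h_of_nonneg x ((le_max_right _ _).trans hx.1)]

namespace IsMild

lemma sq_U_eq (S : IsMild f h μ ξ₀ η₀ U V) (hf : IsChargeRHS m C f)
    {x y : ℝ} (hp : (x, y) ∈ past h ξ₀ η₀) :
    ‖U (x, y)‖ ^ 2 = ‖U (x, h x)‖ ^ 2
      + ∫ r in h x..y, 2 * ((starRingEnd ℂ) (U (x, r)) * f (U (x, r)) (V (x, r))).re := by
  have hU := S.continuous_U
  have hV := S.continuous_V
  have hfc := hf.continuous
  exact norm_sq_eq_of_primitive (w := fun r => U (x, r)) (g := fun r => f (U (x, r)) (V (x, r)))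
    (hfc.comp (by fun_prop : Continuous fun r => (U (x, r), V (x, r)))) hp.2.1
    (fun r hr => S.eq_U x r ⟨hp.1, hr.1, hr.2.trans hp.2.2⟩)

lemma sq_V_eq (H : IsMirror h k μ ξ₀) (S : IsMild f h μ ξ₀ η₀ U V) (hf : IsChargeRHS m C f)
    {x y : ℝ} (hp : (x, y) ∈ past h ξ₀ η₀) :
    ‖V (x, y)‖ ^ 2 = ‖V (y, y)‖ ^ 2
      + ∫ r in x..y, 2 * ((starRingEnd ℂ) (V (r, y)) * f (V (r, y)) (U (r, y))).re := by
  have hU := S.continuous_U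
  have hV := S.continuous_V
  have hfc := hf.continuous
  exact norm_sq_eq_of_primitive_left (w := fun r => V (r, y))
    (g := fun r => f (V (r, y)) (U (r, y)))
    (hfc.comp (by fun_prop : Continuous fun r => (V (r, y), U (r, y))))
    ((H.le_h x).trans hp.2.1)
    (fun r hr => S.eq_V r y ⟨hp.1.trans hr.1, H.h_le_of_le hp.2.1 hr.1 hr.2, hp.2.2⟩)

/-- Charge inequality: the outgoing charge is at most the initial charge. -/
lemma charge_le_apex (S : IsMild f h μ ξ₀ η₀ U V) (H : IsMirror h k μ ξ₀)
    (hf : IsChargeRHS m C f) (h0 : h ξ₀ ≤ η₀) :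
    (∫ x in ξ₀..η₀, ‖U (x, η₀)‖ ^ 2) + ∫ y in h ξ₀..η₀, ‖V (ξ₀, y)‖ ^ 2
      ≤ baseCharge U V ξ₀ η₀ := by
  have hU := S.continuous_U
  have hV := S.continuous_V
  have hh := H.continuous_h
  have hk := H.continuous_k
  have hfc := hf.continuous
  have hξη : ξ₀ ≤ η₀ := (H.le_h _).trans h0
  have hbase : max ξ₀ 0 ≤ η₀ := (H.base_le_h ξ₀).trans h0
  -- σ is the derivative of ‖U‖² in η and also, by the charge law and the minus sign in the equation
  -- of V, the derivative of ‖V‖² in ξ.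
  set σ : ℝ × ℝ → ℝ := fun p => 2 * ((starRingEnd ℂ) (U p) * f (U p) (V p)).re with hσ
  have hσc : Continuous σ := by
    have h1 : Continuous fun p => f (U p) (V p) :=
      hfc.comp (by fun_prop : Continuous fun p => (U p, V p))
    have h2 : Continuous fun p => (starRingEnd ℂ) (U p) := Complex.continuous_conj.comp hU
    fun_prop
  have hA : ∫ x in ξ₀..η₀, ∫ y in h x..η₀, σ (x, y)
      = ∫ x in ξ₀..η₀, (‖U (x, η₀)‖ ^ 2 - ‖U (x, h x)‖ ^ 2) := by
    refine intervalIntegral.integral_congr fun x hx => ?_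
    rw [uIcc_of_le hξη] at hx
    have := S.sq_U_eq hf (x := x) (y := η₀) ⟨hx.1, H.h_le_of_le h0 hx.1 hx.2, le_rfl⟩
    simp only [hσ]; linarith
  have hB : ∫ y in max ξ₀ 0..η₀, ∫ x in max ξ₀ (k y)..y, σ (x, y)
      = ∫ y in max ξ₀ 0..η₀, (‖V (y, y)‖ ^ 2 - ‖V (max ξ₀ (k y), y)‖ ^ 2) := by
    refine intervalIntegral.integral_congr fun y hy => ?_
    rw [uIcc_of_le hbase] at hy
    have hy0 : 0 ≤ y := (le_max_right _ _).trans hy.1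
    have hl : max ξ₀ (k y) ≤ y :=
      max_le ((le_max_left _ _).trans hy.1) ((H.k_nonpos y hy0).trans hy0)
    have := S.sq_V_eq H hf (x := max ξ₀ (k y)) (y := y)
      ⟨le_max_left _ _, (H.h_le_iff hy0).2 ⟨le_max_right _ _, hl⟩, hy.2⟩
    have h2 : ∫ x in max ξ₀ (k y)..y, σ (x, y) = -∫ x in max ξ₀ (k y)..y,
        2 * ((starRingEnd ℂ) (V (x, y)) * f (V (x, y)) (U (x, y))).re := by
      rw [← intervalIntegral.integral_neg]
      refine intervalIntegral.integral_congr fun x _ => ?_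
      have := hf.charge (U (x, y)) (V (x, y))
      simp only [hσ]; linarith
    simp only [h2]; linarith
  -- Equating the two iterated integrals of σ leaves only values of the fields on the edges of the
  -- past.
  have hF := (H.integral_past_vertical hσc.continuousOn h0).symm.trans
    (H.integral_past_horizontal hσc.continuousOn h0)
  rw [hA, hB, intervalIntegral.integral_sub, intervalIntegral.integral_sub] at hF
  rotate_left
  iterate 4 exact Continuous.intervalIntegrable (by fun_prop) _ _
  rw [integral_boundary_eq H hU h0 S.boundary] at hF
  have hI : ∀ a b : ℝ, IntervalIntegrable (fun y => ‖V (max ξ₀ (k y), y)‖ ^ 2) volume a b :=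
    fun a b => Continuous.intervalIntegrable (by fun_prop) _ _
  rw [← intervalIntegral.integral_add_adjacent_intervals (hI (max ξ₀ 0) (h ξ₀)) (hI _ _)] at hF
  -- Above the height `h ξ₀` the horizontal slices end on the edge ξ = ξ₀ instead of the mirror.
  have hD : ∫ y in h ξ₀..η₀, ‖V (max ξ₀ (k y), y)‖ ^ 2 = ∫ y in h ξ₀..η₀, ‖V (ξ₀, y)‖ ^ 2 := by
    refine intervalIntegral.integral_congr fun y hy => ?_
    rw [uIcc_of_le h0] at hy
    have := ((H.h_le_iff ((H.h_nonneg _).trans hy.1)).1 hy.1).1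
    simp only [max_eq_left this]
  -- Below that height the slices end on the mirror, and the charge of V arriving there dominates
  -- the charge of U that leaves it.
  have hR : ∫ x in ξ₀..max ξ₀ 0, ‖μ x‖ ^ 2 * ‖V (x, h x)‖ ^ 2
      ≤ ∫ y in max ξ₀ 0..h ξ₀, ‖V (max ξ₀ (k y), y)‖ ^ 2 := by
    have e1 := H.integral_boundary_le (w := fun y => ‖V (max ξ₀ (k y), y)‖ ^ 2)
      (by fun_prop) (fun y => by positivity)
    refine le_trans (le_of_eq ?_) e1
    rcases le_total ξ₀ 0 with h1 | h1
    · rw [max_eq_right h1]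
      refine intervalIntegral.integral_congr fun x hx => ?_
      rw [uIcc_of_le h1] at hx
      rw [H.k_h x hx.2, max_eq_right hx.1]
    · rw [max_eq_left h1]; simp
  have hE : baseCharge U V ξ₀ η₀ = (∫ x in max ξ₀ 0..η₀, ‖U (x, x)‖ ^ 2)
      + ∫ x in max ξ₀ 0..η₀, ‖V (x, x)‖ ^ 2 :=
    intervalIntegral.integral_add (Continuous.intervalIntegrable (by fun_prop) _ _)
      (Continuous.intervalIntegrable (by fun_prop) _ _)
  rw [hD] at hF
  rw [hE]
  linarith

/-- Each point of the past is the apex of a smaller past, to which the charge inequality applies;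
its data form part of the original data. -/
lemma charge_bounds (S : IsMild f h μ ξ₀ η₀ U V) (H : IsMirror h k μ ξ₀)
    (hf : IsChargeRHS m C f) {x y : ℝ} (hp : (x, y) ∈ past h ξ₀ η₀) :
    ∫ r in x..y, ‖U (r, y)‖ ^ 2 ≤ baseCharge U V ξ₀ η₀ ∧
      ∫ r in h x..y, ‖V (x, r)‖ ^ 2 ≤ baseCharge U V ξ₀ η₀ := by
  have h1 := (S.mono hp.1 hp.2.2).charge_le_apex (H.mono hp.1) hf hp.2.1
  have h2 := baseCharge_mono S.continuous_U S.continuous_V hp.1 hp.2.2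
    ((H.base_le_h x).trans hp.2.1)
  have h3 : 0 ≤ ∫ r in x..y, ‖U (r, y)‖ ^ 2 :=
    intervalIntegral.integral_nonneg ((H.le_h x).trans hp.2.1) fun r _ => by positivity
  have h4 : 0 ≤ ∫ r in h x..y, ‖V (x, r)‖ ^ 2 :=
    intervalIntegral.integral_nonneg hp.2.1 fun r _ => by positivity
  constructor <;> linarith

/-- Bounds along the characteristics. -/
lemma pointwise_bounds (S : IsMild f h μ ξ₀ η₀ U V) (H : IsMirror h k μ ξ₀)
    (hf : IsChargeRHS m C f) (hm : 0 ≤ m) (hC : 0 ≤ C) {E : ℝ} (hE : baseCharge U V ξ₀ η₀ ≤ E)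
    {x y : ℝ} (hp : (x, y) ∈ past h ξ₀ η₀) :
    ‖U (x, y)‖ ^ 2 ≤ Real.exp (m * (η₀ - ξ₀) + C * E) * (‖U (x, h x)‖ ^ 2 + m * E) ∧
      ‖V (x, y)‖ ^ 2 ≤ Real.exp (m * (η₀ - ξ₀) + C * E) * (‖V (y, y)‖ ^ 2 + m * E) := by
  have hU := S.continuous_U
  have hV := S.continuous_V
  have hfc := hf.continuous
  have hxy : x ≤ y := (H.le_h x).trans hp.2.1
  have hhy : h x ≤ y := hp.2.1
  -- The Grönwall coefficients on the two characteristics through (x, y) are m + C‖V‖² and m +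
  -- C‖U‖². The charge bounds their integrals by m(η₀ - ξ₀) + C E.
  obtain ⟨c1, c2⟩ := S.charge_bounds H hf hp
  have c3 : 0 ≤ ∫ r in x..y, ‖U (r, y)‖ ^ 2 :=
    intervalIntegral.integral_nonneg hxy fun r _ => by positivity
  have c4 : 0 ≤ ∫ r in h x..y, ‖V (x, r)‖ ^ 2 :=
    intervalIntegral.integral_nonneg hhy fun r _ => by positivity
  constructor
  · have := norm_sq_le_of_primitive (w := fun r => U (x, r))
      (g := fun r => f (U (x, r)) (V (x, r))) (a := fun r => m + C * ‖V (x, r)‖ ^ 2)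
      (b := fun r => m * ‖V (x, r)‖ ^ 2)
      (hfc.comp (by fun_prop : Continuous fun r => (U (x, r), V (x, r)))) hhy
      (fun r hr => S.eq_U x r ⟨hp.1, hr.1, hr.2.trans hp.2.2⟩) (by fun_prop) (by fun_prop)
      (fun r => by positivity) (fun r => by positivity) (fun r _ => hf.growth _ _)
    refine this.trans ?_
    rw [intervalIntegral.integral_add (Continuous.intervalIntegrable (by fun_prop) _ _)
      (Continuous.intervalIntegrable (by fun_prop) _ _), intervalIntegral.integral_const_mul,
      intervalIntegral.integral_const_mul, intervalIntegral.integral_const, smul_eq_mul]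
    have e1 : (y - h x) * m ≤ m * (η₀ - ξ₀) := by
      rw [mul_comm]; gcongr
      · exact hp.2.2
      · exact hp.1.trans (H.le_h x)
    gcongr
    · exact c2.trans hE
    · exact c2.trans hE
  · have := norm_sq_le_of_primitive_left (w := fun r => V (r, y))
      (g := fun r => f (V (r, y)) (U (r, y))) (a := fun r => m + C * ‖U (r, y)‖ ^ 2)
      (b := fun r => m * ‖U (r, y)‖ ^ 2)
      (hfc.comp (by fun_prop : Continuous fun r => (V (r, y), U (r, y)))) hxy
      (fun r hr => S.eq_V r y ⟨hp.1.trans hr.1, H.h_le_of_le hp.2.1 hr.1 hr.2, hp.2.2⟩)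
      (by fun_prop) (by fun_prop)
      (fun r => by positivity) (fun r => by positivity) (fun r _ => hf.growth _ _)
    refine this.trans ?_
    rw [intervalIntegral.integral_add (Continuous.intervalIntegrable (by fun_prop) _ _)
      (Continuous.intervalIntegrable (by fun_prop) _ _), intervalIntegral.integral_const_mul,
      intervalIntegral.integral_const_mul, intervalIntegral.integral_const, smul_eq_mul]
    have e1 : (y - x) * m ≤ m * (η₀ - ξ₀) := by
      rw [mul_comm]; gcongr
      · exact hp.2.2
      · exact hp.1
    gcongr
    · exact c1.trans hE
    · exact c1.trans hE

end IsMild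

end DiracIBVP

/-! ### A two-dimensional Grönwall inequality. -/

namespace DiracIBVP

/-- The integrand is an exact derivative up to the factor 4 in the exponent, and that factor is the
gain that makes the iteration of `gronwall_past` contract. -/
lemma integral_mul_exp_le {B : ℝ → ℝ} (hB : Continuous B) (c d s t : ℝ) :
    ∫ r in s..t, B r * Real.exp (4 * ((∫ q in c..r, B q) + d))
      ≤ Real.exp (4 * ((∫ q in c..t, B q) + d)) / 4 := by
  have h1 : ∀ r, HasDerivAt (fun r => Real.exp (4 * ((∫ q in c..r, B q) + d)) / 4)
      (B r * Real.exp (4 * ((∫ q in c..r, B q) + d))) r := by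
    intro r
    have := hasDerivAt_primitive hB 0 c r
    simp only [zero_add] at this
    exact (((this.add_const d).const_mul 4).exp.div_const 4).congr_deriv (by ring)
  have hc : Continuous fun r => ∫ q in c..r, B q := by
    refine continuous_iff_continuousAt.2 fun r => ?_
    have := hasDerivAt_primitive hB 0 c r
    simp only [zero_add] at this
    exact this.continuousAt
  rw [intervalIntegral.integral_eq_sub_of_hasDerivAt (fun r _ => h1 r)
    (Continuous.intervalIntegrable (by fun_prop) _ _)]
  have := Real.exp_pos (4 * ((∫ q in c..s, B q) + d))
  linarith

lemma integral_mul_exp_le_left {A : ℝ → ℝ} (hA : Continuous A) (c d s t : ℝ) :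
    ∫ r in s..t, A r * Real.exp (4 * ((∫ q in r..c, A q) + d))
      ≤ Real.exp (4 * ((∫ q in s..c, A q) + d)) / 4 := by
  have := integral_mul_exp_le (B := fun r => A (-r)) (hA.comp continuous_neg) (-c) d (-t) (-s)
  simp only [intervalIntegral.integral_comp_neg A, neg_neg] at this
  rwa [intervalIntegral.integral_comp_neg
    (fun r => A r * Real.exp (4 * ((∫ q in r..c, A q) + d))), neg_neg, neg_neg] at this

/-- A two-dimensional Grönwall inequality on the causal past. -/
lemma gronwall_past {h k : ℝ → ℝ} {μ : ℝ → ℂ} {ξ₀ η₀ : ℝ} (H : IsMirror h k μ ξ₀)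
    {R S : ℝ × ℝ → ℝ} {A B : ℝ → ℝ} {n : ℝ} (hn : 0 ≤ n)
    (hRc : Continuous R) (hSc : Continuous S) (hA : Continuous A) (hB : Continuous B)
    (hA0 : ∀ x, 0 ≤ A x) (hB0 : ∀ x, 0 ≤ B x)
    (hR : ∀ x y, (x, y) ∈ past h ξ₀ η₀ → R (x, y) ≤ n + ∫ r in h x..y, B r * S (x, r))
    (hS : ∀ x y, (x, y) ∈ past h ξ₀ η₀ →
      S (x, y) ≤ n + ∫ r in x..y, A r * (R (r, y) + S (r, h r))) :
    ∀ p ∈ past h ξ₀ η₀,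
      R p ≤ 2 * n * Real.exp (4 * ((∫ r in max ξ₀ 0..η₀, B r) + ∫ r in ξ₀..η₀, A r)) ∧
      S p ≤ 2 * n * Real.exp (4 * ((∫ r in max ξ₀ 0..η₀, B r) + ∫ r in ξ₀..η₀, A r)) := by
  have hh := H.continuous_h
  -- Suppose R and S are at most Z times this weight. Integration gains 1/4; the inequality for S
  -- has two terms under the integral, so both functions improve to n + Z/2 times the weight.
  set W : ℝ → ℝ → ℝ := fun x y =>
    Real.exp (4 * ((∫ q in max ξ₀ 0..y, B q) + ∫ q in x..η₀, A q)) with hW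
  have hmem : ∀ x y, (x, y) ∈ past h ξ₀ η₀ → x ≤ y ∧ max ξ₀ 0 ≤ y ∧ x ≤ η₀ :=
    fun x y hp => ⟨(H.le_h x).trans hp.2.1, max_le (H.past_subset hp).2.1
      ((H.h_nonneg x).trans hp.2.1), (H.past_subset hp).1.2⟩
  have hW1 : ∀ x y, (x, y) ∈ past h ξ₀ η₀ → 1 ≤ W x y := by
    intro x y hp
    have h1 : 0 ≤ ∫ q in max ξ₀ 0..y, B q :=
      intervalIntegral.integral_nonneg (hmem x y hp).2.1 fun q _ => hB0 q
    have h2 : 0 ≤ ∫ q in x..η₀, A q :=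
      intervalIntegral.integral_nonneg (hmem x y hp).2.2 fun q _ => hA0 q
    exact Real.one_le_exp (by linarith)
  have hcB : Continuous fun r => ∫ q in max ξ₀ 0..r, B q := by
    refine continuous_iff_continuousAt.2 fun r => ?_
    have := hasDerivAt_primitive hB 0 (max ξ₀ 0) r
    simp only [zero_add] at this
    exact this.continuousAt
  have hcA : Continuous fun r => ∫ q in r..η₀, A q := by
    have : (fun r => ∫ q in r..η₀, A q) = fun r => -∫ q in η₀..r, A q := by
      ext r; exact intervalIntegral.integral_symm _ _
    rw [this]
    refine (continuous_iff_continuousAt.2 fun r => ?_ : Continuous fun r => ∫ q in η₀..r, A q).neg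
    have := hasDerivAt_primitive hA 0 η₀ r
    simp only [zero_add] at this
    exact this.continuousAt
  -- one step of the iteration
  have step : ∀ Z : ℝ, 0 ≤ Z →
      (∀ x y, (x, y) ∈ past h ξ₀ η₀ → R (x, y) ≤ Z * W x y ∧ S (x, y) ≤ Z * W x y) →
      ∀ x y, (x, y) ∈ past h ξ₀ η₀ →
        R (x, y) ≤ (n + Z / 2) * W x y ∧ S (x, y) ≤ (n + Z / 2) * W x y := by
    intro Z hZ hb x y hp
    have hw := hW1 x y hp
    have hnw : n ≤ n * W x y := le_mul_of_one_le_right hn hw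
    have hw0 : 0 ≤ W x y := by linarith
    constructor
    · have h1 : ∫ r in h x..y, B r * S (x, r) ≤ ∫ r in h x..y, Z * (B r * W x r) := by
        refine intervalIntegral.integral_mono_on hp.2.1
          (Continuous.intervalIntegrable (by fun_prop) _ _)
          (Continuous.intervalIntegrable (by fun_prop) _ _) fun r hr => ?_
        have := (hb x r ⟨hp.1, hr.1, hr.2.trans hp.2.2⟩).2
        calc B r * S (x, r) ≤ B r * (Z * W x r) := mul_le_mul_of_nonneg_left this (hB0 r)
          _ = _ := by ring
      rw [intervalIntegral.integral_const_mul] at h1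
      have h2 := integral_mul_exp_le hB (max ξ₀ 0) (∫ q in x..η₀, A q) (h x) y
      have h3 := mul_le_mul_of_nonneg_left h2 hZ
      have h4 := hR x y hp
      have h5 : Real.exp (4 * ((∫ q in max ξ₀ 0..y, B q) + ∫ q in x..η₀, A q)) = W x y := rfl
      rw [h5] at h3
      have h6 : Z * (W x y / 4) ≤ Z / 2 * W x y := by nlinarith [mul_nonneg hZ hw0]
      have h7 : Z * ∫ r in h x..y, B r * W x r ≤ Z * (W x y / 4) := h3
      linarith
    · have h1 : ∫ r in x..y, A r * (R (r, y) + S (r, h r))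
          ≤ ∫ r in x..y, 2 * Z * (A r * W r y) := by
        refine intervalIntegral.integral_mono_on (hmem x y hp).1
          (Continuous.intervalIntegrable (by fun_prop) _ _)
          (Continuous.intervalIntegrable (by fun_prop) _ _) fun r hr => ?_
        have hry : h r ≤ y := H.h_le_of_le hp.2.1 hr.1 hr.2
        have e1 := (hb r y ⟨hp.1.trans hr.1, hry, hp.2.2⟩).1
        have e2 := (hb r (h r) ⟨hp.1.trans hr.1, le_rfl, hry.trans hp.2.2⟩).2
        -- The reflected term is evaluated lower on the same vertical line, where the weight is
        -- smaller.
        have e3 : W r (h r) ≤ W r y := by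
          refine Real.exp_le_exp.2 ?_
          have : ∫ q in max ξ₀ 0..h r, B q ≤ ∫ q in max ξ₀ 0..y, B q := by
            refine intervalIntegral.integral_mono_interval le_rfl
              ((max_le_max (hp.1.trans hr.1) le_rfl).trans (H.base_le_h r)) hry (Eventually.of_forall hB0)
              (hB.intervalIntegrable _ _)
          linarith
        have e4 := mul_le_mul_of_nonneg_left e3 hZ
        calc A r * (R (r, y) + S (r, h r)) ≤ A r * (2 * Z * W r y) :=
              mul_le_mul_of_nonneg_left (by linarith) (hA0 r)
          _ = _ := by ring
      rw [intervalIntegral.integral_const_mul] at h1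
      have h2 := integral_mul_exp_le_left hA η₀ (∫ q in max ξ₀ 0..y, B q) x y
      have h4 := hS x y hp
      have h5 : ∀ r, Real.exp (4 * ((∫ q in r..η₀, A q) + ∫ q in max ξ₀ 0..y, B q)) = W r y := by
        intro r; simp only [hW]; rw [add_comm]
      simp only [h5] at h2
      have h3 := mul_le_mul_of_nonneg_left h2 (by linarith : 0 ≤ 2 * Z)
      linarith
  obtain ⟨Z₀, hZ₀⟩ := (H.isCompact_past (η₀ := η₀)).exists_bound_of_continuousOn
    (hRc.prodMk hSc).continuousOn
  have hiter : ∀ j : ℕ, ∀ x y, (x, y) ∈ past h ξ₀ η₀ →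
      R (x, y) ≤ (2 * n + |Z₀| / 2 ^ j) * W x y ∧ S (x, y) ≤ (2 * n + |Z₀| / 2 ^ j) * W x y := by
    intro j
    induction j with
    | zero =>
      intro x y hp
      have h1 := hZ₀ _ hp
      have h2 : R (x, y) ≤ |Z₀| := (le_abs_self _).trans
        ((norm_fst_le (R (x, y), S (x, y))).trans (h1.trans (le_abs_self _)))
      have h3 : S (x, y) ≤ |Z₀| := (le_abs_self _).trans
        ((norm_snd_le (R (x, y), S (x, y))).trans (h1.trans (le_abs_self _)))
      have h4 : |Z₀| ≤ (2 * n + |Z₀| / 2 ^ 0) * W x y := by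
        have := hW1 x y hp
        have := abs_nonneg Z₀
        rw [pow_zero, div_one]
        nlinarith
      exact ⟨h2.trans h4, h3.trans h4⟩
    | succ j ih =>
      have := step _ (by positivity) ih
      intro x y hp
      -- The map Z ↦ n + Z/2 has the fixed point 2n, which explains the 2n in the conclusion; the
      -- excess halves at each step.
      have e : n + (2 * n + |Z₀| / 2 ^ j) / 2 = 2 * n + |Z₀| / 2 ^ (j + 1) := by
        rw [pow_succ]; field_simp; ring
      rw [← e]
      exact this x y hp
  rintro ⟨x, y⟩ hp
  have hlim : Tendsto (fun j : ℕ => (2 * n + |Z₀| / 2 ^ j) * W x y) atTop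
      (𝓝 ((2 * n + 0) * W x y)) := by
    refine (tendsto_const_nhds.add ?_).mul_const _
    have := tendsto_pow_atTop_nhds_zero_of_lt_one (r := (1 / 2 : ℝ)) (by norm_num) (by norm_num)
    have := this.const_mul |Z₀|
    rw [mul_zero] at this
    refine this.congr fun j => ?_
    rw [one_div, inv_pow]; rfl
  have hfin : (2 * n + 0) * W x y
      ≤ 2 * n * Real.exp (4 * ((∫ r in max ξ₀ 0..η₀, B r) + ∫ r in ξ₀..η₀, A r)) := by
    rw [add_zero]
    refine mul_le_mul_of_nonneg_left (Real.exp_le_exp.2 ?_) (by linarith)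
    have e1 : ∫ q in max ξ₀ 0..y, B q ≤ ∫ q in max ξ₀ 0..η₀, B q :=
      intervalIntegral.integral_mono_interval le_rfl (hmem x y hp).2.1 hp.2.2
        (Eventually.of_forall hB0) (hB.intervalIntegrable _ _)
    have e2 : ∫ q in x..η₀, A q ≤ ∫ q in ξ₀..η₀, A q :=
      intervalIntegral.integral_mono_interval hp.1 (hmem x y hp).2.2 le_rfl
        (Eventually.of_forall hA0) (hA.intervalIntegrable _ _)
    linarith
  exact ⟨(ge_of_tendsto' hlim fun j => (hiter j x y hp).1).trans hfin,
    (ge_of_tendsto' hlim fun j => (hiter j x y hp).2).trans hfin⟩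

end DiracIBVP

/-! ### Differences of two solutions along one characteristic. -/

namespace DiracIBVP

lemma continuous_integral_between {X E : Type*} [TopologicalSpace X] [FirstCountableTopology X]
    [LocallyCompactSpace X] [NormedAddCommGroup E] [NormedSpace ℝ E]
    {F : X → ℝ → E} (hF : Continuous (Function.uncurry F)) {a b : X → ℝ}
    (ha : Continuous a) (hb : Continuous b) : Continuous fun p => ∫ r in a p..b p, F p r := by
  have h1 : (fun p => ∫ r in a p..b p, F p r)
      = fun p => (∫ r in 0..b p, F p r) - ∫ r in 0..a p, F p r := by
    ext p
    have hFp : Continuous (F p) := hF.comp (by fun_prop : Continuous fun r => (p, r))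
    rw [intervalIntegral.integral_interval_sub_left (hFp.intervalIntegrable _ _)
      (hFp.intervalIntegrable _ _)]
  rw [h1]
  exact (intervalIntegral.continuous_parametric_intervalIntegral_of_continuous hF hb).sub
    (intervalIntegral.continuous_parametric_intervalIntegral_of_continuous hF ha)

/-- Growth factor along characteristics. -/
noncomputable def growthFactor (m G ξ₀ η₀ E : ℝ) : ℝ := Real.exp (m * (η₀ - ξ₀) + 4 * G * E)

lemma growthFactor_pos (m G ξ₀ η₀ E : ℝ) : 0 < growthFactor m G ξ₀ η₀ E := Real.exp_pos _

/-- The interaction coefficient of a field whose squared modulus starts a characteristic with the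
value `w`. -/
noncomputable def interaction (m G ξ₀ η₀ E w : ℝ) : ℝ :=
  m + G * (growthFactor m G ξ₀ η₀ E * (w + m * E))

lemma interaction_nonneg {m G E w : ℝ} (ξ₀ η₀ : ℝ) (hm : 0 ≤ m) (hG : 0 ≤ G) (hE : 0 ≤ E)
    (hw : 0 ≤ w) : 0 ≤ interaction m G ξ₀ η₀ E w := by
  have := growthFactor_pos m G ξ₀ η₀ E
  unfold interaction
  positivity

lemma continuous_interaction (m G ξ₀ η₀ E : ℝ) : Continuous (interaction m G ξ₀ η₀ E) := by
  unfold interaction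
  fun_prop

namespace IsMild

variable {h k : ℝ → ℝ} {μ : ℝ → ℂ} {ξ₀ η₀ : ℝ} {U V U' V' : ℝ × ℝ → ℂ} {m α β E : ℝ}

/-- The exponent is weakened from G E to 4 G E, so that one growth factor serves both single
solutions and differences. -/
lemma pointwise_bounds' (S : IsMild (nullRHS m α β) h μ ξ₀ η₀ U V) (H : IsMirror h k μ ξ₀)
    (hm : 0 ≤ m) (h0 : h ξ₀ ≤ η₀) (hE : baseCharge U V ξ₀ η₀ ≤ E)
    {x y : ℝ} (hp : (x, y) ∈ past h ξ₀ η₀) :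
    ‖U (x, y)‖ ^ 2 ≤ growthFactor m (strength α β) ξ₀ η₀ E * (‖U (x, h x)‖ ^ 2 + m * E) ∧
    ‖V (x, y)‖ ^ 2 ≤ growthFactor m (strength α β) ξ₀ η₀ E * (‖V (y, y)‖ ^ 2 + m * E) := by
  have hE0 : 0 ≤ E := (baseCharge_nonneg U V ((H.base_le_h ξ₀).trans h0)).trans hE
  have hG := strength_nonneg α β
  have h1 := S.pointwise_bounds H (isChargeRHS_nullRHS hm α β) hm hG hE hp
  have h2 : Real.exp (m * (η₀ - ξ₀) + strength α β * E)
      ≤ growthFactor m (strength α β) ξ₀ η₀ E :=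
    Real.exp_le_exp.2 (by nlinarith [mul_nonneg hG hE0])
  exact ⟨h1.1.trans (by gcongr), h1.2.trans (by gcongr)⟩

/-- The pointwise bound of the primed field depends only on where its characteristic starts, so it
leaves the integral as a constant; what remains is the square of the other difference, integrated
along the characteristic. -/
lemma sub_bounds (S : IsMild (nullRHS m α β) h μ ξ₀ η₀ U V)
    (S' : IsMild (nullRHS m α β) h μ ξ₀ η₀ U' V') (H : IsMirror h k μ ξ₀)
    (hm : 0 ≤ m) (h0 : h ξ₀ ≤ η₀) (hE : baseCharge U V ξ₀ η₀ ≤ E)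
    (hE' : baseCharge U' V' ξ₀ η₀ ≤ E) {x y : ℝ} (hp : (x, y) ∈ past h ξ₀ η₀) :
    ‖U (x, y) - U' (x, y)‖ ^ 2 ≤ growthFactor m (strength α β) ξ₀ η₀ E *
      (‖U (x, h x) - U' (x, h x)‖ ^ 2 + interaction m (strength α β) ξ₀ η₀ E (‖U' (x, h x)‖ ^ 2)
        * ∫ r in h x..y, ‖V (x, r) - V' (x, r)‖ ^ 2) ∧
    ‖V (x, y) - V' (x, y)‖ ^ 2 ≤ growthFactor m (strength α β) ξ₀ η₀ E *
      (‖V (y, y) - V' (y, y)‖ ^ 2 + interaction m (strength α β) ξ₀ η₀ E (‖V' (y, y)‖ ^ 2)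
        * ∫ r in x..y, ‖U (r, y) - U' (r, y)‖ ^ 2) := by
  have hU := S.continuous_U
  have hV := S.continuous_V
  have hU' := S'.continuous_U
  have hV' := S'.continuous_V
  have hf := isChargeRHS_nullRHS hm α β
  have hfc := hf.continuous
  have hG := strength_nonneg α β
  have hM := growthFactor_pos m (strength α β) ξ₀ η₀ E
  have hE0 : 0 ≤ E := (baseCharge_nonneg U V ((H.base_le_h ξ₀).trans h0)).trans hE
  have hhy : h x ≤ y := hp.2.1
  have hxy : x ≤ y := (H.le_h x).trans hhy
  obtain ⟨c1, c2⟩ := S.charge_bounds H hf hp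
  obtain ⟨c1', c2'⟩ := S'.charge_bounds H hf hp
  have k1 : Continuous fun r => nullRHS m α β (U (x, r)) (V (x, r)) :=
    hfc.comp (by fun_prop : Continuous fun r => (U (x, r), V (x, r)))
  have k2 : Continuous fun r => nullRHS m α β (U' (x, r)) (V' (x, r)) :=
    hfc.comp (by fun_prop : Continuous fun r => (U' (x, r), V' (x, r)))
  have k3 : Continuous fun r => nullRHS m α β (V (r, y)) (U (r, y)) :=
    hfc.comp (by fun_prop : Continuous fun r => (V (r, y), U (r, y)))
  have k4 : Continuous fun r => nullRHS m α β (V' (r, y)) (U' (r, y)) :=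
    hfc.comp (by fun_prop : Continuous fun r => (V' (r, y), U' (r, y)))
  constructor
  · have := norm_sq_le_of_primitive (w := fun r => U (x, r) - U' (x, r))
      (g := fun r => nullRHS m α β (U (x, r)) (V (x, r)) - nullRHS m α β (U' (x, r)) (V' (x, r)))
      (a := fun r => m + 2 * strength α β * (‖V (x, r)‖ ^ 2 + ‖V' (x, r)‖ ^ 2))
      -- `interaction` is m + G‖U'‖² with ‖U'‖² replaced by its bound from the base, hence
      -- independent of r.
      (b := fun r => interaction m (strength α β) ξ₀ η₀ E (‖U' (x, h x)‖ ^ 2) * ‖V (x, r) - V' (x, r)‖ ^ 2)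
      (k1.sub k2) hhy
      (fun r hr => by
        have hr' : (x, r) ∈ past h ξ₀ η₀ := ⟨hp.1, hr.1, hr.2.trans hp.2.2⟩
        rw [intervalIntegral.integral_sub (k1.intervalIntegrable _ _) (k2.intervalIntegrable _ _),
          S.eq_U x r hr', S'.eq_U x r hr']
        ring)
      (by fun_prop) (by fun_prop)
      (fun r => by positivity)
      (fun r => mul_nonneg (interaction_nonneg _ _ hm hG hE0 (by positivity)) (by positivity))
      (fun r hr => by
        unfold interaction
        refine (two_re_conj_sub_mul_le hm α β _ _ _ _).trans ?_
        gcongr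
        exact (S'.pointwise_bounds' H hm h0 hE' (x := x) (y := r)
          ⟨hp.1, hr.1, hr.2.trans hp.2.2⟩).1)
    refine this.trans ?_
    rw [intervalIntegral.integral_add (Continuous.intervalIntegrable (by fun_prop) _ _)
      (Continuous.intervalIntegrable (by fun_prop) _ _), intervalIntegral.integral_const_mul,
      intervalIntegral.integral_const_mul, intervalIntegral.integral_const, smul_eq_mul,
      intervalIntegral.integral_add (Continuous.intervalIntegrable (by fun_prop) _ _)
      (Continuous.intervalIntegrable (by fun_prop) _ _)]
    have c4 : 0 ≤ ∫ r in h x..y, ‖V (x, r) - V' (x, r)‖ ^ 2 :=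
      intervalIntegral.integral_nonneg hhy fun r _ => by positivity
    have e1 : (y - h x) * m ≤ m * (η₀ - ξ₀) := by
      rw [mul_comm]; gcongr
      · exact hp.2.2
      · exact hp.1.trans (H.le_h x)
    -- The coefficient 2G(‖V‖² + ‖V'‖²) integrates to at most 2G(E + E), the 4 G E of
    -- `growthFactor`.
    refine mul_le_mul (Real.exp_le_exp.2 (by nlinarith)) le_rfl
      (add_nonneg (by positivity)
        (mul_nonneg (interaction_nonneg _ _ hm hG hE0 (by positivity)) c4)) hM.le
  · have := norm_sq_le_of_primitive_left (w := fun r => V (r, y) - V' (r, y))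
      (g := fun r => nullRHS m α β (V (r, y)) (U (r, y)) - nullRHS m α β (V' (r, y)) (U' (r, y)))
      (a := fun r => m + 2 * strength α β * (‖U (r, y)‖ ^ 2 + ‖U' (r, y)‖ ^ 2))
      (b := fun r => interaction m (strength α β) ξ₀ η₀ E (‖V' (y, y)‖ ^ 2) * ‖U (r, y) - U' (r, y)‖ ^ 2)
      (k3.sub k4) hxy
      (fun r hr => by
        have hr' : (r, y) ∈ past h ξ₀ η₀ :=
          ⟨hp.1.trans hr.1, H.h_le_of_le hhy hr.1 hr.2, hp.2.2⟩
        rw [intervalIntegral.integral_sub (k3.intervalIntegrable _ _) (k4.intervalIntegrable _ _),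
          S.eq_V r y hr', S'.eq_V r y hr']
        ring)
      (by fun_prop) (by fun_prop)
      (fun r => by positivity)
      (fun r => mul_nonneg (interaction_nonneg _ _ hm hG hE0 (by positivity)) (by positivity))
      (fun r hr => by
        unfold interaction
        refine (two_re_conj_sub_mul_le hm α β _ _ _ _).trans ?_
        gcongr
        exact (S'.pointwise_bounds' H hm h0 hE' (x := r) (y := y)
          ⟨hp.1.trans hr.1, H.h_le_of_le hhy hr.1 hr.2, hp.2.2⟩).2)
    refine this.trans ?_
    rw [intervalIntegral.integral_add (Continuous.intervalIntegrable (by fun_prop) _ _)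
      (Continuous.intervalIntegrable (by fun_prop) _ _), intervalIntegral.integral_const_mul,
      intervalIntegral.integral_const_mul, intervalIntegral.integral_const, smul_eq_mul,
      intervalIntegral.integral_add (Continuous.intervalIntegrable (by fun_prop) _ _)
      (Continuous.intervalIntegrable (by fun_prop) _ _)]
    have c4 : 0 ≤ ∫ r in x..y, ‖U (r, y) - U' (r, y)‖ ^ 2 :=
      intervalIntegral.integral_nonneg hxy fun r _ => by positivity
    have e1 : (y - x) * m ≤ m * (η₀ - ξ₀) := by
      rw [mul_comm]; gcongr
      · exact hp.2.2
      · exact hp.1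
    refine mul_le_mul (Real.exp_le_exp.2 (by nlinarith)) le_rfl
      (add_nonneg (by positivity)
        (mul_nonneg (interaction_nonneg _ _ hm hG hE0 (by positivity)) c4)) hM.le

end IsMild

end DiracIBVP

/-! ### Stability of mild solutions with respect to their data. -/

namespace DiracIBVP

variable {h k : ℝ → ℝ} {μ : ℝ → ℂ} {ξ₀ η₀ : ℝ} {U V U' V' : ℝ × ℝ → ℂ} {m α β E : ℝ}

/-- The reflected weight is integrated over the whole base. For positive x the value of μ has no
physical meaning and is merely bounded by b, whence the extra b² in the constant. -/
lemma IsMirror.integral_reflected_le (H : IsMirror h k μ ξ₀) (h0 : h ξ₀ ≤ η₀) {b : ℝ}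
    (hb : ∀ x ∈ Icc ξ₀ η₀, ‖μ x‖ ≤ b) {w : ℝ → ℝ} (hw : Continuous w) (hw0 : ∀ y, 0 ≤ w y) :
    ∫ x in ξ₀..η₀, ‖μ x‖ ^ 2 * w (h x) ≤ (1 + b ^ 2) * ∫ y in max ξ₀ 0..η₀, w y := by
  have hh := H.continuous_h
  have hμ := H.continuous_μ
  have hbase := H.base_le_h ξ₀
  rw [← intervalIntegral.integral_add_adjacent_intervals (b := max ξ₀ 0)
    (Continuous.intervalIntegrable (by fun_prop) _ _)
    (Continuous.intervalIntegrable (by fun_prop) _ _)]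
  have e1 := H.integral_boundary_le hw hw0
  have e2 : ∫ y in max ξ₀ 0..h ξ₀, w y ≤ ∫ y in max ξ₀ 0..η₀, w y :=
    intervalIntegral.integral_mono_interval le_rfl hbase h0 (Eventually.of_forall hw0)
      (hw.intervalIntegrable _ _)
  have e3 : ∫ x in max ξ₀ 0..η₀, ‖μ x‖ ^ 2 * w (h x) ≤ ∫ x in max ξ₀ 0..η₀, b ^ 2 * w x := by
    refine intervalIntegral.integral_mono_on (hbase.trans h0)
      (Continuous.intervalIntegrable (by fun_prop) _ _)
      (Continuous.intervalIntegrable (by fun_prop) _ _) fun x hx => ?_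
    rw [H.h_of_nonneg x ((le_max_right _ _).trans hx.1)]
    have := hb x ⟨(le_max_left _ _).trans hx.1, hx.2⟩
    have := hw0 x
    gcongr
  rw [intervalIntegral.integral_const_mul] at e3
  linarith

lemma integral_sq_left_le_baseCharge (hU : Continuous U) (hV : Continuous V) {ξ η : ℝ}
    (h0 : max ξ 0 ≤ η) : ∫ x in max ξ 0..η, ‖U (x, x)‖ ^ 2 ≤ baseCharge U V ξ η := by
  refine intervalIntegral.integral_mono_on h0 (Continuous.intervalIntegrable (by fun_prop) _ _)
    (Continuous.intervalIntegrable (by fun_prop) _ _) fun x _ => ?_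
  have : 0 ≤ ‖V (x, x)‖ ^ 2 := by positivity
  linarith

lemma integral_sq_right_le_baseCharge (hU : Continuous U) (hV : Continuous V) {ξ η : ℝ}
    (h0 : max ξ 0 ≤ η) : ∫ x in max ξ 0..η, ‖V (x, x)‖ ^ 2 ≤ baseCharge U V ξ η := by
  refine intervalIntegral.integral_mono_on h0 (Continuous.intervalIntegrable (by fun_prop) _ _)
    (Continuous.intervalIntegrable (by fun_prop) _ _) fun x _ => ?_
  have : 0 ≤ ‖U (x, x)‖ ^ 2 := by positivity
  linarith

/-- If `‖V(r, y)‖²` is bounded by `g y`, the incoming charge `‖U‖²` on the lower boundary is bounded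
by the charge of the data and `∫ g`. -/
lemma IsMirror.integral_boundary_sq_le (H : IsMirror h k μ ξ₀) (h0 : h ξ₀ ≤ η₀)
    (hU : Continuous U) (hV : Continuous V)
    (hb : ∀ x, ξ₀ ≤ x → x ≤ 0 → h x ≤ η₀ → U (x, h x) = μ x * V (x, h x))
    {g : ℝ → ℝ} (hg : Continuous g) (hg0 : ∀ y, 0 ≤ g y)
    (hVg : ∀ x y, (x, y) ∈ past h ξ₀ η₀ → ‖V (x, y)‖ ^ 2 ≤ g y) :
    ∫ x in ξ₀..η₀, ‖U (x, h x)‖ ^ 2 ≤ (∫ y in max ξ₀ 0..η₀, g y) + baseCharge U V ξ₀ η₀ := by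
  have hh := H.continuous_h
  have hμ := H.continuous_μ
  have hbase := H.base_le_h ξ₀
  rw [integral_boundary_eq H hU h0 hb]
  refine add_le_add ?_ (integral_sq_left_le_baseCharge hU hV (hbase.trans h0))
  calc ∫ x in ξ₀..max ξ₀ 0, ‖μ x‖ ^ 2 * ‖V (x, h x)‖ ^ 2
      ≤ ∫ x in ξ₀..max ξ₀ 0, ‖μ x‖ ^ 2 * g (h x) := by
        refine intervalIntegral.integral_mono_on (le_max_left _ _)
          (Continuous.intervalIntegrable (by fun_prop) _ _)
          (Continuous.intervalIntegrable (by fun_prop) _ _) fun x hx => ?_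
        have := hVg x (h x) ⟨hx.1, le_rfl, H.h_le_of_le h0 hx.1 (hx.2.trans (hbase.trans h0))⟩
        gcongr
    _ ≤ ∫ y in max ξ₀ 0..h ξ₀, g y := H.integral_boundary_le hg hg0
    _ ≤ _ := intervalIntegral.integral_mono_interval le_rfl hbase h0 (Eventually.of_forall hg0)
      (hg.intervalIntegrable _ _)

namespace IsMild

/-- The bound of ‖V(x, y)‖² is a function of y alone, so it can be inserted into the reflection
inequality to control U where it leaves the mirror. -/
lemma integral_profile_le (S : IsMild (nullRHS m α β) h μ ξ₀ η₀ U V) (H : IsMirror h k μ ξ₀)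
    (hm : 0 ≤ m) (h0 : h ξ₀ ≤ η₀) (hE : baseCharge U V ξ₀ η₀ ≤ E) :
    ∫ x in ξ₀..η₀, ‖U (x, h x)‖ ^ 2
      ≤ growthFactor m (strength α β) ξ₀ η₀ E * (E + (η₀ - ξ₀) * (m * E)) + E := by
  have hU := S.continuous_U
  have hV := S.continuous_V
  have hE0 : 0 ≤ E := (baseCharge_nonneg U V ((H.base_le_h ξ₀).trans h0)).trans hE
  have hM := growthFactor_pos m (strength α β) ξ₀ η₀ E
  refine (H.integral_boundary_sq_le h0 hU hV S.boundary
    (g := fun y => growthFactor m (strength α β) ξ₀ η₀ E * (‖V (y, y)‖ ^ 2 + m * E))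
    (by fun_prop) (fun y => by positivity)
    (fun x y hp => (S.pointwise_bounds' H hm h0 hE hp).2)).trans (add_le_add ?_ hE)
  rw [intervalIntegral.integral_const_mul, intervalIntegral.integral_add
    (Continuous.intervalIntegrable (by fun_prop) _ _)
    (Continuous.intervalIntegrable (by fun_prop) _ _), intervalIntegral.integral_const, smul_eq_mul]
  gcongr
  · exact (integral_sq_right_le_baseCharge hU hV ((H.base_le_h ξ₀).trans h0)).trans hE
  · exact le_max_left _ _

end IsMild

lemma integral_interaction_le (hm : 0 ≤ m) {G : ℝ} (hG : 0 ≤ G) (hE0 : 0 ≤ E) {s : ℝ}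
    (hs : ξ₀ ≤ s) {w : ℝ → ℝ} (hw : Continuous w) {K : ℝ} (hK : ∫ x in s..η₀, w x ≤ K) :
    ∫ x in s..η₀, interaction m G ξ₀ η₀ E (w x)
      ≤ (η₀ - ξ₀) * m + G * (growthFactor m G ξ₀ η₀ E * (K + (η₀ - ξ₀) * (m * E))) := by
  have hM := growthFactor_pos m G ξ₀ η₀ E
  unfold interaction
  rw [intervalIntegral.integral_add (Continuous.intervalIntegrable (by fun_prop) _ _)
    (Continuous.intervalIntegrable (by fun_prop) _ _), intervalIntegral.integral_const_mul,
    intervalIntegral.integral_const_mul, intervalIntegral.integral_const,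
    intervalIntegral.integral_add (Continuous.intervalIntegrable (by fun_prop) _ _)
    (Continuous.intervalIntegrable (by fun_prop) _ _), intervalIntegral.integral_const,
    smul_eq_mul, smul_eq_mul]
  gcongr

/-- The difference of two solutions, integrated along characteristics, is controlled by the
difference of the data. -/
lemma exists_characteristic_stability (hm : 0 ≤ m) (α β : ℝ) (H : IsMirror h k μ ξ₀)
    (h0 : h ξ₀ ≤ η₀) (E : ℝ) : ∃ K, 0 ≤ K ∧ ∀ U V U' V' : ℝ × ℝ → ℂ,
      IsMild (nullRHS m α β) h μ ξ₀ η₀ U V → IsMild (nullRHS m α β) h μ ξ₀ η₀ U' V' →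
      baseCharge U V ξ₀ η₀ ≤ E → baseCharge U' V' ξ₀ η₀ ≤ E →
      ∀ x y, (x, y) ∈ past h ξ₀ η₀ →
        ∫ r in h x..y, ‖V (x, r) - V' (x, r)‖ ^ 2 ≤ K * baseCharge (U - U') (V - V') ξ₀ η₀ ∧
        ∫ r in x..y, ‖U (r, y) - U' (r, y)‖ ^ 2 ≤ K * baseCharge (U - U') (V - V') ξ₀ η₀ := by
  have hh := H.continuous_h
  have hμ := H.continuous_μ
  have hbase := H.base_le_h ξ₀
  have hG := strength_nonneg α β
  obtain ⟨b, hb⟩ := (isCompact_Icc (a := ξ₀) (b := η₀)).exists_bound_of_continuousOn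
    hμ.continuousOn
  set G := strength α β with hGdef
  set M := growthFactor m G ξ₀ η₀ E with hMdef
  have hM : 0 < M := growthFactor_pos _ _ _ _ _
  set KB := (η₀ - ξ₀) * m + G * (M * (E + (η₀ - ξ₀) * (m * E))) with hKB
  set KA := (η₀ - ξ₀) * m + G * (M * ((M * (E + (η₀ - ξ₀) * (m * E)) + E)
    + (η₀ - ξ₀) * (m * E))) with hKA
  refine ⟨2 * (M + M ^ 2) * Real.exp (4 * (M * KB + (M * KA + M ^ 2 * ((1 + b ^ 2) * KB)))),
    by positivity, ?_⟩
  intro U V U' V' S S' hE hE'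
  have hU := S.continuous_U
  have hV := S.continuous_V
  have hU' := S'.continuous_U
  have hV' := S'.continuous_V
  have hE0 : 0 ≤ E := (baseCharge_nonneg U V (hbase.trans h0)).trans hE
  set n0 := baseCharge (U - U') (V - V') ξ₀ η₀ with hn0
  have hn00 : 0 ≤ n0 := baseCharge_nonneg _ _ (hbase.trans h0)
  set A : ℝ → ℝ := fun x => interaction m G ξ₀ η₀ E (‖U' (x, h x)‖ ^ 2) with hA
  set B : ℝ → ℝ := fun y => interaction m G ξ₀ η₀ E (‖V' (y, y)‖ ^ 2) with hB
  have hint := continuous_interaction m G ξ₀ η₀ E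
  have hAc : Continuous A := hint.comp (by fun_prop)
  have hBc : Continuous B := hint.comp (by fun_prop)
  have hA0 : ∀ x, 0 ≤ A x := fun x => interaction_nonneg _ _ hm hG hE0 (by positivity)
  have hB0 : ∀ x, 0 ≤ B x := fun x => interaction_nonneg _ _ hm hG hE0 (by positivity)
  -- The unknowns of the two-dimensional Grönwall argument are the characteristic integrals of the
  -- squared differences: each one drives the pointwise estimate of the other field.
  set R : ℝ × ℝ → ℝ := fun p => ∫ r in h p.1..p.2, ‖V (p.1, r) - V' (p.1, r)‖ ^ 2 with hR
  set Q : ℝ × ℝ → ℝ := fun p => ∫ r in p.1..p.2, ‖U (r, p.2) - U' (r, p.2)‖ ^ 2 with hQ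
  have hRc : Continuous R := continuous_integral_between
    (F := fun (p : ℝ × ℝ) r => ‖V (p.1, r) - V' (p.1, r)‖ ^ 2)
    (by fun_prop) (by fun_prop) (by fun_prop)
  have hQc : Continuous Q := continuous_integral_between
    (F := fun (p : ℝ × ℝ) r => ‖U (r, p.2) - U' (r, p.2)‖ ^ 2)
    (by fun_prop) (by fun_prop) (by fun_prop)
  have hR0 : ∀ x y, h x ≤ y → 0 ≤ R (x, y) := fun x y hxy =>
    intervalIntegral.integral_nonneg hxy fun r _ => by positivity
  have hQ0 : ∀ x y, x ≤ y → 0 ≤ Q (x, y) := fun x y hxy =>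
    intervalIntegral.integral_nonneg hxy fun r _ => by positivity
  have hsub : ∀ x y, (x, y) ∈ past h ξ₀ η₀ →
      ‖U (x, y) - U' (x, y)‖ ^ 2 ≤ M * (‖U (x, h x) - U' (x, h x)‖ ^ 2 + A x * R (x, y)) ∧
      ‖V (x, y) - V' (x, y)‖ ^ 2 ≤ M * (‖V (y, y) - V' (y, y)‖ ^ 2 + B y * Q (x, y)) :=
    fun x y hp => S.sub_bounds S' H hm h0 hE hE' hp
  have hVn : ∀ s t, max ξ₀ 0 ≤ s → s ≤ t → t ≤ η₀ →
      ∫ y in s..t, ‖V (y, y) - V' (y, y)‖ ^ 2 ≤ n0 := by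
    intro s t h1 h2 h3
    refine le_trans ?_ (integral_sq_right_le_baseCharge (hU.sub hU') (hV.sub hV')
      (hbase.trans h0))
    exact intervalIntegral.integral_mono_interval h1 h2 h3
      (Eventually.of_forall fun y => by positivity)
      (Continuous.intervalIntegrable (by fun_prop) _ _)
  -- The difference of U starts on the mirror as μ times that of V, which has itself been estimated
  -- by `sub_bounds`. This substitution produces the weight M²‖μ‖²B(h x), the reflected value of Q,
  -- and the M² in front of the data.
  have hgr := gronwall_past H (R := R) (S := Q) (n := (M + M ^ 2) * n0)
    (A := fun x => M * A x + M ^ 2 * (‖μ x‖ ^ 2 * B (h x))) (B := fun y => M * B y)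
    (ξ₀ := ξ₀) (η₀ := η₀) (by positivity) hRc hQc (by fun_prop) (by fun_prop)
    (fun x => by have := hA0 x; have := hB0 (h x); positivity)
    (fun x => by have := hB0 x; positivity) ?_ ?_
  · intro x y hp
    have h1 := hgr (x, y) hp
    have h2 : 2 * ((M + M ^ 2) * n0) * Real.exp (4 * ((∫ r in max ξ₀ 0..η₀, M * B r)
        + ∫ r in ξ₀..η₀, (M * A r + M ^ 2 * (‖μ r‖ ^ 2 * B (h r)))))
        ≤ 2 * (M + M ^ 2) * Real.exp (4 * (M * KB + (M * KA + M ^ 2 * ((1 + b ^ 2) * KB))))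
          * n0 := by
      have eB : ∫ r in max ξ₀ 0..η₀, B r ≤ KB :=
        integral_interaction_le (w := fun y => ‖V' (y, y)‖ ^ 2) hm hG hE0 (le_max_left _ _)
          (by fun_prop)
          ((integral_sq_right_le_baseCharge hU' hV' (hbase.trans h0)).trans hE')
      have eA : ∫ r in ξ₀..η₀, A r ≤ KA :=
        integral_interaction_le (w := fun x => ‖U' (x, h x)‖ ^ 2) hm hG hE0 le_rfl
          (by fun_prop) (S'.integral_profile_le H hm h0 hE')
      have eμ := H.integral_reflected_le h0 hb hBc hB0
      rw [intervalIntegral.integral_add (Continuous.intervalIntegrable (by fun_prop) _ _)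
        (Continuous.intervalIntegrable (by fun_prop) _ _), intervalIntegral.integral_const_mul,
        intervalIntegral.integral_const_mul, intervalIntegral.integral_const_mul]
      have e1 : ∫ x in ξ₀..η₀, ‖μ x‖ ^ 2 * B (h x) ≤ (1 + b ^ 2) * KB :=
        eμ.trans (by gcongr)
      calc _ ≤ 2 * ((M + M ^ 2) * n0)
            * Real.exp (4 * (M * KB + (M * KA + M ^ 2 * ((1 + b ^ 2) * KB)))) := by gcongr
        _ = _ := by ring
    exact ⟨h1.1.trans h2, h1.2.trans h2⟩
  · intro x y hp
    have hhy : h x ≤ y := hp.2.1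
    have h1 : R (x, y) ≤ ∫ r in h x..y, (M * ‖V (r, r) - V' (r, r)‖ ^ 2 + M * B r * Q (x, r)) := by
      refine intervalIntegral.integral_mono_on hhy
        (Continuous.intervalIntegrable (by fun_prop) _ _)
        (Continuous.intervalIntegrable (by fun_prop) _ _) fun r hr => ?_
      refine ((hsub x r ⟨hp.1, hr.1, hr.2.trans hp.2.2⟩).2).trans (le_of_eq (by ring))
    rw [intervalIntegral.integral_add (Continuous.intervalIntegrable (by fun_prop) _ _)
        (Continuous.intervalIntegrable (by fun_prop) _ _),
        intervalIntegral.integral_const_mul] at h1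
    have h2 := hVn (h x) y ((max_le_max hp.1 le_rfl).trans (H.base_le_h x)) hhy hp.2.2
    nlinarith [mul_le_mul_of_nonneg_left h2 hM.le, mul_nonneg (sq_nonneg M) hn00]
  · intro x y hp
    have hhy : h x ≤ y := hp.2.1
    have hxy : x ≤ y := (H.le_h x).trans hhy
    have hxb := H.base_le_h x
    have h1 : Q (x, y) ≤ ∫ r in x..y, (M * ‖U (r, h r) - U' (r, h r)‖ ^ 2
        + M * A r * R (r, y)) := by
      refine intervalIntegral.integral_mono_on hxy
        (Continuous.intervalIntegrable (by fun_prop) _ _)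
        (Continuous.intervalIntegrable (by fun_prop) _ _) fun r hr => ?_
      refine ((hsub r y ⟨hp.1.trans hr.1, H.h_le_of_le hhy hr.1 hr.2, hp.2.2⟩).1).trans
        (le_of_eq (by ring))
    rw [intervalIntegral.integral_add (Continuous.intervalIntegrable (by fun_prop) _ _)
        (Continuous.intervalIntegrable (by fun_prop) _ _),
        intervalIntegral.integral_const_mul] at h1
    have h2 := integral_boundary_eq (U := fun p => U p - U' p) (V := fun p => V p - V' p)
      (H.mono hp.1) (by fun_prop) hhy (fun r hr hr0 hry => by
        rw [S.boundary r (hp.1.trans hr) hr0 (hry.trans hp.2.2),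
          S'.boundary r (hp.1.trans hr) hr0 (hry.trans hp.2.2)]
        ring)
    have h3 : ∫ r in max x 0..y, ‖U (r, r) - U' (r, r)‖ ^ 2 ≤ n0 :=
      (integral_sq_left_le_baseCharge (hU.sub hU') (hV.sub hV') (hxb.trans hhy)).trans
        (baseCharge_mono (hU.sub hU') (hV.sub hV') hp.1 hp.2.2 (hxb.trans hhy))
    have h4 : ∫ r in x..max x 0, ‖μ r‖ ^ 2 * ‖V (r, h r) - V' (r, h r)‖ ^ 2
        ≤ ∫ r in x..max x 0, (M * (‖μ r‖ ^ 2 * ‖V (h r, h r) - V' (h r, h r)‖ ^ 2)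
          + M * (‖μ r‖ ^ 2 * B (h r)) * Q (r, h r)) := by
      refine intervalIntegral.integral_mono_on (le_max_left _ _)
        (Continuous.intervalIntegrable (by fun_prop) _ _)
        (Continuous.intervalIntegrable (by fun_prop) _ _) fun r hr => ?_
      have hry : h r ≤ y := H.h_le_of_le hhy hr.1 (hr.2.trans (hxb.trans hhy))
      have := (hsub r (h r) ⟨hp.1.trans hr.1, le_rfl, hry.trans hp.2.2⟩).2
      have := mul_le_mul_of_nonneg_left this (sq_nonneg ‖μ r‖)
      linarith
    rw [intervalIntegral.integral_add (Continuous.intervalIntegrable (by fun_prop) _ _)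
        (Continuous.intervalIntegrable (by fun_prop) _ _),
        intervalIntegral.integral_const_mul] at h4
    have h5 := (H.mono hp.1).integral_boundary_le
      (w := fun y => ‖V (y, y) - V' (y, y)‖ ^ 2) (by fun_prop) (fun y => by positivity)
    have h6 := hVn (max x 0) (h x) (max_le_max hp.1 le_rfl) hxb (hhy.trans hp.2.2)
    have h7 : ∫ r in x..max x 0, M * (‖μ r‖ ^ 2 * B (h r)) * Q (r, h r)
        ≤ ∫ r in x..y, M * (‖μ r‖ ^ 2 * B (h r)) * Q (r, h r) := by
      refine intervalIntegral.integral_mono_interval le_rfl (le_max_left _ _) (hxb.trans hhy)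
        (Eventually.of_forall fun r => ?_) (Continuous.intervalIntegrable (by fun_prop) _ _)
      have := hB0 (h r)
      have := hQ0 r (h r) (H.le_h r)
      simp only [Pi.zero_apply]
      positivity
    -- The two contributions are merged under one coefficient by adding nonnegative cross terms, to
    -- reach the form required by `gronwall_past`.
    have h8 : (∫ r in x..y, M * A r * R (r, y))
        + M * ∫ r in x..y, M * (‖μ r‖ ^ 2 * B (h r)) * Q (r, h r)
        ≤ ∫ r in x..y, (M * A r + M ^ 2 * (‖μ r‖ ^ 2 * B (h r))) * (R (r, y) + Q (r, h r)) := by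
      rw [← intervalIntegral.integral_const_mul, ← intervalIntegral.integral_add
        (Continuous.intervalIntegrable (by fun_prop) _ _)
        (Continuous.intervalIntegrable (by fun_prop) _ _)]
      refine intervalIntegral.integral_mono_on hxy
        (Continuous.intervalIntegrable (by fun_prop) _ _)
        (Continuous.intervalIntegrable (by fun_prop) _ _) fun r hr => ?_
      have e1 := hB0 (h r)
      have e2 := hQ0 r (h r) (H.le_h r)
      have e3 := hR0 r y (H.h_le_of_le hhy hr.1 hr.2)
      have e4 : 0 ≤ M * A r * Q (r, h r) := by have := hA0 r; positivity
      have e5 : 0 ≤ M ^ 2 * (‖μ r‖ ^ 2 * B (h r)) * R (r, y) := by positivity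
      nlinarith
    simp only at h2
    have h9 : ∫ r in x..max x 0, ‖μ r‖ ^ 2 * ‖V (r, h r) - V' (r, h r)‖ ^ 2
        ≤ M * n0 + ∫ r in x..y, M * (‖μ r‖ ^ 2 * B (h r)) * Q (r, h r) := by
      have := mul_le_mul_of_nonneg_left (h5.trans h6) hM.le
      linarith
    have h10 : M * ∫ r in x..y, ‖U (r, h r) - U' (r, h r)‖ ^ 2
        ≤ M * (M * n0 + (∫ r in x..y, M * (‖μ r‖ ^ 2 * B (h r)) * Q (r, h r)) + n0) :=
      mul_le_mul_of_nonneg_left (by linarith) hM.le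
    linarith

/-- Stability: solutions are bounded, and differences of solutions are controlled by the difference
of the data, by functions of one null coordinate only. -/
theorem exists_stability (hm : 0 ≤ m) (α β : ℝ) (H : IsMirror h k μ ξ₀)
    (h0 : h ξ₀ ≤ η₀) (E : ℝ) : ∃ C, 0 ≤ C ∧ ∀ U V U' V' : ℝ × ℝ → ℂ,
      IsMild (nullRHS m α β) h μ ξ₀ η₀ U V → IsMild (nullRHS m α β) h μ ξ₀ η₀ U' V' →
      baseCharge U V ξ₀ η₀ ≤ E → baseCharge U' V' ξ₀ η₀ ≤ E →
      ∃ p q p' q' : ℝ → ℝ, Continuous p ∧ Continuous q ∧ Continuous p' ∧ Continuous q' ∧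
        (∀ x y, (x, y) ∈ past h ξ₀ η₀ →
          ‖U (x, y) - U' (x, y)‖ ^ 2 ≤ p x ∧ ‖V (x, y) - V' (x, y)‖ ^ 2 ≤ q y ∧
          ‖U' (x, y)‖ ^ 2 ≤ p' x ∧ ‖V' (x, y)‖ ^ 2 ≤ q' y) ∧
        (∀ x, 0 ≤ p x ∧ 0 ≤ q x ∧ 0 ≤ p' x ∧ 0 ≤ q' x) ∧
        ∫ x in ξ₀..η₀, p x ≤ C * baseCharge (U - U') (V - V') ξ₀ η₀ ∧
        ∫ y in max ξ₀ 0..η₀, q y ≤ C * baseCharge (U - U') (V - V') ξ₀ η₀ ∧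
        ∫ x in ξ₀..η₀, p' x ≤ C ∧ ∫ y in max ξ₀ 0..η₀, q' y ≤ C := by
  obtain ⟨K, hK0, hK⟩ := exists_characteristic_stability hm α β H h0 E
  have hh := H.continuous_h
  have hbase := H.base_le_h ξ₀
  have hξη : 0 ≤ η₀ - ξ₀ := sub_nonneg.2 ((H.le_h _).trans h0)
  have hG := strength_nonneg α β
  set G := strength α β with hGdef
  set M := growthFactor m G ξ₀ η₀ E with hMdef
  have hM : 0 < M := growthFactor_pos _ _ _ _ _
  set L := E + (η₀ - ξ₀) * (m * E) with hL
  set KB := (η₀ - ξ₀) * m + G * (M * L) with hKB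
  set KA := (η₀ - ξ₀) * m + G * (M * ((M * L + E) + (η₀ - ξ₀) * (m * E))) with hKA
  -- C1 and C2 bound the masses of q and p relative to the data difference, C3 and C4 those of q'
  -- and p'. The 0 inside the maximum makes the constant nonnegative for every real E.
  set C1 := M * (1 + KB * K) with hC1
  set C2 := M * (C1 + 1 + KA * K) with hC2
  set C3 := M * L with hC3
  set C4 := M * (M * L + L) with hC4
  refine ⟨max (max C1 C2) (max (max C3 C4) 0), by positivity, ?_⟩
  intro U V U' V' S S' hE hE'
  have hU := S.continuous_U
  have hV := S.continuous_V
  have hU' := S'.continuous_U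
  have hV' := S'.continuous_V
  have hE0 : 0 ≤ E := (baseCharge_nonneg U V (hbase.trans h0)).trans hE
  set n0 := baseCharge (U - U') (V - V') ξ₀ η₀ with hn0
  have hn00 : 0 ≤ n0 := baseCharge_nonneg _ _ (hbase.trans h0)
  have hint := continuous_interaction m G ξ₀ η₀ E
  set A : ℝ → ℝ := fun x => interaction m G ξ₀ η₀ E (‖U' (x, h x)‖ ^ 2) with hA
  set B : ℝ → ℝ := fun y => interaction m G ξ₀ η₀ E (‖V' (y, y)‖ ^ 2) with hB
  have hAc : Continuous A := hint.comp (by fun_prop)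
  have hBc : Continuous B := hint.comp (by fun_prop)
  have hA0 : ∀ x, 0 ≤ A x := fun x => interaction_nonneg _ _ hm hG hE0 (by positivity)
  have hB0 : ∀ x, 0 ≤ B x := fun x => interaction_nonneg _ _ hm hG hE0 (by positivity)
  have hV1 := (integral_sq_right_le_baseCharge (hU.sub hU') (hV.sub hV') (hbase.trans h0))
  have hV2 := (integral_sq_right_le_baseCharge hU' hV' (hbase.trans h0)).trans hE'
  have hP := S'.integral_profile_le H hm h0 hE'
  have eB : ∫ r in max ξ₀ 0..η₀, B r ≤ KB :=
    integral_interaction_le (w := fun y => ‖V' (y, y)‖ ^ 2) hm hG hE0 (le_max_left _ _)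
      (by fun_prop) hV2
  have eA : ∫ r in ξ₀..η₀, A r ≤ KA :=
    integral_interaction_le (w := fun x => ‖U' (x, h x)‖ ^ 2) hm hG hE0 le_rfl
      (by fun_prop) hP
  -- With the characteristic integrals bounded uniformly by K n0, each right-hand side depends on a
  -- single null coordinate.
  have hpt : ∀ x y, (x, y) ∈ past h ξ₀ η₀ →
      ‖U (x, y) - U' (x, y)‖ ^ 2 ≤ M * (‖U (x, h x) - U' (x, h x)‖ ^ 2 + A x * (K * n0)) ∧
      ‖V (x, y) - V' (x, y)‖ ^ 2 ≤ M * (‖V (y, y) - V' (y, y)‖ ^ 2 + B y * (K * n0)) := by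
    intro x y hp
    have h1 := S.sub_bounds S' H hm h0 hE hE' hp
    have h2 := hK U V U' V' S S' hE hE' x y hp
    have := hA0 x
    have := hB0 y
    exact ⟨h1.1.trans (mul_le_mul_of_nonneg_left (add_le_add le_rfl
        (mul_le_mul_of_nonneg_left h2.1 (hA0 x))) hM.le),
      h1.2.trans (mul_le_mul_of_nonneg_left (add_le_add le_rfl
        (mul_le_mul_of_nonneg_left h2.2 (hB0 y))) hM.le)⟩
  have hq : ∫ y in max ξ₀ 0..η₀, M * (‖V (y, y) - V' (y, y)‖ ^ 2 + B y * (K * n0))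
      ≤ C1 * n0 := by
    rw [intervalIntegral.integral_const_mul, intervalIntegral.integral_add
      (Continuous.intervalIntegrable (by fun_prop) _ _)
      (Continuous.intervalIntegrable (by fun_prop) _ _), intervalIntegral.integral_mul_const]
    calc _ ≤ M * (n0 + KB * (K * n0)) := by gcongr; exact hV1
      _ = _ := by rw [hC1]; ring
  refine ⟨fun x => M * (‖U (x, h x) - U' (x, h x)‖ ^ 2 + A x * (K * n0)),
    fun y => M * (‖V (y, y) - V' (y, y)‖ ^ 2 + B y * (K * n0)),
    fun x => M * (‖U' (x, h x)‖ ^ 2 + m * E), fun y => M * (‖V' (y, y)‖ ^ 2 + m * E),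
    by fun_prop, by fun_prop, by fun_prop, by fun_prop,
    fun x y hp => ⟨(hpt x y hp).1, (hpt x y hp).2, S'.pointwise_bounds' H hm h0 hE' hp⟩,
    fun x => ⟨?_, ?_, by positivity, by positivity⟩, ?_, ?_, ?_, ?_⟩
  · have := hA0 x; positivity
  · have := hB0 x; positivity
  · have h1 := H.integral_boundary_sq_le (U := fun p => U p - U' p) (V := fun p => V p - V' p)
      h0 (by fun_prop) (by fun_prop) (fun r hr hr0 hry => by
        rw [S.boundary r hr hr0 hry, S'.boundary r hr hr0 hry]; ring)
      (g := fun y => M * (‖V (y, y) - V' (y, y)‖ ^ 2 + B y * (K * n0))) (by fun_prop)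
      (fun y => by have := hB0 y; positivity) (fun x y hp => (hpt x y hp).2)
    have h2 : ∫ x in ξ₀..η₀, ‖U (x, h x) - U' (x, h x)‖ ^ 2 ≤ (C1 + 1) * n0 := by
      have : baseCharge (fun p => U p - U' p) (fun p => V p - V' p) ξ₀ η₀ = n0 := rfl
      linarith
    rw [intervalIntegral.integral_const_mul, intervalIntegral.integral_add
      (Continuous.intervalIntegrable (by fun_prop) _ _)
      (Continuous.intervalIntegrable (by fun_prop) _ _), intervalIntegral.integral_mul_const]
    calc _ ≤ M * ((C1 + 1) * n0 + KA * (K * n0)) := by gcongr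
      _ = C2 * n0 := by rw [hC2]; ring
      _ ≤ _ := by gcongr; exact (le_max_right _ _).trans (le_max_left _ _)
  · exact hq.trans (by gcongr; exact (le_max_left _ _).trans (le_max_left _ _))
  · rw [intervalIntegral.integral_const_mul, intervalIntegral.integral_add
      (Continuous.intervalIntegrable (by fun_prop) _ _)
      (Continuous.intervalIntegrable (by fun_prop) _ _), intervalIntegral.integral_const,
      smul_eq_mul]
    calc _ ≤ M * ((M * L + E) + (η₀ - ξ₀) * (m * E)) := by gcongr
      _ = C4 := by rw [hC4, hL]; ring
      _ ≤ _ := (le_max_right _ _).trans ((le_max_left _ _).trans (le_max_right _ _))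
  · rw [intervalIntegral.integral_const_mul, intervalIntegral.integral_add
      (Continuous.intervalIntegrable (by fun_prop) _ _)
      (Continuous.intervalIntegrable (by fun_prop) _ _), intervalIntegral.integral_const,
      smul_eq_mul]
    calc _ ≤ M * (E + (η₀ - ξ₀) * (m * E)) := by gcongr; exact le_max_left _ _
      _ = C3 := by rw [hC3, hL]
      _ ≤ _ := (le_max_left _ _).trans ((le_max_left _ _).trans (le_max_right _ _))

end DiracIBVP

/-! ### Volterra systems along characteristics with reflection. -/

namespace DiracIBVP

/-- The retraction of the plane onto the causal past of `(ξ₀, η₀)`. -/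
def pastRetract (h : ℝ → ℝ) (ξ₀ η₀ : ℝ) (p : ℝ × ℝ) : ℝ × ℝ :=
  (max ξ₀ (min p.1 η₀), max (h (max ξ₀ (min p.1 η₀))) (min p.2 η₀))

namespace IsMirror

variable {h k : ℝ → ℝ} {μ : ℝ → ℂ} {ξ₀ η₀ : ℝ} (H : IsMirror h k μ ξ₀)
include H

lemma continuous_pastRetract : Continuous (pastRetract h ξ₀ η₀) := by
  have := H.continuous_h
  unfold pastRetract
  fun_prop

lemma pastRetract_mem (h0 : h ξ₀ ≤ η₀) (p : ℝ × ℝ) :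
    pastRetract h ξ₀ η₀ p ∈ past h ξ₀ η₀ := by
  refine ⟨le_max_left _ _, le_max_left _ _, max_le ?_ (min_le_right _ _)⟩
  exact H.h_le_of_le h0 (le_max_left _ _) (max_le ((H.le_h _).trans h0) (min_le_right _ _))

lemma pastRetract_of_mem {p : ℝ × ℝ} (hp : p ∈ past h ξ₀ η₀) : pastRetract h ξ₀ η₀ p = p := by
  have h1 := (H.past_subset hp).1
  unfold pastRetract
  rw [min_eq_left h1.2, max_eq_right h1.1, min_eq_left hp.2.2, max_eq_right hp.2.1]

end IsMirror

lemma integral_exp_up_le {κ : ℝ} (hκ : 0 < κ) (c s t : ℝ) :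
    ∫ r in s..t, Real.exp (κ * (r - c)) ≤ Real.exp (κ * (t - c)) / κ := by
  have h1 : ∀ r, HasDerivAt (fun r => Real.exp (κ * (r - c)) / κ) (Real.exp (κ * (r - c))) r := by
    intro r
    exact (((((hasDerivAt_id r).sub_const c).const_mul κ).exp).div_const κ).congr_deriv
      (by simp only [id_eq, mul_one]; field_simp)
  rw [intervalIntegral.integral_eq_sub_of_hasDerivAt (fun r _ => h1 r)
    (Continuous.intervalIntegrable (by fun_prop) _ _)]
  have : 0 < Real.exp (κ * (s - c)) / κ := by positivity
  linarith

lemma integral_exp_down_le {κ : ℝ} (hκ : 0 < κ) (c s t : ℝ) :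
    ∫ r in s..t, Real.exp (κ * (c - r)) ≤ Real.exp (κ * (c - s)) / κ := by
  have := integral_exp_up_le hκ (-c) (-t) (-s)
  have h2 := intervalIntegral.integral_comp_neg (a := -t) (b := -s)
    (fun r => Real.exp (κ * (c - r)))
  rw [neg_neg, neg_neg] at h2
  rw [← h2]
  have e : ∀ r : ℝ, κ * (c - -r) = κ * (r - -c) := fun r => by ring
  have e' : κ * (c - s) = κ * (-s - -c) := by ring
  simp only [e]
  rwa [e']

lemma norm_integral_sub_le {F G : ℝ → ℂ} {s t : ℝ} (hst : s ≤ t) (hF : Continuous F)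
    (hG : Continuous G) {g : ℝ → ℝ} (hg : Continuous g)
    (hle : ∀ r ∈ Icc s t, ‖F r - G r‖ ≤ g r) :
    ‖(∫ r in s..t, F r) - ∫ r in s..t, G r‖ ≤ ∫ r in s..t, g r := by
  rw [← intervalIntegral.integral_sub (hF.intervalIntegrable _ _) (hG.intervalIntegrable _ _)]
  exact intervalIntegral.norm_integral_le_of_norm_le hst
    (Eventually.of_forall fun r hr => hle r ⟨hr.1.le, hr.2⟩) (hg.intervalIntegrable _ _)

/-- Global solvability of Volterra systems along the two families of characteristics, with a
reflection at the moving boundary, for Lipschitz right-hand sides. -/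
theorem exists_volterra {h k : ℝ → ℝ} {μ : ℝ → ℂ} {ξ₀ η₀ : ℝ} (H : IsMirror h k μ ξ₀)
    (hξ : ξ₀ ≤ 0) (h0 : h ξ₀ ≤ η₀) {F₁ F₂ : ℝ × ℝ → ℂ × ℂ → ℂ}
    (hF₁ : Continuous (Function.uncurry F₁)) (hF₂ : Continuous (Function.uncurry F₂))
    {L : ℝ} (hL : 0 ≤ L) (hL₁ : ∀ p w w', ‖F₁ p w - F₁ p w'‖ ≤ L * ‖w - w'‖)
    (hL₂ : ∀ p w w', ‖F₂ p w - F₂ p w'‖ ≤ L * ‖w - w'‖)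
    {b c : ℝ → ℂ} (hb : Continuous b) (hc : Continuous c) (ν : ℝ → ℂ) (hν : Continuous ν) :
    ∃ W : ℝ × ℝ → ℂ × ℂ, Continuous W ∧ ∀ x y, (x, y) ∈ past h ξ₀ η₀ →
      (W (x, y)).1 = b x + ν x * (W (min x 0, h (min x 0))).2
        + ∫ r in h x..y, F₁ (x, r) (W (x, r)) ∧
      (W (x, y)).2 = c y + ∫ r in x..y, F₂ (r, y) (W (r, y)) := by
  have hh := H.continuous_h
  have : CompactSpace (past h ξ₀ η₀) := isCompact_iff_compactSpace.1 H.isCompact_past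
  obtain ⟨B, hB⟩ := (isCompact_Icc (a := ξ₀) (b := η₀)).exists_bound_of_continuousOn
    hν.continuousOn
  have hB0 : 0 ≤ B := (norm_nonneg _).trans (hB ξ₀ (left_mem_Icc.2 ((H.le_h _).trans h0)))
  -- Fields are measured with the weight exp(κ(y - x)), for which integration along either family
  -- gains 1/κ. The choice gives contraction ratio (B + 1)L/κ ≤ 1/2, and the final 1 keeps κ
  -- positive when L = 0.
  set κ : ℝ := 2 * ((B + 1) * L) + 1 with hκ
  have hκ0 : 0 < κ := by positivity
  -- fields on the plane associated with (weighted) fields on the compact past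
  let ext : C(past h ξ₀ η₀, ℂ × ℂ) → ℝ × ℝ → ℂ × ℂ := fun w p =>
    Real.exp (κ * (p.2 - p.1)) • w ⟨pastRetract h ξ₀ η₀ p, H.pastRetract_mem h0 p⟩
  have hext : ∀ w, Continuous (ext w) := by
    intro w
    have h1 : Continuous fun p => (⟨pastRetract h ξ₀ η₀ p, H.pastRetract_mem h0 p⟩ :
        past h ξ₀ η₀) := H.continuous_pastRetract.subtype_mk _
    have h2 := w.continuous.comp h1
    have h3 : Continuous fun p : ℝ × ℝ => Real.exp (κ * (p.2 - p.1)) := by fun_prop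
    exact h3.smul h2
  have hextd : ∀ w w' p, ‖ext w p - ext w' p‖ ≤ Real.exp (κ * (p.2 - p.1)) * dist w w' := by
    intro w w' p
    simp only [ext]
    rw [← smul_sub, norm_smul, Real.norm_eq_abs, abs_of_pos (Real.exp_pos _), ← dist_eq_norm]
    exact mul_le_mul_of_nonneg_left (ContinuousMap.dist_apply_le_dist _) (Real.exp_pos _).le
  have hG₁ : ∀ w, Continuous fun p => F₁ p (ext w p) := fun w =>
    hF₁.comp (continuous_id.prodMk (hext w))
  have hG₂ : ∀ w, Continuous fun p => F₂ p (ext w p) := fun w =>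
    hF₂.comp (continuous_id.prodMk (hext w))
  let Vop : C(past h ξ₀ η₀, ℂ × ℂ) → ℝ × ℝ → ℂ := fun w p =>
    c p.2 + ∫ r in p.1..p.2, F₂ (r, p.2) (ext w (r, p.2))
  -- The reflected value is taken from `Vop w`, not from `w`: this puts an integral behind the
  -- reflection coefficient, which may be large, and at the fixed point the two values agree.
  let Uop : C(past h ξ₀ η₀, ℂ × ℂ) → ℝ × ℝ → ℂ := fun w p =>
    b p.1 + ν p.1 * Vop w (min p.1 0, h (min p.1 0))
      + ∫ r in h p.1..p.2, F₁ (p.1, r) (ext w (p.1, r))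
  have hVc : ∀ w, Continuous (Vop w) := by
    intro w
    have h1 : Continuous fun p : ℝ × ℝ => ∫ r in p.1..p.2, F₂ (r, p.2) (ext w (r, p.2)) :=
      continuous_integral_between (F := fun (p : ℝ × ℝ) r => F₂ (r, p.2) (ext w (r, p.2)))
        ((hG₂ w).comp (by fun_prop : Continuous fun q : (ℝ × ℝ) × ℝ => (q.2, q.1.2)))
        continuous_fst continuous_snd
    exact (hc.comp continuous_snd).add h1
  have hUc : ∀ w, Continuous (Uop w) := by
    intro w
    have h1 : Continuous fun p : ℝ × ℝ => ∫ r in h p.1..p.2, F₁ (p.1, r) (ext w (p.1, r)) :=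
      continuous_integral_between (F := fun (p : ℝ × ℝ) r => F₁ (p.1, r) (ext w (p.1, r)))
        ((hG₁ w).comp (by fun_prop : Continuous fun q : (ℝ × ℝ) × ℝ => (q.1.1, q.2)))
        (by fun_prop) continuous_snd
    have h2 := hVc w
    exact ((hb.comp continuous_fst).add
      ((hν.comp continuous_fst).mul (h2.comp (by fun_prop)))).add h1
  have hVd : ∀ w w' x y, x ≤ y → ‖Vop w (x, y) - Vop w' (x, y)‖
      ≤ L * dist w w' * (Real.exp (κ * (y - x)) / κ) := by
    intro w w' x y hxy
    have h1 : Vop w (x, y) - Vop w' (x, y) = (∫ r in x..y, F₂ (r, y) (ext w (r, y)))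
        - ∫ r in x..y, F₂ (r, y) (ext w' (r, y)) := by simp only [Vop]; ring
    rw [h1]
    refine (norm_integral_sub_le hxy
      ((hG₂ w).comp (by fun_prop : Continuous fun r : ℝ => (r, y)))
      ((hG₂ w').comp (by fun_prop : Continuous fun r : ℝ => (r, y)))
      (g := fun r => L * dist w w' * Real.exp (κ * (y - r))) (by fun_prop) fun r _ => ?_).trans ?_
    · refine (hL₂ _ _ _).trans ?_
      have := mul_le_mul_of_nonneg_left (hextd w w' (r, y)) hL
      simp only at this
      linarith
    · rw [intervalIntegral.integral_const_mul]
      exact mul_le_mul_of_nonneg_left (integral_exp_down_le hκ0 _ _ _) (by positivity)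
  have hUd : ∀ w w' x y, (x, y) ∈ past h ξ₀ η₀ → ‖Uop w (x, y) - Uop w' (x, y)‖
      ≤ (B + 1) * (L * dist w w' * (Real.exp (κ * (y - x)) / κ)) := by
    intro w w' x y hp
    have hhy : h x ≤ y := hp.2.1
    have h1 : Uop w (x, y) - Uop w' (x, y)
        = ν x * (Vop w (min x 0, h (min x 0)) - Vop w' (min x 0, h (min x 0)))
        + ((∫ r in h x..y, F₁ (x, r) (ext w (x, r)))
        - ∫ r in h x..y, F₁ (x, r) (ext w' (x, r))) := by simp only [Uop]; ring
    rw [h1]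
    have h2 := hVd w w' (min x 0) (h (min x 0)) (H.le_h _)
    -- The reflection point carries a weight no larger than the point (x, y) it feeds.
    have h3 : h (min x 0) - min x 0 ≤ y - x := by
      rcases le_total x 0 with hx | hx
      · rw [min_eq_left hx]; linarith
      · rw [min_eq_right hx, H.h_zero]; linarith [H.le_h x]
    have h4 : Real.exp (κ * (h (min x 0) - min x 0)) ≤ Real.exp (κ * (y - x)) :=
      Real.exp_le_exp.2 (mul_le_mul_of_nonneg_left h3 hκ0.le)
    have h5 := hB x (H.past_subset hp).1
    have h6 : ‖ν x * (Vop w (min x 0, h (min x 0)) - Vop w' (min x 0, h (min x 0)))‖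
        ≤ B * (L * dist w w' * (Real.exp (κ * (y - x)) / κ)) := by
      rw [norm_mul]
      refine mul_le_mul h5 (h2.trans ?_) (norm_nonneg _) hB0
      gcongr
    have h7 : ‖(∫ r in h x..y, F₁ (x, r) (ext w (x, r)))
        - ∫ r in h x..y, F₁ (x, r) (ext w' (x, r))‖
        ≤ L * dist w w' * (Real.exp (κ * (y - x)) / κ) := by
      refine (norm_integral_sub_le hhy
        ((hG₁ w).comp (by fun_prop : Continuous fun r : ℝ => (x, r)))
        ((hG₁ w').comp (by fun_prop : Continuous fun r : ℝ => (x, r)))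
        (g := fun r => L * dist w w' * Real.exp (κ * (r - x))) (by fun_prop)
        fun r _ => ?_).trans ?_
      · refine (hL₁ _ _ _).trans ?_
        have := mul_le_mul_of_nonneg_left (hextd w w' (x, r)) hL
        simp only at this
        linarith
      · rw [intervalIntegral.integral_const_mul]
        exact mul_le_mul_of_nonneg_left (integral_exp_up_le hκ0 _ _ _) (by positivity)
    refine (norm_add_le _ _).trans ?_
    linarith
  let T : C(past h ξ₀ η₀, ℂ × ℂ) → C(past h ξ₀ η₀, ℂ × ℂ) := fun w =>
    { toFun := fun p => Real.exp (-(κ * (p.1.2 - p.1.1))) • (Uop w p.1, Vop w p.1)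
      continuous_toFun := by
        have h1 := hUc w
        have h2 := hVc w
        fun_prop }
  have hT : ContractingWith (1 / 2) T := by
    refine ⟨by rw [← NNReal.coe_lt_coe]; norm_num, LipschitzWith.of_dist_le_mul fun w w' => ?_⟩
    rw [ContinuousMap.dist_le (by positivity)]
    rintro ⟨⟨x, y⟩, hp⟩
    have hxy : x ≤ y := (H.le_h x).trans hp.2.1
    simp only [T, ContinuousMap.coe_mk]
    rw [dist_eq_norm, ← smul_sub, norm_smul, Real.norm_eq_abs, abs_of_pos (Real.exp_pos _)]
    have h1 := hUd w w' x y hp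
    have h2 := hVd w w' x y hxy
    have hpos : 0 ≤ L * dist w w' * (Real.exp (κ * (y - x)) / κ) := by positivity
    have h3 : ‖(Uop w (x, y), Vop w (x, y)) - (Uop w' (x, y), Vop w' (x, y))‖
        ≤ (B + 1) * (L * dist w w' * (Real.exp (κ * (y - x)) / κ)) := by
      rw [Prod.mk_sub_mk, Prod.norm_mk]
      exact max_le h1 (h2.trans (by nlinarith))
    have h4 : Real.exp (-(κ * (y - x))) * ((B + 1) * (L * dist w w'
        * (Real.exp (κ * (y - x)) / κ))) = ((B + 1) * L / κ) * dist w w' := by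
      rw [Real.exp_neg]
      field_simp
    have h5 : (B + 1) * L / κ ≤ 1 / 2 := by
      rw [div_le_iff₀ hκ0, hκ]; linarith
    calc _ ≤ Real.exp (-(κ * (y - x))) * ((B + 1) * (L * dist w w'
        * (Real.exp (κ * (y - x)) / κ))) := mul_le_mul_of_nonneg_left h3 (Real.exp_pos _).le
      _ ≤ _ := by
        rw [h4]
        push_cast
        exact mul_le_mul_of_nonneg_right h5 dist_nonneg
  obtain ⟨w, hw⟩ : ∃ w, T w = w := ⟨hT.fixedPoint T, hT.fixedPoint_isFixedPt⟩
  have hfix : ∀ x y, (x, y) ∈ past h ξ₀ η₀ → ext w (x, y) = (Uop w (x, y), Vop w (x, y)) := by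
    intro x y hp
    have h1 : w ⟨(x, y), hp⟩ = Real.exp (-(κ * (y - x))) • (Uop w (x, y), Vop w (x, y)) := by
      conv_lhs => rw [← hw]
      rfl
    have h2 : ext w (x, y) = Real.exp (κ * (y - x)) • w ⟨(x, y), hp⟩ := by
      simp only [ext]
      congr 2
      exact Subtype.ext (H.pastRetract_of_mem hp)
    rw [h2, h1, smul_smul, ← Real.exp_add, add_neg_cancel, Real.exp_zero, one_smul]
  refine ⟨ext w, hext w, fun x y hp => ?_⟩
  have hmem : (min x 0, h (min x 0)) ∈ past h ξ₀ η₀ :=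
    ⟨le_min hp.1 hξ, le_rfl, H.h_le_of_le h0 (le_min hp.1 hξ)
      ((min_le_right _ _).trans ((H.h_nonneg _).trans h0))⟩
  rw [hfix _ _ hmem, hfix x y hp]
  exact ⟨rfl, rfl⟩

end DiracIBVP

/-! ### Truncation and existence of continuous solutions. -/

namespace DiracIBVP

/-- The factor by which a pair of complex numbers is scaled to lie in the ball of radius `R`. -/
noncomputable def cutoff (R : ℝ) (p : ℂ × ℂ) : ℝ := R / max R ‖p‖

section Cutoff

variable {R : ℝ} (hR : 0 < R)
include hR

lemma continuous_cutoff : Continuous (cutoff R) := by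
  unfold cutoff
  exact continuous_const.div (by fun_prop) fun p => (lt_max_of_lt_left hR).ne'

lemma cutoff_nonneg (p : ℂ × ℂ) : 0 ≤ cutoff R p := by
  unfold cutoff
  positivity

lemma cutoff_le_one (p : ℂ × ℂ) : cutoff R p ≤ 1 :=
  div_le_one_of_le₀ (le_max_left _ _) (lt_max_of_lt_left hR).le

lemma cutoff_of_le {p : ℂ × ℂ} (hp : ‖p‖ ≤ R) : cutoff R p = 1 := by
  rw [cutoff, max_eq_left hp, div_self hR.ne']

lemma cutoff_mul_norm_le (p : ℂ × ℂ) : cutoff R p * ‖p‖ ≤ R := by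
  have h1 : 0 < max R ‖p‖ := lt_max_of_lt_left hR
  rw [cutoff, div_mul_eq_mul_div, div_le_iff₀ h1]
  exact mul_le_mul_of_nonneg_left (le_max_right _ _) hR.le

/-- One unit of the constant comes from the increment scaled by a factor at most 1, the other from
the variation of the factor, which decays fast enough to compensate the size of q. -/
lemma norm_cutoff_smul_sub_le (p q : ℂ × ℂ) :
    ‖cutoff R p • p - cutoff R q • q‖ ≤ 2 * ‖p - q‖ := by
  have h1 : 0 < max R ‖p‖ := lt_max_of_lt_left hR
  have h2 : 0 < max R ‖q‖ := lt_max_of_lt_left hR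
  have h3 : cutoff R p • p - cutoff R q • q
      = cutoff R p • (p - q) + (cutoff R p - cutoff R q) • q := by
    rw [smul_sub, sub_smul]; abel
  have h4 : |cutoff R p - cutoff R q| * ‖q‖ ≤ ‖p - q‖ := by
    have e : cutoff R p - cutoff R q
        = R * (max R ‖q‖ - max R ‖p‖) / (max R ‖p‖ * max R ‖q‖) := by
      unfold cutoff; field_simp
    have e2 : |max R ‖q‖ - max R ‖p‖| ≤ ‖p - q‖ := by
      refine (abs_max_sub_max_le_max _ _ _ _).trans ?_
      rw [sub_self, abs_zero, max_eq_right (abs_nonneg _), norm_sub_rev]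
      exact abs_norm_sub_norm_le q p
    rw [e, abs_div, abs_mul, abs_of_pos hR, abs_of_pos (mul_pos h1 h2), div_mul_eq_mul_div,
      div_le_iff₀ (mul_pos h1 h2)]
    calc R * |max R ‖q‖ - max R ‖p‖| * ‖q‖ ≤ max R ‖p‖ * ‖p - q‖ * max R ‖q‖ := by
          gcongr
          · exact le_max_left _ _
          · exact le_max_right _ _
      _ = _ := by ring
  rw [h3]
  refine (norm_add_le _ _).trans ?_
  rw [norm_smul, norm_smul, Real.norm_eq_abs, Real.norm_eq_abs, abs_of_nonneg (cutoff_nonneg hR p)]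
  have h5 := mul_le_mul_of_nonneg_right (cutoff_le_one hR p) (norm_nonneg (p - q))
  linarith

end Cutoff

/-- The right-hand side with the cubic term truncated outside a ball. -/
noncomputable def truncatedRHS (m α β R : ℝ) (a b : ℂ) : ℂ :=
  Complex.I / 2 * ((m : ℂ) * b - ((cutoff R (a, b) ^ 3 : ℝ) : ℂ) * N1 α β a b)

lemma isChargeRHS_truncatedRHS {m : ℝ} (hm : 0 ≤ m) (α β : ℝ) {R : ℝ} (hR : 0 < R) :
    IsChargeRHS m (strength α β) (truncatedRHS m α β R) :=
  isChargeRHS_of_factor hm α β (s := fun p => cutoff R p ^ 3) ((continuous_cutoff hR).pow 3)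
    (fun p => pow_nonneg (cutoff_nonneg hR p) 3)
    (fun p => pow_le_one₀ (cutoff_nonneg hR p) (cutoff_le_one hR p))
    (fun a b => by simp only [cutoff, Prod.norm_mk, max_comm ‖a‖ ‖b‖])

lemma truncatedRHS_of_le {m α β R : ℝ} (hR : 0 < R) {a b : ℂ} (h : ‖(a, b)‖ ≤ R) :
    truncatedRHS m α β R a b = nullRHS m α β a b := by
  simp [truncatedRHS, nullRHS, cutoff_of_le hR h]

/-- By this homogeneity, multiplying the cubic term by the cube of the cutoff amounts to evaluating
it at the pair retracted to a ball. The truncated term is thus globally Lipschitz, while the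
symmetric scalar factor preserves the charge law. -/
lemma N1_smul (α β s : ℝ) (a b : ℂ) :
    N1 α β (s • a) (s • b) = ((s ^ 3 : ℝ) : ℂ) * N1 α β a b := by
  rw [N1_eq, N1_eq]
  simp only [Complex.real_smul, map_mul, Complex.conj_ofReal]
  push_cast
  ring

lemma norm_truncatedRHS_sub_le {m : ℝ} (hm : 0 ≤ m) (α β : ℝ) {R : ℝ} (hR : 0 < R)
    (p q : ℂ × ℂ) : ‖truncatedRHS m α β R p.1 p.2 - truncatedRHS m α β R q.1 q.2‖
      ≤ (m + strength α β * (6 * R ^ 2)) * ‖p - q‖ := by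
  have hG := strength_nonneg α β
  set p' := cutoff R p • p with hp'
  set q' := cutoff R q • q with hq'
  have e : ∀ z : ℂ × ℂ, truncatedRHS m α β R z.1 z.2 = Complex.I / 2 * ((m : ℂ) * z.2
      - N1 α β (cutoff R z • z).1 (cutoff R z • z).2) := by
    intro z
    rw [Prod.smul_fst, Prod.smul_snd, N1_smul, truncatedRHS]
  have hn : ∀ z : ℂ × ℂ, ‖cutoff R z • z‖ ≤ R := by
    intro z
    rw [norm_smul, Real.norm_eq_abs, abs_of_nonneg (cutoff_nonneg hR z)]
    exact cutoff_mul_norm_le hR z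
  have h1 : ‖p' - q'‖ ≤ 2 * ‖p - q‖ := norm_cutoff_smul_sub_le hR p q
  have h2 : ‖N1 α β p'.1 p'.2 - N1 α β q'.1 q'.2‖ ≤ strength α β * (6 * R ^ 2 * ‖p - q‖) := by
    refine (norm_N1_sub_le α β _ _ _ _).trans (mul_le_mul_of_nonneg_left ?_ hG)
    have a1 : ‖p'.1 - q'.1‖ ≤ 2 * ‖p - q‖ := (norm_fst_le (p' - q')).trans h1
    have a2 : ‖p'.2 - q'.2‖ ≤ 2 * ‖p - q‖ := (norm_snd_le (p' - q')).trans h1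
    have a3 : ‖p'.2‖ ≤ R := (norm_snd_le p').trans (hn p)
    have a4 : ‖q'.1‖ ≤ R := (norm_fst_le q').trans (hn q)
    have a5 : ‖q'.2‖ ≤ R := (norm_snd_le q').trans (hn q)
    -- The number 6 is 2 + 4: each difference carries the Lipschitz constant 2 of the retraction,
    -- and ‖b‖ + ‖b'‖ contributes another 2 to the second term.
    calc _ ≤ R ^ 2 * (2 * ‖p - q‖) + R * (R + R) * (2 * ‖p - q‖) := by gcongr
      _ = _ := by ring
  have h3 : ‖p.2 - q.2‖ ≤ ‖p - q‖ := norm_snd_le (p - q)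
  have h4 : truncatedRHS m α β R p.1 p.2 - truncatedRHS m α β R q.1 q.2
      = Complex.I / 2 * ((m : ℂ) * (p.2 - q.2) - (N1 α β p'.1 p'.2 - N1 α β q'.1 q'.2)) := by
    rw [e, e]; ring
  rw [h4, norm_mul]
  have h5 : ‖Complex.I / 2‖ ≤ 1 := by simp; norm_num
  have h6 : ‖(m : ℂ) * (p.2 - q.2) - (N1 α β p'.1 p'.2 - N1 α β q'.1 q'.2)‖
      ≤ m * ‖p - q‖ + strength α β * (6 * R ^ 2 * ‖p - q‖) := by
    refine (norm_sub_le _ _).trans (add_le_add ?_ h2)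
    rw [norm_mul, Complex.norm_real, Real.norm_eq_abs, abs_of_nonneg hm]
    gcongr
  calc _ ≤ 1 * (m * ‖p - q‖ + strength α β * (6 * R ^ 2 * ‖p - q‖)) := by gcongr
    _ = _ := by ring

variable {h k : ℝ → ℝ} {μ : ℝ → ℂ} {ξ₀ η₀ : ℝ}

/-- One formula describes U on the whole base: u₀ vanishes on the mirror side, and to the right of
the corner the reflected term is μ(0) v₀(0) = 0. -/
lemma exists_isMild_of_lipschitz (H : IsMirror h k μ ξ₀) (hξ : ξ₀ ≤ 0) (h0 : h ξ₀ ≤ η₀)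
    {f : ℂ → ℂ → ℂ} (hf : Continuous fun p : ℂ × ℂ => f p.1 p.2) {L : ℝ} (hL : 0 ≤ L)
    (hLf : ∀ p q : ℂ × ℂ, ‖f p.1 p.2 - f q.1 q.2‖ ≤ L * ‖p - q‖) {u₀ v₀ : ℝ → ℂ}
    (hu : Continuous u₀) (hv : Continuous v₀) (hu0 : ∀ x ≤ 0, u₀ x = 0) (hv0 : v₀ 0 = 0) :
    ∃ U V, IsMild f h μ ξ₀ η₀ U V ∧ ∀ x, 0 ≤ x → x ≤ η₀ → U (x, x) = u₀ x ∧ V (x, x) = v₀ x := by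
  have hμ := H.continuous_μ
  have hη : 0 ≤ η₀ := (H.h_nonneg _).trans h0
  obtain ⟨W, hW, hWeq⟩ := exists_volterra H hξ h0 (F₁ := fun _ w => f w.1 w.2)
    (F₂ := fun _ w => f w.2 w.1) (hf.comp (by fun_prop))
    (hf.comp (by fun_prop : Continuous fun q : (ℝ × ℝ) × (ℂ × ℂ) => (q.2.2, q.2.1))) hL
    (fun _ w w' => hLf w w')
    (fun _ w w' => (hLf (w.2, w.1) (w'.2, w'.1)).trans (le_of_eq (by
      simp only [Prod.norm_def, Prod.fst_sub, Prod.snd_sub]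
      rw [max_comm])))
    hu hv (fun x => μ (min x 0)) (by fun_prop)
  have hdiag : ∀ x, 0 ≤ x → x ≤ η₀ → (W (x, x)).2 = v₀ x := by
    intro x hx hxη
    have := (hWeq x x (H.diag_mem hx (hξ.trans hx) hxη)).2
    rwa [intervalIntegral.integral_same, add_zero] at this
  have hbd : ∀ x, ξ₀ ≤ x → h x ≤ η₀ →
      (W (x, h x)).1 = u₀ x + μ (min x 0) * (W (min x 0, h (min x 0))).2 := by
    intro x hx hxη
    have := (hWeq x (h x) ⟨hx, le_rfl, hxη⟩).1
    rwa [intervalIntegral.integral_same, add_zero] at this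
  refine ⟨fun p => (W p).1, fun p => (W p).2, ⟨by fun_prop, by fun_prop, ?_, ?_, ?_⟩, ?_⟩
  · intro x y hp
    rw [(hWeq x y hp).1, hbd x hp.1 (hp.2.1.trans hp.2.2)]
  · intro x y hp
    have h1 := H.past_subset hp
    rw [(hWeq x y hp).2, hdiag y ((H.h_nonneg x).trans hp.2.1) hp.2.2]
  · intro x hx hx0 hxη
    rw [hbd x hx hxη, hu0 x hx0, zero_add, min_eq_left hx0]
  · intro x hx hxη
    refine ⟨?_, hdiag x hx hxη⟩
    have h1 := hbd x (hξ.trans hx) (by rwa [H.h_of_nonneg x hx])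
    rw [H.h_of_nonneg x hx, min_eq_right hx, H.h_zero, hdiag 0 le_rfl hη, hv0, mul_zero,
      add_zero] at h1
    exact h1

/-- Existence of continuous solutions in the past of `(ξ₀, η₀)`. -/
theorem exists_isMild {m : ℝ} (hm : 0 ≤ m) (α β : ℝ) (H : IsMirror h k μ ξ₀) (hξ : ξ₀ ≤ 0)
    (h0 : h ξ₀ ≤ η₀) {u₀ v₀ : ℝ → ℂ} (hu : Continuous u₀) (hv : Continuous v₀)
    (hu0 : ∀ x ≤ 0, u₀ x = 0) (hv0 : v₀ 0 = 0) :
    ∃ U V, IsMild (nullRHS m α β) h μ ξ₀ η₀ U V ∧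
      ∀ x, 0 ≤ x → x ≤ η₀ → U (x, x) = u₀ x ∧ V (x, x) = v₀ x := by
  have hG := strength_nonneg α β
  have hη : 0 ≤ η₀ := (H.h_nonneg _).trans h0
  obtain ⟨Bμ, hBμ⟩ := (isCompact_Icc (a := ξ₀) (b := η₀)).exists_bound_of_continuousOn
    H.continuous_μ.continuousOn
  obtain ⟨Bu, hBu⟩ := (isCompact_Icc (a := (0 : ℝ)) (b := η₀)).exists_bound_of_continuousOn
    hu.continuousOn
  obtain ⟨Bv, hBv⟩ := (isCompact_Icc (a := (0 : ℝ)) (b := η₀)).exists_bound_of_continuousOn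
    hv.continuousOn
  set E := ∫ x in (0 : ℝ)..η₀, (‖u₀ x‖ ^ 2 + ‖v₀ x‖ ^ 2) with hE
  have hE0 : 0 ≤ E := intervalIntegral.integral_nonneg hη fun x _ => by positivity
  set M := Real.exp (m * (η₀ - ξ₀) + strength α β * E) with hM
  have hM0 : 0 < M := Real.exp_pos _
  set CV := M * (Bv ^ 2 + m * E) with hCV
  set CU := M * ((Bu ^ 2 + Bμ ^ 2 * CV) + m * E) with hCU
  have hCV0 : 0 ≤ CV := by positivity
  have hCU0 : 0 ≤ CU := by positivity
  -- CV and CU depend on the data but not on the truncation, because the growth constant is the same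
  -- for all cutoff radii. The radius is placed beyond them, so the solution of the truncated system
  -- never feels the cutoff.
  set R := Real.sqrt (max CU CV) + 1 with hRdef
  have hR : 0 < R := by positivity
  obtain ⟨U, V, S, hdiag⟩ := exists_isMild_of_lipschitz H hξ h0
    (isChargeRHS_truncatedRHS hm α β hR).continuous (by positivity)
    (norm_truncatedRHS_sub_le hm α β hR) hu hv hu0 hv0
  have hbase : baseCharge U V ξ₀ η₀ = E := by
    rw [baseCharge, max_eq_right hξ]
    refine intervalIntegral.integral_congr fun x hx => ?_
    rw [uIcc_of_le hη] at hx
    rw [(hdiag x hx.1 hx.2).1, (hdiag x hx.1 hx.2).2]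
  have hpt := fun x y hp => S.pointwise_bounds H (isChargeRHS_truncatedRHS hm α β hR) hm hG
    hbase.le (x := x) (y := y) hp
  have hV : ∀ x y, (x, y) ∈ past h ξ₀ η₀ → ‖V (x, y)‖ ^ 2 ≤ CV := by
    intro x y hp
    have hy : 0 ≤ y := (H.h_nonneg x).trans hp.2.1
    refine (hpt x y hp).2.trans ?_
    rw [(hdiag y hy hp.2.2).2]
    have := hBv y ⟨hy, hp.2.2⟩
    rw [hCV, hM]
    gcongr
  have hU : ∀ x y, (x, y) ∈ past h ξ₀ η₀ → ‖U (x, y)‖ ^ 2 ≤ CU := by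
    intro x y hp
    refine (hpt x y hp).1.trans ?_
    have h1 : ‖U (x, h x)‖ ^ 2 ≤ Bu ^ 2 + Bμ ^ 2 * CV := by
      rcases le_total 0 x with hx | hx
      · have hxη := (H.past_subset hp).1.2
        rw [H.h_of_nonneg x hx, (hdiag x hx hxη).1]
        have := hBu x ⟨hx, hxη⟩
        have : ‖u₀ x‖ ^ 2 ≤ Bu ^ 2 := by gcongr
        have : 0 ≤ Bμ ^ 2 * CV := by positivity
        linarith
      · have hxη := hp.2.1.trans hp.2.2
        rw [S.boundary x hp.1 hx hxη, norm_mul, mul_pow]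
        have h2 := hV x (h x) ⟨hp.1, le_rfl, hxη⟩
        have h3 := hBμ x (H.past_subset hp).1
        have : ‖μ x‖ ^ 2 * ‖V (x, h x)‖ ^ 2 ≤ Bμ ^ 2 * CV := by gcongr
        have : 0 ≤ Bu ^ 2 := by positivity
        linarith
    rw [hCU, ← hM]
    gcongr
  have hle : ∀ x y, (x, y) ∈ past h ξ₀ η₀ → ‖U (x, y)‖ ≤ R ∧ ‖V (x, y)‖ ≤ R := by
    intro x y hp
    constructor
    · refine (Real.le_sqrt_of_sq_le ((hU x y hp).trans (le_max_left CU CV))).trans ?_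
      linarith
    · refine (Real.le_sqrt_of_sq_le ((hV x y hp).trans (le_max_right CU CV))).trans ?_
      linarith
  refine ⟨U, V, ⟨S.continuous_U, S.continuous_V, ?_, ?_, S.boundary⟩, hdiag⟩
  · intro x y hp
    rw [S.eq_U x y hp]
    congr 1
    refine intervalIntegral.integral_congr fun r hr => ?_
    rw [uIcc_of_le hp.2.1] at hr
    have := hle x r ⟨hp.1, hr.1, hr.2.trans hp.2.2⟩
    exact truncatedRHS_of_le hR (by rw [Prod.norm_mk]; exact max_le this.1 this.2)
  · intro x y hp
    rw [S.eq_V x y hp]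
    congr 1
    refine intervalIntegral.integral_congr fun r hr => ?_
    rw [uIcc_of_le ((H.le_h x).trans hp.2.1)] at hr
    have := hle r y ⟨hp.1.trans hr.1, H.h_le_of_le hp.2.1 hr.1 hr.2, hp.2.2⟩
    exact truncatedRHS_of_le hR (by rw [Prod.norm_mk]; exact max_le this.2 this.1)

end DiracIBVP

/-! ### Differentiating a characteristic equation in a parameter. -/

namespace DiracIBVP

/-- The slope of `nullRHS` in its first argument, as a real-linear map. -/
noncomputable def slopeFst (α β : ℝ) (b w : ℂ) : ℂ :=
  -(Complex.I / 2) * (((α + 2 * β : ℝ) : ℂ) * (b * (starRingEnd ℂ) b * w)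
    + ((2 * β : ℝ) : ℂ) * (b * b * (starRingEnd ℂ) w))

/-- The slope of `nullRHS` in its second argument, as a real-linear map. -/
noncomputable def slopeSnd (m α β : ℝ) (a b b' w : ℂ) : ℂ :=
  Complex.I / 2 * ((m : ℂ) * w - ((α + 2 * β : ℝ) : ℂ) * (a * (starRingEnd ℂ) b * w
    + a * b' * (starRingEnd ℂ) w) - ((2 * β : ℝ) : ℂ) * ((starRingEnd ℂ) a * (b + b') * w))

/-- An identity without remainder: `nullRHS` is real-affine in its first argument and quadratic in
the second. For b' = b the two slopes form the linearized equation; complex conjugation makes them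
real-linear only. -/
lemma nullRHS_sub (m α β : ℝ) (a b a' b' : ℂ) :
    nullRHS m α β a b - nullRHS m α β a' b'
      = slopeFst α β b (a - a') + slopeSnd m α β a' b b' (b - b') := by
  simp only [nullRHS, N1_eq, slopeFst, slopeSnd, map_sub]
  ring

lemma slopeFst_sub (α β : ℝ) (b w w' : ℂ) :
    slopeFst α β b (w - w') = slopeFst α β b w - slopeFst α β b w' := by
  simp only [slopeFst, map_sub]; ring

lemma slopeFst_smul (α β r : ℝ) (b w : ℂ) :
    slopeFst α β b ((r : ℂ) * w) = r * slopeFst α β b w := by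
  simp only [slopeFst, map_mul, Complex.conj_ofReal]; ring

lemma slopeSnd_sub (m α β : ℝ) (a b b' w w' : ℂ) :
    slopeSnd m α β a b b' (w - w') = slopeSnd m α β a b b' w - slopeSnd m α β a b b' w' := by
  simp only [slopeSnd, map_sub]; ring

lemma slopeSnd_smul (m α β r : ℝ) (a b b' w : ℂ) :
    slopeSnd m α β a b b' ((r : ℂ) * w) = r * slopeSnd m α β a b b' w := by
  simp only [slopeSnd, map_mul, Complex.conj_ofReal]; ring

lemma norm_I_half_le : ‖Complex.I / 2‖ ≤ 1 := by simp; norm_num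

lemma norm_slopeFst_le (α β : ℝ) (b w : ℂ) :
    ‖slopeFst α β b w‖ ≤ strength α β * ‖b‖ ^ 2 * ‖w‖ := by
  rw [slopeFst, norm_mul, norm_neg]
  have h1 : ‖((α + 2 * β : ℝ) : ℂ) * (b * (starRingEnd ℂ) b * w)
    + ((2 * β : ℝ) : ℂ) * (b * b * (starRingEnd ℂ) w)‖ ≤ strength α β * ‖b‖ ^ 2 * ‖w‖ := by
    refine (norm_add_le _ _).trans (le_of_eq ?_)
    simp only [norm_mul, Complex.norm_real, Real.norm_eq_abs, RCLike.norm_conj, strength, abs_mul]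
    ring
  calc _ ≤ 1 * (strength α β * ‖b‖ ^ 2 * ‖w‖) := by
        gcongr
        exact norm_I_half_le
    _ = _ := one_mul _

lemma norm_slopeSnd_le {m : ℝ} (hm : 0 ≤ m) (α β : ℝ) (a b b' w : ℂ) :
    ‖slopeSnd m α β a b b' w‖ ≤ (m + strength α β * (‖a‖ * (‖b‖ + ‖b'‖))) * ‖w‖ := by
  rw [slopeSnd, norm_mul]
  have h1 : ‖(m : ℂ) * w - ((α + 2 * β : ℝ) : ℂ) * (a * (starRingEnd ℂ) b * w
      + a * b' * (starRingEnd ℂ) w) - ((2 * β : ℝ) : ℂ) * ((starRingEnd ℂ) a * (b + b') * w)‖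
      ≤ (m + strength α β * (‖a‖ * (‖b‖ + ‖b'‖))) * ‖w‖ := by
    refine (norm_sub_le _ _).trans ((add_le_add (norm_sub_le _ _) le_rfl).trans ?_)
    simp only [norm_mul, Complex.norm_real, Real.norm_eq_abs, RCLike.norm_conj, strength,
      abs_of_nonneg hm]
    have h2 : ‖a * (starRingEnd ℂ) b * w + a * b' * (starRingEnd ℂ) w‖
        ≤ ‖a‖ * (‖b‖ + ‖b'‖) * ‖w‖ := by
      refine (norm_add_le _ _).trans (le_of_eq ?_)
      simp only [norm_mul, RCLike.norm_conj]; ring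
    have h3 : ‖b + b'‖ ≤ ‖b‖ + ‖b'‖ := norm_add_le _ _
    calc _ ≤ m * ‖w‖ + |α + 2 * β| * (‖a‖ * (‖b‖ + ‖b'‖) * ‖w‖)
          + |2| * |β| * (‖a‖ * (‖b‖ + ‖b'‖) * ‖w‖) := by
          gcongr
      _ = _ := by rw [abs_mul]; ring
  calc _ ≤ 1 * ((m + strength α β * (‖a‖ * (‖b‖ + ‖b'‖))) * ‖w‖) := by
        gcongr
        exact norm_I_half_le
    _ = _ := one_mul _

lemma Continuous.slopeFst {X : Type*} [TopologicalSpace X] {b w : X → ℂ} (α β : ℝ)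
    (hb : Continuous b) (hw : Continuous w) :
    Continuous fun x => slopeFst α β (b x) (w x) := by
  have h1 := Complex.continuous_conj.comp hb
  have h2 := Complex.continuous_conj.comp hw
  simp only [Function.comp_def] at h1 h2
  unfold DiracIBVP.slopeFst
  fun_prop

lemma Continuous.slopeSnd {X : Type*} [TopologicalSpace X] {a b b' w : X → ℂ} (m α β : ℝ)
    (ha : Continuous a) (hb : Continuous b) (hb' : Continuous b') (hw : Continuous w) :
    Continuous fun x => slopeSnd m α β (a x) (b x) (b' x) (w x) := by
  have h0 := Complex.continuous_conj.comp ha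
  have h1 := Complex.continuous_conj.comp hb
  have h2 := Complex.continuous_conj.comp hw
  simp only [Function.comp_def] at h0 h1 h2
  unfold DiracIBVP.slopeSnd
  fun_prop

lemma Continuous.nullRHS {X : Type*} [TopologicalSpace X] {a b : X → ℂ} (m α β : ℝ)
    (ha : Continuous a) (hb : Continuous b) :
    Continuous fun x => nullRHS m α β (a x) (b x) := by
  have := (continuous_N1 α β).comp (ha.prodMk hb)
  simp only [Function.comp_def] at this
  unfold DiracIBVP.nullRHS
  fun_prop

/-- Compactness of the characteristic segment upgrades pointwise smallness to uniform smallness. -/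
lemma eventually_forall_norm_le {E : Type*} [NormedAddCommGroup E] {F : ℝ × ℝ → E}
    (hF : Continuous F) {s₁ : ℝ} (h0 : ∀ σ, F (s₁, σ) = 0) {K : Set ℝ} (hK : IsCompact K)
    {ε : ℝ} (hε : 0 < ε) : ∀ᶠ s in 𝓝 s₁, ∀ σ ∈ K, ‖F (s, σ)‖ ≤ ε := by
  refine hK.eventually_forall_of_forall_eventually (P := fun s σ => ‖F (s, σ)‖ ≤ ε) fun σ _ => ?_
  have : ∀ᶠ z in 𝓝 (s₁, σ), ‖F z‖ < ε := by
    refine hF.norm.continuousAt.eventually_lt continuousAt_const ?_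
    rw [h0, norm_zero]; exact hε
  exact this.mono fun z hz => hz.le

/-- Differentiability of a characteristic ordinary differential equation in a parameter: `Y(s, ·)`
solves `Y' = nullRHS(Y, Z(s, ·))`, and `Q(s₁, ·)` solves the linearized equation. -/
theorem hasDerivWithinAt_parameter {m : ℝ} (hm : 0 ≤ m) (α β : ℝ) {Y Z Q Zs : ℝ × ℝ → ℂ}
    (hY : Continuous Y) (hZ : Continuous Z) (hQ : Continuous Q) (hZs : Continuous Zs)
    {a : ℝ → ℝ} {c : ℝ → ℂ} {I : Set ℝ} {s₁ τ₁ : ℝ} (hs₁ : s₁ ∈ I) (ha : ∀ s ∈ I, a s ≤ τ₁)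
    (hYeq : ∀ s ∈ I, ∀ τ ∈ Icc (a s) τ₁,
      Y (s, τ) = c s + ∫ σ in a s..τ, nullRHS m α β (Y (s, σ)) (Z (s, σ)))
    (hQeq : ∀ τ ∈ Icc (a s₁) τ₁, Q (s₁, τ) = Q (s₁, a s₁) + ∫ σ in a s₁..τ,
      (slopeFst α β (Z (s₁, σ)) (Q (s₁, σ))
        + slopeSnd m α β (Y (s₁, σ)) (Z (s₁, σ)) (Z (s₁, σ)) (Zs (s₁, σ))))
    (hZeq : ∀ s ∈ I, ∀ σ ∈ Icc (max (a s) (a s₁)) τ₁,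
      Z (s, σ) - Z (s₁, σ) = ∫ r in s₁..s, Zs (r, σ))
    (hacont : ContinuousWithinAt a I s₁)
    (hinit : (fun s => Y (s, max (a s) (a s₁)) - Y (s₁, max (a s) (a s₁))
      - ((s - s₁ : ℝ) : ℂ) * Q (s₁, a s₁)) =o[𝓝[I] s₁] fun s => s - s₁) :
    HasDerivWithinAt (fun s => Y (s, τ₁)) (Q (s₁, τ₁)) I s₁ := by
  have hG := strength_nonneg α β
  set K := Icc (a s₁) τ₁ with hKdef
  have hK : IsCompact K := isCompact_Icc
  -- uniform bounds for the coefficients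
  obtain ⟨B₁, hB₁⟩ := ((isCompact_closedBall s₁ 1).prod hK).exists_bound_of_continuousOn
    (f := fun p : ℝ × ℝ => strength α β * ‖Z p‖ ^ 2) (by fun_prop)
  obtain ⟨B₂, hB₂⟩ := ((isCompact_closedBall s₁ 1).prod hK).exists_bound_of_continuousOn
    (f := fun p : ℝ × ℝ => m + strength α β * (‖Y (s₁, p.2)‖ * (‖Z p‖ + ‖Z (s₁, p.2)‖)))
    (by fun_prop)
  set N := max (max B₁ B₂) 1 with hN
  have hN1 : 1 ≤ N := le_max_right _ _
  set A := Real.exp (N * (τ₁ - a s₁)) with hA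
  rw [hasDerivWithinAt_iff_isLittleO, Asymptotics.isLittleO_iff]
  intro ε₀ hε₀
  -- The remainder starts with at most 2ε, its forcing is at most (2 + N)ε, and Grönwall multiplies
  -- by at most A.
  set ε := ε₀ / (A * (4 + N)) with hεdef
  have hA0 : 0 < A := Real.exp_pos _
  have hε : 0 < ε := by positivity
  -- smallness of the errors, uniformly along the characteristic
  have e1 : ∀ᶠ s in 𝓝[I] s₁, ∀ σ ∈ K,
      ‖slopeFst α β (Z (s, σ)) (Q (s₁, σ)) - slopeFst α β (Z (s₁, σ)) (Q (s₁, σ))‖ ≤ ε := by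
    refine nhdsWithin_le_nhds (eventually_forall_norm_le
      (F := fun p => slopeFst α β (Z p) (Q (s₁, p.2)) - slopeFst α β (Z (s₁, p.2)) (Q (s₁, p.2)))
      ?_ (fun σ => sub_self _) hK hε)
    exact (Continuous.slopeFst α β hZ (by fun_prop)).sub
      (Continuous.slopeFst α β (by fun_prop) (by fun_prop))
  have e2 : ∀ᶠ s in 𝓝[I] s₁, ∀ σ ∈ K,
      ‖slopeSnd m α β (Y (s₁, σ)) (Z (s, σ)) (Z (s₁, σ)) (Zs (s₁, σ))
        - slopeSnd m α β (Y (s₁, σ)) (Z (s₁, σ)) (Z (s₁, σ)) (Zs (s₁, σ))‖ ≤ ε := by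
    refine nhdsWithin_le_nhds (eventually_forall_norm_le
      (F := fun p => slopeSnd m α β (Y (s₁, p.2)) (Z p) (Z (s₁, p.2)) (Zs (s₁, p.2))
        - slopeSnd m α β (Y (s₁, p.2)) (Z (s₁, p.2)) (Z (s₁, p.2)) (Zs (s₁, p.2)))
      ?_ (fun σ => sub_self _) hK hε)
    exact (Continuous.slopeSnd m α β (by fun_prop) hZ (by fun_prop) (by fun_prop)).sub
      (Continuous.slopeSnd m α β (by fun_prop) (by fun_prop) (by fun_prop) (by fun_prop))
  have e3 : ∀ᶠ s in 𝓝[I] s₁, ∀ σ ∈ Icc (max (a s) (a s₁)) τ₁,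
      ‖Z (s, σ) - Z (s₁, σ) - ((s - s₁ : ℝ) : ℂ) * Zs (s₁, σ)‖ ≤ ε * |s - s₁| := by
    have h1 := eventually_forall_norm_le (F := fun p => Zs p - Zs (s₁, p.2)) (by fun_prop)
      (fun σ => sub_self _) hK hε
    obtain ⟨δ, hδ, hball⟩ := Metric.eventually_nhds_iff_ball.1 h1
    filter_upwards [self_mem_nhdsWithin, nhdsWithin_le_nhds (Metric.ball_mem_nhds s₁ hδ)]
      with s hsI hsδ σ hσ
    have hσK : σ ∈ K := ⟨(le_max_right _ _).trans hσ.1, hσ.2⟩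
    have hc : ∀ a b : ℝ, IntervalIntegrable (fun r => Zs (r, σ)) volume a b :=
      fun a b => Continuous.intervalIntegrable (by fun_prop) _ _
    have h2 : Z (s, σ) - Z (s₁, σ) - ((s - s₁ : ℝ) : ℂ) * Zs (s₁, σ)
        = ∫ r in s₁..s, (Zs (r, σ) - Zs (s₁, σ)) := by
      rw [hZeq s hsI σ hσ, intervalIntegral.integral_sub (hc _ _)
        intervalIntegrable_const, intervalIntegral.integral_const, Complex.real_smul]
    rw [h2]
    refine intervalIntegral.norm_integral_le_of_norm_le_const fun r hr => ?_
    refine hball r ?_ σ hσK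
    rw [Metric.mem_ball, Real.dist_eq] at hsδ ⊢
    refine lt_of_le_of_lt ?_ hsδ
    have hr' := uIoc_subset_uIcc hr
    have := abs_sub_left_of_mem_uIcc hr'
    exact this
  have e4 := (Asymptotics.isLittleO_iff.1 hinit) hε
  have e5 : ∀ᶠ s in 𝓝[I] s₁, ‖Q (s₁, max (a s) (a s₁)) - Q (s₁, a s₁)‖ ≤ ε := by
    have h1 : ContinuousWithinAt (fun s => Q (s₁, max (a s) (a s₁)) - Q (s₁, a s₁)) I s₁ := by
      have : ContinuousWithinAt (fun s => (s₁, max (a s) (a s₁))) I s₁ :=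
        continuousWithinAt_const.prodMk (hacont.max continuousWithinAt_const)
      exact (hQ.continuousAt.comp_continuousWithinAt this).sub continuousWithinAt_const
    have h2 : ∀ᶠ s in 𝓝[I] s₁, ‖Q (s₁, max (a s) (a s₁)) - Q (s₁, a s₁)‖ < ε := by
      refine (h1.norm).eventually_lt_const ?_
      simpa using hε
    exact h2.mono fun s hs => hs.le
  have e6 : ∀ᶠ s in 𝓝[I] s₁, s ∈ Metric.closedBall s₁ 1 :=
    nhdsWithin_le_nhds (Metric.closedBall_mem_nhds s₁ one_pos)
  filter_upwards [e1, e2, e3, e4, e5, e6, self_mem_nhdsWithin] with s e1 e2 e3 e4 e5 e6 hsI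
  -- From this parameter on, both characteristics have started and can be compared.
  set t := max (a s) (a s₁) with ht
  have htτ : t ≤ τ₁ := max_le (ha s hsI) (ha s₁ hs₁)
  have hsub : Icc t τ₁ ⊆ K := Icc_subset_Icc_left (le_max_right _ _)
  have cYs : ∀ s, Continuous fun σ => nullRHS m α β (Y (s, σ)) (Z (s, σ)) := fun s =>
    Continuous.nullRHS m α β (by fun_prop) (by fun_prop)
  have cL : Continuous fun σ => slopeFst α β (Z (s₁, σ)) (Q (s₁, σ))
        + slopeSnd m α β (Y (s₁, σ)) (Z (s₁, σ)) (Z (s₁, σ)) (Zs (s₁, σ)) :=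
    (Continuous.slopeFst α β (by fun_prop) (by fun_prop)).add
      (Continuous.slopeSnd m α β (by fun_prop) (by fun_prop) (by fun_prop) (by fun_prop))
  set g : ℝ → ℂ := fun σ => nullRHS m α β (Y (s, σ)) (Z (s, σ))
    - nullRHS m α β (Y (s₁, σ)) (Z (s₁, σ)) - ((s - s₁ : ℝ) : ℂ) *
      (slopeFst α β (Z (s₁, σ)) (Q (s₁, σ))
        + slopeSnd m α β (Y (s₁, σ)) (Z (s₁, σ)) (Z (s₁, σ)) (Zs (s₁, σ))) with hg
  have cg : Continuous g := ((cYs s).sub (cYs s₁)).sub (continuous_const.mul cL)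
  set Δ : ℝ → ℂ := fun σ => Y (s, σ) - Y (s₁, σ) - ((s - s₁ : ℝ) : ℂ) * Q (s₁, σ) with hΔ
  have hΔeq : ∀ σ ∈ Icc t τ₁, Δ σ = Δ t + ∫ r in t..σ, g r := by
    intro σ hσ
    have hh : ∀ s', s' ∈ I → a s' ≤ t → Y (s', σ) - Y (s', t)
        = ∫ r in t..σ, nullRHS m α β (Y (s', r)) (Z (s', r)) := by
      intro s' hs' hat
      rw [hYeq s' hs' σ ⟨hat.trans hσ.1, hσ.2⟩, hYeq s' hs' t ⟨hat, htτ⟩, add_sub_add_left_eq_sub,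
        intervalIntegral.integral_interval_sub_left ((cYs s').intervalIntegrable _ _)
        ((cYs s').intervalIntegrable _ _)]
    have h1 := hh s hsI (le_max_left _ _)
    have h2 := hh s₁ hs₁ (le_max_right _ _)
    have h3 : Q (s₁, σ) - Q (s₁, t) = ∫ r in t..σ, (slopeFst α β (Z (s₁, r)) (Q (s₁, r))
        + slopeSnd m α β (Y (s₁, r)) (Z (s₁, r)) (Z (s₁, r)) (Zs (s₁, r))) := by
      rw [hQeq σ (hsub hσ), hQeq t (hsub ⟨le_rfl, htτ⟩), add_sub_add_left_eq_sub,
        intervalIntegral.integral_interval_sub_left (cL.intervalIntegrable _ _)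
        (cL.intervalIntegrable _ _)]
    have h4 : ∫ r in t..σ, g r = (Y (s, σ) - Y (s, t)) - (Y (s₁, σ) - Y (s₁, t))
        - ((s - s₁ : ℝ) : ℂ) * (Q (s₁, σ) - Q (s₁, t)) := by
      have k1 : Continuous fun r => nullRHS m α β (Y (s, r)) (Z (s, r))
        - nullRHS m α β (Y (s₁, r)) (Z (s₁, r)) := (cYs s).sub (cYs s₁)
      have k2 : Continuous fun r => ((s - s₁ : ℝ) : ℂ) *
          (slopeFst α β (Z (s₁, r)) (Q (s₁, r))
            + slopeSnd m α β (Y (s₁, r)) (Z (s₁, r)) (Z (s₁, r)) (Zs (s₁, r))) :=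
        continuous_const.mul cL
      rw [h1, h2, h3, ← intervalIntegral.integral_const_mul,
        ← intervalIntegral.integral_sub ((cYs s).intervalIntegrable _ _)
          ((cYs s₁).intervalIntegrable _ _), ← intervalIntegral.integral_sub
          (k1.intervalIntegrable _ _) (k2.intervalIntegrable _ _)]
    rw [h4]
    simp only [hΔ]
    ring
  have hgle : ∀ σ ∈ Icc t τ₁, ‖g σ‖ ≤ N * ‖Δ σ‖ + (2 + N) * ε * |s - s₁| := by
    intro σ hσ
    have hσK := hsub hσ
    -- The remainder Δ enters linearly through the first slope. The other terms are the change of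
    -- the slopes as Z moves and the Taylor remainder of Z in the parameter, all o(s - s₁) uniformly
    -- in σ.
    have hdecomp : g σ = slopeFst α β (Z (s, σ)) (Δ σ)
        + ((s - s₁ : ℝ) : ℂ) * (slopeFst α β (Z (s, σ)) (Q (s₁, σ))
          - slopeFst α β (Z (s₁, σ)) (Q (s₁, σ)))
        + slopeSnd m α β (Y (s₁, σ)) (Z (s, σ)) (Z (s₁, σ))
          (Z (s, σ) - Z (s₁, σ) - ((s - s₁ : ℝ) : ℂ) * Zs (s₁, σ))
        + ((s - s₁ : ℝ) : ℂ) * (slopeSnd m α β (Y (s₁, σ)) (Z (s, σ)) (Z (s₁, σ)) (Zs (s₁, σ))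
          - slopeSnd m α β (Y (s₁, σ)) (Z (s₁, σ)) (Z (s₁, σ)) (Zs (s₁, σ))) := by
      simp only [hg, hΔ]
      rw [nullRHS_sub, slopeFst_sub _ _ _ (Y (s, σ) - Y (s₁, σ)), slopeFst_smul,
        slopeSnd_sub _ _ _ _ _ _ (Z (s, σ) - Z (s₁, σ)), slopeSnd_smul]
      ring
    have n1 : ‖slopeFst α β (Z (s, σ)) (Δ σ)‖ ≤ N * ‖Δ σ‖ := by
      refine (norm_slopeFst_le _ _ _ _).trans ?_
      gcongr
      exact (le_abs_self _).trans ((hB₁ (s, σ) ⟨e6, hσK⟩).trans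
        ((le_max_left _ _).trans (le_max_left _ _)))
    have n2 : ‖slopeSnd m α β (Y (s₁, σ)) (Z (s, σ)) (Z (s₁, σ))
          (Z (s, σ) - Z (s₁, σ) - ((s - s₁ : ℝ) : ℂ) * Zs (s₁, σ))‖ ≤ N * (ε * |s - s₁|) := by
      refine (norm_slopeSnd_le hm _ _ _ _ _ _).trans ?_
      refine mul_le_mul ?_ (e3 σ hσ) (norm_nonneg _) (by linarith)
      exact (le_abs_self _).trans ((hB₂ (s, σ) ⟨e6, hσK⟩).trans
        ((le_max_right _ _).trans (le_max_left _ _)))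
    have n3 := mul_le_mul_of_nonneg_left (e1 σ hσK) (abs_nonneg (s - s₁))
    have n4 := mul_le_mul_of_nonneg_left (e2 σ hσK) (abs_nonneg (s - s₁))
    rw [hdecomp]
    refine (norm_add_le _ _).trans ((add_le_add ((norm_add_le _ _).trans
      (add_le_add (norm_add_le _ _) le_rfl)) le_rfl).trans ?_)
    rw [norm_mul, norm_mul, Complex.norm_real, Real.norm_eq_abs]
    linarith
  have hΔt : ‖Δ t‖ ≤ 2 * ε * |s - s₁| := by
    have : Δ t = (Y (s, t) - Y (s₁, t) - ((s - s₁ : ℝ) : ℂ) * Q (s₁, a s₁))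
        - ((s - s₁ : ℝ) : ℂ) * (Q (s₁, t) - Q (s₁, a s₁)) := by simp only [hΔ]; ring
    rw [this]
    refine (norm_sub_le _ _).trans ?_
    rw [norm_mul, Complex.norm_real]
    rw [Real.norm_eq_abs] at e4 ⊢
    have := mul_le_mul_of_nonneg_left e5 (abs_nonneg (s - s₁))
    linarith
  have hgr := norm_le_gronwallBound_of_norm_deriv_right_le
    (f := fun σ => Δ t + ∫ r in t..σ, g r) (f' := g) (δ := 2 * ε * |s - s₁|) (K := N)
    (ε := (2 + N) * ε * |s - s₁|) (a := t) (b := τ₁)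
    (fun σ _ => (hasDerivAt_primitive cg (Δ t) t σ).continuousAt.continuousWithinAt)
    (fun σ _ => (hasDerivAt_primitive cg (Δ t) t σ).hasDerivWithinAt)
    (by simpa using hΔt)
    (fun σ hσ => by
      have h1 : σ ∈ Icc t τ₁ := ⟨hσ.1, hσ.2.le⟩
      rw [← hΔeq σ h1]
      exact hgle σ h1) τ₁ ⟨htτ, le_rfl⟩
  rw [← hΔeq τ₁ ⟨htτ, le_rfl⟩, gronwallBound_of_K_ne_0 (by positivity)] at hgr
  have hexp : Real.exp (N * (τ₁ - t)) ≤ A :=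
    Real.exp_le_exp.2 (mul_le_mul_of_nonneg_left (by linarith [le_max_right (a s) (a s₁)])
      (by linarith))
  have hdiv : (2 + N) * ε * |s - s₁| / N ≤ (2 + N) * ε * |s - s₁| :=
    div_le_self (by positivity) hN1
  have hfin : ‖Δ τ₁‖ ≤ ε₀ * |s - s₁| := by
    have p1 : 0 ≤ (2 + N) * ε * |s - s₁| / N := by positivity
    calc ‖Δ τ₁‖ ≤ 2 * ε * |s - s₁| * Real.exp (N * (τ₁ - t))
          + (2 + N) * ε * |s - s₁| / N * (Real.exp (N * (τ₁ - t)) - 1) := hgr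
      _ ≤ 2 * ε * |s - s₁| * A + (2 + N) * ε * |s - s₁| * A := by
          refine add_le_add (mul_le_mul_of_nonneg_left hexp (by positivity)) ?_
          refine (mul_le_mul_of_nonneg_left (by linarith : Real.exp (N * (τ₁ - t)) - 1 ≤ A)
            p1).trans (mul_le_mul_of_nonneg_right hdiv hA0.le)
      _ = ε * (A * (4 + N)) * |s - s₁| := by ring
      _ = ε₀ * |s - s₁| := by rw [hεdef, div_mul_cancel₀ _ (by positivity)]
  rw [Real.norm_eq_abs, Complex.real_smul]
  exact hfin

end DiracIBVP

/-! ### Moving starting points and total differentiability in the past. -/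

namespace DiracIBVP

/-- The increment, between two parameters, of an integral with a moving starting point. -/
lemma isLittleO_moving_start {c : ℝ → ℂ} {a : ℝ → ℝ} {g : ℝ × ℝ → ℂ} {I : Set ℝ} {s₁ a' : ℝ}
    {c' : ℂ} (hg : Continuous g) (ha : HasDerivWithinAt a a' I s₁)
    (hc : HasDerivWithinAt c c' I s₁) :
    (fun s => (c s + ∫ σ in a s..max (a s) (a s₁), g (s, σ))
      - (c s₁ + ∫ σ in a s₁..max (a s) (a s₁), g (s₁, σ))
      - ((s - s₁ : ℝ) : ℂ) * (c' - a' * g (s₁, a s₁))) =o[𝓝[I] s₁] fun s => s - s₁ := by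
  set g₀ := g (s₁, a s₁) with hg₀
  have i1 := hasDerivWithinAt_iff_isLittleO.1 hc
  have i2 := hasDerivWithinAt_iff_isLittleO.1 ha
  have i2' : (fun s => ((a s - a s₁ - (s - s₁) • a' : ℝ) : ℂ) * g₀) =o[𝓝[I] s₁]
      fun s => s - s₁ := by
    have h3 : (fun s => ((a s - a s₁ - (s - s₁) • a' : ℝ) : ℂ)) =o[𝓝[I] s₁]
        fun s => s - s₁ := by
      rw [Asymptotics.isLittleO_iff] at i2 ⊢
      intro ε hε
      filter_upwards [i2 hε] with s hs
      rwa [Complex.norm_real]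
    simpa only [mul_comm g₀] using h3.const_mul_left g₀
  -- Once g is frozen at its value g₀, the error is an integral over an interval of length at most
  -- |a s - a s₁| of a small function, hence o(a s - a s₁), and a is differentiable.
  have i3 : (fun s => (∫ σ in a s..max (a s) (a s₁), (g (s, σ) - g₀))
      - ∫ σ in a s₁..max (a s) (a s₁), (g (s₁, σ) - g₀)) =o[𝓝[I] s₁] fun s => s - s₁ := by
    have h1 : (fun s => (∫ σ in a s..max (a s) (a s₁), (g (s, σ) - g₀))
        - ∫ σ in a s₁..max (a s) (a s₁), (g (s₁, σ) - g₀)) =o[𝓝[I] s₁]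
        fun s => a s - a s₁ := by
      rw [Asymptotics.isLittleO_iff]
      intro ε hε
      obtain ⟨δ, hδ, hball⟩ := Metric.continuousAt_iff.1 (hg.continuousAt (x := (s₁, a s₁)))
        (ε / 2) (by positivity)
      have h2 : ∀ᶠ s in 𝓝[I] s₁, dist (a s) (a s₁) < δ :=
        (Metric.tendsto_nhds.1 ha.continuousWithinAt) δ hδ
      have h3 : ∀ᶠ s in 𝓝[I] s₁, dist s s₁ < δ :=
        nhdsWithin_le_nhds (Metric.ball_mem_nhds s₁ hδ)
      filter_upwards [h2, h3] with s h2 h3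
      have hin : ∀ σ ∈ uIcc (a s) (a s₁), dist σ (a s₁) < δ := by
        intro σ hσ
        refine lt_of_le_of_lt ?_ h2
        rw [Real.dist_eq, Real.dist_eq]
        rw [uIcc_comm] at hσ
        exact abs_sub_left_of_mem_uIcc hσ
      have hI : ∀ σ, σ ∈ uIoc (a s) (max (a s) (a s₁)) ∨ σ ∈ uIoc (a s₁) (max (a s) (a s₁)) →
          σ ∈ uIcc (a s) (a s₁) := by
        rintro σ (hσ | hσ)
        · have := uIoc_subset_uIcc hσ
          rw [uIcc_of_le (le_max_left _ _)] at this
          rcases le_total (a s) (a s₁) with h | h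
          · rwa [max_eq_right h, ← uIcc_of_le h] at this
          · rw [max_eq_left h] at this
            rw [le_antisymm this.2 this.1]; exact left_mem_uIcc
        · have := uIoc_subset_uIcc hσ
          rw [uIcc_of_le (le_max_right _ _)] at this
          rcases le_total (a s) (a s₁) with h | h
          · rw [max_eq_right h] at this
            rw [le_antisymm this.2 this.1]; exact right_mem_uIcc
          · rwa [max_eq_left h, ← uIcc_of_ge h] at this
      have n1 : ‖∫ σ in a s..max (a s) (a s₁), (g (s, σ) - g₀)‖
          ≤ ε / 2 * |max (a s) (a s₁) - a s| := by
        refine intervalIntegral.norm_integral_le_of_norm_le_const fun σ hσ => ?_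
        have h4 := hball (x := (s, σ)) (by
          rw [Prod.dist_eq]; exact max_lt h3 (hin σ (hI σ (Or.inl hσ))))
        rw [dist_eq_norm] at h4
        exact h4.le
      have n2 : ‖∫ σ in a s₁..max (a s) (a s₁), (g (s₁, σ) - g₀)‖
          ≤ ε / 2 * |max (a s) (a s₁) - a s₁| := by
        refine intervalIntegral.norm_integral_le_of_norm_le_const fun σ hσ => ?_
        have h4 := hball (x := (s₁, σ)) (by
          rw [Prod.dist_eq]
          exact max_lt (by rwa [dist_self]) (hin σ (hI σ (Or.inr hσ))))
        rw [dist_eq_norm] at h4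
        exact h4.le
      have n3 : |max (a s) (a s₁) - a s| ≤ |a s - a s₁| := by
        rcases le_total (a s) (a s₁) with h | h
        · rw [max_eq_right h, abs_sub_comm]
        · rw [max_eq_left h, sub_self, abs_zero]; positivity
      have n4 : |max (a s) (a s₁) - a s₁| ≤ |a s - a s₁| := by
        rcases le_total (a s) (a s₁) with h | h
        · rw [max_eq_right h, sub_self, abs_zero]; positivity
        · rw [max_eq_left h]
      refine (norm_sub_le _ _).trans ((add_le_add n1 n2).trans ?_)
      rw [Real.norm_eq_abs]
      have := mul_le_mul_of_nonneg_left n3 (by positivity : 0 ≤ ε / 2)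
      have := mul_le_mul_of_nonneg_left n4 (by positivity : 0 ≤ ε / 2)
      linarith
    exact h1.trans_isBigO ha.differentiableWithinAt.isBigO_sub
  have i4 := (i1.sub i2').add i3
  refine i4.congr_left fun s => ?_
  have c1 : Continuous fun σ => g (s, σ) := by fun_prop
  have c2 : Continuous fun σ => g (s₁, σ) := by fun_prop
  rw [intervalIntegral.integral_sub (c1.intervalIntegrable _ _) intervalIntegrable_const,
    intervalIntegral.integral_sub (c2.intervalIntegrable _ _) intervalIntegrable_const,
    intervalIntegral.integral_const, intervalIntegral.integral_const]
  simp only [Complex.real_smul, smul_eq_mul]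
  push_cast
  ring

variable {h k : ℝ → ℝ} {μ : ℝ → ℂ} {ξ₀ η₀ : ℝ}

/-- A function on the past with continuous partial derivatives, in the integrated sense, is
differentiable within the past. -/
lemma IsMirror.hasFDerivWithinAt_past {W W₁ W₂ : ℝ × ℝ → ℂ}
    (hW₁ : Continuous W₁) (hW₂ : Continuous W₂)
    (h₁ : ∀ x x' y, (x, y) ∈ past h ξ₀ η₀ → (x', y) ∈ past h ξ₀ η₀ →
      W (x', y) - W (x, y) = ∫ r in x..x', W₁ (r, y))
    (h₂ : ∀ x y y', (x, y) ∈ past h ξ₀ η₀ → (x, y') ∈ past h ξ₀ η₀ →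
      W (x, y') - W (x, y) = ∫ r in y..y', W₂ (x, r)) {p : ℝ × ℝ} (hp : p ∈ past h ξ₀ η₀) :
    HasFDerivWithinAt W ((ContinuousLinearMap.fst ℝ ℝ ℝ).smulRight (W₁ p)
      + (ContinuousLinearMap.snd ℝ ℝ ℝ).smulRight (W₂ p)) (past h ξ₀ η₀) p := by
  obtain ⟨x, y⟩ := p
  rw [hasFDerivWithinAt_iff_isLittleO, Asymptotics.isLittleO_iff]
  intro ε hε
  obtain ⟨δ₁, hδ₁, hb₁⟩ := Metric.continuousAt_iff.1 (hW₁.continuousAt (x := (x, y)))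
    (ε / 3) (by positivity)
  obtain ⟨δ₂, hδ₂, hb₂⟩ := Metric.continuousAt_iff.1 (hW₂.continuousAt (x := (x, y)))
    (ε / 3) (by positivity)
  filter_upwards [self_mem_nhdsWithin,
    nhdsWithin_le_nhds (Metric.ball_mem_nhds (x, y) hδ₁),
    nhdsWithin_le_nhds (Metric.ball_mem_nhds (x, y) hδ₂)]
  rintro ⟨x', y'⟩ hq hd₁ hd₂
  -- The two points are joined through the height Y: moving up, across and down keeps all corners in
  -- the past, whereas a direct horizontal move could cross its lower boundary.
  set Y := max y y' with hY
  have hpY : (x, Y) ∈ past h ξ₀ η₀ :=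
    ⟨hp.1, hp.2.1.trans (le_max_left _ _), max_le hp.2.2 hq.2.2⟩
  have hqY : (x', Y) ∈ past h ξ₀ η₀ :=
    ⟨hq.1, hq.2.1.trans (le_max_right _ _), max_le hp.2.2 hq.2.2⟩
  rw [Metric.mem_ball, Prod.dist_eq] at hd₁ hd₂
  simp only at hd₁ hd₂
  set N := ‖((x', y') : ℝ × ℝ) - (x, y)‖ with hN
  have hNx : |x' - x| ≤ N := norm_fst_le (((x', y') : ℝ × ℝ) - (x, y))
  have hNy : |y' - y| ≤ N := norm_snd_le (((x', y') : ℝ × ℝ) - (x, y))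
  have hYy : |Y - y| ≤ |y' - y| := by
    rcases le_total y y' with h | h
    · rw [hY, max_eq_right h]
    · rw [hY, max_eq_left h, sub_self, abs_zero]; positivity
  have hYy' : |y' - Y| ≤ |y' - y| := by
    rcases le_total y y' with h | h
    · rw [hY, max_eq_right h, sub_self, abs_zero]; positivity
    · rw [hY, max_eq_left h]
  have hYu : ∀ r, r ∈ uIoc y Y ∨ r ∈ uIoc Y y' → |r - y| ≤ |y' - y| := by
    rintro r (hr | hr)
    · exact (abs_sub_left_of_mem_uIcc (uIoc_subset_uIcc hr)).trans hYy
    · have := uIoc_subset_uIcc hr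
      rcases le_total y y' with h | h
      · rw [hY, max_eq_right h, uIcc_self] at this
        rw [mem_singleton_iff.1 this]
      · rw [hY, max_eq_left h] at this
        exact abs_sub_left_of_mem_uIcc this
  have hx'₂ : |x' - x| < δ₂ := by
    rw [← Real.dist_eq]; exact (le_max_left _ _).trans_lt hd₂
  have hy'₂ : |y' - y| < δ₂ := by
    rw [← Real.dist_eq]; exact (le_max_right _ _).trans_lt hd₂
  have hx'₁ : |x' - x| < δ₁ := by
    rw [← Real.dist_eq]; exact (le_max_left _ _).trans_lt hd₁
  have hy'₁ : |y' - y| < δ₁ := by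
    rw [← Real.dist_eq]; exact (le_max_right _ _).trans_lt hd₁
  have c2 : ∀ a, Continuous fun r => W₂ (a, r) := fun a => by fun_prop
  have c1 : ∀ a, Continuous fun r => W₁ (r, a) := fun a => by fun_prop
  have n1 : ‖∫ r in y..Y, (W₂ (x, r) - W₂ (x, y))‖ ≤ ε / 3 * |Y - y| := by
    refine intervalIntegral.norm_integral_le_of_norm_le_const fun r hr => ?_
    rw [← dist_eq_norm]
    refine (hb₂ ?_).le
    rw [Prod.dist_eq]
    exact max_lt (by simpa using hδ₂) (by
      rw [Real.dist_eq]; exact (hYu r (Or.inl hr)).trans_lt hy'₂)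
  have n2 : ‖∫ r in x..x', (W₁ (r, Y) - W₁ (x, y))‖ ≤ ε / 3 * |x' - x| := by
    refine intervalIntegral.norm_integral_le_of_norm_le_const fun r hr => ?_
    rw [← dist_eq_norm]
    refine (hb₁ ?_).le
    rw [Prod.dist_eq]
    refine max_lt ?_ ?_
    · rw [Real.dist_eq]
      exact (abs_sub_left_of_mem_uIcc (uIoc_subset_uIcc hr)).trans_lt hx'₁
    · rw [Real.dist_eq]
      exact hYy.trans_lt hy'₁
  have n3 : ‖∫ r in Y..y', (W₂ (x', r) - W₂ (x, y))‖ ≤ ε / 3 * |y' - Y| := by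
    refine intervalIntegral.norm_integral_le_of_norm_le_const fun r hr => ?_
    rw [← dist_eq_norm]
    refine (hb₂ ?_).le
    rw [Prod.dist_eq]
    exact max_lt (by rw [Real.dist_eq]; exact hx'₂) (by
      rw [Real.dist_eq]; exact (hYu r (Or.inr hr)).trans_lt hy'₂)
  have key : W (x', y') - W (x, y) - ((ContinuousLinearMap.fst ℝ ℝ ℝ).smulRight (W₁ (x, y))
      + (ContinuousLinearMap.snd ℝ ℝ ℝ).smulRight (W₂ (x, y))) ((x', y') - (x, y))
      = (∫ r in y..Y, (W₂ (x, r) - W₂ (x, y))) + (∫ r in x..x', (W₁ (r, Y) - W₁ (x, y)))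
        + ∫ r in Y..y', (W₂ (x', r) - W₂ (x, y)) := by
    rw [intervalIntegral.integral_sub ((c2 x).intervalIntegrable _ _) intervalIntegrable_const,
      intervalIntegral.integral_sub ((c2 x').intervalIntegrable _ _) intervalIntegrable_const,
      intervalIntegral.integral_sub ((c1 Y).intervalIntegrable _ _) intervalIntegrable_const,
      intervalIntegral.integral_const, intervalIntegral.integral_const,
      intervalIntegral.integral_const, ← h₂ x y Y hp hpY, ← h₂ x' Y y' hqY hq,
      ← h₁ x x' Y hpY hqY]
    simp only [Prod.mk_sub_mk, add_apply, ContinuousLinearMap.smulRight_apply,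
      ContinuousLinearMap.coe_fst', ContinuousLinearMap.coe_snd', Complex.real_smul]
    push_cast
    ring
  rw [key]
  refine (norm_add₃_le).trans ((add_le_add (add_le_add n1 n2) n3).trans ?_)
  have m1 := mul_le_mul_of_nonneg_left (hYy.trans hNy) (by positivity : 0 ≤ ε / 3)
  have m2 := mul_le_mul_of_nonneg_left hNx (by positivity : 0 ≤ ε / 3)
  have m3 := mul_le_mul_of_nonneg_left (hYy'.trans hNy) (by positivity : 0 ≤ ε / 3)
  linarith

/-- A derivative within an interval integrates. -/
lemma sub_eq_integral_of_hasDerivWithinAt {g g' : ℝ → ℂ} {s : Set ℝ} (hs : s.OrdConnected)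
    (hg' : Continuous g') (hd : ∀ x ∈ s, HasDerivWithinAt g (g' x) s x) {x x' : ℝ} (hx : x ∈ s)
    (hx' : x' ∈ s) : g x' - g x = ∫ r in x..x', g' r := by
  have main : ∀ a b, a ∈ s → b ∈ s → a ≤ b → g b - g a = ∫ r in a..b, g' r := by
    intro a b ha hb hab
    have hsub : Icc a b ⊆ s := hs.out ha hb
    refine (intervalIntegral.integral_eq_sub_of_hasDerivAt_of_le hab
      (fun r hr => ((hd r (hsub hr)).mono hsub).continuousWithinAt)
      (fun r hr => ((hd r (hsub (Ioo_subset_Icc_self hr))).mono hsub).hasDerivAt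
        (Icc_mem_nhds hr.1 hr.2)) (hg'.intervalIntegrable _ _)).symm
  rcases le_total x x' with hle | hle
  · exact main x x' hx hx' hle
  · rw [intervalIntegral.integral_symm, ← main x' x hx' hx hle, neg_sub]

end DiracIBVP

/-! ### C¹ regularity for data vanishing near the corner. -/

namespace DiracIBVP

@[simp] lemma nullRHS_zero (m α β : ℝ) : nullRHS m α β 0 0 = 0 := by simp [nullRHS, N1]

variable {h k : ℝ → ℝ} {μ : ℝ → ℂ} {ξ₀ η₀ : ℝ}

lemma IsMirror.past_horizontal (H : IsMirror h k μ ξ₀) {x y r : ℝ} (hp : (x, y) ∈ past h ξ₀ η₀)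
    (h1 : x ≤ r) (h2 : r ≤ y) : (r, y) ∈ past h ξ₀ η₀ :=
  ⟨hp.1.trans h1, H.h_le_of_le hp.2.1 h1 h2, hp.2.2⟩

namespace IsMild

section general

variable {f : ℂ → ℂ → ℂ} {U V : ℝ × ℝ → ℂ}

lemma sub_U_eq (S : IsMild f h μ ξ₀ η₀ U V) (hf : Continuous fun p : ℂ × ℂ => f p.1 p.2)
    {x y y' : ℝ} (hp : (x, y) ∈ past h ξ₀ η₀) (hq : (x, y') ∈ past h ξ₀ η₀) :
    U (x, y') - U (x, y) = ∫ r in y..y', f (U (x, r)) (V (x, r)) := by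
  have hU := S.continuous_U
  have hV := S.continuous_V
  have hc : Continuous fun r => f (U (x, r)) (V (x, r)) :=
    hf.comp (f := fun r => (U (x, r), V (x, r))) (by fun_prop)
  rw [S.eq_U x y hp, S.eq_U x y' hq, add_sub_add_left_eq_sub,
    intervalIntegral.integral_interval_sub_left (hc.intervalIntegrable _ _)
      (hc.intervalIntegrable _ _)]

lemma sub_V_eq (S : IsMild f h μ ξ₀ η₀ U V) (hf : Continuous fun p : ℂ × ℂ => f p.1 p.2)
    {x x' y : ℝ} (hp : (x, y) ∈ past h ξ₀ η₀) (hq : (x', y) ∈ past h ξ₀ η₀) :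
    V (x', y) - V (x, y) = ∫ r in x..x', -f (V (r, y)) (U (r, y)) := by
  have hU := S.continuous_U
  have hV := S.continuous_V
  have hc : Continuous fun r => f (V (r, y)) (U (r, y)) :=
    hf.comp (f := fun r => (V (r, y), U (r, y))) (by fun_prop)
  rw [S.eq_V x y hp, S.eq_V x' y hq, add_sub_add_left_eq_sub, intervalIntegral.integral_neg,
    ← intervalIntegral.integral_add_adjacent_intervals (hc.intervalIntegrable x x')
      (hc.intervalIntegrable x' y), sub_add_cancel_right]

end general

variable {m α β : ℝ} {U V : ℝ × ℝ → ℂ}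

/-- Solutions with data supported away from the corner vanish near it. -/
lemma eq_zero_of_le (S : IsMild (nullRHS m α β) h μ ξ₀ η₀ U V) (H : IsMirror h k μ ξ₀)
    (hm : 0 ≤ m) {ε : ℝ} (hUV : ∀ x, 0 ≤ x → x ≤ ε → x ≤ η₀ → U (x, x) = 0 ∧ V (x, x) = 0)
    {x y : ℝ} (hp : (x, y) ∈ past h ξ₀ η₀) (hy : y ≤ ε) : U (x, y) = 0 ∧ V (x, y) = 0 := by
  obtain ⟨C, hC, hf⟩ : ∃ C, 0 ≤ C ∧ IsChargeRHS m C (nullRHS m α β) := by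
    have := isChargeRHS_nullRHS hm α β
    exact ⟨_, by have := strength_nonneg α β; positivity, this⟩
  have key : ∀ x y, (x, y) ∈ past h ξ₀ η₀ → y ≤ ε →
      ‖U (x, y)‖ ^ 2 ≤ Real.exp (m * (y - x) + C * 0) * (‖U (x, h x)‖ ^ 2 + m * 0) ∧
      V (x, y) = 0 := by
    intro x y hp hy
    have S' := S.mono hp.1 hp.2.2
    have h0y : 0 ≤ y := (H.h_nonneg x).trans hp.2.1
    -- The data seen from (x, y) lie in the part of the initial line where they vanish, so the a
    -- priori bounds apply with charge zero.
    have hE : baseCharge U V x y ≤ 0 := by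
      refine le_of_eq ?_
      rw [baseCharge, intervalIntegral.integral_zero_ae]
      refine Eventually.of_forall fun r hr => ?_
      rw [uIoc_of_le (max_le ((H.le_h x).trans hp.2.1) h0y)] at hr
      have h0r : 0 ≤ r := (le_max_right _ _).trans hr.1.le
      rw [(hUV r h0r (hr.2.trans hy) (hr.2.trans hp.2.2)).1,
        (hUV r h0r (hr.2.trans hy) (hr.2.trans hp.2.2)).2]
      simp
    have hb := S'.pointwise_bounds (H.mono hp.1) hf hm hC hE
      (⟨le_rfl, hp.2.1, le_rfl⟩ : (x, y) ∈ past h x y)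
    refine ⟨hb.1, ?_⟩
    have h2 := hb.2
    rw [(hUV y h0y hy hp.2.2).2] at h2
    simpa using h2
  obtain ⟨k1, k2⟩ := key x y hp hy
  refine ⟨?_, k2⟩
  -- The starting value of U is either a vanishing datum or the reflection of a value of V already
  -- known to vanish.
  have hb : U (x, h x) = 0 := by
    have hx : (x, h x) ∈ past h ξ₀ η₀ := ⟨hp.1, le_rfl, hp.2.1.trans hp.2.2⟩
    rcases le_total 0 x with hx0 | hx0
    · have hxx := H.h_of_nonneg x hx0
      rw [hxx]
      exact (hUV x hx0 (by linarith [hp.2.1]) (by linarith [hp.2.1, hp.2.2])).1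
    · rw [S.boundary x hp.1 hx0 hx.2.2, (key x (h x) hx (hp.2.1.trans hy)).2, mul_zero]
  rw [hb] at k1
  simpa using k1

/-- The transport equation satisfied by the transversal derivative of `V`. -/
lemma exists_transversal_V (S : IsMild (nullRHS m α β) h μ ξ₀ η₀ U V) (H : IsMirror h k μ ξ₀)
    (hξ : ξ₀ ≤ 0) (h0 : h ξ₀ ≤ η₀) {e : ℝ → ℂ} (he : Continuous e) :
    ∃ Q : ℝ × ℝ → ℂ, Continuous Q ∧ ∀ x y, (x, y) ∈ past h ξ₀ η₀ →
      Q (x, y) = e y + ∫ r in x..y, (slopeFst α β (U (r, y)) (Q (r, y))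
        + slopeSnd m α β (V (r, y)) (U (r, y)) (U (r, y))
          (nullRHS m α β (U (r, y)) (V (r, y)))) := by
  have hU := S.continuous_U
  have hV := S.continuous_V
  have hG := strength_nonneg α β
  -- Composing the coefficients with the retraction extends them from the past to the whole plane
  -- with the same bound, as the global Lipschitz hypothesis of `exists_volterra` requires.
  have hret := H.continuous_pastRetract (η₀ := η₀)
  obtain ⟨B, hB⟩ := (H.isCompact_past (η₀ := η₀)).exists_bound_of_continuousOn hU.continuousOn
  have hUr := hU.comp hret
  have hVr := hV.comp hret
  simp only [Function.comp_def] at hUr hVr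
  obtain ⟨W, hW, hWeq⟩ := exists_volterra H hξ h0 (F₁ := fun _ _ => 0)
    (F₂ := fun p w => slopeFst α β (U (pastRetract h ξ₀ η₀ p)) w.2
      + slopeSnd m α β (V (pastRetract h ξ₀ η₀ p)) (U (pastRetract h ξ₀ η₀ p))
        (U (pastRetract h ξ₀ η₀ p)) (nullRHS m α β (U (pastRetract h ξ₀ η₀ p))
        (V (pastRetract h ξ₀ η₀ p)))) (L := strength α β * B ^ 2) continuous_const
    ((Continuous.slopeFst α β (hUr.comp continuous_fst)
        (continuous_snd.comp continuous_snd)).add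
      (Continuous.slopeSnd m α β (hVr.comp continuous_fst) (hUr.comp continuous_fst)
        (hUr.comp continuous_fst) (Continuous.nullRHS m α β (hUr.comp continuous_fst)
        (hVr.comp continuous_fst)))) (by positivity)
    (fun _ w w' => by rw [sub_self, norm_zero]; positivity)
    (fun p w w' => by
      rw [add_sub_add_right_eq_sub, ← slopeFst_sub]
      refine (norm_slopeFst_le _ _ _ _).trans ?_
      have h1 := hB _ (H.pastRetract_mem h0 p)
      have h2 : ‖w.2 - w'.2‖ ≤ ‖w - w'‖ := norm_snd_le (w - w')
      gcongr)
    (b := fun _ => 0) continuous_const he (fun _ => 0) continuous_const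
  refine ⟨fun p => (W p).2, by fun_prop, fun x y hp => ?_⟩
  refine ((hWeq x y hp).2).trans ?_
  congr 1
  refine intervalIntegral.integral_congr fun r hr => ?_
  rw [uIcc_of_le ((H.le_h x).trans hp.2.1)] at hr
  simp only [H.pastRetract_of_mem (H.past_horizontal hp hr.1 hr.2)]

/-- The transport equation satisfied by the transversal derivative of `U`. -/
lemma exists_transversal_U (S : IsMild (nullRHS m α β) h μ ξ₀ η₀ U V) (H : IsMirror h k μ ξ₀)
    (hξ : ξ₀ ≤ 0) (h0 : h ξ₀ ≤ η₀) {e : ℝ → ℂ} (he : Continuous e) :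
    ∃ P : ℝ × ℝ → ℂ, Continuous P ∧ ∀ x y, (x, y) ∈ past h ξ₀ η₀ →
      P (x, y) = e x + ∫ r in h x..y, (slopeFst α β (V (x, r)) (P (x, r))
        + slopeSnd m α β (U (x, r)) (V (x, r)) (V (x, r))
          (-nullRHS m α β (V (x, r)) (U (x, r)))) := by
  have hU := S.continuous_U
  have hV := S.continuous_V
  have hG := strength_nonneg α β
  have hret := H.continuous_pastRetract (η₀ := η₀)
  obtain ⟨B, hB⟩ := (H.isCompact_past (η₀ := η₀)).exists_bound_of_continuousOn hV.continuousOn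
  have hUr := hU.comp hret
  have hVr := hV.comp hret
  simp only [Function.comp_def] at hUr hVr
  obtain ⟨W, hW, hWeq⟩ := exists_volterra H hξ h0 (F₂ := fun _ _ => 0)
    (F₁ := fun p w => slopeFst α β (V (pastRetract h ξ₀ η₀ p)) w.1
      + slopeSnd m α β (U (pastRetract h ξ₀ η₀ p)) (V (pastRetract h ξ₀ η₀ p))
        (V (pastRetract h ξ₀ η₀ p)) (-nullRHS m α β (V (pastRetract h ξ₀ η₀ p))
        (U (pastRetract h ξ₀ η₀ p)))) (L := strength α β * B ^ 2)
    ((Continuous.slopeFst α β (hVr.comp continuous_fst)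
        (continuous_fst.comp continuous_snd)).add
      (Continuous.slopeSnd m α β (hUr.comp continuous_fst) (hVr.comp continuous_fst)
        (hVr.comp continuous_fst) (Continuous.nullRHS m α β (hVr.comp continuous_fst)
        (hUr.comp continuous_fst)).neg)) continuous_const (by positivity)
    (fun p w w' => by
      rw [add_sub_add_right_eq_sub, ← slopeFst_sub]
      refine (norm_slopeFst_le _ _ _ _).trans ?_
      have h1 := hB _ (H.pastRetract_mem h0 p)
      have h2 : ‖w.1 - w'.1‖ ≤ ‖w - w'‖ := norm_fst_le (w - w')
      gcongr)
    (fun _ w w' => by rw [sub_self, norm_zero]; positivity)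
    (c := fun _ => 0) he continuous_const (fun _ => 0) continuous_const
  refine ⟨fun p => (W p).1, by fun_prop, fun x y hp => ?_⟩
  refine ((hWeq x y hp).1).trans ?_
  rw [zero_mul, add_zero]
  congr 1
  refine intervalIntegral.integral_congr fun r hr => ?_
  rw [uIcc_of_le hp.2.1] at hr
  simp only [H.pastRetract_of_mem (⟨hp.1, hr.1, hr.2.trans hp.2.2⟩ : (x, r) ∈ past h ξ₀ η₀)]

/-- The characteristics of V are parametrized by τ = -ξ, so they start at a(s) = -s. Differentiating
this start gives the term +`nullRHS` in the initial value of Q. -/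
lemma hasDerivWithinAt_V (S : IsMild (nullRHS m α β) h μ ξ₀ η₀ U V) (H : IsMirror h k μ ξ₀)
    (hm : 0 ≤ m) {v₀ v₀' : ℝ → ℂ} (hv : ∀ x, HasDerivAt v₀ (v₀' x) x)
    (hV0 : ∀ x, 0 ≤ x → x ≤ η₀ → V (x, x) = v₀ x) {Q : ℝ × ℝ → ℂ} (hQ : Continuous Q)
    (hQeq : ∀ x y, (x, y) ∈ past h ξ₀ η₀ →
      Q (x, y) = v₀' y + nullRHS m α β (V (y, y)) (U (y, y))
        + ∫ r in x..y, (slopeFst α β (U (r, y)) (Q (r, y))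
        + slopeSnd m α β (V (r, y)) (U (r, y)) (U (r, y))
          (nullRHS m α β (U (r, y)) (V (r, y)))))
    {x y : ℝ} (hp : (x, y) ∈ past h ξ₀ η₀) :
    HasDerivWithinAt (fun s => V (x, s)) (Q (x, y)) {s | (x, s) ∈ past h ξ₀ η₀} y := by
  have hU := S.continuous_U
  have hV := S.continuous_V
  have hf := (isChargeRHS_nullRHS hm α β).continuous
  set I := {s | (x, s) ∈ past h ξ₀ η₀} with hI
  have hmem : ∀ s ∈ I, ∀ τ ∈ Icc (-s) (-x), (-τ, s) ∈ past h ξ₀ η₀ := fun s hs τ hτ =>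
    H.past_horizontal hs (by linarith [hτ.2]) (by linarith [hτ.1])
  have hs_le : ∀ s ∈ I, -s ≤ -x := fun s hs => neg_le_neg ((H.le_h x).trans hs.2.1)
  have hYeq : ∀ s ∈ I, ∀ τ ∈ Icc (-s) (-x), V (-τ, s) = v₀ s
      + ∫ σ in -s..τ, nullRHS m α β (V (-σ, s)) (U (-σ, s)) := by
    intro s hs τ hτ
    rw [intervalIntegral.integral_comp_neg (fun r => nullRHS m α β (V (r, s)) (U (r, s))),
      neg_neg, ← hV0 s ((H.h_nonneg x).trans hs.2.1) hs.2.2]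
    exact S.eq_V _ _ (hmem s hs τ hτ)
  have hdiag : Q (- -y, y) = v₀' y + nullRHS m α β (V (y, y)) (U (y, y)) := by
    rw [neg_neg, hQeq y y (H.past_horizontal hp ((H.le_h x).trans hp.2.1) le_rfl)]
    simp
  have := hasDerivWithinAt_parameter hm α β (Y := fun q => V (-q.2, q.1))
    (Z := fun q => U (-q.2, q.1)) (Q := fun q => Q (-q.2, q.1))
    (Zs := fun q => nullRHS m α β (U (-q.2, q.1)) (V (-q.2, q.1)))
    (a := fun s => -s) (c := v₀) (I := I) (s₁ := y) (τ₁ := -x)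
    (by fun_prop) (by fun_prop) (by fun_prop)
    (Continuous.nullRHS m α β (by fun_prop) (by fun_prop)) hp hs_le hYeq ?_ ?_
    continuous_neg.continuousWithinAt ?_
  · simpa using this
  · intro τ hτ
    rw [hdiag, hQeq _ _ (hmem y hp τ hτ)]
    have := intervalIntegral.integral_comp_neg (a := -y) (b := τ)
      (fun r => (slopeFst α β (U (r, y)) (Q (r, y))
        + slopeSnd m α β (V (r, y)) (U (r, y)) (U (r, y))
          (nullRHS m α β (U (r, y)) (V (r, y)))))
    rw [neg_neg] at this
    rw [this]
  · intro s hs σ hσ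
    refine S.sub_U_eq hf (hmem y hp σ ⟨(le_max_right _ _).trans hσ.1, hσ.2⟩)
      (hmem s hs σ ⟨(le_max_left _ _).trans hσ.1, hσ.2⟩)
  · have hg : Continuous fun q : ℝ × ℝ => nullRHS m α β (V (-q.2, q.1)) (U (-q.2, q.1)) :=
      Continuous.nullRHS m α β (by fun_prop) (by fun_prop)
    have hmv := isLittleO_moving_start (I := I) (s₁ := y) hg
      ((hasDerivAt_neg y).hasDerivWithinAt) ((hv y).hasDerivWithinAt)
    refine hmv.congr' ?_ EventuallyEq.rfl
    filter_upwards [self_mem_nhdsWithin] with s hs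
    have hle : max (-s) (-y) ≤ -x := max_le (hs_le s hs) (hs_le y hp)
    rw [hYeq s hs _ ⟨le_max_left _ _, hle⟩, hYeq y hp _ ⟨le_max_right _ _, hle⟩, hdiag]
    simp only [neg_neg]
    push_cast
    ring

lemma hasFDerivWithinAt_V (S : IsMild (nullRHS m α β) h μ ξ₀ η₀ U V)
    (hm : 0 ≤ m) {Q : ℝ × ℝ → ℂ} (hQ : Continuous Q)
    (hd : ∀ x y, (x, y) ∈ past h ξ₀ η₀ →
      HasDerivWithinAt (fun s => V (x, s)) (Q (x, y)) {s | (x, s) ∈ past h ξ₀ η₀} y)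
    {p : ℝ × ℝ} (hp : p ∈ past h ξ₀ η₀) :
    HasFDerivWithinAt V ((ContinuousLinearMap.fst ℝ ℝ ℝ).smulRight
      (-nullRHS m α β (V p) (U p)) + (ContinuousLinearMap.snd ℝ ℝ ℝ).smulRight (Q p))
      (past h ξ₀ η₀) p := by
  have hU := S.continuous_U
  have hV := S.continuous_V
  refine IsMirror.hasFDerivWithinAt_past (W₁ := fun p => -nullRHS m α β (V p) (U p))
    (Continuous.nullRHS m α β hV hU).neg hQ (fun x x' y h1 h2 =>
      S.sub_V_eq (isChargeRHS_nullRHS hm α β).continuous h1 h2) (fun x y y' h1 h2 => ?_) hp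
  exact sub_eq_integral_of_hasDerivWithinAt (g := fun s => V (x, s)) (g' := fun s => Q (x, s))
    (s := {s | (x, s) ∈ past h ξ₀ η₀})
    ⟨fun a ha b hb r hr => ⟨ha.1, ha.2.1.trans hr.1, hr.2.trans hb.2.2⟩⟩
    (by fun_prop) (fun r hr => hd x r hr) h1 h2

/-- The behaviour at the base is left as the hypothesis `hinit`, because it is verified differently
on the mirror, at the corner and on the initial line. -/
lemma hasDerivWithinAt_U (S : IsMild (nullRHS m α β) h μ ξ₀ η₀ U V) (H : IsMirror h k μ ξ₀)
    (hm : 0 ≤ m) {P : ℝ × ℝ → ℂ} (hP : Continuous P) {e : ℝ → ℂ}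
    (hPeq : ∀ x y, (x, y) ∈ past h ξ₀ η₀ →
      P (x, y) = e x + ∫ r in h x..y, (slopeFst α β (V (x, r)) (P (x, r))
        + slopeSnd m α β (U (x, r)) (V (x, r)) (V (x, r))
          (-nullRHS m α β (V (x, r)) (U (x, r)))))
    {x y : ℝ} (hp : (x, y) ∈ past h ξ₀ η₀)
    (hinit : (fun s => U (s, max (h s) (h x)) - U (x, max (h s) (h x))
      - ((s - x : ℝ) : ℂ) * e x) =o[𝓝[{s | (s, y) ∈ past h ξ₀ η₀}] x] fun s => s - x) :
    HasDerivWithinAt (fun s => U (s, y)) (P (x, y)) {s | (s, y) ∈ past h ξ₀ η₀} x := by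
  have hU := S.continuous_U
  have hV := S.continuous_V
  have hf := (isChargeRHS_nullRHS hm α β).continuous
  have hmem : ∀ s σ, (s, y) ∈ past h ξ₀ η₀ → σ ∈ Icc (h s) y → (s, σ) ∈ past h ξ₀ η₀ :=
    fun s σ hs hσ => ⟨hs.1, hσ.1, hσ.2.trans hs.2.2⟩
  have hbase : P (x, h x) = e x := by
    rw [hPeq x (h x) (hmem x (h x) hp ⟨le_rfl, hp.2.1⟩)]
    simp
  refine hasDerivWithinAt_parameter hm α β (Y := U) (Z := V) (Q := P)
    (Zs := fun q => -nullRHS m α β (V q) (U q)) (a := h) (c := fun s => U (s, h s)) hU hV hP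
    (Continuous.nullRHS m α β hV hU).neg hp (fun s hs => hs.2.1)
    (fun s hs τ hτ => S.eq_U s τ (hmem s τ hs hτ)) (fun τ hτ => ?_) (fun s hs σ hσ => ?_)
    H.continuous_h.continuousWithinAt ?_
  · rw [hbase, hPeq x τ (hmem x τ hp hτ)]
  · exact S.sub_V_eq hf (hmem x σ hp ⟨(le_max_right _ _).trans hσ.1, hσ.2⟩)
      (hmem s σ hs ⟨(le_max_left _ _).trans hσ.1, hσ.2⟩)
  · rw [hbase]
    exact hinit

/-- The increment of `U` along the base of the past, where the base is differentiable. -/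
lemma isLittleO_base_U (S : IsMild (nullRHS m α β) h μ ξ₀ η₀ U V)
    {c : ℝ → ℂ} {c' : ℂ} {x y h' : ℝ} (hp : (x, y) ∈ past h ξ₀ η₀)
    (hh : HasDerivAt h h' x)
    (hc : HasDerivWithinAt c c' {s | (s, y) ∈ past h ξ₀ η₀} x)
    (hcU : ∀ᶠ s in 𝓝[{s | (s, y) ∈ past h ξ₀ η₀}] x, U (s, h s) = c s)
    (hcx : U (x, h x) = c x) :
    (fun s => U (s, max (h s) (h x)) - U (x, max (h s) (h x))
      - ((s - x : ℝ) : ℂ) * (c' - h' * nullRHS m α β (U (x, h x)) (V (x, h x))))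
      =o[𝓝[{s | (s, y) ∈ past h ξ₀ η₀}] x] fun s => s - x := by
  have hg : Continuous fun q : ℝ × ℝ => nullRHS m α β (U q) (V q) :=
    Continuous.nullRHS m α β S.continuous_U S.continuous_V
  refine (isLittleO_moving_start hg hh.hasDerivWithinAt hc).congr' ?_ EventuallyEq.rfl
  filter_upwards [self_mem_nhdsWithin, hcU] with s hs hcs
  have hle : max (h s) (h x) ≤ y := max_le hs.2.1 hp.2.1
  have e1 := S.eq_U s (max (h s) (h x)) ⟨hs.1, le_max_left _ _, hle.trans hs.2.2⟩
  have e2 := S.eq_U x (max (h s) (h x)) ⟨hp.1, le_max_right _ _, hle.trans hs.2.2⟩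
  rw [e1, e2, hcs, hcx]

/-- Solutions with `C¹` data supported away from the corner are `C¹`. -/
theorem exists_hasFDerivWithinAt (S : IsMild (nullRHS m α β) h μ ξ₀ η₀ U V)
    (H : IsMirror h k μ ξ₀) (hm : 0 ≤ m) (hξ : ξ₀ ≤ 0) (h0 : h ξ₀ ≤ η₀)
    {h' : ℝ → ℝ} (hh' : Continuous h') (hh : ∀ x, ξ₀ ≤ x → x < 0 → HasDerivAt h (h' x) x)
    {μ' : ℝ → ℂ} (hμ' : Continuous μ') (hμ : ∀ x, ξ₀ ≤ x → x < 0 → HasDerivAt μ (μ' x) x)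
    {u₀ u₀' v₀ v₀' : ℝ → ℂ} (hu : ∀ x, HasDerivAt u₀ (u₀' x) x) (hu' : Continuous u₀')
    (hv : ∀ x, HasDerivAt v₀ (v₀' x) x) (hv' : Continuous v₀')
    {ε : ℝ} (hε : 0 < ε) (hu0 : ∀ x ≤ ε, u₀ x = 0) (hv0 : ∀ x ≤ ε, v₀ x = 0)
    (hUV : ∀ x, 0 ≤ x → x ≤ η₀ → U (x, x) = u₀ x ∧ V (x, x) = v₀ x) :
    ∃ P Q : ℝ × ℝ → ℂ, Continuous P ∧ Continuous Q ∧ ∀ p ∈ past h ξ₀ η₀,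
      HasFDerivWithinAt U ((ContinuousLinearMap.fst ℝ ℝ ℝ).smulRight (P p)
        + (ContinuousLinearMap.snd ℝ ℝ ℝ).smulRight (nullRHS m α β (U p) (V p)))
        (past h ξ₀ η₀) p ∧
      HasFDerivWithinAt V ((ContinuousLinearMap.fst ℝ ℝ ℝ).smulRight
        (-nullRHS m α β (V p) (U p)) + (ContinuousLinearMap.snd ℝ ℝ ℝ).smulRight (Q p))
        (past h ξ₀ η₀) p := by
  have hU := S.continuous_U
  have hV := S.continuous_V
  have hhc := H.continuous_h
  have hμc := H.continuous_μ
  have hη : 0 ≤ η₀ := (H.h_nonneg _).trans h0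
  -- Both fields vanish near the corner, so the compatibility conditions between data and boundary
  -- condition hold trivially.
  have hzero : ∀ x y, (x, y) ∈ past h ξ₀ η₀ → y ≤ ε → U (x, y) = 0 ∧ V (x, y) = 0 :=
    fun x y hp hy => S.eq_zero_of_le H hm (fun r hr hrε hrη => by
      rw [(hUV r hr hrη).1, (hUV r hr hrη).2]; exact ⟨hu0 r hrε, hv0 r hrε⟩) hp hy
  have h00 : ((0 : ℝ), (0 : ℝ)) ∈ past h ξ₀ η₀ := H.diag_mem le_rfl hξ hη
  have hderiv0 : ∀ {w w' : ℝ → ℂ}, (∀ x, HasDerivAt w (w' x) x) → (∀ x ≤ ε, w x = 0) →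
      w' 0 = 0 := by
    intro w w' hw hw0
    refine (hw 0).unique ((hasDerivAt_const (0 : ℝ) (0 : ℂ)).congr_of_eventuallyEq ?_)
    filter_upwards [Iio_mem_nhds hε] with x hx using hw0 x (le_of_lt hx)
  obtain ⟨Q, hQ, hQeq⟩ := S.exists_transversal_V H hξ h0
    (e := fun y => v₀' y + nullRHS m α β (V (y, y)) (U (y, y)))
    (hv'.add (Continuous.nullRHS m α β (by fun_prop) (by fun_prop)))
  have hdV := fun x y (hp : (x, y) ∈ past h ξ₀ η₀) =>
    S.hasDerivWithinAt_V H hm hv (fun x hx hx' => (hUV x hx hx').2) hQ hQeq hp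
  have hfV := fun p (hp : p ∈ past h ξ₀ η₀) => S.hasFDerivWithinAt_V hm hQ hdV hp
  have hQ0 : Q (0, 0) = 0 := by
    rw [hQeq 0 0 h00, (hzero 0 0 h00 hε.le).1, (hzero 0 0 h00 hε.le).2, hderiv0 hv hv0]
    simp
  -- The values of ∂_ξ U on the base: differentiate U along the base, as u₀ on the initial line or
  -- as μ V on the mirror, and subtract the slope of the base times ∂_η U.
  set e₁ : ℝ → ℂ := fun s => u₀' s - nullRHS m α β (U (s, s)) (V (s, s)) with he₁
  set e₂ : ℝ → ℂ := fun s => μ' s * V (s, h s)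
    + μ s * (-nullRHS m α β (V (s, h s)) (U (s, h s)) + Q (s, h s) * h' s)
    - h' s * nullRHS m α β (U (s, h s)) (V (s, h s)) with he₂
  have he₁c : Continuous e₁ := hu'.sub (Continuous.nullRHS m α β (by fun_prop) (by fun_prop))
  have he₂c : Continuous e₂ := by
    have n1 : Continuous fun s => nullRHS m α β (V (s, h s)) (U (s, h s)) :=
      Continuous.nullRHS m α β (by fun_prop) (by fun_prop)
    have n2 : Continuous fun s => nullRHS m α β (U (s, h s)) (V (s, h s)) :=
      Continuous.nullRHS m α β (by fun_prop) (by fun_prop)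
    fun_prop
  have e₁0 : e₁ 0 = 0 := by
    simp only [he₁]
    rw [(hzero 0 0 h00 hε.le).1, (hzero 0 0 h00 hε.le).2, hderiv0 hu hu0]
    simp
  have e₂0 : e₂ 0 = 0 := by
    simp only [he₂, H.h_zero]
    rw [(hzero 0 0 h00 hε.le).1, (hzero 0 0 h00 hε.le).2, hQ0]
    simp
  -- The two prescriptions match at the corner since both vanish there.
  have hec : Continuous fun s : ℝ => if 0 ≤ s then e₁ s else e₂ s :=
    Continuous.if_le he₁c he₂c continuous_const continuous_id (fun s hs => by
      rw [← hs, e₁0, e₂0])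
  obtain ⟨P, hP, hPeq⟩ := S.exists_transversal_U H hξ h0 hec
  have hdU : ∀ x y, (x, y) ∈ past h ξ₀ η₀ →
      HasDerivWithinAt (fun s => U (s, y)) (P (x, y)) {s | (s, y) ∈ past h ξ₀ η₀} x := by
    intro x y hp
    refine S.hasDerivWithinAt_U H hm hP hPeq hp ?_
    rcases lt_trichotomy x 0 with hx | rfl | hx
    · rw [if_neg hx.not_ge]
      have hcurve : HasDerivWithinAt (fun s => V (s, h s))
          (-nullRHS m α β (V (x, h x)) (U (x, h x)) + Q (x, h x) * h' x)
          {s | (s, y) ∈ past h ξ₀ η₀} x := by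
        have := (hfV (x, h x) ⟨hp.1, le_rfl, hp.2.1.trans hp.2.2⟩).comp_hasDerivWithinAt
          (t := past h ξ₀ η₀) (f := fun s => (s, h s)) x
          ((hasDerivAt_id x).prodMk (hh x hp.1 hx)).hasDerivWithinAt
          (s := {s | (s, y) ∈ past h ξ₀ η₀})
          (fun s hs => ⟨hs.1, le_rfl, hs.2.1.trans hs.2.2⟩)
        refine this.congr_deriv ?_
        simp [mul_comm]
      have hcd := ((hμ x hp.1 hx).hasDerivWithinAt
        (s := {s | (s, y) ∈ past h ξ₀ η₀})).mul hcurve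
      refine S.isLittleO_base_U hp (hh x hp.1 hx) hcd ?_
        (S.boundary x hp.1 hx.le (hp.2.1.trans hp.2.2))
      filter_upwards [self_mem_nhdsWithin, nhdsWithin_le_nhds (Iio_mem_nhds hx)] with s hs hs0
      exact S.boundary s hs.1 (le_of_lt hs0) (hs.2.1.trans hs.2.2)
    -- At the corner `h` may have a kink, so no chain rule is used: the values of U being compared
    -- are zero for all s close to 0.
    · rw [if_pos le_rfl, e₁0]
      refine (Asymptotics.isLittleO_zero _ _).congr' ?_ EventuallyEq.rfl
      have hcont : Tendsto h (𝓝[{s | (s, y) ∈ past h ξ₀ η₀}] 0) (𝓝 0) := by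
        have := H.continuous_h.tendsto 0
        rw [H.h_zero] at this
        exact this.mono_left nhdsWithin_le_nhds
      filter_upwards [self_mem_nhdsWithin, hcont (Iio_mem_nhds hε)] with s hs hsε
      have hsε' : h s ≤ ε := le_of_lt hsε
      rw [H.h_zero, max_eq_left (H.h_nonneg s),
        (hzero s (h s) ⟨hs.1, le_rfl, hs.2.1.trans hs.2.2⟩ hsε').1,
        (hzero 0 (h s) ⟨hξ, by simpa [H.h_zero] using H.h_nonneg s, hs.2.1.trans hs.2.2⟩ hsε').1]
      simp
    · rw [if_pos hx.le]
      have hxx := H.h_of_nonneg x hx.le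
      have hloc : h =ᶠ[𝓝 x] fun s => s := by
        filter_upwards [Ioi_mem_nhds hx] with s hs using H.h_of_nonneg s (le_of_lt hs)
      have hd1 : HasDerivAt h 1 x := (hasDerivAt_id x).congr_of_eventuallyEq hloc
      have hxy : x ≤ η₀ := by have := hp.2.1.trans hp.2.2; simp only at this; linarith
      have := S.isLittleO_base_U hp hd1 (hu x).hasDerivWithinAt ?_
        (by rw [hxx]; exact (hUV x hx.le hxy).1)
      · simpa [he₁, hxx] using this
      · filter_upwards [self_mem_nhdsWithin, nhdsWithin_le_nhds (Ioi_mem_nhds hx)] with s hs hs0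
        have hss := H.h_of_nonneg s (le_of_lt hs0)
        have : h s ≤ η₀ := hs.2.1.trans hs.2.2
        rw [hss] at this ⊢
        exact (hUV s (le_of_lt hs0) this).1
  refine ⟨P, Q, hP, hQ, fun p hp => ⟨?_, hfV p hp⟩⟩
  refine IsMirror.hasFDerivWithinAt_past (W₂ := fun p => nullRHS m α β (U p) (V p))
    hP (Continuous.nullRHS m α β hU hV) (fun x x' y h1 h2 => ?_)
    (fun x y y' h1 h2 => S.sub_U_eq (isChargeRHS_nullRHS hm α β).continuous h1 h2) hp
  exact sub_eq_integral_of_hasDerivWithinAt (g := fun s => U (s, y)) (g' := fun s => P (s, y))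
    (s := {s | (s, y) ∈ past h ξ₀ η₀})
    ⟨fun a ha b hb r hr => H.past_horizontal ha hr.1 (hr.2.trans ((H.le_h b).trans hb.2.1))⟩
    (by fun_prop) (fun r hr => hdU r y hr) h1 h2

end IsMild

end DiracIBVP

/-! ### The moving boundary in null coordinates. -/

namespace DiracIBVP

/-- Continuous inverse of a continuously differentiable function whose derivative is bounded
below by a positive constant. -/
lemma exists_inverse_of_deriv_ge {a a' : ℝ → ℝ} (ha : ∀ t, HasDerivAt a (a' t) t) {δ : ℝ}
    (hδ : 0 < δ) (h' : ∀ t, δ ≤ a' t) :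
    ∃ A : ℝ → ℝ, Continuous A ∧ StrictMono A ∧ (∀ x, a (A x) = x) ∧ (∀ t, A (a t) = t) ∧
      ∀ x, HasDerivAt A (a' (A x))⁻¹ x := by
  have hcont : Continuous a := continuous_iff_continuousAt.2 fun t => (ha t).continuousAt
  have hmono : StrictMono a := strictMono_of_deriv_pos fun t => by
    rw [(ha t).deriv]; exact hδ.trans_le (h' t)
  have hge : ∀ s t, s ≤ t → δ * (t - s) ≤ a t - a s := fun s t hst =>
    Convex.mul_sub_le_image_sub_of_le_deriv (convex_univ) hcont.continuousOn
      (fun t _ => (ha t).differentiableAt.differentiableWithinAt)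
      (fun t _ => by rw [(ha t).deriv]; exact h' t) s (mem_univ _) t (mem_univ _) hst
  have hsurj : Function.Surjective a := by
    refine hcont.surjective ?_ ?_
    · refine tendsto_atTop_mono' _ (f₁ := fun t => a 0 + δ * t) ?_
        (tendsto_atTop_add_const_left _ _ (tendsto_id.const_mul_atTop hδ))
      filter_upwards [eventually_ge_atTop 0] with t ht
      have := hge 0 t ht
      linarith
    · refine tendsto_atBot_mono' (f₂ := a) (f₁ := fun t => a 0 + δ * t) _ ?_
        (tendsto_atBot_add_const_left _ _ (tendsto_id.const_mul_atBot hδ))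
      filter_upwards [eventually_le_atBot 0] with t ht
      have := hge t 0 ht
      linarith
  set E := hmono.orderIsoOfSurjective a hsurj with hE
  have hl : ∀ t, E.symm (a t) = t := fun t => E.symm_apply_apply t
  have hr : ∀ x, a (E.symm x) = x := fun x => E.apply_symm_apply x
  refine ⟨E.symm, E.symm.continuous, E.symm.strictMono, hr, hl, fun x => ?_⟩
  exact HasDerivAt.of_local_left_inverse E.symm.continuous.continuousAt (ha _)
    (hδ.trans_le (h' _)).ne' (Eventually.of_forall hr)

/-- Local part of the region: the points of the closed region in the causal past of the
point with null coordinates `(z R - R, 2 R)`. -/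
def region (z : ℝ → ℝ) (R : ℝ) : Set (ℝ × ℝ) :=
  {p | p ∈ Omega z ∧ z R - R ≤ p.1 - p.2 ∧ p.1 + p.2 ≤ 2 * R}

/-- A description of the region `region z R`, its boundary curve and its boundary coefficient in
null coordinates. -/
structure IsNullFrame (z : ℝ → ℝ) (lam : ℝ → ℂ) (R : ℝ) (h k : ℝ → ℝ) (μ : ℝ → ℂ) : Prop where
  mirror : IsMirror h k μ (z R - R)
  left_nonpos : z R - R ≤ 0
  apex_le : h (z R - R) ≤ 2 * R
  mem_past_iff : ∀ x t, (x - t, x + t) ∈ past h (z R - R) (2 * R) ↔ (x, t) ∈ region z R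
  h_boundary : ∀ t ∈ Icc 0 R, h (z t - t) = z t + t
  μ_boundary : ∀ t ∈ Icc 0 R, μ (z t - t) = lam t
  exists_time : ∀ x, z R - R ≤ x → x ≤ 0 → ∃ t ∈ Icc 0 R, z t - t = x
  exists_deriv_h : ∃ h' : ℝ → ℝ, Continuous h' ∧
    ∀ x, z R - R ≤ x → x < 0 → HasDerivAt h (h' x) x
  exists_deriv_μ : ∃ μ' : ℝ → ℂ, Continuous μ' ∧
    ∀ x, z R - R ≤ x → x < 0 → HasDerivAt μ (μ' x) x

theorem exists_isNullFrame {z : ℝ → ℝ} {lam : ℝ → ℂ} (hz : ContDiffOn ℝ 1 z (Ici 0))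
    (hlam : ContDiffOn ℝ 1 lam (Ici 0)) (hz0 : z 0 = 0)
    (H1 : ∀ t : ℝ, 0 ≤ t → -1 < timeDeriv z t ∧ timeDeriv z t < 1)
    (H2 : ∀ t : ℝ, 0 ≤ t → ‖lam t‖ ^ 2 * (1 - timeDeriv z t) ≤ 1 + timeDeriv z t)
    {R : ℝ} (hR : 0 < R) : ∃ h k μ, IsNullFrame z lam R h k μ := by
  -- No point of the region has time larger than 2R. The derivative of z is frozen outside this time
  -- interval, which extends the boundary curve to all of ℝ without changing it where it matters.
  set T := 2 * R with hT
  have hT0 : 0 < T := by positivity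
  set cl : ℝ → ℝ := fun t => max 0 (min t T) with hcl
  have hclc : Continuous cl := by fun_prop
  have hcl0 : ∀ t, cl t ∈ Ici (0 : ℝ) := fun t => mem_Ici.2 (le_max_left 0 (min t T))
  have hcl_of : ∀ t ∈ Icc 0 T, cl t = t := fun t ht => by
    simp only [hcl]; rw [min_eq_left ht.2, max_eq_right ht.1]
  have hclT : ∀ t, cl t ∈ Icc 0 T := fun t => ⟨hcl0 t, max_le hT0.le (min_le_right _ _)⟩
  set ρ : ℝ → ℝ := fun t => timeDeriv z (cl t) with hρ
  have hzd : ContinuousOn (timeDeriv z) (Ici 0) :=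
    hz.continuousOn_derivWithin (uniqueDiffOn_Ici 0) le_rfl
  have hρc : Continuous ρ := hzd.comp_continuous hclc hcl0
  -- Compactness of the time interval makes the strict speed bounds (H1) uniform, as needed to
  -- invert t - ζ(t) and t + ζ(t) globally.
  obtain ⟨δ, hδ, hρδ⟩ : ∃ δ > 0, ∀ t, δ ≤ 1 - ρ t ∧ δ ≤ 1 + ρ t := by
    obtain ⟨t₁, ht₁, h1⟩ := (isCompact_Icc (a := (0 : ℝ)) (b := T)).exists_isMinOn
      ⟨0, left_mem_Icc.2 hT0.le⟩ (f := fun t => min (1 - timeDeriv z t) (1 + timeDeriv z t))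
      (by have := hzd.mono (fun t (ht : t ∈ Icc 0 T) => ht.1); fun_prop)
    refine ⟨min (1 - timeDeriv z t₁) (1 + timeDeriv z t₁), ?_, fun t => ?_⟩
    · have := H1 t₁ ht₁.1
      exact lt_min (by linarith) (by linarith)
    · have := h1 (hclT t)
      exact le_min_iff.1 this
  set ζ : ℝ → ℝ := fun t => 0 + ∫ s in 0..t, ρ s with hζ
  have hζd : ∀ t, HasDerivAt ζ (ρ t) t := fun t => hasDerivAt_primitive hρc 0 0 t
  have hζ0 : ζ 0 = 0 := by simp [hζ]
  have hζz : ∀ t ∈ Icc 0 T, ζ t = z t := by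
    intro t ht
    have h1 : ∫ s in 0..t, ρ s = z t - z 0 := by
      refine intervalIntegral.integral_eq_sub_of_hasDerivAt_of_le ht.1
        (hz.continuousOn.mono Icc_subset_Ici_self) (fun s hs => ?_)
        (hρc.intervalIntegrable _ _)
      have hs' : s ∈ Icc 0 T := ⟨hs.1.le, hs.2.le.trans ht.2⟩
      simp only [hρ, hcl_of s hs']
      exact ((hz.differentiableOn one_ne_zero s hs.1.le).hasDerivWithinAt).hasDerivAt
        (Ici_mem_nhds hs.1)
    simp only [hζ, h1, hz0]
    ring
  have had : ∀ t, HasDerivAt (fun t => t - ζ t) (1 - ρ t) t := fun t =>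
    (hasDerivAt_id t).sub (hζd t)
  have hbd : ∀ t, HasDerivAt (fun t => t + ζ t) (1 + ρ t) t := fun t =>
    (hasDerivAt_id t).add (hζd t)
  obtain ⟨A, hA, hAm, haA, hAa, hAd⟩ := exists_inverse_of_deriv_ge had hδ fun t => (hρδ t).1
  obtain ⟨B, hB, hBm, hbB, hBb, -⟩ := exists_inverse_of_deriv_ge hbd hδ fun t => (hρδ t).2
  have hζc : Continuous ζ := continuous_iff_continuousAt.2 fun t => (hζd t).continuousAt
  have hA0 : A 0 = 0 := by have := hAa 0; simpa [hζ0] using this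
  have hB0 : B 0 = 0 := by have := hBb 0; simpa [hζ0] using this
  have hbm : StrictMono fun t => t + ζ t := fun s t hst => by
    by_contra hle
    have := hBm.monotone (not_lt.1 hle)
    rw [hBb, hBb] at this
    exact absurd hst this.not_gt
  have ham : StrictMono fun t => t - ζ t := fun s t hst => by
    by_contra hle
    have := hAm.monotone (not_lt.1 hle)
    rw [hAa, hAa] at this
    exact absurd hst this.not_gt
  -- A and B invert t - ζ(t) and t + ζ(t). For x ≤ 0 the vertical line ξ = x meets the mirror at
  -- time A(-x), and η there equals t + ζ(t).
  set h : ℝ → ℝ := fun x => max x 0 + (A (max (-x) 0) + ζ (A (max (-x) 0))) with hh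
  have h_nonneg : ∀ x, 0 ≤ x → h x = x := fun x hx => by
    simp only [hh]
    rw [max_eq_left hx, max_eq_right (by linarith : -x ≤ 0), hA0, hζ0]
    ring
  have h_nonpos : ∀ x, x ≤ 0 → h x = A (-x) + ζ (A (-x)) := fun x hx => by
    simp only [hh]
    rw [max_eq_right hx, max_eq_left (by linarith : 0 ≤ -x), zero_add]
  set μ : ℝ → ℂ := fun x => lam (cl (A (-x))) with hμ
  have hlamc : Continuous fun t => lam (cl t) := hlam.continuousOn.comp_continuous hclc hcl0
  set k : ℝ → ℝ := fun y => -(B y - ζ (B y)) with hk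
  have hBpos : ∀ y, 0 ≤ y → 0 ≤ B y := fun y hy => by rw [← hB0]; exact hBm.monotone hy
  have hk0 : ∀ y, 0 ≤ y → k y ≤ 0 := fun y hy => by
    have := ham.monotone (hBpos y hy)
    simp only [hζ0] at this
    simp only [hk]; linarith
  have hmir : ∀ ξ₀, IsMirror h k μ ξ₀ := fun ξ₀ =>
    { continuous_h := by fun_prop
      continuous_k := by fun_prop
      continuous_μ := by exact hlamc.comp (by fun_prop : Continuous fun x => A (-x))
      h_of_nonneg := h_nonneg
      h_antitone := fun x hx y hy hxy => by
        rw [h_nonpos x hx, h_nonpos y hy]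
        exact hbm.monotone (hAm.monotone (neg_le_neg hxy))
      h_k := fun y hy => by
        rw [h_nonpos _ (hk0 y hy)]
        simp only [hk, neg_neg]
        rw [hAa, hbB]
      k_h := fun x hx => by
        simp only [hk]
        rw [h_nonpos x hx, hBb, haA, neg_neg]
      k_nonpos := hk0
      reflect := fun w hw hw0 ξ _ hξ => by
        set t₁ := A (-ξ) with ht₁
        have ht₁0 : 0 ≤ t₁ := by rw [← hA0]; exact hAm.monotone (by linarith)
        -- Both sides of the reflection inequality are rewritten as integrals over time on the
        -- mirror. The Jacobians are 1 - z' and 1 + z', so the comparison of integrands is exactly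
        -- (H2).
        have e1 := intervalIntegral.integral_comp_mul_deriv (a := 0) (b := t₁)
          (f := fun t => -(t - ζ t)) (f' := fun t => -(1 - ρ t))
          (g := fun x => ‖μ x‖ ^ 2 * w (A (-x) + ζ (A (-x)))) (fun t _ => (had t).neg)
          (by fun_prop) (by
            have : Continuous μ := hlamc.comp (by fun_prop : Continuous fun x => A (-x))
            fun_prop)
        have e2 := intervalIntegral.integral_comp_mul_deriv (a := 0) (b := t₁)
          (f := fun t => t + ζ t) (f' := fun t => 1 + ρ t) (g := w)
          (fun t _ => hbd t) (by fun_prop) hw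
        have e3 : ∫ x in ξ..0, ‖μ x‖ ^ 2 * w (h x)
            = ∫ x in ξ..0, ‖μ x‖ ^ 2 * w (A (-x) + ζ (A (-x))) := by
          refine intervalIntegral.integral_congr fun x hx => ?_
          rw [uIcc_of_le hξ] at hx
          simp only [h_nonpos x hx.2]
        simp only [Function.comp_def, hμ, neg_neg, hAa, hζ0, haA, ht₁, sub_zero, neg_zero,
          add_zero] at e1 e2
        rw [e3, h_nonpos ξ hξ, ← e2, intervalIntegral.integral_symm]
        simp only [hμ]
        rw [← e1, ← intervalIntegral.integral_neg]
        simp only [mul_neg, neg_neg]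
        have hwc : Continuous fun t => w (t + ζ t) := by fun_prop
        refine intervalIntegral.integral_mono_on ht₁0
          (Continuous.intervalIntegrable (((hlamc.norm.pow 2).mul hwc).mul
            (continuous_const.sub hρc)) _ _)
          (Continuous.intervalIntegrable (by fun_prop) _ _) fun t _ => ?_
        have := mul_le_mul_of_nonneg_right (H2 (cl t) (hcl0 t)) (hw0 (t + ζ t))
        simp only [hρ]
        linarith }
  have hRT : R ∈ Icc 0 T := ⟨hR.le, by linarith⟩
  have hlt : ∀ t, 0 ≤ t → -t ≤ ζ t ∧ ζ t ≤ t := fun t ht => by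
    have h1 := ham.monotone ht
    have h2 := hbm.monotone ht
    simp only [hζ0] at h1 h2
    constructor <;> linarith
  have hzR := hlt R hR.le
  have hAneg : ∀ t ∈ Icc 0 T, A (-(z t - t)) = t := fun t ht => by
    rw [neg_sub, ← hζz t ht, hAa]
  have hneg : ∀ t ∈ Icc 0 T, z t - t ≤ 0 := fun t ht => by
    have := hlt t ht.1
    rw [hζz t ht] at this
    linarith
  have hb : ∀ t ∈ Icc 0 T, h (z t - t) = z t + t := fun t ht => by
    rw [h_nonpos _ (hneg t ht), hAneg t ht, hζz t ht, add_comm]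
  rw [hζz R hRT] at hzR
  have hmem : ∀ x t, 0 ≤ t → (h (x - t) ≤ x + t ↔ ζ t ≤ x) := by
    intro x t ht
    rcases le_total 0 (x - t) with hx | hx
    · rw [h_nonneg _ hx]
      have := hlt t ht
      constructor <;> intro <;> linarith
    · rw [h_nonpos _ hx]
      have h1 := haA (-(x - t))
      set s := A (-(x - t)) with hs
      constructor
      · intro h2
        have h3 : s ≤ t := by linarith
        have h4 := ham.monotone h3
        linarith
      · intro h2
        have h3 : s ≤ t := by
          refine ham.le_iff_le.1 ?_
          linarith
        linarith
  refine ⟨h, k, μ, hmir _, by linarith, by rw [hb R hRT]; linarith, fun x t => ?_,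
    fun t ht => hb t ⟨ht.1, by linarith [ht.2]⟩, fun t ht => ?_, fun x hx hx0 => ?_, ?_, ?_⟩
  · simp only [past, region, Omega, mem_ofPred_eq]
    constructor
    · rintro ⟨h1, h2, h3⟩
      have h4 := (hmir 0).le_h (x - t)
      have ht : 0 ≤ t := by linarith
      have htT : t ≤ T := by linarith
      exact ⟨⟨ht, by rw [← hζz t ⟨ht, htT⟩]; exact (hmem x t ht).1 h2⟩, h1, h3⟩
    · rintro ⟨⟨ht, h2⟩, h1, h3⟩
      have htT : t ≤ T := by linarith
      exact ⟨h1, (hmem x t ht).2 (by rwa [hζz t ⟨ht, htT⟩]), h3⟩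
  · have ht' : t ∈ Icc 0 T := ⟨ht.1, by linarith [ht.2]⟩
    simp only [hμ, hAneg t ht', hcl_of t ht']
  · have ht0 : 0 ≤ A (-x) := by rw [← hA0]; exact hAm.monotone (by linarith)
    have htR : A (-x) ≤ R := by
      rw [← hAneg R hRT]; exact hAm.monotone (by linarith)
    refine ⟨A (-x), ⟨ht0, htR⟩, ?_⟩
    have := haA (-x)
    rw [hζz _ ⟨ht0, htR.trans hRT.2⟩] at this
    linarith
  · have hpos : ∀ x, 1 - ρ (A (-x)) ≠ 0 := fun x => (hδ.trans_le (hρδ _).1).ne'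
    refine ⟨fun x => (1 + ρ (A (-x))) * ((1 - ρ (A (-x)))⁻¹ * -1), by fun_prop (disch := assumption), fun x _ hx => ?_⟩
    have h1 : HasDerivAt (fun x => A (-x)) ((1 - ρ (A (-x)))⁻¹ * -1) x :=
      (hAd (-x)).comp x (hasDerivAt_neg x)
    refine ((hbd (A (-x))).comp x h1).congr_of_eventuallyEq ?_
    filter_upwards [Iio_mem_nhds hx] with y hy using h_nonpos y (le_of_lt hy)
  · have hpos : ∀ x, 1 - ρ (A (-x)) ≠ 0 := fun x => (hδ.trans_le (hρδ _).1).ne'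
    have hld : ContinuousOn (derivWithin lam (Ici 0)) (Ici 0) :=
      hlam.continuousOn_derivWithin (uniqueDiffOn_Ici 0) le_rfl
    have hldc : Continuous fun x => derivWithin lam (Ici 0) (cl (A (-x))) :=
      hld.comp_continuous (by fun_prop) fun x => hcl0 _
    have hic : Continuous fun x => (1 - ρ (A (-x)))⁻¹ * -1 := by
      fun_prop (disch := assumption)
    refine ⟨fun x => ((1 - ρ (A (-x)))⁻¹ * -1) • derivWithin lam (Ici 0) (cl (A (-x))),
      hic.smul hldc, fun x hx hx0 => ?_⟩
    have h1 : HasDerivAt (fun x => A (-x)) ((1 - ρ (A (-x)))⁻¹ * -1) x :=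
      (hAd (-x)).comp x (hasDerivAt_neg x)
    have ht0 : 0 < A (-x) := by rw [← hA0]; exact hAm (by linarith)
    have htT : A (-x) < T := by
      refine lt_of_le_of_lt ?_ (by linarith : R < T)
      rw [← hAneg R hRT]; exact hAm.monotone (by linarith)
    have h2 : HasDerivAt lam (derivWithin lam (Ici 0) (cl (A (-x)))) (A (-x)) := by
      rw [hcl_of _ ⟨ht0.le, htT.le⟩]
      exact ((hlam.differentiableOn one_ne_zero _ ht0.le).hasDerivWithinAt).hasDerivAt
        (Ici_mem_nhds ht0)
    refine (h2.scomp x h1).congr_of_eventuallyEq ?_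
    filter_upwards [h1.continuousAt (Ioo_mem_nhds ht0 htT)] with y hy
    simp only [hμ, Function.comp_apply]
    rw [hcl_of _ ⟨le_of_lt hy.1, le_of_lt hy.2⟩]

end DiracIBVP

/-! ### Transfer between the space-time region and null coordinates. -/

namespace DiracIBVP

/-- The point of the plane with given null coordinates `(x - t, x + t)`. -/
noncomputable def toPlane (q : ℝ × ℝ) : ℝ × ℝ := ((q.1 + q.2) / 2, (q.2 - q.1) / 2)

/-- The null coordinates `(x - t, x + t)` of a point of the plane. -/
def toNull (p : ℝ × ℝ) : ℝ × ℝ := (p.1 - p.2, p.1 + p.2)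

@[simp] lemma toPlane_toNull (p : ℝ × ℝ) : toPlane (toNull p) = p := by
  ext <;> simp only [toPlane, toNull] <;> ring

@[simp] lemma toNull_toPlane (q : ℝ × ℝ) : toNull (toPlane q) = q := by
  ext <;> simp only [toPlane, toNull] <;> ring

lemma continuous_toPlane : Continuous toPlane := by unfold toPlane; fun_prop

lemma continuous_toNull : Continuous toNull := by unfold toNull; fun_prop

/-- A function on the region, in null coordinates, extended from the past to the plane. -/
noncomputable def nullField (h : ℝ → ℝ) (ξ₀ η₀ : ℝ) (w : ℝ × ℝ → ℂ) (q : ℝ × ℝ) : ℂ :=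
  w (toPlane (pastRetract h ξ₀ η₀ q))

/-- A boundary curve with speed less than one. -/
structure IsSubluminal (z : ℝ → ℝ) : Prop where
  contDiffOn : ContDiffOn ℝ 1 z (Ici 0)
  zero : z 0 = 0
  deriv_mem : ∀ t : ℝ, 0 ≤ t → -1 < timeDeriv z t ∧ timeDeriv z t < 1

section region

variable {z : ℝ → ℝ} {lam : ℝ → ℂ} {R : ℝ} {h k : ℝ → ℝ} {μ : ℝ → ℂ}

lemma IsSubluminal.sub_le_sub (hz : IsSubluminal z) {s t : ℝ} (hs : 0 ≤ s) (hst : s ≤ t) :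
    z t - z s ≤ t - s ∧ z s - z t ≤ t - s := by
  have hd : ∀ r ∈ interior (Ici (0 : ℝ)), HasDerivAt z (timeDeriv z r) r := by
    intro r hr
    rw [interior_Ici] at hr
    exact ((hz.contDiffOn.differentiableOn one_ne_zero r
      (mem_Ici.2 (le_of_lt hr))).hasDerivWithinAt).hasDerivAt (Ici_mem_nhds hr)
  have h1 := monotoneOn_of_hasDerivWithinAt_nonneg (convex_Ici (0 : ℝ))
    (f := fun t => t - z t) (f' := fun t => 1 - timeDeriv z t)
    (continuousOn_id.sub hz.contDiffOn.continuousOn)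
    (fun r hr => ((hasDerivAt_id r).sub (hd r hr)).hasDerivWithinAt)
    (fun r hr => by have := (hz.deriv_mem r (interior_subset hr)).2; linarith)
    (mem_Ici.2 hs) (mem_Ici.2 (hs.trans hst)) hst
  have h2 := monotoneOn_of_hasDerivWithinAt_nonneg (convex_Ici (0 : ℝ))
    (f := fun t => t + z t) (f' := fun t => 1 + timeDeriv z t)
    (continuousOn_id.add hz.contDiffOn.continuousOn)
    (fun r hr => ((hasDerivAt_id r).add (hd r hr)).hasDerivWithinAt)
    (fun r hr => by have := (hz.deriv_mem r (interior_subset hr)).1; linarith)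
    (mem_Ici.2 hs) (mem_Ici.2 (hs.trans hst)) hst
  simp only at h1 h2
  constructor <;> linarith

/-- For times up to R the constraint by the line x - t = z(R) - R is automatic, since z(t) - t does
not increase. -/
lemma IsSubluminal.mem_region (hz : IsSubluminal z) {p : ℝ × ℝ} (hp : p ∈ Omega z)
    (h1 : p.2 ≤ R) (h2 : p.1 + p.2 ≤ 2 * R) : p ∈ region z R := by
  have := (hz.sub_le_sub hp.1 h1).1
  have := hp.2
  exact ⟨hp, by linarith, h2⟩

lemma IsSubluminal.isClosed_Omega (hz : IsSubluminal z) : IsClosed (Omega z) := by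
  have h1 : Continuous fun t => z (max t 0) :=
    hz.contDiffOn.continuousOn.comp_continuous (by fun_prop) fun t => mem_Ici.2 (le_max_right t 0)
  have h2 : Omega z = {p | 0 ≤ p.2} ∩ {p | z (max p.2 0) ≤ p.1} := by
    ext p
    simp only [Omega, mem_ofPred_eq, mem_inter_iff]
    refine and_congr_right fun hp => ?_
    rw [max_eq_left hp]
  rw [h2]
  exact (isClosed_le (by fun_prop) (by fun_prop)).inter
    (isClosed_le (h1.comp continuous_snd) continuous_fst)

lemma IsSubluminal.exists_subset_region (hz : IsSubluminal z) {K : Set (ℝ × ℝ)}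
    (hK : K ⊆ Omega z) (hb : Bornology.IsBounded K) : ∃ R₀ > 0, ∀ R ≥ R₀, K ⊆ region z R := by
  obtain ⟨r, hr⟩ := hb.subset_closedBall 0
  refine ⟨max r 1, by positivity, fun R hR p hp => ?_⟩
  have h1 := hr hp
  rw [mem_closedBall_zero_iff, Prod.norm_def, max_le_iff, Real.norm_eq_abs, Real.norm_eq_abs] at h1
  have h2 := le_abs_self p.1
  have h3 := le_abs_self p.2
  have h4 := le_max_left r 1
  exact hz.mem_region (hK hp) (by linarith) (by linarith)

lemma IsSubluminal.region_mem_nhdsWithin (hz : IsSubluminal z) {p : ℝ × ℝ} (h1 : p.2 < R)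
    (h2 : p.1 + p.2 < 2 * R) : region z R ∈ 𝓝[Omega z] p := by
  have e1 : ∀ᶠ q : ℝ × ℝ in 𝓝 p, q.2 < R := continuous_snd.continuousAt.eventually_lt
    continuousAt_const h1
  have e2 : ∀ᶠ q : ℝ × ℝ in 𝓝 p, q.1 + q.2 < 2 * R :=
    (continuous_fst.add continuous_snd).continuousAt.eventually_lt continuousAt_const h2
  filter_upwards [self_mem_nhdsWithin, nhdsWithin_le_nhds e1, nhdsWithin_le_nhds e2] with q q0 q1 q2
  exact hz.mem_region q0 q1.le q2.le

/-- The boundary moves more slowly than the characteristics, so the region contains, from each of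
its points, the convex wedge of later times to the right of the line x - t = const, and that wedge
has interior points. -/
lemma IsSubluminal.uniqueDiffOn (hz : IsSubluminal z) : UniqueDiffOn ℝ (Omega z) := by
  intro p hp
  set s : Set (ℝ × ℝ) := {q | p.2 ≤ q.2 ∧ p.1 - p.2 ≤ q.1 - q.2} with hs
  have hsub : s ⊆ Omega z := by
    rintro q ⟨h1, h2⟩
    have := (hz.sub_le_sub hp.1 h1).1
    have := hp.2
    exact ⟨hp.1.trans h1, by linarith⟩
  refine UniqueDiffWithinAt.mono ?_ hsub
  refine uniqueDiffWithinAt_convex ?_ ?_ (subset_closure ⟨le_rfl, le_rfl⟩)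
  · have e1 : Convex ℝ {q : ℝ × ℝ | p.2 ≤ q.2} :=
      convex_halfSpace_ge (LinearMap.snd ℝ ℝ ℝ).isLinear _
    have e2 : Convex ℝ {q : ℝ × ℝ | p.1 - p.2 ≤ q.1 - q.2} :=
      convex_halfSpace_ge (LinearMap.fst ℝ ℝ ℝ - LinearMap.snd ℝ ℝ ℝ).isLinear _
    exact e1.inter e2
  · refine ⟨(p.1 + 2, p.2 + 1), mem_interior.2 ⟨{q | p.2 < q.2} ∩ {q | p.1 - p.2 < q.1 - q.2},
      fun q hq => ⟨le_of_lt hq.1, le_of_lt hq.2⟩, ?_, ?_, ?_⟩⟩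
    · exact (isOpen_lt (by fun_prop) (by fun_prop)).inter (isOpen_lt (by fun_prop) (by fun_prop))
    · simp
    · simp only [mem_ofPred_eq]; linarith

namespace IsNullFrame

variable (F : IsNullFrame z lam R h k μ)
include F

lemma toPlane_mem_iff {q : ℝ × ℝ} :
    toPlane q ∈ region z R ↔ q ∈ past h (z R - R) (2 * R) := by
  rw [← F.mem_past_iff (toPlane q).1 (toPlane q).2]
  exact Iff.of_eq (congrArg (· ∈ past h (z R - R) (2 * R)) (toNull_toPlane q))

lemma toNull_mem_iff {p : ℝ × ℝ} :
    toNull p ∈ past h (z R - R) (2 * R) ↔ p ∈ region z R := by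
  rw [← F.toPlane_mem_iff, toPlane_toNull]

lemma continuous_nullField {w : ℝ × ℝ → ℂ} (hw : ContinuousOn w (Omega z)) :
    Continuous (nullField h (z R - R) (2 * R) w) :=
  hw.comp_continuous (continuous_toPlane.comp F.mirror.continuous_pastRetract) fun q =>
    (F.toPlane_mem_iff.2 (F.mirror.pastRetract_mem F.apex_le q)).1

lemma nullField_eq (w : ℝ × ℝ → ℂ) {q : ℝ × ℝ} (hq : q ∈ past h (z R - R) (2 * R)) :
    nullField h (z R - R) (2 * R) w q = w (toPlane q) := by
  rw [nullField, F.mirror.pastRetract_of_mem hq]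

lemma nullField_toNull (w : ℝ × ℝ → ℂ) {p : ℝ × ℝ} (hp : p ∈ region z R) :
    nullField h (z R - R) (2 * R) w (toNull p) = w p := by
  rw [F.nullField_eq w (F.toNull_mem_iff.2 hp), toPlane_toNull]

lemma nullField_diag (w : ℝ × ℝ → ℂ) {x : ℝ} (h0 : 0 ≤ x) (h1 : x ≤ 2 * R) :
    nullField h (z R - R) (2 * R) w (x, x) = w (x, 0) := by
  rw [F.nullField_eq w (F.mirror.diag_mem h0 (F.left_nonpos.trans h0) h1)]
  simp [toPlane]

end IsNullFrame

end region

/-- Classical solutions are mild solutions in null coordinates. -/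
lemma IsClassicalSolution.isMild {m α β : ℝ} {z : ℝ → ℝ} {lam : ℝ → ℂ} {R : ℝ} {h k : ℝ → ℝ}
    {μ : ℝ → ℂ} {u v : ℝ × ℝ → ℂ} (S : IsClassicalSolution m α β z u v) (hm : 0 ≤ m)
    (F : IsNullFrame z lam R h k μ) (hb : ∀ t, 0 ≤ t → u (z t, t) = lam t * v (z t, t)) :
    IsMild (nullRHS m α β) h μ (z R - R) (2 * R) (nullField h (z R - R) (2 * R) u)
      (nullField h (z R - R) (2 * R) v) := by
  have hf := (isChargeRHS_nullRHS hm α β).continuous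
  have hU := F.continuous_nullField S.contDiffOn_u.continuousOn
  have hV := F.continuous_nullField S.contDiffOn_v.continuousOn
  refine ⟨hU, hV, fun x y hp => ?_, fun x y hp => ?_, fun x hx hx0 hxh => ?_⟩
  · have hmem : ∀ r ∈ Icc (h x) y, (x, r) ∈ past h (z R - R) (2 * R) := fun r hr =>
      ⟨hp.1, hr.1, hr.2.trans hp.2.2⟩
    rw [← sub_eq_iff_eq_add']
    refine sub_eq_integral_of_hasDerivWithinAt
      (g := fun r => nullField h (z R - R) (2 * R) u (x, r)) (s := Icc (h x) y) ordConnected_Icc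
      (Continuous.nullRHS m α β (by fun_prop) (by fun_prop)) (fun r hr => ?_)
      (left_mem_Icc.2 hp.2.1) (right_mem_Icc.2 hp.2.1)
    have hΩ := (F.toPlane_mem_iff.2 (hmem r hr)).1
    have h1 := (S.contDiffOn_u.differentiableOn one_ne_zero _ hΩ).hasFDerivWithinAt
    have h2 : HasDerivWithinAt (fun r => toPlane (x, r)) (1 / 2, 1 / 2) (Icc (h x) y) r :=
      ((((hasDerivAt_id r).const_add x).div_const 2).prodMk
        (((hasDerivAt_id r).sub_const x).div_const 2)).hasDerivWithinAt
    have h3 := h1.comp_hasDerivWithinAt (f := fun r => toPlane (x, r)) r h2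
      (fun r hr => (F.toPlane_mem_iff.2 (hmem r hr)).1)
    have h4 : fderivWithin ℝ u (Omega z) (toPlane (x, r)) (1 / 2, 1 / 2)
        = nullRHS m α β (u (toPlane (x, r))) (v (toPlane (x, r))) := by
      have e : ((1 / 2, 1 / 2) : ℝ × ℝ) = (1 / 2 : ℝ) • (((0, 1) : ℝ × ℝ) + (1, 0)) := by
        ext <;> simp
      rw [e, map_smul, map_add]
      have h5 := S.eq_u _ hΩ
      simp only [dt, dx] at h5
      rw [nullRHS, Complex.real_smul]
      have h6 := congrArg (fun w => -(Complex.I / 2) * w) h5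
      rw [← mul_assoc] at h6
      have h7 : -(Complex.I / 2) * Complex.I = 1 / 2 := by
        linear_combination (-1 / 2 : ℂ) * Complex.I_mul_I
      rw [h7] at h6
      push_cast
      rw [h6]
      ring
    rw [h4] at h3
    rw [F.nullField_eq u (hmem r hr), F.nullField_eq v (hmem r hr)]
    refine h3.congr (fun r hr => F.nullField_eq u (hmem r hr)) (F.nullField_eq u (hmem r hr))
  · have hxy : x ≤ y := (F.mirror.le_h x).trans hp.2.1
    have hmem : ∀ r ∈ Icc x y, (r, y) ∈ past h (z R - R) (2 * R) := fun r hr =>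
      F.mirror.past_horizontal hp hr.1 hr.2
    have main : nullField h (z R - R) (2 * R) v (y, y) - nullField h (z R - R) (2 * R) v (x, y)
        = ∫ r in x..y, -nullRHS m α β (nullField h (z R - R) (2 * R) v (r, y))
          (nullField h (z R - R) (2 * R) u (r, y)) := by
      refine sub_eq_integral_of_hasDerivWithinAt
        (g := fun r => nullField h (z R - R) (2 * R) v (r, y)) (s := Icc x y) ordConnected_Icc
        (g' := fun r => -nullRHS m α β (nullField h (z R - R) (2 * R) v (r, y))
          (nullField h (z R - R) (2 * R) u (r, y)))
        (Continuous.nullRHS m α β (by fun_prop) (by fun_prop)).neg (fun r hr => ?_)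
        (left_mem_Icc.2 hxy) (right_mem_Icc.2 hxy)
      have hΩ := (F.toPlane_mem_iff.2 (hmem r hr)).1
      have h1 := (S.contDiffOn_v.differentiableOn one_ne_zero _ hΩ).hasFDerivWithinAt
      have h2 : HasDerivWithinAt (fun r => toPlane (r, y)) (1 / 2, -1 / 2) (Icc x y) r :=
        ((((hasDerivAt_id r).add_const y).div_const 2).prodMk
          (((hasDerivAt_id r).const_sub y).div_const 2)).hasDerivWithinAt
      have h3 := h1.comp_hasDerivWithinAt (f := fun r => toPlane (r, y)) r h2
        (fun r hr => (F.toPlane_mem_iff.2 (hmem r hr)).1)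
      have h4 : fderivWithin ℝ v (Omega z) (toPlane (r, y)) (1 / 2, -1 / 2)
          = -nullRHS m α β (v (toPlane (r, y))) (u (toPlane (r, y))) := by
        have e : ((1 / 2, -1 / 2) : ℝ × ℝ) = (-(1 / 2) : ℝ) • (((0, 1) : ℝ × ℝ) - (1, 0)) := by
          ext <;> norm_num
        rw [e, map_smul, map_sub]
        have h5 := S.eq_v _ hΩ
        simp only [dt, dx] at h5
        rw [nullRHS, Complex.real_smul, ← N2_eq_N1]
        have h6 := congrArg (fun w => (Complex.I / 2) * w) h5
        rw [← mul_assoc] at h6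
        have h7 : (Complex.I / 2) * Complex.I = -(1 / 2) := by
          linear_combination (1 / 2 : ℂ) * Complex.I_mul_I
        rw [h7] at h6
        push_cast
        rw [h6]
        ring
      rw [h4] at h3
      rw [F.nullField_eq u (hmem r hr), F.nullField_eq v (hmem r hr)]
      refine h3.congr (fun r hr => F.nullField_eq v (hmem r hr)) (F.nullField_eq v (hmem r hr))
    rw [intervalIntegral.integral_neg] at main
    linear_combination -main
  · obtain ⟨t, ht, rfl⟩ := F.exists_time x hx hx0
    have hmem : (z t - t, h (z t - t)) ∈ past h (z R - R) (2 * R) := ⟨hx, le_rfl, hxh⟩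
    rw [F.nullField_eq u hmem, F.nullField_eq v hmem, F.μ_boundary t ht, F.h_boundary t ht]
    have e : toPlane (z t - t, z t + t) = (z t, t) := toPlane_toNull (z t, t)
    rw [e, hb t ht.1]

/-- Mild solutions are determined by their initial data. -/
lemma IsMild.eq_of_base {m α β : ℝ} (hm : 0 ≤ m) {h k : ℝ → ℝ} {μ : ℝ → ℂ} {ξ₀ η₀ : ℝ}
    (H : IsMirror h k μ ξ₀) (h0 : h ξ₀ ≤ η₀) (hlt : max ξ₀ 0 < η₀) {U V U' V' : ℝ × ℝ → ℂ}
    (S : IsMild (nullRHS m α β) h μ ξ₀ η₀ U V) (S' : IsMild (nullRHS m α β) h μ ξ₀ η₀ U' V')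
    (hbase : ∀ x, 0 ≤ x → x ≤ η₀ → U (x, x) = U' (x, x) ∧ V (x, x) = V' (x, x))
    {p : ℝ × ℝ} (hp : p ∈ past h ξ₀ η₀) : U p = U' p ∧ V p = V' p := by
  obtain ⟨C, hC, hst⟩ := exists_stability hm α β H h0
    (max (baseCharge U V ξ₀ η₀) (baseCharge U' V' ξ₀ η₀))
  have hd : baseCharge (U - U') (V - V') ξ₀ η₀ = 0 := by
    rw [baseCharge, intervalIntegral.integral_zero_ae]
    refine Eventually.of_forall fun x hx => ?_
    rw [uIoc_of_le hlt.le] at hx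
    obtain ⟨h1, h2⟩ := hbase x ((le_max_right _ _).trans hx.1.le) hx.2
    simp [h1, h2]
  -- With equal data the stability estimate makes the integrals of the majorants nonpositive, and a
  -- continuous nonnegative function with such an integral vanishes.
  have hzero : ∀ {w : ℝ → ℝ} {a : ℝ}, Continuous w → (∀ x, 0 ≤ w x) → a < η₀ →
      ∫ x in a..η₀, w x ≤ C * baseCharge (U - U') (V - V') ξ₀ η₀ → ∀ x ∈ Icc a η₀, w x = 0 := by
    intro w a hw hw0 ha hle x hx
    rw [hd, mul_zero] at hle
    by_contra hne
    exact absurd hle (intervalIntegral.integral_pos ha hw.continuousOn (fun y _ => hw0 y)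
      ⟨x, hx, lt_of_le_of_ne (hw0 x) (Ne.symm hne)⟩).not_ge
  obtain ⟨f, g, f', g', hf, hg, -, -, hle, hnn, if', ig, -⟩ := hst U V U' V' S S'
    (le_max_left _ _) (le_max_right _ _)
  obtain ⟨x, y⟩ := p
  obtain ⟨l1, l2, -⟩ := hle x y hp
  have hsub := H.past_subset hp
  rw [hzero hf (fun x => (hnn x).1) ((le_max_left _ _).trans_lt hlt) if' x hsub.1] at l1
  rw [hzero hg (fun x => (hnn x).2.1) hlt ig y
    ⟨max_le hsub.2.1 ((H.h_nonneg x).trans hp.2.1), hsub.2.2⟩] at l2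
  have z1 := pow_eq_zero_iff two_ne_zero |>.1 (le_antisymm l1 (sq_nonneg _))
  have z2 := pow_eq_zero_iff two_ne_zero |>.1 (le_antisymm l2 (sq_nonneg _))
  exact ⟨sub_eq_zero.1 (norm_eq_zero.1 z1), sub_eq_zero.1 (norm_eq_zero.1 z2)⟩

end DiracIBVP

/-! ### Global classical solutions by gluing. -/

namespace DiracIBVP

lemma IsMild.congr_frame {f : ℂ → ℂ → ℂ} {h h' : ℝ → ℝ} {μ μ' : ℝ → ℂ} {ξ₀ η₀ : ℝ}
    {U V : ℝ × ℝ → ℂ} (S : IsMild f h μ ξ₀ η₀ U V) (hh : ∀ x, ξ₀ ≤ x → h x = h' x)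
    (hμ : ∀ x, ξ₀ ≤ x → x ≤ 0 → μ x = μ' x) : IsMild f h' μ' ξ₀ η₀ U V where
  continuous_U := S.continuous_U
  continuous_V := S.continuous_V
  eq_U x y hp := by
    rw [← hh x hp.1]
    exact S.eq_U x y ⟨hp.1, by rw [hh x hp.1]; exact hp.2.1, hp.2.2⟩
  eq_V x y hp := S.eq_V x y ⟨hp.1, by rw [hh x hp.1]; exact hp.2.1, hp.2.2⟩
  boundary x hx hx0 hxh := by
    rw [← hh x hx] at hxh ⊢
    rw [← hμ x hx hx0]
    exact S.boundary x hx hx0 hxh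

/-- The frames for different radii are chosen independently, but on the smaller past both are
determined by z and lam; this lets the local solutions be compared. -/
lemma IsNullFrame.agree {z : ℝ → ℝ} {lam : ℝ → ℂ} {R R' : ℝ} {h k h' k' : ℝ → ℝ} {μ μ' : ℝ → ℂ}
    (F : IsNullFrame z lam R h k μ) (F' : IsNullFrame z lam R' h' k' μ') (hR : R ≤ R') :
    (∀ x, z R - R ≤ x → h' x = h x) ∧ ∀ x, z R - R ≤ x → x ≤ 0 → μ' x = μ x := by
  constructor
  · intro x hx
    rcases le_total 0 x with h0 | h0
    · rw [F.mirror.h_of_nonneg x h0, F'.mirror.h_of_nonneg x h0]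
    · obtain ⟨t, ht, rfl⟩ := F.exists_time x hx h0
      rw [F.h_boundary t ht, F'.h_boundary t ⟨ht.1, ht.2.trans hR⟩]
  · intro x hx h0
    obtain ⟨t, ht, rfl⟩ := F.exists_time x hx h0
    rw [F.μ_boundary t ht, F'.μ_boundary t ⟨ht.1, ht.2.trans hR⟩]

/-- Existence of global classical solutions for smooth data supported away from the corner. -/
theorem exists_isClassicalSolution {m : ℝ} (hm : 0 ≤ m) (α β : ℝ) {z : ℝ → ℝ} {lam : ℝ → ℂ}
    (hz : IsSubluminal z)
    (hF : ∀ R : ℝ, 0 < R → ∃ h k μ, IsNullFrame z lam R h k μ)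
    {u₀ u₀' v₀ v₀' : ℝ → ℂ} (hu : ∀ x, HasDerivAt u₀ (u₀' x) x) (hu' : Continuous u₀')
    (hv : ∀ x, HasDerivAt v₀ (v₀' x) x) (hv' : Continuous v₀')
    {ε : ℝ} (hε : 0 < ε) (hu0 : ∀ x ≤ ε, u₀ x = 0) (hv0 : ∀ x ≤ ε, v₀ x = 0) :
    ∃ u v, IsClassicalSolution m α β z u v ∧ (∀ t, 0 ≤ t → u (z t, t) = lam t * v (z t, t)) ∧
      ∀ x, 0 ≤ x → u (x, 0) = u₀ x ∧ v (x, 0) = v₀ x := by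
  have hRpos : ∀ n : ℕ, (0 : ℝ) < (n : ℝ) + 1 := fun n => by positivity
  choose h k μ F using fun n : ℕ => hF ((n : ℝ) + 1) (hRpos n)
  set R : ℕ → ℝ := fun n => (n : ℝ) + 1 with hRdef
  have huc : Continuous u₀ := continuous_iff_continuousAt.2 fun x => (hu x).continuousAt
  have hvc : Continuous v₀ := continuous_iff_continuousAt.2 fun x => (hv x).continuousAt
  choose U V S hbase using fun n : ℕ => exists_isMild hm α β (F n).mirror (F n).left_nonpos
    (F n).apex_le huc hvc (fun x hx => hu0 x (hx.trans hε.le)) (hv0 0 hε.le)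
  -- the local solutions agree
  have hagree : ∀ n n', n ≤ n' → ∀ p ∈ past (h n) (z (R n) - R n) (2 * R n),
      U n p = U n' p ∧ V n p = V n' p := by
    intro n n' hn p hp
    have hRR : R n ≤ R n' := by simp only [hRdef]; exact_mod_cast Nat.add_le_add_right hn 1
    obtain ⟨a1, a2⟩ := (F n).agree (F n') hRR
    have hzz := (hz.sub_le_sub (hRpos n).le hRR).1
    have S' := ((S n').mono (ξ := z (R n) - R n) (η := 2 * R n) (by linarith)
      (by linarith)).congr_frame a1 a2
    refine IsMild.eq_of_base hm (F n).mirror (F n).apex_le ?_ (S n) S' (fun x h0 hx => ?_) hp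
    · have := hRpos n
      rw [max_eq_right (F n).left_nonpos]
      positivity
    · have b1 := hbase n x h0 hx
      have b2 := hbase n' x h0 (by linarith : x ≤ 2 * R n')
      rw [b1.1, b1.2, b2.1, b2.2]
      exact ⟨rfl, rfl⟩
  -- the index of a local solution defined at a given point
  set N : ℝ × ℝ → ℕ := fun p => ⌈|p.1| + |p.2|⌉₊ with hN
  have hNle : ∀ p, p.2 < R (N p) ∧ p.1 + p.2 < 2 * R (N p) := by
    intro p
    have h1 := Nat.le_ceil (|p.1| + |p.2|)
    have h2 := le_abs_self p.1
    have h3 := le_abs_self p.2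
    have h4 := abs_nonneg p.1
    have h5 := abs_nonneg p.2
    simp only [hRdef, hN]
    constructor <;> linarith
  have hNmem : ∀ p ∈ Omega z, p ∈ region z (R (N p)) := fun p hp =>
    hz.mem_region hp (hNle p).1.le (hNle p).2.le
  set u : ℝ × ℝ → ℂ := fun p => U (N p) (toNull p) with hudef
  set v : ℝ × ℝ → ℂ := fun p => V (N p) (toNull p) with hvdef
  have hloc : ∀ n, ∀ p ∈ region z (R n), u p = U n (toNull p) ∧ v p = V n (toNull p) := by
    intro n p hp
    simp only [hudef, hvdef]
    have m1 := (F n).toNull_mem_iff.2 hp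
    have m2 := (F (N p)).toNull_mem_iff.2 (hNmem p hp.1)
    rcases le_total n (N p) with hle | hle
    · have := hagree n (N p) hle _ m1
      exact ⟨this.1.symm, this.2.symm⟩
    · exact hagree (N p) n hle _ m2
  -- local regularity
  have hreg : ∀ n, ∃ Du Dv : ℝ × ℝ → (ℝ × ℝ →L[ℝ] ℂ), Continuous Du ∧ Continuous Dv ∧
      ∀ p ∈ region z (R n), HasFDerivWithinAt u (Du p) (region z (R n)) p ∧
        HasFDerivWithinAt v (Dv p) (region z (R n)) p ∧
        Du p (0, 1) + Du p (1, 0) = 2 * nullRHS m α β (u p) (v p) ∧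
        Dv p (0, 1) - Dv p (1, 0) = 2 * nullRHS m α β (v p) (u p) := by
    intro n
    obtain ⟨h', hh'c, hh'⟩ := (F n).exists_deriv_h
    obtain ⟨μ', hμ'c, hμ'⟩ := (F n).exists_deriv_μ
    obtain ⟨P, Q, hP, hQ, hD⟩ := (S n).exists_hasFDerivWithinAt (F n).mirror hm (F n).left_nonpos
      (F n).apex_le hh'c hh' hμ'c hμ' hu hu' hv hv' hε hu0 hv0 (hbase n)
    have hUc := (S n).continuous_U
    have hVc := (S n).continuous_V
    set L : ℝ × ℝ →L[ℝ] ℝ × ℝ :=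
      (ContinuousLinearMap.fst ℝ ℝ ℝ - ContinuousLinearMap.snd ℝ ℝ ℝ).prod
        (ContinuousLinearMap.fst ℝ ℝ ℝ + ContinuousLinearMap.snd ℝ ℝ ℝ) with hL
    have hLt : ∀ p, L p = toNull p := fun p => rfl
    have hsr : ∀ (ℓ : ℝ × ℝ →L[ℝ] ℝ) {w : ℝ × ℝ → ℂ}, Continuous w →
        Continuous fun q => ℓ.smulRight (w q) := fun ℓ w hw =>
      (ContinuousLinearMap.smulRightL ℝ (ℝ × ℝ) ℂ ℓ).continuous.comp hw
    set G₁ : ℝ × ℝ → (ℝ × ℝ →L[ℝ] ℂ) := fun q => (ContinuousLinearMap.fst ℝ ℝ ℝ).smulRight (P q)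
      + (ContinuousLinearMap.snd ℝ ℝ ℝ).smulRight (nullRHS m α β (U n q) (V n q)) with hG₁
    set G₂ : ℝ × ℝ → (ℝ × ℝ →L[ℝ] ℂ) := fun q => (ContinuousLinearMap.fst ℝ ℝ ℝ).smulRight
      (-nullRHS m α β (V n q) (U n q)) + (ContinuousLinearMap.snd ℝ ℝ ℝ).smulRight (Q q) with hG₂
    have hG₁c : Continuous G₁ := (hsr _ hP).add (hsr _ (Continuous.nullRHS m α β hUc hVc))
    have hG₂c : Continuous G₂ := (hsr _ (Continuous.nullRHS m α β hVc hUc).neg).add (hsr _ hQ)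
    refine ⟨fun p => (G₁ (toNull p)).comp L, fun p => (G₂ (toNull p)).comp L,
      (hG₁c.comp continuous_toNull).clm_comp continuous_const,
      (hG₂c.comp continuous_toNull).clm_comp continuous_const, fun p hp => ?_⟩
    have hm1 := (F n).toNull_mem_iff.2 hp
    obtain ⟨d1, d2⟩ := hD (toNull p) hm1
    have hmaps : MapsTo L (region z (R n)) (past (h n) (z (R n) - R n) (2 * R n)) :=
      fun q hq => (F n).toNull_mem_iff.2 hq
    refine ⟨(d1.comp p (L.hasFDerivWithinAt) hmaps).congr (fun q hq => (hloc n q hq).1)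
      (hloc n p hp).1, (d2.comp p (L.hasFDerivWithinAt) hmaps).congr
      (fun q hq => (hloc n q hq).2) (hloc n p hp).2, ?_, ?_⟩
    · rw [(hloc n p hp).1, (hloc n p hp).2]
      simp [hG₁, hL]
      ring
    · rw [(hloc n p hp).1, (hloc n p hp).2]
      simp [hG₂, hL]
      ring
  choose Du Dv hDu hDv hD using hreg
  -- The index N p was chosen with strict inequalities, so the region of that index is a
  -- neighbourhood of p relative to Ω and derivatives within it are derivatives within Ω.
  have hnhds : ∀ p, region z (R (N p)) ∈ 𝓝[Omega z] p := fun p =>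
    hz.region_mem_nhdsWithin (hNle p).1 (hNle p).2
  have hfu : ∀ p ∈ Omega z, HasFDerivWithinAt u (Du (N p) p) (Omega z) p := fun p hp =>
    (hD (N p) p (hNmem p hp)).1.mono_of_mem_nhdsWithin (hnhds p)
  have hfv : ∀ p ∈ Omega z, HasFDerivWithinAt v (Dv (N p) p) (Omega z) p := fun p hp =>
    (hD (N p) p (hNmem p hp)).2.1.mono_of_mem_nhdsWithin (hnhds p)
  have hcd : ∀ {w : ℝ × ℝ → ℂ} {D : ℕ → ℝ × ℝ → (ℝ × ℝ →L[ℝ] ℂ)}, (∀ n, Continuous (D n)) →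
      (∀ n, ∀ p ∈ region z (R n), HasFDerivWithinAt w (D n p) (region z (R n)) p) →
      ContDiffOn ℝ 1 w (Omega z) := by
    intro w D hDc hwD p hp
    have e : (1 : WithTop ℕ∞) = 0 + 1 := by norm_num
    rw [e, contDiffWithinAt_succ_iff_hasFDerivWithinAt (by simp)]
    refine ⟨region z (R (N p)), ?_, fun h => absurd h (by simp), D (N p), hwD (N p), ?_⟩
    · rw [insert_eq_of_mem hp]; exact hnhds p
    · exact (contDiff_zero.2 (hDc (N p))).contDiffWithinAt
  refine ⟨u, v, ⟨hcd hDu fun n p hp => (hD n p hp).1, hcd hDv fun n p hp => (hD n p hp).2.1,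
    fun p hp => ?_, fun p hp => ?_⟩, fun t ht => ?_, fun x hx => ?_⟩
  · rw [dt, dx, (hfu p hp).fderivWithin (hz.uniqueDiffOn p hp), (hD (N p) p (hNmem p hp)).2.2.1,
      nullRHS]
    linear_combination (m * v p - N1 α β (u p) (v p)) * Complex.I_mul_I
  · rw [dt, dx, (hfv p hp).fderivWithin (hz.uniqueDiffOn p hp), (hD (N p) p (hNmem p hp)).2.2.2,
      nullRHS, N2_eq_N1]
    linear_combination (m * u p - N1 α β (v p) (u p)) * Complex.I_mul_I
  · have hp : (z t, t) ∈ Omega z := ⟨ht, le_rfl⟩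
    have hR' := hNmem _ hp
    have hm1 := (F (N (z t, t))).toNull_mem_iff.2 hR'
    have htR : t ∈ Icc 0 (R (N (z t, t))) := ⟨ht, (hNle (z t, t)).1.le⟩
    have hb := (S (N (z t, t))).boundary (z t - t) hm1.1 (by
      have := (hz.sub_le_sub le_rfl ht).1
      rw [hz.zero] at this
      linarith) (hm1.2.1.trans hm1.2.2)
    rw [(F _).h_boundary t htR, (F _).μ_boundary t htR] at hb
    exact hb
  · have hp : (x, (0 : ℝ)) ∈ Omega z := ⟨le_rfl, by rw [hz.zero]; exact hx⟩
    have e : toNull (x, 0) = (x, x) := by simp [toNull]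
    have hx2 := (hNle (x, 0)).2.le
    simp only [add_zero] at hx2
    have := hbase (N (x, 0)) x hx hx2
    simp only [hudef, hvdef, e]
    exact this

end DiracIBVP

/-! ### Stability of classical solutions in L². -/

namespace DiracIBVP

/-- The passage to null coordinates as a linear map. -/
noncomputable def toNullLinear : ℝ × ℝ →ₗ[ℝ] ℝ × ℝ :=
  Matrix.toLin (Module.Basis.finTwoProd ℝ) (Module.Basis.finTwoProd ℝ) !![1, -1; 1, 1]

lemma toNullLinear_apply (p : ℝ × ℝ) : toNullLinear p = toNull p := by
  rw [toNullLinear, Matrix.toLin_finTwoProd]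
  ext <;> simp [toNull, sub_eq_add_neg]

lemma map_toNull_volume :
    Measure.map toNull (volume : Measure (ℝ × ℝ)) = ENNReal.ofReal (1 / 2) • volume := by
  have hdet : LinearMap.det toNullLinear = 2 := by
    rw [toNullLinear, LinearMap.det_toLin, Matrix.det_fin_two_of]
    norm_num
  have h := Measure.map_linearMap_addHaar_eq_smul_addHaar (volume : Measure (ℝ × ℝ))
    (f := toNullLinear) (by rw [hdet]; norm_num)
  have e : (⇑toNullLinear : ℝ × ℝ → ℝ × ℝ) = toNull := funext toNullLinear_apply
  rw [e, hdet] at h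
  rw [h]
  norm_num

lemma measurableEmbedding_toNull : MeasurableEmbedding toNull :=
  MeasurableEquiv.measurableEmbedding
    { toFun := toNull
      invFun := toPlane
      left_inv := toPlane_toNull
      right_inv := toNull_toPlane
      measurable_toFun := continuous_toNull.measurable
      measurable_invFun := continuous_toPlane.measurable }

section

variable {z : ℝ → ℝ} {lam : ℝ → ℂ} {R : ℝ} {h k : ℝ → ℝ} {μ : ℝ → ℂ}

namespace IsNullFrame

variable (F : IsNullFrame z lam R h k μ)
include F

lemma preimage_past : toNull ⁻¹' past h (z R - R) (2 * R) = region z R := by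
  ext p
  exact F.toNull_mem_iff

lemma integral_region (g : ℝ × ℝ → ℂ) :
    ∫ p in region z R, g (toNull p) = (1 / 2) * ∫ q in past h (z R - R) (2 * R), g q := by
  rw [← F.preimage_past, ← measurableEmbedding_toNull.setIntegral_map, map_toNull_volume,
    Measure.restrict_smul, integral_smul_measure, ENNReal.toReal_ofReal (by norm_num),
    Complex.real_smul]
  norm_num

lemma lintegral_region_le (g : ℝ × ℝ → ENNReal) :
    ∫⁻ p in region z R, g (toNull p) ≤ ∫⁻ q in past h (z R - R) (2 * R), g q := by
  rw [← F.preimage_past, ← measurableEmbedding_toNull.lintegral_map,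
    ← measurableEmbedding_toNull.restrict_map, map_toNull_volume,
    Measure.restrict_smul, lintegral_smul_measure]
  refine (mul_le_mul_left (b := ENNReal.ofReal (1 / 2)) (c := 1) ?_ _).trans (one_mul _).le
  rw [ENNReal.ofReal_le_one]
  norm_num

/-- Here the one-coordinate majorants pay off: the past lies in a rectangle on which Tonelli
separates the two factors. The Jacobian 1/2 is simply dropped. -/
lemma lintegral_region_le_mul {w : ℝ × ℝ → ENNReal} {P Q : ℝ → ℝ} (hP : Continuous P)
    (hQ : Continuous Q) (hP0 : ∀ x, 0 ≤ P x) (hQ0 : ∀ x, 0 ≤ Q x)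
    (hw : ∀ x y, (x, y) ∈ past h (z R - R) (2 * R) →
      w (toPlane (x, y)) ≤ ENNReal.ofReal (P x * Q y)) :
    ∫⁻ p in region z R, w p ≤ ENNReal.ofReal ((∫ x in (z R - R)..(2 * R), P x) *
      ∫ y in max (z R - R) 0..(2 * R), Q y) := by
  have h0 := F.apex_le
  have hle := (F.mirror.le_h _).trans h0
  have hle' : max (z R - R) 0 ≤ 2 * R := (F.mirror.base_le_h _).trans h0
  have e1 : ∀ {f : ℝ → ℝ} {a b : ℝ}, a ≤ b → Continuous f → (∀ x, 0 ≤ f x) →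
      ENNReal.ofReal (∫ x in a..b, f x) = ∫⁻ x in Icc a b, ENNReal.ofReal (f x) := by
    intro f a b hab hf hf0
    rw [intervalIntegral.integral_of_le hab, ← integral_Icc_eq_integral_Ioc,
      ofReal_integral_eq_lintegral_ofReal (hf.integrableOn_Icc) (Eventually.of_forall hf0)]
  calc ∫⁻ p in region z R, w p
      = ∫⁻ p in region z R, w (toPlane (toNull p)) := by simp only [toPlane_toNull]
    _ ≤ ∫⁻ q in past h (z R - R) (2 * R), w (toPlane q) :=
        F.lintegral_region_le fun q => w (toPlane q)
    _ ≤ ∫⁻ q in past h (z R - R) (2 * R), ENNReal.ofReal (P q.1) * ENNReal.ofReal (Q q.2) := by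
        refine setLIntegral_mono' F.mirror.isClosed_past.measurableSet fun q hq => ?_
        rw [← ENNReal.ofReal_mul (hP0 _)]
        exact hw q.1 q.2 hq
    _ ≤ ∫⁻ q in Icc (z R - R) (2 * R) ×ˢ Icc (max (z R - R) 0) (2 * R),
          ENNReal.ofReal (P q.1) * ENNReal.ofReal (Q q.2) := by
        refine lintegral_mono_set fun q hq => ⟨(F.mirror.past_subset hq).1, ?_, hq.2.2⟩
        exact max_le (F.mirror.past_subset hq).2.1 ((F.mirror.h_nonneg _).trans hq.2.1)
    _ = _ := by
        rw [Measure.volume_eq_prod, ← Measure.prod_restrict, lintegral_prod_mul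
          (f := fun x => ENNReal.ofReal (P x)) (g := fun x => ENNReal.ofReal (Q x))
          hP.measurable.ennreal_ofReal.aemeasurable hQ.measurable.ennreal_ofReal.aemeasurable,
          ENNReal.ofReal_mul (intervalIntegral.integral_nonneg hle fun x _ => hP0 x),
          e1 hle hP hP0, e1 hle' hQ hQ0]

lemma isClosed_region : IsClosed (region z R) := by
  rw [← F.preimage_past]
  exact F.mirror.isClosed_past.preimage continuous_toNull

lemma isCompact_region : IsCompact (region z R) := by
  have : region z R = toPlane '' past h (z R - R) (2 * R) := by
    ext p
    constructor
    · exact fun hp => ⟨toNull p, F.toNull_mem_iff.2 hp, toPlane_toNull p⟩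
    · rintro ⟨q, hq, rfl⟩
      exact F.toPlane_mem_iff.2 hq
  rw [this]
  exact F.mirror.isCompact_past.image continuous_toPlane

end IsNullFrame

end

/-- The charge of a pair of data on `[0, 2 R]`. -/
noncomputable def dataCharge (R : ℝ) (f g : ℝ → ℂ) : ℝ :=
  ∫ x in (0 : ℝ)..(2 * R), (‖f x‖ ^ 2 + ‖g x‖ ^ 2)

lemma IsNullFrame.baseCharge_nullField {z : ℝ → ℝ} {lam : ℝ → ℂ} {R : ℝ} {h k : ℝ → ℝ}
    {μ : ℝ → ℂ} (F : IsNullFrame z lam R h k μ) (hR : 0 ≤ R) (u v : ℝ × ℝ → ℂ) :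
    baseCharge (nullField h (z R - R) (2 * R) u) (nullField h (z R - R) (2 * R) v) (z R - R)
      (2 * R) = dataCharge R (fun x => u (x, 0)) (fun x => v (x, 0)) := by
  rw [baseCharge, dataCharge, max_eq_right F.left_nonpos]
  refine intervalIntegral.integral_congr fun x hx => ?_
  rw [uIcc_of_le (by positivity)] at hx
  simp only [F.nullField_diag u hx.1 hx.2, F.nullField_diag v hx.1 hx.2]

lemma enorm_sq_eq (a : ℂ) : ‖a‖ₑ ^ 2 = ENNReal.ofReal (‖a‖ ^ 2) := by
  rw [ENNReal.ofReal_pow (norm_nonneg _), ofReal_norm]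

/-- The Cauchy–Schwarz inequality with explicit bounds. -/
lemma lintegral_mul_le_of_sq_le {X : Type*} [MeasurableSpace X] {ν : Measure X}
    {f g : X → ENNReal} (hf : AEMeasurable f ν) (hg : AEMeasurable g ν) {A B : ℝ} (hA : 0 ≤ A)
    (hB : 0 ≤ B) (hfA : ∫⁻ x, f x ^ 2 ∂ν ≤ ENNReal.ofReal (A ^ 2))
    (hgB : ∫⁻ x, g x ^ 2 ∂ν ≤ ENNReal.ofReal (B ^ 2)) :
    ∫⁻ x, f x * g x ∂ν ≤ ENNReal.ofReal (A * B) := by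
  have h := ENNReal.lintegral_mul_le_Lp_mul_Lq ν Real.HolderConjugate.two_two hf hg
  have e : ∀ {A : ℝ}, 0 ≤ A → ∀ {w : X → ENNReal}, ∫⁻ x, w x ^ 2 ∂ν ≤ ENNReal.ofReal (A ^ 2) →
      (∫⁻ x, w x ^ (2 : ℝ) ∂ν) ^ (1 / (2 : ℝ)) ≤ ENNReal.ofReal A := by
    intro A hA w hw
    have h2 : ∀ x : ENNReal, x ^ (2 : ℝ) = x ^ 2 := fun x => by
      rw [← ENNReal.rpow_natCast]; norm_num
    simp only [h2]
    refine (ENNReal.rpow_le_rpow hw (by norm_num)).trans (le_of_eq ?_)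
    rw [ENNReal.ofReal_pow hA, ← h2, ← ENNReal.rpow_mul]
    norm_num
  refine h.trans ?_
  rw [ENNReal.ofReal_mul hA]
  exact mul_le_mul' (e hA hfA) (e hB hgB)

/-- Each cubic difference is a single field times a quadratic product of both fields. Cauchy–Schwarz
pairs them, so only the L² norms of such products are needed, never a higher power of one field. -/
lemma lintegral_N1_sub_le (α β : ℝ) {X : Type*} [MeasurableSpace X] {ν : Measure X}
    {a b a' b' : X → ℂ} (ha : AEStronglyMeasurable a ν) (hb : AEStronglyMeasurable b ν)
    (ha' : AEStronglyMeasurable a' ν) (hb' : AEStronglyMeasurable b' ν) {A B : ℝ} (hA : 0 ≤ A)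
    (hB : 0 ≤ B) (h1 : ∫⁻ x, ‖b x‖ₑ ^ 2 ∂ν ≤ ENNReal.ofReal (A ^ 2))
    (h2 : ∫⁻ x, ‖b' x‖ₑ ^ 2 ∂ν ≤ ENNReal.ofReal (A ^ 2))
    (h3 : ∫⁻ x, ‖a x - a' x‖ₑ ^ 2 * ‖b x‖ₑ ^ 2 ∂ν ≤ ENNReal.ofReal (B ^ 2))
    (h4 : ∫⁻ x, ‖a' x‖ₑ ^ 2 * ‖b x - b' x‖ₑ ^ 2 ∂ν ≤ ENNReal.ofReal (B ^ 2)) :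
    ∫⁻ x, ‖N1 α β (a x) (b x) - N1 α β (a' x) (b' x)‖ₑ ∂ν
      ≤ ENNReal.ofReal (3 * strength α β * (A * B)) := by
  have hs := strength_nonneg α β
  have mb := hb.enorm
  have mb' := hb'.enorm
  have m3 : AEMeasurable (fun x => ‖a x - a' x‖ₑ * ‖b x‖ₑ) ν := (ha.sub ha').enorm.mul mb
  have m4 : AEMeasurable (fun x => ‖a' x‖ₑ * ‖b x - b' x‖ₑ) ν := ha'.enorm.mul (hb.sub hb').enorm
  have k1 := lintegral_mul_le_of_sq_le mb m3 hA hB h1 (by simpa only [mul_pow] using h3)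
  have k2 := lintegral_mul_le_of_sq_le mb m4 hA hB h1 (by simpa only [mul_pow] using h4)
  have k3 := lintegral_mul_le_of_sq_le mb' m4 hA hB h2 (by simpa only [mul_pow] using h4)
  have hpt : ∀ x, ‖N1 α β (a x) (b x) - N1 α β (a' x) (b' x)‖ₑ
      ≤ ENNReal.ofReal (strength α β) * (‖b x‖ₑ * (‖a x - a' x‖ₑ * ‖b x‖ₑ)
        + ‖b x‖ₑ * (‖a' x‖ₑ * ‖b x - b' x‖ₑ) + ‖b' x‖ₑ * (‖a' x‖ₑ * ‖b x - b' x‖ₑ)) := by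
    intro x
    have h := norm_N1_sub_le α β (a x) (b x) (a' x) (b' x)
    simp only [← ofReal_norm]
    rw [← ENNReal.ofReal_mul (norm_nonneg _), ← ENNReal.ofReal_mul (norm_nonneg _),
      ← ENNReal.ofReal_mul (norm_nonneg _), ← ENNReal.ofReal_mul (norm_nonneg _),
      ← ENNReal.ofReal_mul (norm_nonneg _), ← ENNReal.ofReal_add (by positivity) (by positivity),
      ← ENNReal.ofReal_add (by positivity) (by positivity), ← ENNReal.ofReal_mul hs]
    refine ENNReal.ofReal_le_ofReal (h.trans (le_of_eq ?_))
    ring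
  have m5 : AEMeasurable (fun x => ‖b x‖ₑ * (‖a' x‖ₑ * ‖b x - b' x‖ₑ)) ν := mb.mul m4
  have m6 : AEMeasurable (fun x => ‖b' x‖ₑ * (‖a' x‖ₑ * ‖b x - b' x‖ₑ)) ν := mb'.mul m4
  refine (lintegral_mono hpt).trans ?_
  rw [lintegral_const_mul' _ _ ENNReal.ofReal_ne_top,
    lintegral_add_right' _ m6, lintegral_add_right' _ m5]
  have e : ENNReal.ofReal (3 * strength α β * (A * B)) = ENNReal.ofReal (strength α β) *
      (ENNReal.ofReal (A * B) + ENNReal.ofReal (A * B) + ENNReal.ofReal (A * B)) := by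
    rw [← ENNReal.ofReal_add (by positivity) (by positivity),
      ← ENNReal.ofReal_add (by positivity) (by positivity), ← ENNReal.ofReal_mul hs]
    congr 1
    ring
  rw [e]
  gcongr

set_option maxHeartbeats 1000000 in
/-- Classical solutions depend continuously on their data, in `L²` of the data. -/
theorem exists_classical_stability {m : ℝ} (hm : 0 ≤ m) (α β : ℝ) {z : ℝ → ℝ} {lam : ℝ → ℂ}
    {R : ℝ} {h k : ℝ → ℝ} {μ : ℝ → ℂ} (F : IsNullFrame z lam R h k μ) (hR : 0 ≤ R) (E : ℝ) :
    ∃ C, 0 ≤ C ∧ ∀ u v u' v' : ℝ × ℝ → ℂ,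
      IsClassicalSolution m α β z u v → IsClassicalSolution m α β z u' v' →
      (∀ t, 0 ≤ t → u (z t, t) = lam t * v (z t, t)) →
      (∀ t, 0 ≤ t → u' (z t, t) = lam t * v' (z t, t)) →
      dataCharge R (fun x => u (x, 0)) (fun x => v (x, 0)) ≤ E →
      dataCharge R (fun x => u' (x, 0)) (fun x => v' (x, 0)) ≤ E → ∀ d, 0 ≤ d →
      dataCharge R (fun x => u (x, 0) - u' (x, 0)) (fun x => v (x, 0) - v' (x, 0)) ≤ d ^ 2 →
      ∫⁻ p in region z R, ‖u p - u' p‖ₑ ^ 2 ≤ ENNReal.ofReal ((C * d) ^ 2) ∧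
      ∫⁻ p in region z R, ‖v p - v' p‖ₑ ^ 2 ≤ ENNReal.ofReal ((C * d) ^ 2) ∧
      ∫⁻ p in region z R, ‖N1 α β (u p) (v p) - N1 α β (u' p) (v' p)‖ₑ
        ≤ ENNReal.ofReal (C * d) ∧
      ∫⁻ p in region z R, ‖N1 α β (v p) (u p) - N1 α β (v' p) (u' p)‖ₑ
        ≤ ENNReal.ofReal (C * d) ∧
      ∫⁻ p in region z R, ‖u' p‖ₑ ^ 2 * ‖v' p‖ₑ ^ 2 ≤ ENNReal.ofReal (C ^ 2) := by
  obtain ⟨C, hC, hst⟩ := exists_stability hm α β F.mirror F.apex_le E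
  have hs := strength_nonneg α β
  have hle := (F.mirror.le_h _).trans F.apex_le
  have hle' : max (z R - R) 0 ≤ 2 * R := (F.mirror.base_le_h _).trans F.apex_le
  set L := 2 * R - (z R - R) with hL
  have hL0 : 0 ≤ L := sub_nonneg.2 hle
  -- One constant dominating 1, C² and L C, hence every product of two masses that occurs below.
  set M := (1 + C) * (1 + C + L) with hM
  have hM0 : 0 ≤ M := by positivity
  have hMC : C * C ≤ M := by rw [hM]; gcongr <;> linarith
  have hML : L * C ≤ M := by rw [hM, mul_comm L]; gcongr <;> linarith
  have hM1 : 1 ≤ M := by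
    rw [hM]
    exact one_le_mul_of_one_le_of_one_le (by linarith) (by linarith)
  have hMM : M ≤ M ^ 2 := by
    rw [sq]; exact le_mul_of_one_le_left hM0 hM1
  have hMK : M ^ 2 ≤ M ^ 2 * (1 + 3 * strength α β) :=
    le_mul_of_one_le_right (by positivity) (by linarith)
  refine ⟨M ^ 2 * (1 + 3 * strength α β), by positivity,
    fun u v u' v' S S' hb hb' hE hE' d hd0 hd => ?_⟩
  have T := S.isMild hm F hb
  have T' := S'.isMild hm F hb'
  rw [← F.baseCharge_nullField hR] at hE hE'
  obtain ⟨p, q, p', q', hp, hq, hp', hq', hbd, hnn, ip, iq, ip', iq'⟩ :=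
    hst _ _ _ _ T T' hE hE'
  -- `exists_stability` majorizes only the second solution of a pair; applying it to the pair (u, v)
  -- with itself supplies the majorants of u and v.
  obtain ⟨p₁, q₁, p₂, q₂, -, -, hp₂, hq₂, hbd₂, hnn₂, -, -, ip₂, iq₂⟩ := hst _ _ _ _ T T hE hE
  have hd' : baseCharge (nullField h (z R - R) (2 * R) u - nullField h (z R - R) (2 * R) u')
      (nullField h (z R - R) (2 * R) v - nullField h (z R - R) (2 * R) v') (z R - R) (2 * R)
      ≤ d ^ 2 := (F.baseCharge_nullField hR (u - u') (v - v')).trans_le hd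
  have ip := ip.trans (mul_le_mul_of_nonneg_left hd' hC)
  have iq := iq.trans (mul_le_mul_of_nonneg_left hd' hC)
  have hnf : ∀ (w : ℝ × ℝ → ℂ) {x y : ℝ}, (x, y) ∈ past h (z R - R) (2 * R) →
      nullField h (z R - R) (2 * R) w (x, y) = w (toPlane (x, y)) := fun w _ _ hxy =>
    F.nullField_eq w hxy
  have hpt : ∀ x y, (x, y) ∈ past h (z R - R) (2 * R) →
      ‖u (toPlane (x, y)) - u' (toPlane (x, y))‖ ^ 2 ≤ p x ∧
      ‖v (toPlane (x, y)) - v' (toPlane (x, y))‖ ^ 2 ≤ q y ∧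
      ‖u' (toPlane (x, y))‖ ^ 2 ≤ p' x ∧ ‖v' (toPlane (x, y))‖ ^ 2 ≤ q' y ∧
      ‖u (toPlane (x, y))‖ ^ 2 ≤ p₂ x ∧ ‖v (toPlane (x, y))‖ ^ 2 ≤ q₂ y := by
    intro x y hxy
    have b1 := hbd x y hxy
    have b2 := hbd₂ x y hxy
    rw [hnf u hxy, hnf u' hxy, hnf v hxy, hnf v' hxy] at b1
    rw [hnf u hxy, hnf v hxy] at b2
    exact ⟨b1.1, b1.2.1, b1.2.2.1, b1.2.2.2, b2.2.2.1, b2.2.2.2⟩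
  have i1 : ∫ x in (z R - R)..(2 * R), (1 : ℝ) ≤ L := by simp [hL]
  have i1' : ∫ x in max (z R - R) 0..(2 * R), (1 : ℝ) ≤ L := by
    rw [intervalIntegral.integral_const, smul_eq_mul, mul_one, hL]
    have := le_max_left (z R - R) 0
    linarith
  have prod : ∀ {w : ℝ × ℝ → ENNReal} {P Q : ℝ → ℝ} {a b K : ℝ}, Continuous P → Continuous Q →
      (∀ x, 0 ≤ P x) → (∀ x, 0 ≤ Q x) → ∫ x in (z R - R)..(2 * R), P x ≤ a →
      ∫ y in max (z R - R) 0..(2 * R), Q y ≤ b → a * b ≤ K →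
      (∀ x y, (x, y) ∈ past h (z R - R) (2 * R) →
        w (toPlane (x, y)) ≤ ENNReal.ofReal (P x * Q y)) →
      ∫⁻ r in region z R, w r ≤ ENNReal.ofReal K := by
    intro w P Q a b K hP hQ hP0 hQ0 ha hb hK hw
    refine (F.lintegral_region_le_mul hP hQ hP0 hQ0 hw).trans (ENNReal.ofReal_le_ofReal ?_)
    refine le_trans ?_ hK
    exact mul_le_mul ha hb (intervalIntegral.integral_nonneg hle' fun x _ => hQ0 x)
      ((intervalIntegral.integral_nonneg hle fun x _ => hP0 x).trans ha)
  have sq1 : ∀ {a : ℂ} {s : ℝ}, ‖a‖ ^ 2 ≤ s → ‖a‖ₑ ^ 2 ≤ ENNReal.ofReal s := fun {a} {s} ha => by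
    rw [enorm_sq_eq]; exact ENNReal.ofReal_le_ofReal ha
  have sq2 : ∀ {a b : ℂ} {s t : ℝ}, ‖a‖ ^ 2 ≤ s → ‖b‖ ^ 2 ≤ t →
      ‖a‖ₑ ^ 2 * ‖b‖ₑ ^ 2 ≤ ENNReal.ofReal (s * t) := fun {a} {b} {s} {t} ha hb => by
    rw [ENNReal.ofReal_mul ((sq_nonneg _).trans ha)]
    exact mul_le_mul' (sq1 ha) (sq1 hb)
  have n1 : ∀ x : ℝ, (0 : ℝ) ≤ 1 := fun _ => zero_le_one
  have hdM : M * d ^ 2 ≤ (M * d) ^ 2 := by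
    rw [mul_pow]; exact mul_le_mul_of_nonneg_right hMM (sq_nonneg d)
  have hLd : L * C * d ^ 2 ≤ (M * d) ^ 2 :=
    (mul_le_mul_of_nonneg_right hML (sq_nonneg d)).trans hdM
  have hCC : C * C * d ^ 2 ≤ (M * d) ^ 2 :=
    (mul_le_mul_of_nonneg_right hMC (sq_nonneg d)).trans hdM
  have hLd' : L * (C * d ^ 2) ≤ (M * d) ^ 2 := by rwa [← mul_assoc]
  have hLd : C * d ^ 2 * L ≤ (M * d) ^ 2 := by rwa [mul_comm]
  have hCd' : C * (C * d ^ 2) ≤ (M * d) ^ 2 := by rwa [← mul_assoc]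
  have hCd : C * d ^ 2 * C ≤ (M * d) ^ 2 := by rwa [mul_comm]
  have A1 : ∫⁻ r in region z R, ‖u r - u' r‖ₑ ^ 2 ≤ ENNReal.ofReal ((M * d) ^ 2) :=
    prod hp continuous_const (fun x => (hnn x).1) n1 ip i1' hLd fun x y hxy =>
      sq1 (by rw [mul_one]; exact (hpt x y hxy).1)
  have A2 : ∫⁻ r in region z R, ‖v r - v' r‖ₑ ^ 2 ≤ ENNReal.ofReal ((M * d) ^ 2) :=
    prod continuous_const hq n1 (fun x => (hnn x).2.1) i1 iq hLd' fun x y hxy =>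
      sq1 (by rw [one_mul]; exact (hpt x y hxy).2.1)
  have B1 : ∫⁻ r in region z R, ‖v r‖ₑ ^ 2 ≤ ENNReal.ofReal (M ^ 2) :=
    prod continuous_const hq₂ n1 (fun x => (hnn₂ x).2.2.2) i1 iq₂ (hML.trans hMM) fun x y hxy =>
      sq1 (by rw [one_mul]; exact (hpt x y hxy).2.2.2.2.2)
  have B2 : ∫⁻ r in region z R, ‖v' r‖ₑ ^ 2 ≤ ENNReal.ofReal (M ^ 2) :=
    prod continuous_const hq' n1 (fun x => (hnn x).2.2.2) i1 iq' (hML.trans hMM) fun x y hxy =>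
      sq1 (by rw [one_mul]; exact (hpt x y hxy).2.2.2.1)
  have B3 : ∫⁻ r in region z R, ‖u r‖ₑ ^ 2 ≤ ENNReal.ofReal (M ^ 2) :=
    prod hp₂ continuous_const (fun x => (hnn₂ x).2.2.1) n1 ip₂ i1'
      ((mul_comm C L).trans_le (hML.trans hMM)) fun x y hxy =>
      sq1 (by rw [mul_one]; exact (hpt x y hxy).2.2.2.2.1)
  have B4 : ∫⁻ r in region z R, ‖u' r‖ₑ ^ 2 ≤ ENNReal.ofReal (M ^ 2) :=
    prod hp' continuous_const (fun x => (hnn x).2.2.1) n1 ip' i1'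
      ((mul_comm C L).trans_le (hML.trans hMM)) fun x y hxy =>
      sq1 (by rw [mul_one]; exact (hpt x y hxy).2.2.1)
  have D1 : ∫⁻ r in region z R, ‖u r - u' r‖ₑ ^ 2 * ‖v r‖ₑ ^ 2 ≤ ENNReal.ofReal ((M * d) ^ 2) :=
    prod hp hq₂ (fun x => (hnn x).1) (fun x => (hnn₂ x).2.2.2) ip iq₂ hCd fun x y hxy =>
      sq2 (hpt x y hxy).1 (hpt x y hxy).2.2.2.2.2
  have D2 : ∫⁻ r in region z R, ‖u' r‖ₑ ^ 2 * ‖v r - v' r‖ₑ ^ 2 ≤ ENNReal.ofReal ((M * d) ^ 2) :=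
    prod hp' hq (fun x => (hnn x).2.2.1) (fun x => (hnn x).2.1) ip' iq hCd' fun x y hxy =>
      sq2 (hpt x y hxy).2.2.1 (hpt x y hxy).2.1
  have D3 : ∫⁻ r in region z R, ‖v r - v' r‖ₑ ^ 2 * ‖u r‖ₑ ^ 2 ≤ ENNReal.ofReal ((M * d) ^ 2) :=
    prod hp₂ hq (fun x => (hnn₂ x).2.2.1) (fun x => (hnn x).2.1) ip₂ iq hCd' fun x y hxy => by
      rw [mul_comm]; exact sq2 (hpt x y hxy).2.2.2.2.1 (hpt x y hxy).2.1
  have D4 : ∫⁻ r in region z R, ‖v' r‖ₑ ^ 2 * ‖u r - u' r‖ₑ ^ 2 ≤ ENNReal.ofReal ((M * d) ^ 2) :=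
    prod hp hq' (fun x => (hnn x).1) (fun x => (hnn x).2.2.2) ip iq' hCd fun x y hxy => by
      rw [mul_comm]; exact sq2 (hpt x y hxy).1 (hpt x y hxy).2.2.2.1
  have D5 : ∫⁻ r in region z R, ‖u' r‖ₑ ^ 2 * ‖v' r‖ₑ ^ 2 ≤ ENNReal.ofReal M :=
    prod hp' hq' (fun x => (hnn x).2.2.1) (fun x => (hnn x).2.2.2) ip' iq' hMC fun x y hxy =>
      sq2 (hpt x y hxy).2.2.1 (hpt x y hxy).2.2.2.1
  have hmeas : ∀ {w : ℝ × ℝ → ℂ}, ContDiffOn ℝ 1 w (Omega z) →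
      AEStronglyMeasurable w (volume.restrict (region z R)) := fun hw =>
    (hw.continuousOn.mono fun r hr => hr.1).aestronglyMeasurable F.isClosed_region.measurableSet
  have mu := hmeas S.contDiffOn_u
  have mv := hmeas S.contDiffOn_v
  have mu' := hmeas S'.contDiffOn_u
  have mv' := hmeas S'.contDiffOn_v
  have hMd : 0 ≤ M * d := by positivity
  have f1 : ENNReal.ofReal ((M * d) ^ 2)
      ≤ ENNReal.ofReal ((M ^ 2 * (1 + 3 * strength α β) * d) ^ 2) := by
    refine ENNReal.ofReal_le_ofReal (pow_le_pow_left₀ hMd ?_ 2)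
    exact mul_le_mul_of_nonneg_right (hMM.trans hMK) hd0
  have f2 : ENNReal.ofReal (3 * strength α β * (M * (M * d)))
      ≤ ENNReal.ofReal (M ^ 2 * (1 + 3 * strength α β) * d) := by
    refine ENNReal.ofReal_le_ofReal ?_
    have : 0 ≤ M ^ 2 * d := by positivity
    linarith
  refine ⟨A1.trans f1, A2.trans f1,
    (lintegral_N1_sub_le α β mu mv mu' mv' hM0 hMd B1 B2 D1 D2).trans f2,
    (lintegral_N1_sub_le α β mv mu mv' mu' hM0 hMd B3 B4 D3 D4).trans f2,
    D5.trans (ENNReal.ofReal_le_ofReal ?_)⟩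
  have h1 : 1 ≤ M ^ 2 * (1 + 3 * strength α β) := hM1.trans (hMM.trans hMK)
  refine (hMM.trans hMK).trans ?_
  rw [sq (M ^ 2 * (1 + 3 * strength α β))]
  exact le_mul_of_one_le_left (by positivity) h1

end DiracIBVP

/-! ### Approximation of data and fast Cauchy sequences. -/

namespace DiracIBVP

lemma lintegral_enorm_sq {X : Type*} [MeasurableSpace X] (ν : Measure X) (f : X → ℂ) :
    ∫⁻ x, ‖f x‖ₑ ^ 2 ∂ν = eLpNorm f 2 ν ^ 2 := by
  have := eLpNorm_nnreal_pow_eq_lintegral (f := f) (μ := ν) (p := 2) (by norm_num)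
  have e : ∀ x : ENNReal, x ^ ((2 : NNReal) : ℝ) = x ^ 2 := fun x => by
    rw [← ENNReal.rpow_natCast]; norm_num
  simp only [e] at this
  exact this.symm

lemma eLpNorm_two_le_iff {X : Type*} [MeasurableSpace X] {ν : Measure X} {f : X → ℂ} {δ : ℝ}
    (hδ : 0 ≤ δ) :
    eLpNorm f 2 ν ≤ ENNReal.ofReal δ ↔ ∫⁻ x, ‖f x‖ₑ ^ 2 ∂ν ≤ ENNReal.ofReal (δ ^ 2) := by
  rw [lintegral_enorm_sq, ENNReal.ofReal_pow hδ]
  exact (ENNReal.pow_le_pow_left_iff two_ne_zero).symm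

/-- Locally square integrable data are approximated by smooth data supported away from the
corner. -/
lemma exists_smooth_approx {f : ℝ → ℂ} {N : ℝ} (hf : MemLp f 2 (volume.restrict (Icc 0 N)))
    {δ : ℝ} (hδ : 0 < δ) : ∃ (g g' : ℝ → ℂ) (ε : ℝ), 0 < ε ∧ (∀ x, HasDerivAt g (g' x) x) ∧
      Continuous g' ∧ (∀ x ≤ ε, g x = 0) ∧
      ∫⁻ x in Icc 0 N, ‖g x - f x‖ₑ ^ 2 ≤ ENNReal.ofReal (δ ^ 2) := by
  set w : ℝ → ℂ := (Icc 0 N).indicator f with hw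
  have hwL : MemLp w 2 volume := (memLp_indicator_iff_restrict measurableSet_Icc).2 hf
  -- Sets of small measure carry little L² norm, so the datum may be set to zero on a short interval
  -- at the corner.
  obtain ⟨a, ha, hsmall⟩ := hwL.eLpNorm_indicator_le one_le_two (by simp)
    (half_pos hδ)
  set w₁ : ℝ → ℂ := (Icc 0 a)ᶜ.indicator w with hw₁
  have hw₁L : MemLp w₁ 2 volume := hwL.indicator measurableSet_Icc.compl
  have hw₁0 : ∀ x ≤ a, w₁ x = 0 := by
    intro x hx
    rcases lt_or_ge x 0 with h0 | h0
    · have : w x = 0 := indicator_of_notMem (fun hm => absurd hm.1 h0.not_ge) _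
      rw [hw₁, indicator_apply, this, ite_self]
    · exact indicator_of_notMem (notMem_compl_iff.2 (show x ∈ Icc 0 a from ⟨h0, hx⟩)) _
  obtain ⟨g₀, -, hg₀, hle⟩ := hw₁L.exist_eLpNorm_sub_le (by simp) one_le_two (half_pos hδ)
  -- This smooth factor is 0 up to a/2 and 1 from a onwards.
  set χ : ℝ → ℝ := fun x => Real.smoothTransition (2 * x / a - 1) with hχ
  have hχd : ContDiff ℝ 1 χ := by
    have h1 : ContDiff ℝ 1 Real.smoothTransition := Real.smoothTransition.contDiff
    have h2 : ContDiff ℝ 1 fun x : ℝ => 2 * x / a - 1 := by fun_prop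
    exact h1.comp h2
  set g : ℝ → ℂ := fun x => χ x • g₀ x with hg
  have hgd : ContDiff ℝ 1 g := hχd.smul (hg₀.of_le (by exact_mod_cast le_top))
  refine ⟨g, deriv g, a / 2, by positivity,
    fun x => (hgd.differentiable one_ne_zero x).hasDerivAt, hgd.continuous_deriv le_rfl,
    fun x hx => ?_, ?_⟩
  · have h1 : 2 * x / a ≤ 1 := by rw [div_le_one ha]; linarith
    simp only [hg, hχ]
    rw [Real.smoothTransition.zero_of_nonpos (by linarith), zero_smul]
  · have h1 : eLpNorm (w₁ - g) 2 volume ≤ ENNReal.ofReal (δ / 2) := by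
      -- On x ≤ a the target is zero, so multiplying the approximation by χ ≤ 1 only brings it
      -- closer; elsewhere χ = 1.
      refine le_trans (eLpNorm_mono fun x => ?_) hle
      simp only [Pi.sub_apply]
      rcases le_total x a with hx | hx
      · rw [hw₁0 x hx, zero_sub, zero_sub, norm_neg, norm_neg]
        simp only [hg]
        rw [norm_smul, Real.norm_of_nonneg (Real.smoothTransition.nonneg _)]
        exact mul_le_of_le_one_left (norm_nonneg _) (Real.smoothTransition.le_one _)
      · have h2 : 1 ≤ 2 * x / a - 1 := by
          rw [le_sub_iff_add_le, le_div_iff₀ ha]; linarith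
        simp only [hg, hχ]
        rw [Real.smoothTransition.one_of_one_le h2, one_smul]
    have h2 : eLpNorm (w - w₁) 2 volume ≤ ENNReal.ofReal (δ / 2) := by
      have e : w - w₁ = (Icc 0 a).indicator w := by
        rw [hw₁, indicator_compl]; simp
      rw [e]
      exact hsmall _ measurableSet_Icc (by simp)
    have hgm : AEStronglyMeasurable g volume := hgd.continuous.aestronglyMeasurable
    have h3 : eLpNorm (w - g) 2 volume ≤ ENNReal.ofReal δ := by
      have e : w - g = (w - w₁) + (w₁ - g) := by ring
      rw [e]
      refine (eLpNorm_add_le (hwL.1.sub hw₁L.1) (hw₁L.1.sub hgm) one_le_two).trans ?_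
      refine (add_le_add h2 h1).trans (le_of_eq ?_)
      rw [← ENNReal.ofReal_add (by positivity) (by positivity), add_halves]
    rw [eLpNorm_two_le_iff hδ.le] at h3
    refine le_trans ?_ h3
    calc ∫⁻ x in Icc 0 N, ‖g x - f x‖ₑ ^ 2 = ∫⁻ x in Icc 0 N, ‖(w - g) x‖ₑ ^ 2 := by
          refine setLIntegral_congr_fun measurableSet_Icc fun x hx => ?_
          simp only [Pi.sub_apply, hw, indicator_of_mem hx]
          rw [← enorm_neg, neg_sub]
      _ ≤ _ := setLIntegral_le_lintegral _ _

section limits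

variable {X : Type*} [MeasurableSpace X] {ν : Measure X} {p : ENNReal} {f : ℕ → X → ℂ} {A : ℝ}
  {k : ℕ}

/-- The completeness criterion asks for strict inequalities from the first index on: the shift by k
supplies the range, and A + 1 in place of A the strictness. -/
lemma eLpNorm_shift_lt (hA : 0 ≤ A) (hc : ∀ N ≥ k, ∀ n ≥ N, ∀ m ≥ N,
    eLpNorm (f n - f m) p ν ≤ ENNReal.ofReal (A * (1 / 2) ^ N)) (N n m : ℕ) (hn : N ≤ n)
    (hm : N ≤ m) :
    eLpNorm (f (n + k) - f (m + k)) p ν < ENNReal.ofReal ((A + 1) * (1 / 2) ^ N) := by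
  refine (hc (N + k) (Nat.le_add_left k N) _ (Nat.add_le_add_right hn k) _
    (Nat.add_le_add_right hm k)).trans_lt ?_
  rw [ENNReal.ofReal_lt_ofReal_iff (by positivity)]
  have h1 : ((1 : ℝ) / 2) ^ (N + k) ≤ (1 / 2) ^ N :=
    pow_le_pow_of_le_one (by norm_num) (by norm_num) (Nat.le_add_right N k)
  have h2 : (0 : ℝ) < (1 / 2) ^ N := by positivity
  nlinarith [mul_le_mul_of_nonneg_left h1 hA]

lemma tsum_rate_ne_top (A : ℝ) :
    ∑' N : ℕ, ENNReal.ofReal ((A + 1) * (1 / 2) ^ N) ≠ ⊤ :=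
  ((summable_geometric_of_lt_one (by norm_num) (by norm_num)).mul_left _).tsum_ofReal_ne_top

lemma ae_exists_limit (hf : ∀ n, AEStronglyMeasurable (f n) ν) (hp : 1 ≤ p) (hA : 0 ≤ A)
    (hc : ∀ N ≥ k, ∀ n ≥ N, ∀ m ≥ N,
      eLpNorm (f n - f m) p ν ≤ ENNReal.ofReal (A * (1 / 2) ^ N)) :
    ∀ᵐ x ∂ν, ∃ l, Tendsto (fun n => f n x) atTop (𝓝 l) := by
  filter_upwards [Lp.ae_tendsto_of_cauchy_eLpNorm (f := fun n => f (n + k)) (fun n => hf _) hp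
    (tsum_rate_ne_top A) (eLpNorm_shift_lt hA hc)] with x hx
  obtain ⟨l, hl⟩ := hx
  exact ⟨l, (tendsto_add_atTop_iff_nat (f := fun n => f n x) k).1 hl⟩

lemma tendsto_eLpNorm_of_ae (hf : ∀ n, AEStronglyMeasurable (f n) ν) (hA : 0 ≤ A)
    (hc : ∀ N ≥ k, ∀ n ≥ N, ∀ m ≥ N,
      eLpNorm (f n - f m) p ν ≤ ENNReal.ofReal (A * (1 / 2) ^ N)) {g : X → ℂ}
    (hg : ∀ᵐ x ∂ν, Tendsto (fun n => f n x) atTop (𝓝 (g x))) :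
    Tendsto (fun n => eLpNorm (f n - g) p ν) atTop (𝓝 0) := by
  have := Lp.cauchy_tendsto_of_tendsto (f := fun n => f (n + k)) (p := p) (fun n => hf _) g
    (tsum_rate_ne_top A) (eLpNorm_shift_lt hA hc) (by
      filter_upwards [hg] with x hx
      exact (tendsto_add_atTop_iff_nat (f := fun n => f n x) k).2 hx)
  exact (tendsto_add_atTop_iff_nat (f := fun n => eLpNorm (f n - g) p ν) k).1 this

end limits

/-- The square of the `L²` distance of two pairs of data on `[0, 2 R]`. -/
lemma ofReal_dataCharge {R : ℝ} (hR : 0 ≤ R) {f g : ℝ → ℂ} (hf : ContinuousOn f (Ici 0))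
    (hg : ContinuousOn g (Ici 0)) :
    ENNReal.ofReal (dataCharge R f g)
      = ∫⁻ x in Icc 0 (2 * R), (‖f x‖ₑ ^ 2 + ‖g x‖ₑ ^ 2) := by
  have h0 : 0 ≤ 2 * R := by positivity
  rw [dataCharge, intervalIntegral.integral_of_le h0, ← integral_Icc_eq_integral_Ioc,
    ofReal_integral_eq_lintegral_ofReal]
  · refine lintegral_congr fun x => ?_
    rw [ENNReal.ofReal_add (by positivity) (by positivity), enorm_sq_eq, enorm_sq_eq]
  · have h1 := (hf.mono (fun x (hx : x ∈ Icc 0 (2 * R)) => hx.1)).norm.pow 2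
    have h2 := (hg.mono (fun x (hx : x ∈ Icc 0 (2 * R)) => hx.1)).norm.pow 2
    exact (h1.add h2).integrableOn_compact isCompact_Icc
  · exact Eventually.of_forall fun x => by positivity

lemma enorm_sub_sq_le (a b c : ℂ) : ‖a - b‖ₑ ^ 2 ≤ 2 * ‖a - c‖ₑ ^ 2 + 2 * ‖b - c‖ₑ ^ 2 := by
  simp only [enorm_sq_eq]
  have e : (2 : ENNReal) = ENNReal.ofReal 2 := by simp
  rw [e, ← ENNReal.ofReal_mul (by norm_num), ← ENNReal.ofReal_mul (by norm_num),
    ← ENNReal.ofReal_add (by positivity) (by positivity)]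
  refine ENNReal.ofReal_le_ofReal ?_
  have h1 : ‖a - b‖ ≤ ‖a - c‖ + ‖b - c‖ := by
    have := norm_sub_le_norm_sub_add_norm_sub a c b
    rwa [norm_sub_rev c b] at this
  nlinarith [sq_nonneg (‖a - c‖ - ‖b - c‖), norm_nonneg (a - b)]

/-- Two pairs within distance a of the same data are within 2a of each other. Taking one pair to be
zero turns this into a bound on a charge. -/
lemma dataCharge_sub_le {R : ℝ} (hR : 0 ≤ R) {f g f' g' u₀ v₀ : ℝ → ℂ}
    (hf : ContinuousOn f (Ici 0)) (hg : ContinuousOn g (Ici 0)) (hf' : ContinuousOn f' (Ici 0))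
    (hg' : ContinuousOn g' (Ici 0)) {a : ℝ}
    (h : ∫⁻ x in Icc 0 (2 * R), (‖f x - u₀ x‖ₑ ^ 2 + ‖g x - v₀ x‖ₑ ^ 2)
      ≤ ENNReal.ofReal (a ^ 2))
    (h' : ∫⁻ x in Icc 0 (2 * R), (‖f' x - u₀ x‖ₑ ^ 2 + ‖g' x - v₀ x‖ₑ ^ 2)
      ≤ ENNReal.ofReal (a ^ 2)) (hu₀ : AEStronglyMeasurable u₀ (volume.restrict (Icc 0 (2 * R))))
    (hv₀ : AEStronglyMeasurable v₀ (volume.restrict (Icc 0 (2 * R)))) :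
    dataCharge R (fun x => f x - f' x) (fun x => g x - g' x) ≤ (2 * a) ^ 2 := by
  have key := ofReal_dataCharge hR (hf.sub hf') (hg.sub hg')
  have hfm := (hf.mono (fun x (hx : x ∈ Icc 0 (2 * R)) => hx.1)).aestronglyMeasurable
    measurableSet_Icc (μ := volume)
  have hgm := (hg.mono (fun x (hx : x ∈ Icc 0 (2 * R)) => hx.1)).aestronglyMeasurable
    measurableSet_Icc (μ := volume)
  have hm : AEMeasurable (fun x => 2 * (‖f x - u₀ x‖ₑ ^ 2 + ‖g x - v₀ x‖ₑ ^ 2))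
      (volume.restrict (Icc 0 (2 * R))) :=
    (((hfm.sub hu₀).enorm.pow_const 2).add ((hgm.sub hv₀).enorm.pow_const 2)).const_mul 2
  have hle : ENNReal.ofReal (dataCharge R (fun x => f x - f' x) (fun x => g x - g' x))
      ≤ ENNReal.ofReal ((2 * a) ^ 2) := by
    refine (key.le).trans ?_
    calc ∫⁻ x in Icc 0 (2 * R), (‖f x - f' x‖ₑ ^ 2 + ‖g x - g' x‖ₑ ^ 2)
        ≤ ∫⁻ x in Icc 0 (2 * R), (2 * (‖f x - u₀ x‖ₑ ^ 2 + ‖g x - v₀ x‖ₑ ^ 2)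
          + 2 * (‖f' x - u₀ x‖ₑ ^ 2 + ‖g' x - v₀ x‖ₑ ^ 2)) := by
          refine lintegral_mono fun x => ?_
          refine (add_le_add (enorm_sub_sq_le _ _ (u₀ x)) (enorm_sub_sq_le _ _ (v₀ x))).trans
            (le_of_eq ?_)
          ring
      _ ≤ 2 * ENNReal.ofReal (a ^ 2) + 2 * ENNReal.ofReal (a ^ 2) := by
          rw [lintegral_add_left' hm, lintegral_const_mul' _ _ (by simp),
            lintegral_const_mul' _ _ (by simp)]
          gcongr
      _ = _ := by
          have e : (2 : ENNReal) = ENNReal.ofReal 2 := by simp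
          rw [e, ← ENNReal.ofReal_mul (by norm_num), ← ENNReal.ofReal_add (by positivity)
            (by positivity)]
          congr 1
          ring
  exact (ENNReal.ofReal_le_ofReal_iff (by positivity)).1 hle

end DiracIBVP

/-! ### The weak equations for classical solutions. -/

namespace DiracIBVP

section

variable {z : ℝ → ℝ} {lam : ℝ → ℂ} {R : ℝ} {h k : ℝ → ℝ} {μ : ℝ → ℂ}

namespace IsNullFrame

variable (F : IsNullFrame z lam R h k μ)
include F

lemma hasDerivWithinAt_vertical {w : ℝ × ℝ → ℂ} (hw : ContDiffOn ℝ 1 w (Omega z)) {x r : ℝ}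
    (hx : z R - R ≤ x) (hr : r ∈ Icc (h x) (2 * R)) :
    HasDerivWithinAt (fun r => nullField h (z R - R) (2 * R) w (x, r))
      ((dt z w (toPlane (x, r)) + dx z w (toPlane (x, r))) / 2) (Icc (h x) (2 * R)) r := by
  have hmem : ∀ r ∈ Icc (h x) (2 * R), (x, r) ∈ past h (z R - R) (2 * R) := fun r hr =>
    ⟨hx, hr.1, hr.2⟩
  have hΩ := (F.toPlane_mem_iff.2 (hmem r hr)).1
  have h1 := (hw.differentiableOn one_ne_zero _ hΩ).hasFDerivWithinAt
  have h2 : HasDerivWithinAt (fun r => toPlane (x, r)) (1 / 2, 1 / 2) (Icc (h x) (2 * R)) r :=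
    ((((hasDerivAt_id r).const_add x).div_const 2).prodMk
      (((hasDerivAt_id r).sub_const x).div_const 2)).hasDerivWithinAt
  have h3 := h1.comp_hasDerivWithinAt (f := fun r => toPlane (x, r)) r h2
    (fun r hr => (F.toPlane_mem_iff.2 (hmem r hr)).1)
  have h4 : fderivWithin ℝ w (Omega z) (toPlane (x, r)) (1 / 2, 1 / 2)
      = (dt z w (toPlane (x, r)) + dx z w (toPlane (x, r))) / 2 := by
    have e : ((1 / 2, 1 / 2) : ℝ × ℝ) = (1 / 2 : ℝ) • (((0, 1) : ℝ × ℝ) + (1, 0)) := by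
      ext <;> simp
    rw [e, map_smul, map_add, Complex.real_smul, dt, dx]
    push_cast
    ring
  rw [h4] at h3
  exact h3.congr (fun r hr => F.nullField_eq w (hmem r hr)) (F.nullField_eq w (hmem r hr))

lemma hasDerivWithinAt_horizontal {w : ℝ × ℝ → ℂ} (hw : ContDiffOn ℝ 1 w (Omega z)) {x y r : ℝ}
    (hp : (x, y) ∈ past h (z R - R) (2 * R)) (hr : r ∈ Icc x y) :
    HasDerivWithinAt (fun r => nullField h (z R - R) (2 * R) w (r, y))
      (-(dt z w (toPlane (r, y)) - dx z w (toPlane (r, y))) / 2) (Icc x y) r := by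
  have hmem : ∀ r ∈ Icc x y, (r, y) ∈ past h (z R - R) (2 * R) := fun r hr =>
    F.mirror.past_horizontal hp hr.1 hr.2
  have hΩ := (F.toPlane_mem_iff.2 (hmem r hr)).1
  have h1 := (hw.differentiableOn one_ne_zero _ hΩ).hasFDerivWithinAt
  have h2 : HasDerivWithinAt (fun r => toPlane (r, y)) (1 / 2, -1 / 2) (Icc x y) r :=
    ((((hasDerivAt_id r).add_const y).div_const 2).prodMk
      (((hasDerivAt_id r).const_sub y).div_const 2)).hasDerivWithinAt
  have h3 := h1.comp_hasDerivWithinAt (f := fun r => toPlane (r, y)) r h2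
    (fun r hr => (F.toPlane_mem_iff.2 (hmem r hr)).1)
  have h4 : fderivWithin ℝ w (Omega z) (toPlane (r, y)) (1 / 2, -1 / 2)
      = -(dt z w (toPlane (r, y)) - dx z w (toPlane (r, y))) / 2 := by
    have e : ((1 / 2, -1 / 2) : ℝ × ℝ) = (-(1 / 2) : ℝ) • (((0, 1) : ℝ × ℝ) - (1, 0)) := by
      ext
      · simp
      · simp; norm_num
    rw [e, map_smul, map_sub, Complex.real_smul, dt, dx]
    push_cast
    ring
  rw [h4] at h3
  exact h3.congr (fun r hr => F.nullField_eq w (hmem r hr)) (F.nullField_eq w (hmem r hr))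

lemma nullField_boundary {φ : ℝ × ℝ → ℂ} (hφ : ∀ t, 0 ≤ t → φ (z t, t) = 0) {x : ℝ}
    (hx : z R - R ≤ x) (hx0 : x ≤ 0) : nullField h (z R - R) (2 * R) φ (x, h x) = 0 := by
  have hxh : h x ≤ 2 * R :=
    F.mirror.h_le_of_le F.apex_le hx (hx0.trans ((F.mirror.h_nonneg _).trans F.apex_le))
  have hmem : (x, h x) ∈ past h (z R - R) (2 * R) := ⟨hx, le_rfl, hxh⟩
  obtain ⟨t, ht, rfl⟩ := F.exists_time x hx hx0
  rw [F.nullField_eq φ hmem, F.h_boundary t ht]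
  have e : toPlane (z t - t, z t + t) = (z t, t) := toPlane_toNull (z t, t)
  rw [e, hφ t ht.1]

lemma integral_region_eq {G : ℝ × ℝ → ℂ} :
    ∫ p in region z R, G p
      = (1 / 2) * ∫ q in past h (z R - R) (2 * R), nullField h (z R - R) (2 * R) G q := by
  rw [← F.integral_region]
  exact setIntegral_congr_fun F.isClosed_region.measurableSet fun p hp =>
    (F.nullField_toNull G hp).symm

end IsNullFrame

lemma IsSubluminal.continuousOn_dt_add_dx (hz : IsSubluminal z) {w : ℝ × ℝ → ℂ}
    (hw : ContDiffOn ℝ 1 w (Omega z)) : ContinuousOn (fun p => dt z w p + dx z w p) (Omega z) := by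
  have := hw.continuousOn_fderivWithin hz.uniqueDiffOn le_rfl
  unfold dt dx
  fun_prop

lemma IsSubluminal.continuousOn_dt_sub_dx (hz : IsSubluminal z) {w : ℝ × ℝ → ℂ}
    (hw : ContDiffOn ℝ 1 w (Omega z)) : ContinuousOn (fun p => dt z w p - dx z w p) (Omega z) := by
  have := hw.continuousOn_fderivWithin hz.uniqueDiffOn le_rfl
  unfold dt dx
  fun_prop

lemma continuousOn_N1 (α β : ℝ) {X : Type*} [TopologicalSpace X] {a b : X → ℂ} {s : Set X}
    (ha : ContinuousOn a s) (hb : ContinuousOn b s) :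
    ContinuousOn (fun x => N1 α β (a x) (b x)) s :=
  Continuous.comp_continuousOn (g := fun p : ℂ × ℂ => N1 α β p.1 p.2)
    (f := fun x => (a x, b x)) (continuous_N1 α β) (ha.prodMk hb)

variable {m α β : ℝ} {u v φ : ℝ × ℝ → ℂ} {R₀ : ℝ}

/-- The weak form of the first equation for classical solutions. -/
lemma IsClassicalSolution.weak_fst (S : IsClassicalSolution m α β z u v) (hz : IsSubluminal z)
    (F : IsNullFrame z lam R h k μ) (hφ : IsTestFunction z φ)
    (hsupp : ∀ p ∈ Omega z, φ p ≠ 0 → p ∈ region z R₀) (hR₀ : 0 ≤ R₀) (hR : R₀ < R) :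
    ∫ p in region z R, (Complex.I * u p * (dt z φ p + dx z φ p) - (m : ℂ) * v p * φ p
        + N1 α β (u p) (v p) * φ p) = -Complex.I * ∫ x in (0 : ℝ)..(2 * R), u (x, 0) * φ (x, 0) := by
  have hu := S.contDiffOn_u.continuousOn
  have hv := S.contDiffOn_v.continuousOn
  have hφc := hφ.contDiffOn.continuousOn
  have hηpos : 0 ≤ 2 * R := by linarith
  set G : ℝ × ℝ → ℂ := fun p => Complex.I * u p * (dt z φ p + dx z φ p) - (m : ℂ) * v p * φ p
        + N1 α β (u p) (v p) * φ p with hG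
  have hGc : ContinuousOn G (Omega z) := by
    have h1 := hz.continuousOn_dt_add_dx hφ.contDiffOn
    have h2 := continuousOn_N1 α β hu hv
    exact (((continuousOn_const.mul hu).mul h1).sub ((continuousOn_const.mul hv).mul hφc)).add
      (h2.mul hφc)
  have hGn := F.continuous_nullField hGc
  have hun := F.continuous_nullField hu
  have hφn := F.continuous_nullField hφc
  set ξ₀ := z R - R with hξ₀
  set η₀ := 2 * R with hη₀
  -- The equation makes the integrand the exact derivative 2i ∂_η(u φ), so each vertical slice
  -- reduces to its endpoints.
  have hinner : ∀ x ∈ Icc ξ₀ η₀, ∫ y in h x..η₀, nullField h ξ₀ η₀ G (x, y)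
      = -(2 * Complex.I * (nullField h ξ₀ η₀ u (x, h x) * nullField h ξ₀ η₀ φ (x, h x))) := by
    intro x hx
    have hxh : h x ≤ η₀ := F.mirror.h_le_of_le F.apex_le hx.1 hx.2
    -- The support of φ lies in the region of radius R₀ < R and does not reach the upper edge.
    have htop : nullField h ξ₀ η₀ φ (x, η₀) = 0 := by
      have hm : (x, η₀) ∈ past h ξ₀ η₀ := ⟨hx.1, hxh, le_rfl⟩
      rw [F.nullField_eq φ hm]
      by_contra hne
      have h1 := (hsupp _ (F.toPlane_mem_iff.2 hm).1 hne).2.2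
      have e : (toPlane (x, η₀)).1 + (toPlane (x, η₀)).2 = η₀ := by simp only [toPlane]; ring
      rw [e] at h1
      linarith
    rw [← sub_eq_integral_of_hasDerivWithinAt (s := Icc (h x) η₀)
      (g := fun y => 2 * Complex.I * (nullField h ξ₀ η₀ u (x, y) * nullField h ξ₀ η₀ φ (x, y)))
      (g' := fun y => nullField h ξ₀ η₀ G (x, y)) ordConnected_Icc (by fun_prop)
      (fun r hr => ?_) (left_mem_Icc.2 hxh) (right_mem_Icc.2 hxh)]
    · rw [htop]; ring
    · have hm : (x, r) ∈ past h ξ₀ η₀ := ⟨hx.1, hr.1, hr.2⟩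
      have d1 := F.hasDerivWithinAt_vertical S.contDiffOn_u hx.1 hr
      have d2 := F.hasDerivWithinAt_vertical hφ.contDiffOn hx.1 hr
      refine ((d1.mul d2).const_mul (2 * Complex.I)).congr_deriv ?_
      rw [F.nullField_eq u hm, F.nullField_eq φ hm, F.nullField_eq G hm]
      simp only [hG]
      linear_combination φ (toPlane (x, r)) * S.eq_u _ (F.toPlane_mem_iff.2 hm).1
  have hcont : Continuous fun x => -(2 * Complex.I *
      (nullField h ξ₀ η₀ u (x, h x) * nullField h ξ₀ η₀ φ (x, h x))) := by
    have := F.mirror.continuous_h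
    fun_prop
  rw [F.integral_region_eq, F.mirror.integral_past_vertical hGn.continuousOn F.apex_le]
  rw [intervalIntegral.integral_congr (g := fun x => -(2 * Complex.I *
      (nullField h ξ₀ η₀ u (x, h x) * nullField h ξ₀ η₀ φ (x, h x)))) fun x hx => ?_]
  · rw [← intervalIntegral.integral_add_adjacent_intervals (hcont.intervalIntegrable ξ₀ 0)
      (hcont.intervalIntegrable 0 η₀)]
    -- On the mirror φ vanishes, so the boundary values of u do not enter.
    have e1 : ∫ x in ξ₀..0, -(2 * Complex.I *
        (nullField h ξ₀ η₀ u (x, h x) * nullField h ξ₀ η₀ φ (x, h x))) = 0 := by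
      rw [intervalIntegral.integral_congr (g := fun _ => (0 : ℂ)) fun x hx => ?_]
      · simp
      · rw [uIcc_of_le F.left_nonpos] at hx
        have hb : nullField h ξ₀ η₀ φ (x, h x) = 0 := F.nullField_boundary hφ.boundary hx.1 hx.2
        simp only [hb, mul_zero, neg_zero]
    have e2 : ∫ x in 0..η₀, -(2 * Complex.I *
        (nullField h ξ₀ η₀ u (x, h x) * nullField h ξ₀ η₀ φ (x, h x)))
        = -(2 * Complex.I * ∫ x in 0..η₀, u (x, 0) * φ (x, 0)) := by
      rw [← intervalIntegral.integral_const_mul, ← intervalIntegral.integral_neg]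
      refine intervalIntegral.integral_congr fun x hx => ?_
      rw [uIcc_of_le hηpos] at hx
      simp only [F.mirror.h_of_nonneg x hx.1]
      rw [F.nullField_diag u hx.1 hx.2, F.nullField_diag φ hx.1 hx.2]
    rw [e1, e2]
    ring
  · rw [uIcc_of_le ((F.mirror.le_h _).trans F.apex_le)] at hx
    exact hinner x hx

/-- The weak form of the second equation for classical solutions. -/
lemma IsClassicalSolution.weak_snd (S : IsClassicalSolution m α β z u v) (hz : IsSubluminal z)
    (F : IsNullFrame z lam R h k μ) (hφ : IsTestFunction z φ)
    (hsupp : ∀ p ∈ Omega z, φ p ≠ 0 → p ∈ region z R₀) (hR₀ : 0 ≤ R₀) (hR : R₀ < R)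
    (hzR : z R - R < z R₀ - R₀) :
    ∫ p in region z R, (Complex.I * v p * (dt z φ p - dx z φ p) - (m : ℂ) * u p * φ p
        + N2 α β (u p) (v p) * φ p) = -Complex.I * ∫ x in (0 : ℝ)..(2 * R), v (x, 0) * φ (x, 0) := by
  have hu := S.contDiffOn_u.continuousOn
  have hv := S.contDiffOn_v.continuousOn
  have hφc := hφ.contDiffOn.continuousOn
  have hηpos : 0 ≤ 2 * R := by linarith
  set G : ℝ × ℝ → ℂ := fun p => Complex.I * v p * (dt z φ p - dx z φ p) - (m : ℂ) * u p * φ p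
        + N2 α β (u p) (v p) * φ p with hG
  have hGc : ContinuousOn G (Omega z) := by
    have h1 := hz.continuousOn_dt_sub_dx hφ.contDiffOn
    have h2 := continuousOn_N1 α β hv hu
    simp only [← N2_eq_N1] at h2
    exact (((continuousOn_const.mul hv).mul h1).sub ((continuousOn_const.mul hu).mul hφc)).add
      (h2.mul hφc)
  have hGn := F.continuous_nullField hGc
  have hvn := F.continuous_nullField hv
  have hφn := F.continuous_nullField hφc
  set ξ₀ := z R - R with hξ₀
  set η₀ := 2 * R with hη₀
  -- Here the integrand is -2i ∂_ξ(v φ), integrated along horizontal slices whose right end lies on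
  -- the initial line.
  have hinner : ∀ y ∈ Icc 0 η₀, ∫ x in max ξ₀ (k y)..y, nullField h ξ₀ η₀ G (x, y)
      = -(2 * Complex.I * (v (y, 0) * φ (y, 0))) := by
    intro y hy
    have hky := F.mirror.k_nonpos y hy.1
    have hley : max ξ₀ (k y) ≤ y := max_le (F.left_nonpos.trans hy.1) (hky.trans hy.1)
    have hm0 : (max ξ₀ (k y), y) ∈ past h ξ₀ η₀ :=
      ⟨le_max_left _ _, (F.mirror.h_le_iff hy.1).2 ⟨le_max_right _ _, hley⟩, hy.2⟩
    -- The left end lies either on the mirror, where φ vanishes, or on the edge ξ = ξ₀, which `hzR`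
    -- keeps strictly away from the support.
    have hleft : nullField h ξ₀ η₀ φ (max ξ₀ (k y), y) = 0 := by
      rcases le_total ξ₀ (k y) with hle | hle
      · rw [max_eq_right hle]
        have := F.nullField_boundary hφ.boundary hle hky
        rwa [F.mirror.h_k y hy.1] at this
      · rw [max_eq_left hle] at hm0 ⊢
        rw [F.nullField_eq φ hm0]
        by_contra hne
        have h1 := (hsupp _ (F.toPlane_mem_iff.2 hm0).1 hne).2.1
        have e : (toPlane (ξ₀, y)).1 - (toPlane (ξ₀, y)).2 = ξ₀ := by simp only [toPlane]; ring
        rw [e] at h1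
        linarith
    rw [← sub_eq_integral_of_hasDerivWithinAt (s := Icc (max ξ₀ (k y)) y)
      (g := fun x => -(2 * Complex.I) *
        (nullField h ξ₀ η₀ v (x, y) * nullField h ξ₀ η₀ φ (x, y)))
      (g' := fun x => nullField h ξ₀ η₀ G (x, y)) ordConnected_Icc (by fun_prop)
      (fun r hr => ?_) (left_mem_Icc.2 hley) (right_mem_Icc.2 hley)]
    · rw [hleft, F.nullField_diag v hy.1 hy.2, F.nullField_diag φ hy.1 hy.2]; ring
    · have hm : (r, y) ∈ past h ξ₀ η₀ := F.mirror.past_horizontal hm0 hr.1 hr.2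
      have d1 := F.hasDerivWithinAt_horizontal S.contDiffOn_v hm0 hr
      have d2 := F.hasDerivWithinAt_horizontal hφ.contDiffOn hm0 hr
      refine ((d1.mul d2).const_mul (-(2 * Complex.I))).congr_deriv ?_
      rw [F.nullField_eq v hm, F.nullField_eq φ hm, F.nullField_eq G hm]
      simp only [hG]
      linear_combination φ (toPlane (r, y)) * S.eq_v _ (F.toPlane_mem_iff.2 hm).1
  rw [F.integral_region_eq, F.mirror.integral_past_horizontal hGn.continuousOn F.apex_le,
    max_eq_right F.left_nonpos]
  rw [intervalIntegral.integral_congr (g := fun y => -(2 * Complex.I * (v (y, 0) * φ (y, 0))))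
    fun y hy => ?_]
  · rw [intervalIntegral.integral_neg, intervalIntegral.integral_const_mul]
    ring
  · rw [uIcc_of_le hηpos] at hy
    exact hinner y hy

end

end DiracIBVP

/-! ### Limits of integrals, and stability in terms of the distance to the data. -/

namespace DiracIBVP

/-- Strictness is needed to enlarge a region so that the support of a test function avoids the new
left edge. -/
lemma IsSubluminal.sub_lt_sub {z : ℝ → ℝ} (hz : IsSubluminal z) {s t : ℝ} (hs : 0 ≤ s)
    (hst : s < t) : z t - t < z s - s := by
  have hd : ∀ r ∈ interior (Ici (0 : ℝ)), HasDerivAt z (timeDeriv z r) r := by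
    intro r hr
    rw [interior_Ici] at hr
    exact ((hz.contDiffOn.differentiableOn one_ne_zero r
      (mem_Ici.2 (le_of_lt hr))).hasDerivWithinAt).hasDerivAt (Ici_mem_nhds hr)
  have h1 := strictMonoOn_of_hasDerivWithinAt_pos (convex_Ici (0 : ℝ))
    (f := fun t => t - z t) (f' := fun t => 1 - timeDeriv z t)
    (continuousOn_id.sub hz.contDiffOn.continuousOn)
    (fun r hr => ((hasDerivAt_id r).sub (hd r hr)).hasDerivWithinAt)
    (fun r hr => by have := (hz.deriv_mem r (interior_subset hr)).2; linarith)
    (mem_Ici.2 hs) (mem_Ici.2 (hs.trans hst.le)) hst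
  simp only at h1
  linarith

lemma IsSubluminal.iUnion_region {z : ℝ → ℝ} (hz : IsSubluminal z) :
    ⋃ k : ℕ, region z ((k : ℝ) + 1) = Omega z := by
  refine Subset.antisymm (iUnion_subset fun k p hp => hp.1) fun p hp => ?_
  obtain ⟨k, hk⟩ := exists_nat_ge (|p.1| + |p.2|)
  have h1 := le_abs_self p.1
  have h2 := le_abs_self p.2
  have h3 := abs_nonneg p.1
  have h4 := abs_nonneg p.2
  exact mem_iUnion.2 ⟨k, hz.mem_region hp (by linarith) (by linarith)⟩

section limits

variable {X : Type*} [MeasurableSpace X] {ν : Measure X}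

lemma integrable_mul_bounded {f g : X → ℂ} (hf : Integrable f ν) (hg : AEStronglyMeasurable g ν)
    {B : ℝ} (hB : ∀ᵐ x ∂ν, ‖g x‖ ≤ B) : Integrable (fun x => f x * g x) ν :=
  hf.mul_bdd hg hB

lemma tendsto_integral_mul_bounded {f : ℕ → X → ℂ} {f' g : X → ℂ}
    (hf : ∀ n, Integrable (f n) ν) (hf' : Integrable f' ν) (hg : AEStronglyMeasurable g ν)
    {B : ℝ} (hB : ∀ᵐ x ∂ν, ‖g x‖ ≤ B)
    (hlim : Tendsto (fun n => eLpNorm (f n - f') 1 ν) atTop (𝓝 0)) :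
    Tendsto (fun n => ∫ x, f n x * g x ∂ν) atTop (𝓝 (∫ x, f' x * g x ∂ν)) := by
  refine tendsto_integral_of_L1 _ (integrable_mul_bounded hf' hg hB).aestronglyMeasurable
    (Eventually.of_forall fun n => integrable_mul_bounded (hf n) hg hB) ?_
  have h0 : Tendsto (fun n => ENNReal.ofReal B * eLpNorm (f n - f') 1 ν) atTop (𝓝 0) := by
    have := ENNReal.Tendsto.const_mul hlim (Or.inr (ENNReal.ofReal_ne_top (r := B)))
    rwa [mul_zero] at this
  refine tendsto_of_tendsto_of_tendsto_of_le_of_le tendsto_const_nhds h0 (fun _ => zero_le)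
    fun n => ?_
  simp only
  rw [eLpNorm_one_eq_lintegral_enorm, ← lintegral_const_mul' _ _ ENNReal.ofReal_ne_top]
  refine lintegral_mono_ae ?_
  filter_upwards [hB] with x hx
  rw [← sub_mul, enorm_mul, mul_comm]
  refine mul_le_mul' ?_ le_rfl
  rw [← ofReal_norm]
  exact ENNReal.ofReal_le_ofReal hx

lemma tendsto_eLpNorm_one_of_two [IsFiniteMeasure ν] {f : ℕ → X → ℂ} {f' : X → ℂ}
    (hf : ∀ n, AEStronglyMeasurable (f n) ν) (hf' : AEStronglyMeasurable f' ν)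
    (hlim : Tendsto (fun n => eLpNorm (f n - f') 2 ν) atTop (𝓝 0)) :
    Tendsto (fun n => eLpNorm (f n - f') 1 ν) atTop (𝓝 0) := by
  set c : ENNReal := ν univ ^ (1 / (1 : ENNReal).toReal - 1 / (2 : ENNReal).toReal) with hc
  have hct : c ≠ ⊤ := ENNReal.rpow_ne_top_of_nonneg (by norm_num) (measure_ne_top _ _)
  have h0 : Tendsto (fun n => eLpNorm (f n - f') 2 ν * c) atTop (𝓝 0) := by
    have := ENNReal.Tendsto.mul_const hlim (Or.inr hct)
    rwa [zero_mul] at this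
  exact tendsto_of_tendsto_of_tendsto_of_le_of_le tendsto_const_nhds h0 (fun _ => zero_le)
    fun n => eLpNorm_le_eLpNorm_mul_rpow_measure_univ one_le_two ((hf n).sub hf')

/-- Passage to the limit in the weak form of a transport equation. -/
lemma tendsto_integral_weak (m : ℝ) {f g w : ℕ → X → ℂ} {f' g' w' a φ : X → ℂ}
    (hf : ∀ n, Integrable (f n) ν) (hf' : Integrable f' ν)
    (hg : ∀ n, Integrable (g n) ν) (hg' : Integrable g' ν)
    (hw : ∀ n, Integrable (w n) ν) (hw' : Integrable w' ν)
    (ha : AEStronglyMeasurable a ν) (hφ : AEStronglyMeasurable φ ν) {A B : ℝ}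
    (hA : ∀ᵐ x ∂ν, ‖a x‖ ≤ A) (hB : ∀ᵐ x ∂ν, ‖φ x‖ ≤ B)
    (lf : Tendsto (fun n => eLpNorm (f n - f') 1 ν) atTop (𝓝 0))
    (lg : Tendsto (fun n => eLpNorm (g n - g') 1 ν) atTop (𝓝 0))
    (lw : Tendsto (fun n => eLpNorm (w n - w') 1 ν) atTop (𝓝 0)) :
    Integrable (fun x => Complex.I * f' x * a x - (m : ℂ) * g' x * φ x + w' x * φ x) ν ∧
    Tendsto (fun n => ∫ x, (Complex.I * f n x * a x - (m : ℂ) * g n x * φ x + w n x * φ x) ∂ν)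
      atTop (𝓝 (∫ x, (Complex.I * f' x * a x - (m : ℂ) * g' x * φ x + w' x * φ x) ∂ν)) := by
  have key : ∀ {f g w : X → ℂ}, Integrable f ν → Integrable g ν → Integrable w ν →
      Integrable (fun x => Complex.I * f x * a x - (m : ℂ) * g x * φ x + w x * φ x) ν ∧
      ∫ x, (Complex.I * f x * a x - (m : ℂ) * g x * φ x + w x * φ x) ∂ν
        = Complex.I * (∫ x, f x * a x ∂ν) - m * (∫ x, g x * φ x ∂ν) + ∫ x, w x * φ x ∂ν := by
    intro f g w hf hg hw
    have i1 := (integrable_mul_bounded hf ha hA).const_mul Complex.I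
    have i2 := (integrable_mul_bounded hg hφ hB).const_mul (m : ℂ)
    have i3 := integrable_mul_bounded hw hφ hB
    simp only [mul_assoc]
    refine ⟨(i1.sub i2).add i3, ?_⟩
    have e1 := integral_add (i1.sub i2) i3
    simp only [Pi.sub_apply] at e1
    rw [e1, integral_sub i1 i2, integral_const_mul, integral_const_mul]
  refine ⟨(key hf' hg' hw').1, ?_⟩
  rw [(key hf' hg' hw').2]
  simp only [fun n => (key (hf n) (hg n) (hw n)).2]
  exact (((tendsto_integral_mul_bounded hf hf' ha hA lf).const_mul _).sub
    ((tendsto_integral_mul_bounded hg hg' hφ hB lg).const_mul _)).add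
    (tendsto_integral_mul_bounded hw hw' hφ hB lw)

end limits

/-- The distance of initial data, on `[0, N]`, as an extended square. -/
noncomputable def dataError (N : ℝ) (u v : ℝ × ℝ → ℂ) (u₀ v₀ : ℝ → ℂ) : ENNReal :=
  ∫⁻ x in Icc 0 N, (‖u (x, 0) - u₀ x‖ₑ ^ 2 + ‖v (x, 0) - v₀ x‖ₑ ^ 2)

lemma dataError_mono {N N' : ℝ} (h : N ≤ N') (u v : ℝ × ℝ → ℂ) (u₀ v₀ : ℝ → ℂ) :
    dataError N u v u₀ v₀ ≤ dataError N' u v u₀ v₀ :=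
  lintegral_mono_set (Icc_subset_Icc_right h)

variable {m α β : ℝ} {z : ℝ → ℝ} {lam : ℝ → ℂ} {u₀ v₀ : ℝ → ℂ}

lemma IsSubluminal.continuousOn_base (hz : IsSubluminal z) {w : ℝ × ℝ → ℂ}
    (hw : ContinuousOn w (Omega z)) : ContinuousOn (fun x => w (x, 0)) (Ici 0) :=
  hw.comp (by fun_prop) fun x hx => ⟨le_rfl, by rw [hz.zero]; exact hx⟩

/-- Approximation by classical solutions. -/
lemma exists_approximating_solutions (hm : 0 ≤ m) (α β : ℝ) (hz : IsSubluminal z)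
    (hF : ∀ R : ℝ, 0 < R → ∃ h k μ, IsNullFrame z lam R h k μ)
    (hu₀ : L2locHalfLine u₀) (hv₀ : L2locHalfLine v₀) {N δ : ℝ} (hN : 0 < N) (hδ : 0 < δ) :
    ∃ u v, IsClassicalSolution m α β z u v ∧ (∀ t, 0 ≤ t → u (z t, t) = lam t * v (z t, t)) ∧
      dataError N u v u₀ v₀ ≤ ENNReal.ofReal (δ ^ 2) := by
  obtain ⟨f, f', ε, hε, hf, hf', hf0, hfe⟩ := exists_smooth_approx (hu₀ N hN) (half_pos hδ)
  obtain ⟨g, g', ε', hε', hg, hg', hg0, hge⟩ := exists_smooth_approx (hv₀ N hN) (half_pos hδ)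
  obtain ⟨u, v, S, hb, hbase⟩ := exists_isClassicalSolution hm α β hz hF hf hf' hg hg'
    (lt_min hε hε') (fun x hx => hf0 x (hx.trans (min_le_left _ _)))
    (fun x hx => hg0 x (hx.trans (min_le_right _ _)))
  refine ⟨u, v, S, hb, ?_⟩
  have hfc : Continuous f := continuous_iff_continuousAt.2 fun x => (hf x).continuousAt
  have hm : AEMeasurable (fun x => ‖f x - u₀ x‖ₑ ^ 2) (volume.restrict (Icc 0 N)) :=
    (hfc.aestronglyMeasurable.sub (hu₀ N hN).1).enorm.pow_const 2
  calc dataError N u v u₀ v₀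
      = ∫⁻ x in Icc 0 N, (‖f x - u₀ x‖ₑ ^ 2 + ‖g x - v₀ x‖ₑ ^ 2) := by
        refine setLIntegral_congr_fun measurableSet_Icc fun x hx => ?_
        simp only [(hbase x hx.1).1, (hbase x hx.1).2]
    _ ≤ ENNReal.ofReal ((δ / 2) ^ 2) + ENNReal.ofReal ((δ / 2) ^ 2) := by
        rw [lintegral_add_left' hm]
        exact add_le_add hfe hge
    _ ≤ _ := by
        rw [← ENNReal.ofReal_add (by positivity) (by positivity)]
        refine ENNReal.ofReal_le_ofReal ?_
        nlinarith [sq_nonneg δ]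

/-- Stability of classical solutions in terms of the distance to given data. -/
lemma exists_stability_of_dataError (hm : 0 ≤ m) (α β : ℝ) (hz : IsSubluminal z)
    (hF : ∀ R : ℝ, 0 < R → ∃ h k μ, IsNullFrame z lam R h k μ)
    (hu₀ : L2locHalfLine u₀) (hv₀ : L2locHalfLine v₀) {R : ℝ} (hR : 0 < R) :
    ∃ C, 0 ≤ C ∧ ∀ u v u' v' : ℝ × ℝ → ℂ,
      IsClassicalSolution m α β z u v → IsClassicalSolution m α β z u' v' →
      (∀ t, 0 ≤ t → u (z t, t) = lam t * v (z t, t)) →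
      (∀ t, 0 ≤ t → u' (z t, t) = lam t * v' (z t, t)) → ∀ a, 0 ≤ a → a ≤ 1 →
      dataError (2 * R) u v u₀ v₀ ≤ ENNReal.ofReal (a ^ 2) →
      dataError (2 * R) u' v' u₀ v₀ ≤ ENNReal.ofReal (a ^ 2) →
      eLpNorm (u - u') 2 (volume.restrict (region z R)) ≤ ENNReal.ofReal (C * a) ∧
      eLpNorm (v - v') 2 (volume.restrict (region z R)) ≤ ENNReal.ofReal (C * a) ∧
      eLpNorm ((fun p => N1 α β (u p) (v p)) - fun p => N1 α β (u' p) (v' p)) 1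
        (volume.restrict (region z R)) ≤ ENNReal.ofReal (C * a) ∧
      eLpNorm ((fun p => N1 α β (v p) (u p)) - fun p => N1 α β (v' p) (u' p)) 1
        (volume.restrict (region z R)) ≤ ENNReal.ofReal (C * a) ∧
      ∫⁻ p in region z R, ‖u' p‖ₑ ^ 2 * ‖v' p‖ₑ ^ 2 ≤ ENNReal.ofReal (C ^ 2) := by
  obtain ⟨h, k, μ, F⟩ := hF R hR
  have h2R : 0 < 2 * R := by positivity
  have mu₀ := (hu₀ (2 * R) h2R).1
  have mv₀ := (hv₀ (2 * R) h2R).1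
  -- D is the squared distance of the data from zero. As a ≤ 1 ≤ A, the zero pair and both solutions
  -- start within A of the data, so all charges are at most (2A)².
  set D := ∫⁻ x in Icc 0 (2 * R), (‖(0 : ℂ) - u₀ x‖ₑ ^ 2 + ‖(0 : ℂ) - v₀ x‖ₑ ^ 2) with hD
  have hDt : D ≠ ⊤ := by
    have hm : AEMeasurable (fun x => ‖(0 : ℂ) - u₀ x‖ₑ ^ 2) (volume.restrict (Icc 0 (2 * R))) :=
      (aestronglyMeasurable_const.sub mu₀).enorm.pow_const 2
    rw [hD, lintegral_add_left' hm]
    simp only [zero_sub, enorm_neg]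
    rw [lintegral_enorm_sq, lintegral_enorm_sq]
    exact ENNReal.add_ne_top.2 ⟨ENNReal.pow_ne_top (hu₀ _ h2R).2.ne,
      ENNReal.pow_ne_top (hv₀ _ h2R).2.ne⟩
  set A := 1 + D.toReal with hA
  have hA1 : 1 ≤ A := le_add_of_nonneg_right ENNReal.toReal_nonneg
  have hDA : D ≤ ENNReal.ofReal (A ^ 2) := by
    rw [← ENNReal.ofReal_toReal hDt]
    refine ENNReal.ofReal_le_ofReal ?_
    have : (0 : ℝ) ≤ D.toReal := ENNReal.toReal_nonneg
    nlinarith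
  obtain ⟨C, hC, hst⟩ := exists_classical_stability hm α β F hR.le ((2 * A) ^ 2)
  refine ⟨2 * C, by positivity, fun u v u' v' S S' hb hb' a ha0 ha1 he he' => ?_⟩
  have cu := hz.continuousOn_base S.contDiffOn_u.continuousOn
  have cv := hz.continuousOn_base S.contDiffOn_v.continuousOn
  have cu' := hz.continuousOn_base S'.contDiffOn_u.continuousOn
  have cv' := hz.continuousOn_base S'.contDiffOn_v.continuousOn
  have haA : ENNReal.ofReal (a ^ 2) ≤ ENNReal.ofReal (A ^ 2) :=
    ENNReal.ofReal_le_ofReal (by nlinarith)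
  have hE := dataCharge_sub_le hR.le cu cv continuousOn_const continuousOn_const
    (he.trans haA) hDA mu₀ mv₀
  have hE' := dataCharge_sub_le hR.le cu' cv' continuousOn_const continuousOn_const
    (he'.trans haA) hDA mu₀ mv₀
  simp only [sub_zero] at hE hE'
  have hd := dataCharge_sub_le hR.le cu cv cu' cv' he he' mu₀ mv₀
  obtain ⟨s1, s2, s3, s4, s5⟩ := hst u v u' v' S S' hb hb' hE hE' (2 * a) (by positivity) hd
  have e : C * (2 * a) = 2 * C * a := by ring
  rw [e] at s1 s2 s3 s4
  rw [eLpNorm_two_le_iff (by positivity), eLpNorm_two_le_iff (by positivity),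
    eLpNorm_one_eq_lintegral_enorm, eLpNorm_one_eq_lintegral_enorm]
  refine ⟨s1, s2, s3, s4, s5.trans (ENNReal.ofReal_le_ofReal ?_)⟩
  nlinarith

end DiracIBVP

/-! ### Construction of the limit for square integrable data. -/

namespace DiracIBVP

variable {m α β : ℝ} {z : ℝ → ℝ} {lam : ℝ → ℂ} {u₀ v₀ : ℝ → ℂ}

lemma isCompact_region
    (hF : ∀ R : ℝ, 0 < R → ∃ h k μ, IsNullFrame z lam R h k μ) (R : ℝ) (hR : 0 < R) :
    IsCompact (region z R) := by
  obtain ⟨h, k, μ, F⟩ := hF R hR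
  exact F.isCompact_region

lemma tendsto_N1 (α β : ℝ) {a b : ℕ → ℂ} {a' b' : ℂ} (ha : Tendsto a atTop (𝓝 a'))
    (hb : Tendsto b atTop (𝓝 b')) :
    Tendsto (fun n => N1 α β (a n) (b n)) atTop (𝓝 (N1 α β a' b')) :=
  Tendsto.comp (g := fun p : ℂ × ℂ => N1 α β p.1 p.2) (f := fun n => (a n, b n))
    ((continuous_N1 α β).tendsto (a', b')) (ha.prodMk_nhds hb)

/-- The boundary condition extends to the corner. -/
lemma IsClassicalSolution.boundary_of_pos {u v : ℝ × ℝ → ℂ} (S : IsClassicalSolution m α β z u v)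
    (hz : IsSubluminal z) (hlam : ContinuousOn lam (Ici 0))
    (hb : ∀ t, 0 < t → u (z t, t) = lam t * v (z t, t)) (t : ℝ) (ht : 0 ≤ t) :
    u (z t, t) = lam t * v (z t, t) := by
  have hc : ∀ {w : ℝ × ℝ → ℂ}, ContDiffOn ℝ 1 w (Omega z) →
      ContinuousOn (fun t => w (z t, t)) (Ici 0) := fun hw =>
    hw.continuousOn.comp (hz.contDiffOn.continuousOn.prodMk continuousOn_id)
      fun s hs => ⟨hs, le_rfl⟩
  -- Strong solutions impose the condition for t > 0 only, while the stability estimates use it at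
  -- the corner too; both sides are continuous up to t = 0.
  refine Set.EqOn.of_subset_closure (s := Ioi (0 : ℝ)) (t := Ici 0) (fun s hs => hb s hs)
    (hc S.contDiffOn_u) (hlam.mul (hc S.contDiffOn_v)) Ioi_subset_Ici_self ?_ ht
  rw [closure_Ioi]

/-- A pair of functions together with a fast approximation by classical solutions. -/
structure IsFastLimit (m α β : ℝ) (z : ℝ → ℝ) (lam : ℝ → ℂ) (u₀ v₀ : ℝ → ℂ)
    (un vn : ℕ → ℝ × ℝ → ℂ) (u v : ℝ × ℝ → ℂ) : Prop where
  sol : ∀ n, IsClassicalSolution m α β z (un n) (vn n)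
  boundary : ∀ n t, 0 ≤ t → un n (z t, t) = lam t * vn n (z t, t)
  data : ∀ k n : ℕ, k ≤ n → dataError (2 * ((k : ℝ) + 1)) (un n) (vn n) u₀ v₀
    ≤ ENNReal.ofReal (((1 / 2) ^ n) ^ 2)
  meas_u : AEStronglyMeasurable u (volume.restrict (Omega z))
  meas_v : AEStronglyMeasurable v (volume.restrict (Omega z))
  ae_u : ∀ᵐ p ∂volume.restrict (Omega z), Tendsto (fun n => un n p) atTop (𝓝 (u p))
  ae_v : ∀ᵐ p ∂volume.restrict (Omega z), Tendsto (fun n => vn n p) atTop (𝓝 (v p))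
  lim_u : ∀ k : ℕ, Tendsto
    (fun n => eLpNorm (un n - u) 2 (volume.restrict (region z ((k : ℝ) + 1)))) atTop (𝓝 0)
  lim_v : ∀ k : ℕ, Tendsto
    (fun n => eLpNorm (vn n - v) 2 (volume.restrict (region z ((k : ℝ) + 1)))) atTop (𝓝 0)
  lim_N1 : ∀ k : ℕ, Tendsto (fun n => eLpNorm ((fun p => N1 α β (un n p) (vn n p))
    - fun p => N1 α β (u p) (v p)) 1 (volume.restrict (region z ((k : ℝ) + 1)))) atTop (𝓝 0)
  lim_N2 : ∀ k : ℕ, Tendsto (fun n => eLpNorm ((fun p => N1 α β (vn n p) (un n p))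
    - fun p => N1 α β (v p) (u p)) 1 (volume.restrict (region z ((k : ℝ) + 1)))) atTop (𝓝 0)
  product : ∀ k : ℕ, ∃ C : ℝ, ∀ n ≥ k,
    ∫⁻ p in region z ((k : ℝ) + 1), ‖un n p‖ₑ ^ 2 * ‖vn n p‖ₑ ^ 2 ≤ ENNReal.ofReal C

set_option maxHeartbeats 1000000 in
theorem exists_isFastLimit (hm : 0 ≤ m) (α β : ℝ) (hz : IsSubluminal z)
    (hF : ∀ R : ℝ, 0 < R → ∃ h k μ, IsNullFrame z lam R h k μ)
    (hu₀ : L2locHalfLine u₀) (hv₀ : L2locHalfLine v₀) :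
    ∃ un vn u v, IsFastLimit m α β z lam u₀ v₀ un vn u v := by
  -- The n-th solution approximates the data on an interval growing with n, with geometric error; on
  -- each fixed region the sequence is therefore fast Cauchy from some index on.
  choose un vn hS hb he using fun n : ℕ => exists_approximating_solutions hm α β hz hF hu₀ hv₀
    (N := 2 * ((n : ℝ) + 1)) (δ := (1 / 2) ^ n) (by positivity) (by positivity)
  choose C hC hst using fun k : ℕ => exists_stability_of_dataError hm α β hz hF hu₀ hv₀
    (R := (k : ℝ) + 1) (by positivity)
  have herr : ∀ k N n : ℕ, k ≤ n → N ≤ n → dataError (2 * ((k : ℝ) + 1)) (un n) (vn n) u₀ v₀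
      ≤ ENNReal.ofReal (((1 / 2) ^ N) ^ 2) := by
    intro k N n hk hn
    have hkn : (k : ℝ) ≤ n := by exact_mod_cast hk
    refine (dataError_mono (by linarith) _ _ _ _).trans ((he n).trans ?_)
    refine ENNReal.ofReal_le_ofReal (pow_le_pow_left₀ (by positivity) ?_ 2)
    exact pow_le_pow_of_le_one (by norm_num) (by norm_num) hn
  have hrate := fun (k N : ℕ) (hN : N ≥ k) (n : ℕ) (hn : n ≥ N) (n' : ℕ) (hn' : n' ≥ N) =>
    hst k _ _ _ _ (hS n) (hS n') (hb n) (hb n') ((1 / 2) ^ N) (by positivity)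
      (pow_le_one₀ (by norm_num) (by norm_num)) (herr k N n (hN.trans hn) hn)
      (herr k N n' (hN.trans hn') hn')
  have hcpt := fun k : ℕ => isCompact_region hF ((k : ℝ) + 1) (by positivity)
  have hcu := fun n => (hS n).contDiffOn_u.continuousOn
  have hcv := fun n => (hS n).contDiffOn_v.continuousOn
  have hmeas : ∀ {w : ℝ × ℝ → ℂ}, ContinuousOn w (Omega z) → ∀ k : ℕ,
      AEStronglyMeasurable w (volume.restrict (region z ((k : ℝ) + 1))) := fun hw k =>
    (hw.mono fun p hp => hp.1).aestronglyMeasurable (hcpt k).measurableSet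
  have hmono : ∀ k : ℕ, volume.restrict (region z ((k : ℝ) + 1)) ≤ volume.restrict (Omega z) :=
    fun k => Measure.restrict_mono (fun p hp => hp.1) le_rfl
  -- The limit is defined pointwise without reference to a region, so almost everywhere convergence
  -- on countably many regions gives it on all of Ω.
  have hae : ∀ {w : ℕ → ℝ × ℝ → ℂ}, (∀ n, ContinuousOn (w n) (Omega z)) →
      (∀ k N : ℕ, N ≥ k → ∀ n ≥ N, ∀ n' ≥ N,
        eLpNorm (w n - w n') 2 (volume.restrict (region z ((k : ℝ) + 1)))
          ≤ ENNReal.ofReal (C k * (1 / 2) ^ N)) →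
      ∀ᵐ p ∂volume.restrict (Omega z),
        Tendsto (fun n => w n p) atTop (𝓝 (limUnder atTop fun n => w n p)) := by
    intro w hw hr
    rw [← hz.iUnion_region, ae_restrict_iUnion_iff]
    intro k
    filter_upwards [ae_exists_limit (fun n => hmeas (hw n) k) one_le_two (hC k) (hr k)] with p hp
    exact tendsto_nhds_limUnder hp
  have aeu := hae hcu fun k N hN n hn n' hn' => (hrate k N hN n hn n' hn').1
  have aev := hae hcv fun k N hN n hn n' hn' => (hrate k N hN n hn n' hn').2.1
  have hΩ := hz.isClosed_Omega.measurableSet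
  refine ⟨un, vn, fun p => limUnder atTop fun n => un n p, fun p => limUnder atTop fun n => vn n p,
    hS, hb, fun k n hk => herr k n n hk le_rfl,
    aestronglyMeasurable_of_tendsto_ae atTop (fun n => (hcu n).aestronglyMeasurable hΩ) aeu,
    aestronglyMeasurable_of_tendsto_ae atTop (fun n => (hcv n).aestronglyMeasurable hΩ) aev,
    aeu, aev, fun k => ?_, fun k => ?_, fun k => ?_, fun k => ?_, fun k => ?_⟩
  · exact tendsto_eLpNorm_of_ae (fun n => hmeas (hcu n) k) (hC k)
      (fun N hN n hn n' hn' => (hrate k N hN n hn n' hn').1) (ae_mono (hmono k) aeu)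
  · exact tendsto_eLpNorm_of_ae (fun n => hmeas (hcv n) k) (hC k)
      (fun N hN n hn n' hn' => (hrate k N hN n hn n' hn').2.1) (ae_mono (hmono k) aev)
  -- The cubic terms are Cauchy in L¹ by stability, and almost everywhere convergence of the fields
  -- identifies their limit; L² convergence of the fields alone would not suffice.
  · refine tendsto_eLpNorm_of_ae (f := fun n p => N1 α β (un n p) (vn n p))
      (fun n => hmeas (continuousOn_N1 α β (hcu n) (hcv n)) k) (hC k)
      (fun N hN n hn n' hn' => (hrate k N hN n hn n' hn').2.2.1) ?_
    filter_upwards [ae_mono (hmono k) aeu, ae_mono (hmono k) aev] with p hu hv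
    exact tendsto_N1 α β hu hv
  · refine tendsto_eLpNorm_of_ae (f := fun n p => N1 α β (vn n p) (un n p))
      (fun n => hmeas (continuousOn_N1 α β (hcv n) (hcu n)) k) (hC k)
      (fun N hN n hn n' hn' => (hrate k N hN n hn n' hn').2.2.2.1) ?_
    filter_upwards [ae_mono (hmono k) aeu, ae_mono (hmono k) aev] with p hu hv
    exact tendsto_N1 α β hv hu
  -- The stability estimate is applied to the n-th solution and itself, for its bound on the
  -- product.
  · exact ⟨C k ^ 2, fun n hn => (hrate k k le_rfl n hn n hn).2.2.2.2⟩

namespace IsFastLimit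

variable {un vn : ℕ → ℝ × ℝ → ℂ} {u v : ℝ × ℝ → ℂ}
  (L : IsFastLimit m α β z lam u₀ v₀ un vn u v)
include L

lemma tendsto_data (N : ℝ) :
    Tendsto (fun n => dataError N (un n) (vn n) u₀ v₀) atTop (𝓝 0) := by
  obtain ⟨k, hk⟩ := exists_nat_ge N
  have h0 : Tendsto (fun n : ℕ => ENNReal.ofReal ((((1 : ℝ) / 2) ^ n) ^ 2)) atTop (𝓝 0) := by
    have h1 := (tendsto_pow_atTop_nhds_zero_of_lt_one (r := (1 : ℝ) / 2) (by norm_num)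
      (by norm_num)).pow 2
    have h2 := ENNReal.tendsto_ofReal h1
    simpa using h2
  refine tendsto_of_tendsto_of_tendsto_of_le_of_le' tendsto_const_nhds h0
    (Eventually.of_forall fun _ => zero_le) ?_
  filter_upwards [eventually_ge_atTop k] with n hn
  have hk0 : (0 : ℝ) ≤ k := Nat.cast_nonneg k
  exact (dataError_mono (by linarith) _ _ _ _).trans (L.data k n hn)

lemma tendsto_lintegral (hz : IsSubluminal z) {K : Set (ℝ × ℝ)} {k : ℕ} (hK : K ⊆ region z ((k : ℝ) + 1)) :
    Tendsto (fun n => ∫⁻ p in K, (‖un n p - u p‖ₑ ^ 2 + ‖vn n p - v p‖ₑ ^ 2))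
      atTop (𝓝 0) := by
  have h0 : Tendsto (fun n => eLpNorm (un n - u) 2 (volume.restrict (region z ((k : ℝ) + 1))) ^ 2
      + eLpNorm (vn n - v) 2 (volume.restrict (region z ((k : ℝ) + 1))) ^ 2) atTop (𝓝 0) := by
    have := (ENNReal.Tendsto.pow (n := 2) (L.lim_u k)).add
      (ENNReal.Tendsto.pow (n := 2) (L.lim_v k))
    simpa using this
  refine tendsto_of_tendsto_of_tendsto_of_le_of_le tendsto_const_nhds h0 (fun _ => zero_le)
    fun n => ?_
  simp only
  rw [← lintegral_enorm_sq, ← lintegral_enorm_sq]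
  have hmono : volume.restrict (region z ((k : ℝ) + 1)) ≤ volume.restrict (Omega z) :=
    Measure.restrict_mono (fun p hp => hp.1) le_rfl
  have hΩ : AEStronglyMeasurable (un n) (volume.restrict (region z ((k : ℝ) + 1))) :=
    ((L.sol n).contDiffOn_u.continuousOn.aestronglyMeasurable
      hz.isClosed_Omega.measurableSet).mono_measure hmono
  have hm : AEMeasurable (fun p => ‖(un n - u) p‖ₑ ^ 2)
      (volume.restrict (region z ((k : ℝ) + 1))) :=
    (hΩ.sub (L.meas_u.mono_measure hmono)).enorm.pow_const 2
  rw [← lintegral_add_left' hm]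
  exact lintegral_mono_set hK

end IsFastLimit

end DiracIBVP

/-! ### Weak form, integrability and uniqueness of the limit. -/

namespace DiracIBVP

lemma tendsto_zero_of_sq {x : ℕ → ENNReal} (h : Tendsto (fun n => x n ^ 2) atTop (𝓝 0)) :
    Tendsto x atTop (𝓝 0) := by
  rw [ENNReal.tendsto_atTop_zero] at h ⊢
  intro ε hε
  obtain ⟨N, hN⟩ := h (ε ^ 2) (ENNReal.pow_pos hε 2)
  exact ⟨N, fun n hn => (ENNReal.pow_le_pow_left_iff two_ne_zero).1 (hN n hn)⟩

lemma memLp_restrict_of_isCompact {X : Type*} [TopologicalSpace X] [T2Space X]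
    [MeasurableSpace X] [BorelSpace X] {ν : Measure X} [IsFiniteMeasureOnCompacts ν] {K : Set X}
    (hK : IsCompact K) {w : X → ℂ} (hw : ContinuousOn w K) (p : ENNReal) :
    MemLp w p (ν.restrict K) := by
  obtain ⟨B, hB⟩ := hK.exists_bound_of_continuousOn hw
  have : IsFiniteMeasure (ν.restrict K) := ⟨by simpa using hK.measure_lt_top⟩
  exact MemLp.of_bound (hw.aestronglyMeasurable_of_isCompact hK hK.measurableSet) B
    (ae_restrict_of_forall_mem hK.measurableSet hB)

variable {m α β : ℝ} {z : ℝ → ℝ} {lam : ℝ → ℂ} {u₀ v₀ : ℝ → ℂ}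

/-- Passage to the limit in the weak form of a transport equation on the region. -/
lemma isWeak_of_limit (hz : IsSubluminal z) (k : ℕ)
    (hK : IsCompact (region z ((k : ℝ) + 1))) {f g w : ℕ → ℝ × ℝ → ℂ}
    {f' g' w' a φ : ℝ × ℝ → ℂ} {f₀ : ℝ → ℂ}
    (hf : ∀ n, ContinuousOn (f n) (Omega z)) (hg : ∀ n, ContinuousOn (g n) (Omega z))
    (hw : ∀ n, ContinuousOn (w n) (Omega z)) (ha : ContinuousOn a (Omega z))
    (hφ : ContinuousOn φ (Omega z))
    (hf' : MemLp f' 2 (volume.restrict (region z ((k : ℝ) + 1))))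
    (hg' : MemLp g' 2 (volume.restrict (region z ((k : ℝ) + 1))))
    (hw' : MemLp w' 1 (volume.restrict (region z ((k : ℝ) + 1))))
    (hf₀ : MemLp f₀ 2 (volume.restrict (Icc 0 (2 * ((k : ℝ) + 1)))))
    (lf : Tendsto (fun n => eLpNorm (f n - f') 2 (volume.restrict (region z ((k : ℝ) + 1)))) atTop
      (𝓝 0))
    (lg : Tendsto (fun n => eLpNorm (g n - g') 2 (volume.restrict (region z ((k : ℝ) + 1)))) atTop
      (𝓝 0))
    (lw : Tendsto (fun n => eLpNorm (w n - w') 1 (volume.restrict (region z ((k : ℝ) + 1)))) atTop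
      (𝓝 0))
    (lf₀ : Tendsto (fun n => eLpNorm ((fun x => f n (x, 0)) - f₀) 2
      (volume.restrict (Icc 0 (2 * ((k : ℝ) + 1))))) atTop (𝓝 0))
    (hzero : ∀ p ∈ Omega z, p ∉ region z ((k : ℝ) + 1) → a p = 0 ∧ φ p = 0)
    (hweak : ∀ n, ∫ p in region z ((k : ℝ) + 1),
      (Complex.I * f n p * a p - (m : ℂ) * g n p * φ p + w n p * φ p)
        = -Complex.I * ∫ x in (0 : ℝ)..(2 * ((k : ℝ) + 1)), f n (x, 0) * φ (x, 0)) :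
    IntegrableOn (fun p => Complex.I * f' p * a p - (m : ℂ) * g' p * φ p + w' p * φ p) (Omega z) ∧
      IntegrableOn (fun x => f₀ x * φ (x, 0)) (Ici 0) ∧
      ∫ p in Omega z, (Complex.I * f' p * a p - (m : ℂ) * g' p * φ p + w' p * φ p)
        = -Complex.I * ∫ x in Ici 0, f₀ x * φ (x, 0) := by
  have hk : (0 : ℝ) ≤ k := Nat.cast_nonneg k
  set K := region z ((k : ℝ) + 1) with hKdef
  set N := 2 * ((k : ℝ) + 1) with hN
  have hN0 : 0 ≤ N := by positivity
  have hKΩ : K ⊆ Omega z := fun p hp => hp.1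
  have : IsFiniteMeasure (volume.restrict K) := ⟨by simpa using hK.measure_lt_top⟩
  have hmem : ∀ {y : ℝ × ℝ → ℂ}, ContinuousOn y (Omega z) → ∀ p, MemLp y p (volume.restrict K) :=
    fun hy p => memLp_restrict_of_isCompact hK (hy.mono hKΩ) p
  obtain ⟨A, hA⟩ := hK.exists_bound_of_continuousOn (ha.mono hKΩ)
  obtain ⟨B, hB⟩ := hK.exists_bound_of_continuousOn (hφ.mono hKΩ)
  obtain ⟨hint, hlim⟩ := tendsto_integral_weak (ν := volume.restrict K) m
    (fun n => (hmem (hf n) 1).integrable le_rfl) (hf'.integrable one_le_two)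
    (fun n => (hmem (hg n) 1).integrable le_rfl) (hg'.integrable one_le_two)
    (fun n => (hmem (hw n) 1).integrable le_rfl) (hw'.integrable le_rfl)
    (hmem ha 1).1 (hmem hφ 1).1 (ae_restrict_of_forall_mem hK.measurableSet hA)
    (ae_restrict_of_forall_mem hK.measurableSet hB)
    (tendsto_eLpNorm_one_of_two (fun n => (hmem (hf n) 2).1) hf'.1 lf)
    (tendsto_eLpNorm_one_of_two (fun n => (hmem (hg n) 2).1) hg'.1 lg) lw
  have hbase : ∀ {y : ℝ × ℝ → ℂ}, ContinuousOn y (Omega z) →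
      ContinuousOn (fun x => y (x, 0)) (Icc 0 N) := fun hy =>
    (hz.continuousOn_base hy).mono fun x hx => hx.1
  obtain ⟨D, hD⟩ := isCompact_Icc.exists_bound_of_continuousOn (hbase hφ)
  have hbmem : ∀ {y : ℝ × ℝ → ℂ}, ContinuousOn y (Omega z) → ∀ p,
      MemLp (fun x => y (x, 0)) p (volume.restrict (Icc 0 N)) :=
    fun hy p => memLp_restrict_of_isCompact isCompact_Icc (hbase hy) p
  have hφD := ae_restrict_of_forall_mem (μ := volume) measurableSet_Icc hD
  have hlim₀ := tendsto_integral_mul_bounded (ν := volume.restrict (Icc 0 N))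
    (f := fun n x => f n (x, 0)) (fun n => (hbmem (hf n) 1).integrable le_rfl)
    (hf₀.integrable one_le_two) (hbmem hφ 1).1 hφD
    (tendsto_eLpNorm_one_of_two (fun n => (hbmem (hf n) 2).1) hf₀.1 lf₀)
  have hint₀ : IntegrableOn (fun x => f₀ x * φ (x, 0)) (Icc 0 N) :=
    integrable_mul_bounded (hf₀.integrable one_le_two) (hbmem hφ 1).1 hφD
  have hΩm := hz.isClosed_Omega.measurableSet
  have hvan : ∀ p ∈ Omega z \ K,
      Complex.I * f' p * a p - (m : ℂ) * g' p * φ p + w' p * φ p = 0 := by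
    rintro p ⟨hp, hpK⟩
    rw [(hzero p hp hpK).1, (hzero p hp hpK).2]
    ring
  have hvan₀ : ∀ x ∈ Ici 0 \ Icc 0 N, f₀ x * φ (x, 0) = 0 := by
    rintro x ⟨hx, hxN⟩
    have hxΩ : (x, (0 : ℝ)) ∈ Omega z := ⟨le_rfl, by rw [hz.zero]; exact hx⟩
    rw [(hzero (x, 0) hxΩ fun hm => hxN ⟨hx, by simpa using hm.2.2⟩).2, mul_zero]
  refine ⟨IntegrableOn.of_forall_sdiff_eq_zero (μ := volume) (s := K) hint hΩm hvan,
    hint₀.of_forall_sdiff_eq_zero measurableSet_Ici hvan₀, ?_⟩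
  rw [setIntegral_eq_of_subset_of_forall_sdiff_eq_zero hΩm hKΩ hvan,
    setIntegral_eq_of_subset_of_forall_sdiff_eq_zero measurableSet_Ici (fun x hx => hx.1) hvan₀]
  refine tendsto_nhds_unique hlim ?_
  simp only [hweak]
  refine (hlim₀.const_mul (-Complex.I)).congr fun n => ?_
  rw [intervalIntegral.integral_of_le hN0, ← integral_Icc_eq_integral_Ioc]

/-- Test functions, with their derivatives, vanish outside a large region. -/
lemma IsTestFunction.exists_region {φ : ℝ × ℝ → ℂ} (hφ : IsTestFunction z φ)
    (hz : IsSubluminal z) (hF : ∀ R : ℝ, 0 < R → ∃ h k μ, IsNullFrame z lam R h k μ) :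
    ∃ R₀ > 0, (∀ p ∈ Omega z, φ p ≠ 0 → p ∈ region z R₀) ∧ ∀ R ≥ R₀, ∀ p ∈ Omega z,
      p ∉ region z R → (dt z φ p + dx z φ p = 0 ∧ φ p = 0) ∧ dt z φ p - dx z φ p = 0 := by
  obtain ⟨R₀, hR₀, hsub⟩ := hz.exists_subset_region (K := {p | p ∈ Omega z ∧ φ p ≠ 0})
    (fun p hp => hp.1) hφ.bounded_support
  refine ⟨R₀, hR₀, fun p hp hne => hsub R₀ le_rfl ⟨hp, hne⟩, fun R hR p hp hpR => ?_⟩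
  have hφ0 : ∀ q ∈ Omega z, q ∉ region z R → φ q = 0 := fun q hq hqR => by
    by_contra hne
    exact hqR (hsub R hR ⟨hq, hne⟩)
  have hcl := (isCompact_region hF R (hR₀.trans_le hR)).isClosed
  -- The region is closed, so outside it φ vanishes on a whole relative neighbourhood and its
  -- derivatives vanish as well.
  have hev : φ =ᶠ[𝓝[Omega z] p] fun _ => 0 := by
    filter_upwards [self_mem_nhdsWithin, nhdsWithin_le_nhds (hcl.isOpen_compl.mem_nhds hpR)]
      with q hq hqR using hφ0 q hq hqR
  have hfd : fderivWithin ℝ φ (Omega z) p = 0 := by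
    rw [hev.fderivWithin_eq (hφ0 p hp hpR), fderivWithin_const_apply]
  rw [dt, dx, hfd]
  simp [hφ0 p hp hpR]

namespace IsFastLimit

variable {un vn : ℕ → ℝ × ℝ → ℂ} {u v : ℝ × ℝ → ℂ}
  (L : IsFastLimit m α β z lam u₀ v₀ un vn u v)
include L

lemma memLp_u (hF : ∀ R : ℝ, 0 < R → ∃ h k μ, IsNullFrame z lam R h k μ) (k : ℕ) :
    MemLp u 2 (volume.restrict (region z ((k : ℝ) + 1))) :=
  Lp.memLp_of_cauchy_tendsto one_le_two (fun n => memLp_restrict_of_isCompact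
    (isCompact_region hF _ (by positivity))
    ((L.sol n).contDiffOn_u.continuousOn.mono fun p hp => hp.1) 2) u
    (L.meas_u.mono_measure (Measure.restrict_mono (fun p hp => hp.1) le_rfl)) (L.lim_u k)

lemma memLp_v (hF : ∀ R : ℝ, 0 < R → ∃ h k μ, IsNullFrame z lam R h k μ) (k : ℕ) :
    MemLp v 2 (volume.restrict (region z ((k : ℝ) + 1))) :=
  Lp.memLp_of_cauchy_tendsto one_le_two (fun n => memLp_restrict_of_isCompact
    (isCompact_region hF _ (by positivity))
    ((L.sol n).contDiffOn_v.continuousOn.mono fun p hp => hp.1) 2) v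
    (L.meas_v.mono_measure (Measure.restrict_mono (fun p hp => hp.1) le_rfl)) (L.lim_v k)

lemma memLp_N1 (hF : ∀ R : ℝ, 0 < R → ∃ h k μ, IsNullFrame z lam R h k μ) (k : ℕ) :
    MemLp (fun p => N1 α β (u p) (v p)) 1 (volume.restrict (region z ((k : ℝ) + 1))) :=
  Lp.memLp_of_cauchy_tendsto le_rfl (fun n => memLp_restrict_of_isCompact
    (isCompact_region hF _ (by positivity))
    ((continuousOn_N1 α β (L.sol n).contDiffOn_u.continuousOn
      (L.sol n).contDiffOn_v.continuousOn).mono fun p hp => hp.1) 1) _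
    (((continuous_N1 α β).comp_aestronglyMeasurable (L.meas_u.prodMk L.meas_v)).mono_measure
      (Measure.restrict_mono (fun p hp => hp.1) le_rfl)) (L.lim_N1 k)

lemma memLp_N2 (hF : ∀ R : ℝ, 0 < R → ∃ h k μ, IsNullFrame z lam R h k μ) (k : ℕ) :
    MemLp (fun p => N1 α β (v p) (u p)) 1 (volume.restrict (region z ((k : ℝ) + 1))) :=
  Lp.memLp_of_cauchy_tendsto le_rfl (fun n => memLp_restrict_of_isCompact
    (isCompact_region hF _ (by positivity))
    ((continuousOn_N1 α β (L.sol n).contDiffOn_v.continuousOn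
      (L.sol n).contDiffOn_u.continuousOn).mono fun p hp => hp.1) 1) _
    (((continuous_N1 α β).comp_aestronglyMeasurable (L.meas_v.prodMk L.meas_u)).mono_measure
      (Measure.restrict_mono (fun p hp => hp.1) le_rfl)) (L.lim_N2 k)

/-- The products of the components converge to a locally square integrable function. -/
lemma memLp_product (hz : IsSubluminal z) (k : ℕ) :
    MemLp (fun p => ‖u p‖ * ‖v p‖) 2 (volume.restrict (region z ((k : ℝ) + 1))) := by
  have hmono : volume.restrict (region z ((k : ℝ) + 1)) ≤ volume.restrict (Omega z) :=
    Measure.restrict_mono (fun p hp => hp.1) le_rfl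
  have hΩ := hz.isClosed_Omega.measurableSet
  refine ⟨(L.meas_u.norm.mul L.meas_v.norm).mono_measure hmono, ?_⟩
  rw [eLpNorm_lt_top_iff_lintegral_rpow_enorm_lt_top (by norm_num) (by norm_num)]
  obtain ⟨C, hC⟩ := L.product k
  have hle : ∫⁻ p in region z ((k : ℝ) + 1), ‖u p‖ₑ ^ 2 * ‖v p‖ₑ ^ 2 ≤ ENNReal.ofReal C := by
    -- Fatou's lemma carries the uniform bound of the products to the limit.
    have hlim : ∀ᵐ p ∂volume.restrict (region z ((k : ℝ) + 1)),
        liminf (fun n => ‖un n p‖ₑ ^ 2 * ‖vn n p‖ₑ ^ 2) atTop = ‖u p‖ₑ ^ 2 * ‖v p‖ₑ ^ 2 := by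
      filter_upwards [ae_mono hmono L.ae_u, ae_mono hmono L.ae_v] with p hu hv
      have h1 := ENNReal.Tendsto.pow (n := 2) hu.enorm
      have h2 := ENNReal.Tendsto.pow (n := 2) hv.enorm
      exact (ENNReal.Tendsto.mul h1 (Or.inr (by finiteness)) h2
        (Or.inr (by finiteness))).liminf_eq
    rw [← lintegral_congr_ae hlim]
    refine (lintegral_liminf_le' fun n => ?_).trans ?_
    · have h1 := ((L.sol n).contDiffOn_u.continuousOn.aestronglyMeasurable hΩ
        (μ := volume)).mono_measure hmono
      have h2 := ((L.sol n).contDiffOn_v.continuousOn.aestronglyMeasurable hΩ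
        (μ := volume)).mono_measure hmono
      exact (h1.enorm.pow_const 2).mul (h2.enorm.pow_const 2)
    · refine (liminf_le_liminf (v := fun _ => ENNReal.ofReal C) ?_).trans (liminf_const _).le
      filter_upwards [eventually_ge_atTop k] with n hn using hC n hn
  refine lt_of_le_of_lt (le_of_eq ?_) (hle.trans_lt ENNReal.ofReal_lt_top)
  refine lintegral_congr fun p => ?_
  have e : ∀ x : ENNReal, x ^ (2 : ENNReal).toReal = x ^ 2 := fun x => by
    rw [← ENNReal.rpow_natCast]; norm_num
  rw [e, enorm_mul, mul_pow, enorm_norm, enorm_norm]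

lemma isStrongSolution (hz : IsSubluminal z) : IsStrongSolution m α β z lam u₀ v₀ u v := by
  refine ⟨L.meas_u, L.meas_v, un, vn, L.sol, fun n t ht => L.boundary n t ht.le,
    fun N _ => L.tendsto_data N, fun K hK hKc => ?_⟩
  obtain ⟨R₀, -, hR₀⟩ := hz.exists_subset_region hK hKc.isBounded
  obtain ⟨k, hk⟩ := exists_nat_ge R₀
  exact L.tendsto_lintegral hz (hR₀ ((k : ℝ) + 1) (by linarith))

/-- Strong solutions are unique. -/
lemma ae_eq_of_isStrongSolution (hm : 0 ≤ m) (hz : IsSubluminal z)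
    (hF : ∀ R : ℝ, 0 < R → ∃ h k μ, IsNullFrame z lam R h k μ) (hlam : ContinuousOn lam (Ici 0))
    (hu₀ : L2locHalfLine u₀) (hv₀ : L2locHalfLine v₀) {u' v' : ℝ × ℝ → ℂ}
    (S : IsStrongSolution m α β z lam u₀ v₀ u' v') :
    u' =ᵐ[volume.restrict (Omega z)] u ∧ v' =ᵐ[volume.restrict (Omega z)] v := by
  obtain ⟨mu, mv, wn, yn, hS, hb, hdata, hlim⟩ := S
  have hΩ := hz.isClosed_Omega.measurableSet
  have hb' := fun n => (hS n).boundary_of_pos hz hlam (hb n)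
  have key : ∀ k : ℕ, u' =ᵐ[volume.restrict (region z ((k : ℝ) + 1))] u ∧
      v' =ᵐ[volume.restrict (region z ((k : ℝ) + 1))] v := by
    intro k
    set ν := volume.restrict (region z ((k : ℝ) + 1)) with hν
    have hmono : ν ≤ volume.restrict (Omega z) :=
      Measure.restrict_mono (fun p hp => hp.1) le_rfl
    have hmeas : ∀ {w : ℝ × ℝ → ℂ}, ContDiffOn ℝ 1 w (Omega z) → AEStronglyMeasurable w ν :=
      fun hw => (hw.continuousOn.aestronglyMeasurable hΩ).mono_measure hmono
    have hcpt := isCompact_region hF ((k : ℝ) + 1) (by positivity)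
    have l1 := hlim _ (fun p hp => hp.1) hcpt
    have l1u : Tendsto (fun n => eLpNorm (wn n - u') 2 ν) atTop (𝓝 0) := by
      refine tendsto_zero_of_sq (tendsto_of_tendsto_of_tendsto_of_le_of_le tendsto_const_nhds l1
        (fun _ => zero_le) fun n => ?_)
      simp only
      rw [← lintegral_enorm_sq]
      exact lintegral_mono fun p => le_self_add
    have l1v : Tendsto (fun n => eLpNorm (yn n - v') 2 ν) atTop (𝓝 0) := by
      refine tendsto_zero_of_sq (tendsto_of_tendsto_of_tendsto_of_le_of_le tendsto_const_nhds l1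
        (fun _ => zero_le) fun n => ?_)
      simp only
      rw [← lintegral_enorm_sq]
      exact lintegral_mono fun p => le_add_self
    obtain ⟨C, hC, hst⟩ := exists_stability_of_dataError hm α β hz hF hu₀ hv₀
      (R := (k : ℝ) + 1) (by positivity)
    -- The two approximating sequences start close to the same data, so stability forces them
    -- together on every region.
    have l2 : ∀ ε : ENNReal, 0 < ε → ∀ᶠ n in atTop,
        eLpNorm (un n - wn n) 2 ν ≤ ε ∧ eLpNorm (vn n - yn n) 2 ν ≤ ε := by
      intro ε hε
      obtain ⟨r, hr, hrε⟩ : ∃ r : ℝ, 0 < r ∧ ENNReal.ofReal r ≤ ε := by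
        obtain ⟨r, hr1, hr2⟩ := ENNReal.lt_iff_exists_nnreal_btwn.1 hε
        exact ⟨r, by exact_mod_cast hr1, by simpa using hr2.le⟩
      -- The stability estimate requires a ≤ 1, and C + 1 avoids dividing by a vanishing constant.
      set a := min 1 (r / (C + 1)) with ha
      have ha0 : 0 < a := lt_min one_pos (by positivity)
      have hCa : C * a ≤ r := by
        have h1 : a ≤ r / (C + 1) := min_le_right _ _
        rw [le_div_iff₀ (by positivity)] at h1
        nlinarith
      have ha2 : (0 : ENNReal) < ENNReal.ofReal (a ^ 2) := ENNReal.ofReal_pos.2 (by positivity)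
      have d1 := (L.tendsto_data (2 * ((k : ℝ) + 1))).eventually (ge_mem_nhds ha2)
      have d2 := (hdata (2 * ((k : ℝ) + 1)) (by positivity)).eventually (ge_mem_nhds ha2)
      filter_upwards [d1, d2] with n h1 h2
      obtain ⟨s1, s2, -⟩ := hst _ _ _ _ (L.sol n) (hS n) (L.boundary n) (hb' n) a ha0.le
        (min_le_left _ _) h1 h2
      have h3 : ENNReal.ofReal (C * a) ≤ ε := (ENNReal.ofReal_le_ofReal hCa).trans hrε
      exact ⟨s1.trans h3, s2.trans h3⟩
    have fin : ∀ {f g : ℕ → ℝ × ℝ → ℂ} {f' g' : ℝ × ℝ → ℂ}, (∀ n, AEStronglyMeasurable (f n) ν) →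
        (∀ n, AEStronglyMeasurable (g n) ν) → AEStronglyMeasurable f' ν →
        AEStronglyMeasurable g' ν → Tendsto (fun n => eLpNorm (f n - f') 2 ν) atTop (𝓝 0) →
        Tendsto (fun n => eLpNorm (g n - g') 2 ν) atTop (𝓝 0) →
        Tendsto (fun n => eLpNorm (f n - g n) 2 ν) atTop (𝓝 0) → g' =ᵐ[ν] f' := by
      intro f g f' g' mf mg mf' mg' h1 h2 h3
      have h4 : Tendsto (fun n => eLpNorm (g n - g') 2 ν + eLpNorm (f n - g n) 2 ν
          + eLpNorm (f n - f') 2 ν) atTop (𝓝 0) := by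
        simpa using (h2.add h3).add h1
      have h5 : eLpNorm (g' - f') 2 ν = 0 := by
        refine le_antisymm (ge_of_tendsto' h4 fun n => ?_) zero_le
        have e : g' - f' = -(g n - g') - (f n - g n) + (f n - f') := by ring
        rw [e]
        refine (eLpNorm_add_le (((mg n).sub mg').neg.sub ((mf n).sub (mg n)))
          ((mf n).sub mf') one_le_two).trans (add_le_add ?_ le_rfl)
        refine (eLpNorm_sub_le ((mg n).sub mg').neg ((mf n).sub (mg n)) one_le_two).trans
          (le_of_eq ?_)
        rw [eLpNorm_neg]
      rw [eLpNorm_eq_zero_iff (mg'.sub mf') (by norm_num)] at h5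
      filter_upwards [h5] with p hp
      exact sub_eq_zero.1 hp
    refine ⟨fin (fun n => hmeas (L.sol n).contDiffOn_u) (fun n => hmeas (hS n).contDiffOn_u)
      (L.meas_u.mono_measure hmono) (mu.mono_measure hmono) (L.lim_u k) l1u ?_,
      fin (fun n => hmeas (L.sol n).contDiffOn_v) (fun n => hmeas (hS n).contDiffOn_v)
      (L.meas_v.mono_measure hmono) (mv.mono_measure hmono) (L.lim_v k) l1v ?_⟩
    · exact ENNReal.tendsto_nhds_zero.2 fun ε hε => (l2 ε hε).mono fun n hn => hn.1
    · exact ENNReal.tendsto_nhds_zero.2 fun ε hε => (l2 ε hε).mono fun n hn => hn.2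
  rw [← hz.iUnion_region]
  exact ⟨(ae_restrict_iUnion_iff _ _).2 fun k => (key k).1,
    (ae_restrict_iUnion_iff _ _).2 fun k => (key k).2⟩

lemma isWeakSolution (hz : IsSubluminal z)
    (hF : ∀ R : ℝ, 0 < R → ∃ h k μ, IsNullFrame z lam R h k μ)
    (hu₀ : L2locHalfLine u₀) (hv₀ : L2locHalfLine v₀) :
    IsWeakSolution m α β z u₀ v₀ u v := by
  have hcu := fun n => (L.sol n).contDiffOn_u.continuousOn
  have hcv := fun n => (L.sol n).contDiffOn_v.continuousOn
  have hN12 := fun n => continuousOn_N1 α β (hcu n) (hcv n)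
  have hN21 := fun n => continuousOn_N1 α β (hcv n) (hcu n)
  have hbase_u : ∀ N : ℝ, Tendsto (fun n => eLpNorm ((fun x => un n (x, 0)) - u₀) 2
      (volume.restrict (Icc 0 N))) atTop (𝓝 0) := fun N => by
    refine tendsto_zero_of_sq (tendsto_of_tendsto_of_tendsto_of_le_of_le tendsto_const_nhds
      (L.tendsto_data N) (fun _ => zero_le) fun n => ?_)
    simp only
    rw [← lintegral_enorm_sq]
    exact lintegral_mono fun p => le_self_add
  have hbase_v : ∀ N : ℝ, Tendsto (fun n => eLpNorm ((fun x => vn n (x, 0)) - v₀) 2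
      (volume.restrict (Icc 0 N))) atTop (𝓝 0) := fun N => by
    refine tendsto_zero_of_sq (tendsto_of_tendsto_of_tendsto_of_le_of_le tendsto_const_nhds
      (L.tendsto_data N) (fun _ => zero_le) fun n => ?_)
    simp only
    rw [← lintegral_enorm_sq]
    exact lintegral_mono fun p => le_add_self
  intro φ ψ hφ hψ
  constructor
  · obtain ⟨R₀, hR₀, hsupp, hvan⟩ := hφ.exists_region hz hF
    obtain ⟨k, hk⟩ := exists_nat_ge R₀
    obtain ⟨h, k', μ, F⟩ := hF ((k : ℝ) + 1) (by positivity)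
    exact isWeak_of_limit hz k (isCompact_region hF _ (by positivity)) hcu hcv hN12
      (hz.continuousOn_dt_add_dx hφ.contDiffOn) hφ.contDiffOn.continuousOn (L.memLp_u hF k)
      (L.memLp_v hF k) (L.memLp_N1 hF k) (hu₀ _ (by positivity)) (L.lim_u k) (L.lim_v k)
      (L.lim_N1 k) (hbase_u _) (fun p hp hpR => (hvan _ (by linarith) p hp hpR).1)
      (fun n => (L.sol n).weak_fst hz F hφ hsupp hR₀.le (by linarith))
  · obtain ⟨R₀, hR₀, hsupp, hvan⟩ := hψ.exists_region hz hF
    obtain ⟨k, hk⟩ := exists_nat_ge R₀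
    obtain ⟨h, k', μ, F⟩ := hF ((k : ℝ) + 1) (by positivity)
    have hweak := fun n => (L.sol n).weak_snd hz F hψ hsupp hR₀.le (by linarith)
      (hz.sub_lt_sub hR₀.le (by linarith))
    simp only [N2_eq_N1] at hweak ⊢
    exact isWeak_of_limit hz k (isCompact_region hF _ (by positivity)) hcv hcu hN21
      (hz.continuousOn_dt_sub_dx hψ.contDiffOn) hψ.contDiffOn.continuousOn (L.memLp_v hF k)
      (L.memLp_u hF k) (L.memLp_N2 hF k) (hv₀ _ (by positivity)) (L.lim_v k) (L.lim_u k)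
      (L.lim_N2 k) (hbase_v _)
      (fun p hp hpR => ⟨(hvan _ (by linarith) p hp hpR).2, (hvan _ (by linarith) p hp hpR).1.2⟩)
      hweak

end IsFastLimit

end DiracIBVP

/-! ### Assembly of the theorem on arbitrary compact sets. -/

theorem theorem3 (m α β : ℝ) (hm : 0 ≤ m)
    (z : ℝ → ℝ) (hz : ContDiffOn ℝ 1 z (Set.Ici 0))
    (lam : ℝ → ℂ) (hlam : ContDiffOn ℝ 1 lam (Set.Ici 0))
    (hz0 : z 0 = 0)
    (H1 : ∀ t : ℝ, 0 ≤ t → -1 < DiracIBVP.timeDeriv z t ∧ DiracIBVP.timeDeriv z t < 1)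
    (H2 : ∀ t : ℝ, 0 ≤ t →
      ‖lam t‖ ^ 2 * (1 - DiracIBVP.timeDeriv z t) ≤ 1 + DiracIBVP.timeDeriv z t)
    (u₀ v₀ : ℝ → ℂ) (hu₀ : DiracIBVP.L2locHalfLine u₀) (hv₀ : DiracIBVP.L2locHalfLine v₀) :
    ∃ u v : ℝ × ℝ → ℂ,
      DiracIBVP.IsStrongSolution m α β z lam u₀ v₀ u v ∧
      DiracIBVP.L2locOmega z u ∧ DiracIBVP.L2locOmega z v ∧
      (∀ u' v' : ℝ × ℝ → ℂ, DiracIBVP.IsStrongSolution m α β z lam u₀ v₀ u' v' →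
        u' =ᵐ[MeasureTheory.volume.restrict (DiracIBVP.Omega z)] u ∧
        v' =ᵐ[MeasureTheory.volume.restrict (DiracIBVP.Omega z)] v) ∧
      DiracIBVP.L2locOmega z (fun p => ‖u p‖ * ‖v p‖) ∧
      DiracIBVP.IsWeakSolution m α β z u₀ v₀ u v := by 
  have hz' : DiracIBVP.IsSubluminal z := ⟨hz, hz0, H1⟩
  have hF : ∀ R : ℝ, 0 < R → ∃ h k μ, DiracIBVP.IsNullFrame z lam R h k μ :=
    fun R hR => DiracIBVP.exists_isNullFrame hz hlam hz0 H1 H2 hR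
  obtain ⟨un, vn, u, v, L⟩ := DiracIBVP.exists_isFastLimit hm α β hz' hF hu₀ hv₀
  have exhaust : ∀ K ⊆ DiracIBVP.Omega z, IsCompact K →
      ∃ k : ℕ, K ⊆ DiracIBVP.region z ((k : ℝ) + 1) := by
    intro K hK hKc
    obtain ⟨R₀, -, hR₀⟩ := hz'.exists_subset_region hK hKc.isBounded
    obtain ⟨k, hk⟩ := exists_nat_ge R₀
    exact ⟨k, hR₀ _ (by linarith)⟩
  refine ⟨u, v, L.isStrongSolution hz', ?_, ?_, fun u' v' S =>
    L.ae_eq_of_isStrongSolution hm hz' hF hlam.continuousOn hu₀ hv₀ S, ?_,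
    L.isWeakSolution hz' hF hu₀ hv₀⟩
  · intro K hK hKc
    obtain ⟨k, hk⟩ := exhaust K hK hKc
    exact (L.memLp_u hF k).mono_measure (MeasureTheory.Measure.restrict_mono hk le_rfl)
  · intro K hK hKc
    obtain ⟨k, hk⟩ := exhaust K hK hKc
    exact (L.memLp_v hF k).mono_measure (MeasureTheory.Measure.restrict_mono hk le_rfl)
  · intro K hK hKc
    obtain ⟨k, hk⟩ := exhaust K hK hKc
    exact (L.memLp_product hz' k).mono_measure (MeasureTheory.Measure.restrict_mono hk le_rfl)
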